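/- **Setting.** Let $k$ be an algebraically closed field of characteristic $p>0$. An algebraic scheme is a separated scheme of finite type over $k$. Let $X_0$ be a closed subscheme of a smooth algebraic scheme. Let $A,B$ be local artinian $k$-algebras with residue field $k$, and let $\Phi:0\to k\cdot t\to B\xrightarrow{\varphi}A\to 0$ be a small extension ($\varphi$ is a surjective $k$-algebra map with kernel $k\cdot t$, $t\ne 0$, $\mathfrak m_B t=0$). $\operatorname{Def}'_{X_0}(A)$ is the set of isomorphism classes of locally trivial deformations of $X_0$ over $A$ (flat $A$-schemes with an identification of the closed fibre with $X_0$, locally on $X_0$ isomorphic to the trivial deformation; isomorphisms are over $\operatorname{Spec}A$ and restrict to $\operatorname{id}_{X_0}$), and $\alpha:\operatorname{Def}'_{X_0}(B)\to\operatorname{Def}'_{X_0}(A)$ is base change along $\varphi$. Let $X\in \operatorname{Def}'_{X_0}(A)$. For a $k$-algebra $R$, $\operatorname{HS}^A(R)$ is the group of $A$-algebra automorphisms of $A\otimes_k R$ inducing the identity on $R=(A\otimes_kR)/\mathfrak m_A$; $\varphi_*:\operatorname{HS}^B(R)\to\operatorname{HS}^A(R)$ is reduction. For $d\in\operatorname{Der}_k(R)$,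 $d\langle t\rangle\in \operatorname{HS}^B(R)$ is given by $r\mapsto 1\otimes r+t\otimes d(r)$. Write $R=T/I$ with $T$ a polynomial ring over $k$. Put $T^1_{R/k}=\operatorname{coker}(\operatorname{Hom}_R(\Omega_{T/k}\otimes_T R,R)\to\operatorname{Hom}_R(I/I^2,R))$. For $D\in \operatorname{HS}^A(R)$ choose a lift $E\in \operatorname{HS}^B(T)$; the composite $I\to B\otimes T\to B\otimes R$ of $E$ and the projection has the form $x\mapsto t\otimes f_E(x)$ with $f_E\in\operatorname{Hom}_R(I/I^2,R)$, and $\operatorname{ob}_\Phi(D)\in T^1_{R/k}$ is the class of $f_E$. Let $\operatorname{Ob}^\Phi_R\subset T^1_{R/k}$ be the image of $\operatorname{ob}_\Phi$; these form a subsheaf $\operatorname{Ob}^\Phi_{X_0}$ of $T^1_{X_0/k}$. Let $\mathfrak U=\{U_\alpha=\operatorname{Spec}R_\alpha\}$ be any affine open cover of $X_0$, $U_\alpha\cap U_\beta=\operatorname{Spec}R_{\alpha\beta}$. All cohomology is (alternating) Čech cohomology over $\mathfrak U$; it computes $H^i(X_0,\operatorname{Der}_k(\mathcal O_{X_0}))$,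 and $\check H^0(\mathfrak U,\operatorname{Ob}^\Phi_{X_0})=H^0(X_0,\operatorname{Ob}^\Phi_{X_0})$. *Couples.* A couple over $A$ is a family $D^{\alpha\beta}\in\operatorname{HS}^A(R_{\alpha\beta})$ with $D^{\alpha\alpha}=\operatorname{id}$ and $D^{\alpha\beta}=(D^{\beta\alpha})^{-1}$. It satisfies the cocycle conditions if $D^{\beta\gamma}D^{\alpha\beta}=D^{\alpha\gamma}$ on $U_\alpha\cap U_\beta\cap U_\gamma$; gluing the $\operatorname{Spec}(A\otimes R_\alpha)$ along $D$ then gives a class in $\operatorname{Def}'_{X_0}(A)$, said to be induced by the couple. An isomorphism from $D$ to $D'$ is a family $E^\alpha\in\operatorname{HS}^A(R_\alpha)$ with $E^\beta D^{\alpha\beta}=D'^{\alpha\beta}E^\alpha$. For a couple $x$ over $A$ satisfying the cocycle conditions and inducing $X$, a lift of $x$ is a couple $Y=(D_Y^{\alpha\beta})$ over $B$ together with an isomorphism $(E_Y^\alpha):\varphi_*Y\cong x$. For lifts $Y,Z$ put: * $h_Y(Z)=\{\operatorname{ob}_\Phi((E_Y^\alpha)^{-1}E_Z^\alpha)\}_\alpha\in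 \check H^0(\mathfrak U,\operatorname{Ob}^\Phi_{X_0})$; * $v^2(x,Z)\in\check H^2(\mathfrak U,\operatorname{Der}_k(\mathcal O_{X_0}))$, the class of the derivations $d_{\alpha\beta\gamma}$ with $d_{\alpha\beta\gamma}\langle t\rangle=D_Z^{\gamma\alpha}D_Z^{\beta\gamma}D_Z^{\alpha\beta}$; * $g_Y(m)=v^2(x,Z)$ for any lift $Z$ with $h_Y(Z)=m$ (such $Z$ exist, and the value does not depend on $Z$), and $V_Y(X)=g_Y^{-1}(0)\subset \check H^0(\mathfrak U,\operatorname{Ob}^\Phi_{X_0})$; * $L(X)=\{\{\operatorname{ob}_\Phi(E^\alpha)\}_\alpha : (E^\alpha)\in\operatorname{Aut}(x)\}\subset \check H^0(\mathfrak U,\operatorname{Ob}^\Phi_{X_0})$. **Theorem.** (a) $X$ is induced by a couple $x$ over $\mathfrak U$ satisfying the cocycle conditions. (b) $\check H^1(\mathfrak U,\operatorname{Der}_k(\mathcal O_{X_0}))$ acts on the fibre $\alpha^{-1}(X)$ so that, whenever a couple $Z$ over $B$ satisfying the cocycle conditions induces $z\in\alpha^{-1}(X)$, the couple $\{d_{\alpha\beta}\langle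 t\rangle D_Z^{\alpha\beta}\}$ induces $[d]\cdot z$. (c) For every $x$ as in (a): if $\alpha^{-1}(X)\neq\emptyset$, then $x$ has a lift to $B$. For every lift $Y$ of $x$ to $B$ there is a bijection $$\alpha^{-1}(X)/\check H^1(\mathfrak U,\operatorname{Der}_k(\mathcal O_{X_0}))\;\xrightarrow{\ \sim\ }\;V_Y(X)/L(X),$$ which sends the orbit of $z$ to the class of $h_Y(Z)$ for every lift $Z$ of $x$ that satisfies the cocycle conditions and induces $z$. -/

import Mathlib

open CategoryTheory Limits AlgebraicGeometry TensorProduct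

noncomputable section

set_option linter.unusedSectionVars false

namespace LocTriv

universe u

section Artin

/-- Local artinian `k`-algebras `A` with `A / 𝔪_A = k`. -/
class ArtinLocal (k A : Type*) [Field k] [CommRing A] [Algebra k A] : Prop
    extends IsLocalRing A, IsArtinianRing A where
  residue_bijective : Function.Bijective (algebraMap k (IsLocalRing.ResidueField A))

variable (k A : Type*) [Field k] [CommRing A] [Algebra k A] [ArtinLocal k A]

/-- The residue map `A → A / 𝔪_A = k`. -/
def residue : A →ₐ[k] k :=
  (AlgEquiv.ofBijective (Algebra.ofId k (IsLocalRing.ResidueField A))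
    (ArtinLocal.residue_bijective (k := k) (A := A))).symm.toAlgHom.comp
    (IsScalarTower.toAlgHom k A (IsLocalRing.ResidueField A))

variable {k A}

lemma residue_eq_zero_iff (a : A) : residue k A a = 0 ↔ a ∈ IsLocalRing.maximalIdeal A := by
  have : residue k A a = 0 ↔ IsLocalRing.residue A a = 0 := by
    simp only [residue, AlgHom.comp_apply]
    exact (map_eq_zero_iff _ (AlgEquiv.injective _))
  rw [this, IsLocalRing.residue_eq_zero_iff]

lemma ker_residue : RingHom.ker (residue k A) = IsLocalRing.maximalIdeal A := by
  ext a; exact residue_eq_zero_iff a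

end Artin

/-- A small extension `0 → k·t → B → A → 0`. -/
structure SmallExtension (k B A : Type*) [Field k] [CommRing B] [Algebra k B] [ArtinLocal k B]
    [CommRing A] [Algebra k A] [ArtinLocal k A] where
  φ : B →ₐ[k] A
  surjective : Function.Surjective φ
  t : B
  t_ne_zero : t ≠ 0
  ker_eq : ∀ b : B, φ b = 0 ↔ ∃ c : k, b = c • t
  maximalIdeal_mul : ∀ b ∈ IsLocalRing.maximalIdeal B, b * t = 0

section HS

variable (k A R : Type*) [Field k] [CommRing A] [Algebra k A] [ArtinLocal k A]
  [CommRing R] [Algebra k R]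

/-- The reduction `A ⊗ R → (A / 𝔪_A) ⊗ R = R`. -/
def red : A ⊗[k] R →ₐ[k] R :=
  Algebra.TensorProduct.lift ((Algebra.ofId k R).comp (residue k A)) (AlgHom.id k R)
    fun _ _ ↦ Commute.all _ _

@[simp] lemma red_tmul (a : A) (r : R) : red k A R (a ⊗ₜ r) = residue k A a • r := by
  simp [red, Algebra.ofId_apply, Algebra.smul_def]

/-- `HS^A(R)`: the group, under composition, of the `A`-algebra automorphisms of `A ⊗ R` that
induce the identity on `(A / 𝔪_A) ⊗ R = R`. -/
def HS : Subgroup (A ⊗[k] R ≃ₐ[A] A ⊗[k] R) where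
  carrier := {D | ∀ x, red k A R (D x) = red k A R x}
  one_mem' _ := rfl
  mul_mem' {D E} hD hE x := (hD (E x)).trans (hE x)
  inv_mem' {D} hD x := by
    have := hD (D.symm x)
    rw [AlgEquiv.apply_symm_apply] at this
    exact this.symm

variable {k A R}

/-- The restriction `D|_R : R → A ⊗ R` of `D ∈ HS^A(R)`. -/
def HS.toAlgHom (D : HS k A R) : R →ₐ[k] A ⊗[k] R :=
  ((D.1 : A ⊗[k] R →ₐ[A] A ⊗[k] R).restrictScalars k).comp
    Algebra.TensorProduct.includeRight

lemma HS.toAlgHom_apply (D : HS k A R) (r : R) : (HS.toAlgHom D) r = D.1 (1 ⊗ₜ r) := rfl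

/-- The `A`-linear extension of `f : R → A ⊗ R`. -/
def extendScalars (f : R →ₐ[k] A ⊗[k] R) : A ⊗[k] R →ₐ[A] A ⊗[k] R :=
  Algebra.TensorProduct.lift (Algebra.ofId A _) f fun _ _ ↦ Commute.all _ _

@[simp] lemma extendScalars_tmul (f : R →ₐ[k] A ⊗[k] R) (a : A) (r : R) :
    extendScalars f (a ⊗ₜ r) = a • f r := by
  simp [extendScalars, Algebra.ofId_apply, Algebra.smul_def]

lemma red_smul (a : A) (x : A ⊗[k] R) : red k A R (a • x) = residue k A a • red k A R x := by
  rw [Algebra.smul_def, map_mul, Algebra.TensorProduct.algebraMap_apply]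
  simp

lemma red_extendScalars (f : R →ₐ[k] A ⊗[k] R) (hf : ∀ r, red k A R (f r) = r)
    (x : A ⊗[k] R) : red k A R (extendScalars f x) = red k A R x := by
  induction x with
  | zero => simp
  | tmul a r => simp [red_smul, hf]
  | add x y hx hy => simp [hx, hy]

lemma ker_red_le (x : A ⊗[k] R) (hx : red k A R x = 0) :
    x ∈ (IsLocalRing.maximalIdeal A) • (⊤ : Submodule A (A ⊗[k] R)) := by
  have key : ∀ y : A ⊗[k] R, y - 1 ⊗ₜ red k A R y ∈
      (IsLocalRing.maximalIdeal A) • (⊤ : Submodule A (A ⊗[k] R)) := by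
    intro y
    induction y with
    | zero => simp
    | tmul a r =>
      have : a ⊗ₜ[k] r - 1 ⊗ₜ red k A R (a ⊗ₜ[k] r) =
          (a - algebraMap k A (residue k A a)) • ((1 : A) ⊗ₜ[k] r) := by
        rw [red_tmul, sub_smul, algebraMap_smul, tmul_smul]
        congr 1
        rw [smul_tmul', smul_eq_mul, mul_one]
      rw [this]
      refine Submodule.smul_mem_smul ?_ trivial
      rw [← residue_eq_zero_iff (k := k)]
      simp
    | add y z hy hz =>
      rw [map_add, tmul_add, add_sub_add_comm]
      exact add_mem hy hz
  simpa [hx] using key x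

lemma bijective_extendScalars (f : R →ₐ[k] A ⊗[k] R) (hf : ∀ r, red k A R (f r) = r) :
    Function.Bijective (extendScalars f) := by
  set I := IsLocalRing.maximalIdeal A
  let N : Module.End A (A ⊗[k] R) := (extendScalars f).toLinearMap - 1
  have hN : ∀ n : ℕ, ∀ x, (N ^ n) x ∈ I ^ n • (⊤ : Submodule A (A ⊗[k] R)) := by
    intro n
    induction n with
    | zero => intro x; rw [pow_zero, Ideal.one_eq_top, Submodule.top_smul]; trivial
    | succ n ih =>
      intro x
      rw [pow_succ' N, Module.End.mul_apply, pow_succ I, mul_smul]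
      refine Submodule.smul_induction_on (ih x) ?_ ?_
      · intro a ha y _
        rw [map_smul]
        refine Submodule.smul_mem_smul ha (ker_red_le _ ?_)
        simp [N, red_extendScalars f hf]
      · intro y z hy hz
        rw [map_add]
        exact add_mem hy hz
  obtain ⟨n, hn⟩ := IsArtinianRing.isNilpotent_jacobson_bot (R := A)
  rw [IsLocalRing.jacobson_eq_maximalIdeal _ bot_ne_top] at hn
  have hnil : IsNilpotent N := ⟨n, by
    ext1; ext x
    have := hN n ((1 : A) ⊗ₜ x)
    rw [show I ^ n = ⊥ from hn, Submodule.bot_smul, Submodule.mem_bot] at this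
    simpa using this⟩
  have hu : IsUnit ((extendScalars f).toLinearMap : Module.End A (A ⊗[k] R)) := by
    have := hnil.isUnit_add_one
    simpa [N] using this
  exact (Module.End.isUnit_iff _).mp hu

/-- An algebra morphism `f : R → A ⊗ R` whose composition with `A ⊗ R → R` is the identity
is `D|_R` for a unique `D ∈ HS^A(R)`. -/
def HS.ofAlgHom (f : R →ₐ[k] A ⊗[k] R) (hf : ∀ r, red k A R (f r) = r) : HS k A R :=
  ⟨AlgEquiv.ofBijective (extendScalars f) (bijective_extendScalars f hf),
    red_extendScalars f hf⟩

@[simp] lemma HS.ofAlgHom_tmul (f : R →ₐ[k] A ⊗[k] R) (hf : ∀ r, red k A R (f r) = r)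
    (a : A) (r : R) : (HS.ofAlgHom f hf).1 (a ⊗ₜ r) = a • f r :=
  extendScalars_tmul f a r

lemma HS.red_toAlgHom (D : HS k A R) (r : R) : red k A R ((HS.toAlgHom D) r) = r := by
  rw [HS.toAlgHom_apply, D.2]; simp

lemma residue_map {B : Type*} [CommRing B] [Algebra k B] [ArtinLocal k B] (φ : B →ₐ[k] A)
    (b : B) : residue k A (φ b) = residue k B b := by
  have h : b - algebraMap k B (residue k B b) ∈ IsLocalRing.maximalIdeal B := by
    rw [← residue_eq_zero_iff (k := k)]; simp
  have h2 : IsNilpotent (φ (b - algebraMap k B (residue k B b))) := by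
    refine IsNilpotent.map ?_ φ
    obtain ⟨n, hn⟩ := IsArtinianRing.isNilpotent_jacobson_bot (R := B)
    rw [IsLocalRing.jacobson_eq_maximalIdeal _ bot_ne_top] at hn
    exact ⟨n, by simpa [hn] using Ideal.pow_mem_pow h n⟩
  have h3 := (h2.map (residue k A)).eq_zero
  simpa [sub_eq_zero] using h3

lemma red_map {B : Type*} [CommRing B] [Algebra k B] [ArtinLocal k B] (φ : B →ₐ[k] A)
    {R' : Type*} [CommRing R'] [Algebra k R'] (ρ : R →ₐ[k] R')
    (x : B ⊗[k] R) :
    red k A R' (Algebra.TensorProduct.map φ ρ x) = ρ (red k B R x) := by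
  induction x with
  | zero => simp
  | tmul b r => simp [residue_map]
  | add x y hx hy => simp [hx, hy]

/-- `φ_* : HS^B(R) → HS^A(R)`, `D ↦ id_A ⊗_B D`: the automorphism with
`(φ_* D)|_R = (φ ⊗ id) ∘ D|_R`. -/
def HS.baseChange {B : Type*} [CommRing B] [Algebra k B] [ArtinLocal k B] (φ : B →ₐ[k] A)
    (D : HS k B R) : HS k A R :=
  HS.ofAlgHom ((Algebra.TensorProduct.map φ (AlgHom.id k R)).comp (HS.toAlgHom D)) fun r ↦ by
    rw [AlgHom.comp_apply, red_map, HS.red_toAlgHom]; rfl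

lemma exists_lift_of_formallyEtale {S S' C : Type*} [CommRing S] [CommRing S'] [CommRing C]
    (ρ : S →+* S') (hρ : ρ.FormallyEtale) (f : S →+* C) (q : C →+* S')
    (hq : Function.Surjective q) (hn : IsNilpotent (RingHom.ker q)) (h : q.comp f = ρ) :
    ∃ g : S' →+* C, q.comp g = RingHom.id S' ∧ g.comp ρ = f := by
  algebraize [ρ, f]
  let q' : C →ₐ[S] S' := { q with commutes' := fun s ↦ RingHom.congr_fun h s }
  let g := Algebra.FormallySmooth.liftOfSurjective (AlgHom.id S S') q' hq hn
  refine ⟨g.toRingHom, ?_, ?_⟩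
  · ext x
    exact Algebra.FormallySmooth.liftOfSurjective_apply (AlgHom.id S S') q' hq hn x
  · ext s
    exact g.commutes s

lemma isNilpotent_ker_red : IsNilpotent (RingHom.ker (red k A R : A ⊗[k] R →+* R)) := by
  obtain ⟨n, hn⟩ := IsArtinianRing.isNilpotent_jacobson_bot (R := A)
  rw [IsLocalRing.jacobson_eq_maximalIdeal _ bot_ne_top] at hn
  have hle : RingHom.ker (red k A R : A ⊗[k] R →+* R) ≤
      (IsLocalRing.maximalIdeal A).map (algebraMap A (A ⊗[k] R)) := by
    intro x hx
    have := ker_red_le x hx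
    rwa [Ideal.smul_top_eq_map] at this
  refine ⟨n, ?_⟩
  rw [Ideal.zero_eq_bot, eq_bot_iff]
  refine (Ideal.pow_right_mono hle n).trans ?_
  rw [← Ideal.map_pow, hn]
  simp

lemma red_surjective : Function.Surjective (red k A R) := fun r ↦ ⟨1 ⊗ₜ r, by simp⟩

lemma HS.exists_restrict {R' : Type*} [CommRing R'] [Algebra k R'] (ρ : R →ₐ[k] R')
    (hρ : (ρ : R →+* R').FormallyEtale) (D : HS k A R) :
    ∃ g : R' →ₐ[k] A ⊗[k] R', (∀ r, red k A R' (g r) = r) ∧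
      ∀ r, g (ρ r) = Algebra.TensorProduct.map (AlgHom.id A A) ρ (D.1 (1 ⊗ₜ r)) := by
  obtain ⟨g, hg, hg'⟩ := exists_lift_of_formallyEtale (ρ : R →+* R') hρ
    (((Algebra.TensorProduct.map (AlgHom.id k A) ρ).comp (HS.toAlgHom D) :
      R →ₐ[k] A ⊗[k] R') : R →+* A ⊗[k] R')
    (red k A R' : A ⊗[k] R' →+* R') red_surjective isNilpotent_ker_red (by
      ext r
      change red k A R' (Algebra.TensorProduct.map (AlgHom.id k A) ρ (HS.toAlgHom D r)) = ρ r
      rw [red_map, HS.red_toAlgHom])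
  refine ⟨{ g with commutes' := fun c ↦ ?_ }, fun r ↦ RingHom.congr_fun hg r,
    fun r ↦ RingHom.congr_fun hg' r⟩
  have := RingHom.congr_fun hg' (algebraMap k R c)
  simpa using this

/-- The natural map `HS^A(R) → HS^A(R')` when `Spec R' → Spec R` is étale, e.g. an open immersion:
the image of `D` is the unique element whose action on `A ⊗ R'` extends that of `D`. -/
def HS.restrict {R' : Type*} [CommRing R'] [Algebra k R'] (ρ : R →ₐ[k] R')
    (hρ : (ρ : R →+* R').FormallyEtale) (D : HS k A R) : HS k A R' :=
  HS.ofAlgHom (HS.exists_restrict ρ hρ D).choose (HS.exists_restrict ρ hρ D).choose_spec.1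

lemma HS.restrict_apply {R' : Type*} [CommRing R'] [Algebra k R'] (ρ : R →ₐ[k] R')
    (hρ : (ρ : R →+* R').FormallyEtale) (D : HS k A R) (x : A ⊗[k] R) :
    (HS.restrict ρ hρ D).1 (Algebra.TensorProduct.map (AlgHom.id A A) ρ x) =
      Algebra.TensorProduct.map (AlgHom.id A A) ρ (D.1 x) := by
  induction x with
  | zero => simp
  | tmul a r =>
    have h := (HS.exists_restrict ρ hρ D).choose_spec.2 r
    have ha : a ⊗ₜ[k] r = a • ((1 : A) ⊗ₜ[k] r) := by simp [smul_tmul']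
    rw [Algebra.TensorProduct.map_tmul, HS.restrict, HS.ofAlgHom_tmul, h, ha, map_smul, map_smul]
    rfl
  | add x y hx hy => simp only [map_add, hx, hy]

end HS

section Der

variable {k R R' : Type*} [Field k] [CommRing R] [Algebra k R] [CommRing R'] [Algebra k R']

lemma exists_derivation_restrict (ρ : R →ₐ[k] R') (hρ : (ρ : R →+* R').FormallyEtale)
    (d : Derivation k R R) : ∃! d' : Derivation k R' R', ∀ r, d' (ρ r) = ρ (d r) := by
  let _ := (ρ : R →+* R').toAlgebra
  have : IsScalarTower k R R' := .of_algebraMap_eq fun c ↦ (ρ.commutes c).symm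
  have : Algebra.FormallyEtale R R' := hρ
  have halg : ∀ r, algebraMap R R' r = ρ r := fun _ ↦ rfl
  let e := KaehlerDifferential.tensorKaehlerEquivOfFormallyEtale k R R'
  let l : R' ⊗[R] Ω[R⁄k] →ₗ[R'] R' :=
    LinearMap.liftBaseChange R' ((Algebra.linearMap R R').comp d.liftKaehlerDifferential)
  refine ⟨(l.comp e.symm.toLinearMap).compDer (KaehlerDifferential.D k R'), fun r ↦ ?_, ?_⟩
  · have := KaehlerDifferential.tensorKaehlerEquivOfFormallyEtale_symm_D_algebraMap k R R' r
    rw [halg] at this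
    exact (congrArg l this).trans (by simp [l, halg])
  · intro d' hd'
    have key : ∀ d₁ d₂ : Derivation k R' R', (∀ r, d₁ (ρ r) = d₂ (ρ r)) → d₁ = d₂ := by
      intro d₁ d₂ h
      obtain ⟨δ₀, hδ₀⟩ : ∃ δ₀ : Derivation k R' R', δ₀ = d₁ - d₂ := ⟨_, rfl⟩
      have h0 : ∀ r, δ₀ (algebraMap R R' r) = 0 := fun r ↦ by
        simp [hδ₀, halg, h r]
      let δ : Derivation R R' R' :=
        { toFun := δ₀
          map_add' := map_add δ₀
          map_smul' := fun r x ↦ by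
            simp [Algebra.smul_def r, h0]
          map_one_eq_zero' := δ₀.map_one_eq_zero
          leibniz' := δ₀.leibniz }
      have hδ : δ = 0 := by
        have : δ.liftKaehlerDifferential = 0 := by
          refine LinearMap.ext fun x ↦ ?_
          rw [Subsingleton.elim x 0, map_zero, map_zero]
        ext x
        rw [← Derivation.liftKaehlerDifferential_comp_D δ x, this]; rfl
      ext x
      have : δ₀ x = 0 := congrArg (fun D : Derivation R R' R' ↦ D x) hδ
      rw [hδ₀] at this
      exact sub_eq_zero.mp this
    refine key _ _ fun r ↦ ?_
    rw [hd']
    have := KaehlerDifferential.tensorKaehlerEquivOfFormallyEtale_symm_D_algebraMap k R R' r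
    rw [halg] at this
    exact ((congrArg l this).trans (by simp [l, halg])).symm

/-- The restriction map `Der_k(R) → Der_k(R')` when `Spec R' → Spec R` is étale. -/
def derRestrict (ρ : R →ₐ[k] R') (hρ : (ρ : R →+* R').FormallyEtale) :
    Derivation k R R →+ Derivation k R' R' where
  toFun d := (exists_derivation_restrict ρ hρ d).choose
  map_zero' := ((exists_derivation_restrict ρ hρ 0).choose_spec.2 0 (by simp)).symm
  map_add' d₁ d₂ := by
    refine ((exists_derivation_restrict ρ hρ (d₁ + d₂)).choose_spec.2 _ fun r ↦ ?_).symm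
    simp [(exists_derivation_restrict ρ hρ d₁).choose_spec.1 r,
      (exists_derivation_restrict ρ hρ d₂).choose_spec.1 r]

lemma derRestrict_apply (ρ : R →ₐ[k] R') (hρ : (ρ : R →+* R').FormallyEtale)
    (d : Derivation k R R) (r : R) : derRestrict ρ hρ d (ρ r) = ρ (d r) :=
  (exists_derivation_restrict ρ hρ d).choose_spec.1 r

end Der

section Bracket

variable {k B A R : Type*} [Field k] [CommRing B] [Algebra k B] [ArtinLocal k B]
    [CommRing A] [Algebra k A] [ArtinLocal k A] [CommRing R] [Algebra k R]

lemma SmallExtension.t_mem (Φ : SmallExtension k B A) :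
    Φ.t ∈ IsLocalRing.maximalIdeal B := by
  rw [← residue_eq_zero_iff (k := k), ← residue_map Φ.φ, (Φ.ker_eq _).2 ⟨1, by simp⟩, map_zero]

lemma SmallExtension.t_mul_t (Φ : SmallExtension k B A) : Φ.t * Φ.t = 0 :=
  Φ.maximalIdeal_mul _ Φ.t_mem

/-- `d⟨t⟩ ∈ HS^B(R)`, given on `R` by `r ↦ 1 ⊗ r + t ⊗ d r`. -/
def bracket (Φ : SmallExtension k B A) (d : Derivation k R R) : HS k B R :=
  HS.ofAlgHom
    (AlgHom.ofLinearMap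
      (Algebra.TensorProduct.includeRight.toLinearMap +
        (TensorProduct.mk k B R Φ.t).comp d.toLinearMap)
      (by simp [Algebra.TensorProduct.one_def])
      (fun x y ↦ by
        simp [add_mul, mul_add, Φ.t_mul_t, tmul_add, mul_comm y]
        abel))
    (fun r ↦ by simp [(residue_eq_zero_iff (k := k) _).2 Φ.t_mem])

lemma bracket_apply (Φ : SmallExtension k B A) (d : Derivation k R R) (r : R) :
    (bracket Φ d).1 (1 ⊗ₜ r) = 1 ⊗ₜ r + Φ.t ⊗ₜ d r := by
  simp [bracket]

end Bracket

section T1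

variable (k R : Type*) [Field k] [CommRing R] [Algebra k R]

/-- The canonical presentation `R = T / I` with `T = k[X_r : r ∈ R]`, `X_r ↦ r`. -/
abbrev Pres : Algebra.Extension k R := (Algebra.Generators.self k R).toExtension

/-- The first cotangent module
`T¹_{R/k} = coker (Hom_R(Ω_{T/k} ⊗_T R, R) → Hom_R(I/I², R))`. -/
abbrev T1 : Type _ :=
  ((Pres k R).Cotangent →ₗ[R] R) ⧸ LinearMap.range (LinearMap.lcomp R R (Pres k R).cotangentComplex)

variable {k R}

/-- The class in `T¹_{R/k}` of a homomorphism `I/I² → R`. -/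
def T1.mk (f : (Pres k R).Cotangent →ₗ[R] R) : T1 k R := Submodule.Quotient.mk f

/-- `c' ∈ T¹_{R'/k}` is the restriction of `c ∈ T¹_{R/k}` along an open immersion
`Spec R' → Spec R`: representatives `f : I/I² → R` and `f' : I'/I'² → R'` give two maps
`I/I² → R'`, which have to agree modulo `Hom_R(Ω_{T/k} ⊗_T R, R')`. (For an open immersion both
maps from `T¹_{R/k}` and `T¹_{R'/k}` to the cokernel of
`Hom_R(Ω_{T/k} ⊗_T R, R') → Hom_R(I/I², R')` are defined and the second one is bijective.) -/
def T1.IsRestriction {R' : Type*} [CommRing R'] [Algebra k R'] (ρ : R →ₐ[k] R')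
    (c : T1 k R) (c' : T1 k R') : Prop :=
  letI := (ρ : R →+* R').toAlgebra
  haveI : IsScalarTower k R R' := .of_algebraMap_eq fun c ↦ (ρ.commutes c).symm
  ∃ (f : (Pres k R).Cotangent →ₗ[R] R) (f' : (Pres k R').Cotangent →ₗ[R'] R')
    (v : (Pres k R).CotangentSpace →ₗ[R] R'),
    T1.mk f = c ∧ T1.mk f' = c' ∧
    ∀ y : (Pres k R).Cotangent,
      f' (Algebra.Extension.Cotangent.map (Algebra.Generators.defaultHom
        (Algebra.Generators.self k R) (Algebra.Generators.self k R')).toExtensionHom y) =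
      ρ (f y) + v ((Pres k R).cotangentComplex y)

end T1

section Ob

variable {k B A R : Type*} [Field k] [CommRing B] [Algebra k B] [ArtinLocal k B]
    [CommRing A] [Algebra k A] [ArtinLocal k A] [CommRing R] [Algebra k R]

variable (k R) in
/-- The projection `T → R = T / I` of the canonical presentation. -/
def presProj : (Pres k R).Ring →ₐ[k] R := IsScalarTower.toAlgHom k (Pres k R).Ring R

/-- `E ∈ HS^B(T)` is a lift of `D ∈ HS^A(R)`, where `R = T / I`. -/
def IsLift (Φ : SmallExtension k B A) (D : HS k A R) (E : HS k B (Pres k R).Ring) : Prop :=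
  ∀ y : B ⊗[k] (Pres k R).Ring,
    Algebra.TensorProduct.map Φ.φ (presProj k R) (E.1 y) =
      D.1 (Algebra.TensorProduct.map Φ.φ (presProj k R) y)

/-- `f : I/I² → R` is the homomorphism `f_E` induced by `E`: on `I`, the composition
`T → B ⊗ T → B ⊗ R` of `E|_T` with the projection is `x ↦ t ⊗ f x`. -/
def IsInduced (Φ : SmallExtension k B A) (E : HS k B (Pres k R).Ring)
    (f : (Pres k R).Cotangent →ₗ[R] R) : Prop :=
  ∀ x : (Pres k R).ker,
    Algebra.TensorProduct.map (AlgHom.id k B) (presProj k R) (E.1 (1 ⊗ₜ (x : (Pres k R).Ring))) =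
      Φ.t ⊗ₜ f (Algebra.Extension.Cotangent.mk x)

lemma presProj_surjective : Function.Surjective (presProj k R) :=
  (Pres k R).algebraMap_surjective

lemma map_presProj_surjective (Φ : SmallExtension k B A) :
    Function.Surjective (Algebra.TensorProduct.map Φ.φ (presProj k R)) :=
  TensorProduct.map_surjective Φ.surjective presProj_surjective

variable (k) in
/-- The variable `X_r` of the canonical presentation. -/
def presX (r : R) : (Pres k R).Ring := (MvPolynomial.X r : MvPolynomial R k)

lemma presProj_X (r : R) : presProj k R (presX k r) = r := by
  change MvPolynomial.aeval id (MvPolynomial.X r : MvPolynomial R k) = r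
  exact MvPolynomial.aeval_X _ _

lemma exists_isLift (Φ : SmallExtension k B A) (D : HS k A R) :
    ∃ E : HS k B (Pres k R).Ring, IsLift Φ D E := by
  have h : ∀ r : R, ∃ e : B ⊗[k] (Pres k R).Ring,
      Algebra.TensorProduct.map Φ.φ (presProj k R) e = D.1 (1 ⊗ₜ r) ∧
      red k B _ e = presX k r := by
    intro r
    obtain ⟨e₀, he₀⟩ := map_presProj_surjective Φ (D.1 (1 ⊗ₜ r))
    have h1 : presProj k R (red k B _ e₀) = r := by
      rw [← red_map Φ.φ, he₀, D.2]; simp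
    have h2 : presProj k R (presX k r) = r := by
      change MvPolynomial.aeval _ _ = _
      exact MvPolynomial.aeval_X _ _
    refine ⟨e₀ - 1 ⊗ₜ (red k B _ e₀ - presX k r), ?_, ?_⟩
    · rw [map_sub, he₀, Algebra.TensorProduct.map_tmul, map_sub, h1, h2, sub_self, tmul_zero,
        sub_zero]
    · rw [map_sub, red_tmul, map_one, one_smul, sub_sub_cancel]
  choose e he he' using h
  let g : (Pres k R).Ring →ₐ[k] B ⊗[k] (Pres k R).Ring := MvPolynomial.aeval e
  have hgX : ∀ r, g (presX k r) = e r := fun r ↦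
    MvPolynomial.aeval_X _ _
  have hg : ∀ p, red k B _ (g p) = p := by
    have : ((red k B _).comp g : MvPolynomial R k →ₐ[k] MvPolynomial R k) = AlgHom.id k _ :=
      MvPolynomial.algHom_ext fun r ↦ by
        change red k B _ (g (presX k r)) = presX k r
        rw [hgX, he']
    intro p
    exact congrArg (fun F : MvPolynomial R k →ₐ[k] MvPolynomial R k ↦ F p) this
  refine ⟨HS.ofAlgHom g hg, fun y ↦ ?_⟩
  have h1 : ((Algebra.TensorProduct.map Φ.φ (presProj k R)).comp g :
      MvPolynomial R k →ₐ[k] A ⊗[k] R) = (HS.toAlgHom D).comp (presProj k R) :=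
    MvPolynomial.algHom_ext fun r ↦ by
      change Algebra.TensorProduct.map Φ.φ (presProj k R) (g (presX k r)) =
        D.1 (1 ⊗ₜ presProj k R (presX k r))
      rw [hgX, he, presProj_X]
  induction y with
  | zero => simp
  | tmul b p =>
    have h2 : Algebra.TensorProduct.map Φ.φ (presProj k R) (g p) = D.1 (1 ⊗ₜ presProj k R p) :=
      congrArg (fun F : MvPolynomial R k →ₐ[k] A ⊗[k] R ↦ F p) h1
    have h3 : Φ.φ b ⊗ₜ[k] presProj k R p = Φ.φ b • ((1 : A) ⊗ₜ[k] presProj k R p) := by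
      simp [smul_tmul']
    have h4 : D.1 (Φ.φ b • ((1 : A) ⊗ₜ[k] presProj k R p)) =
        Φ.φ b • D.1 ((1 : A) ⊗ₜ[k] presProj k R p) := map_smul _ _ _
    rw [HS.ofAlgHom_tmul, Algebra.TensorProduct.map_tmul, h3, h4, ← h2, Algebra.smul_def,
      map_mul, Algebra.smul_def, Algebra.TensorProduct.algebraMap_apply,
      Algebra.TensorProduct.algebraMap_apply, Algebra.TensorProduct.map_tmul]
    simp
  | add x y hx hy => simp only [map_add, hx, hy]

lemma SmallExtension.tmul_injective (Φ : SmallExtension k B A) :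
    Function.Injective fun r : R ↦ Φ.t ⊗ₜ[k] r := by
  have h : Function.Injective (LinearMap.toSpanSingleton k B Φ.t) := by
    rw [← LinearMap.ker_eq_bot]; exact LinearMap.ker_toSpanSingleton k Φ.t_ne_zero
  have := (Module.Flat.rTensor_preserves_injective_linearMap (M := R) _ h).comp
    (TensorProduct.lid k R).symm.injective
  convert this using 1
  ext r; simp

lemma SmallExtension.exists_tmul (Φ : SmallExtension k B A) (z : B ⊗[k] R)
    (hz : Algebra.TensorProduct.map Φ.φ (AlgHom.id k R) z = 0) : ∃ r : R, z = Φ.t ⊗ₜ r := by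
  have hex : Function.Exact (LinearMap.toSpanSingleton k B Φ.t) Φ.φ.toLinearMap := by
    intro b
    rw [AlgHom.toLinearMap_apply, Φ.ker_eq]
    simp [eq_comm]
  obtain ⟨w, rfl⟩ := (rTensor_exact R hex Φ.surjective z).1 hz
  refine ⟨TensorProduct.lid k R w, ?_⟩
  obtain ⟨r, rfl⟩ := (TensorProduct.lid k R).symm.surjective w
  simp

lemma mul_t_tmul (Φ : SmallExtension k B A) (z : B ⊗[k] R) (r : R) :
    z * (Φ.t ⊗ₜ r) = Φ.t ⊗ₜ (red k B R z * r) := by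
  induction z with
  | zero => simp
  | tmul b s =>
    have h : b * Φ.t = residue k B b • Φ.t := by
      have := Φ.maximalIdeal_mul (b - algebraMap k B (residue k B b))
        ((residue_eq_zero_iff (k := k) _).1 (by simp))
      rw [sub_mul, sub_eq_zero] at this
      rw [this, Algebra.smul_def]
    rw [Algebra.TensorProduct.tmul_mul_tmul, h, red_tmul, smul_tmul, smul_mul_assoc]
  | add x y hx hy => rw [add_mul, hx, hy, map_add, add_mul, tmul_add]

lemma exists_isInduced (Φ : SmallExtension k B A) (D : HS k A R) (E : HS k B (Pres k R).Ring)
    (hE : IsLift Φ D E) : ∃ f : (Pres k R).Cotangent →ₗ[R] R, IsInduced Φ E f := by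
  let ψ : (Pres k R).Ring →ₐ[k] B ⊗[k] R :=
    (Algebra.TensorProduct.map (AlgHom.id k B) (presProj k R)).comp (HS.toAlgHom E)
  have hred : ∀ p, red k B R (ψ p) = presProj k R p := fun p ↦ by
    change red k B R (Algebra.TensorProduct.map _ _ (HS.toAlgHom E p)) = _
    rw [red_map, HS.red_toAlgHom]
  have hψ : ∀ x : (Pres k R).ker, ∃ r : R, ψ x = Φ.t ⊗ₜ r := by
    intro x
    refine Φ.exists_tmul _ ?_
    have h1 : (Algebra.TensorProduct.map Φ.φ (AlgHom.id k R)).comp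
        (Algebra.TensorProduct.map (AlgHom.id k B) (presProj k R)) =
        Algebra.TensorProduct.map Φ.φ (presProj k R) := by
      ext <;> rfl
    have h2 : presProj k R (x : (Pres k R).Ring) = 0 := x.2
    have h3 := hE (1 ⊗ₜ (x : (Pres k R).Ring))
    rw [Algebra.TensorProduct.map_tmul, h2, tmul_zero, map_zero] at h3
    rw [← h3, ← h1]
    rfl
  choose g hg using hψ
  let G : (Pres k R).ker →ₗ[(Pres k R).Ring] R :=
    { toFun := g
      map_add' := fun x y ↦ Φ.tmul_injective (by
        change Φ.t ⊗ₜ[k] g (x + y) = Φ.t ⊗ₜ[k] (g x + g y)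
        rw [tmul_add, ← hg, ← hg, ← hg, ← map_add]; rfl)
      map_smul' := fun p x ↦ Φ.tmul_injective (by
        change Φ.t ⊗ₜ[k] g (p • x) = Φ.t ⊗ₜ[k] (p • g x)
        have h : ψ ((p • x : (Pres k R).ker) : (Pres k R).Ring) = ψ p * ψ x := map_mul ψ p x
        rw [← hg, h, hg x, mul_t_tmul, hred, Algebra.smul_def]
        rfl) }
  refine ⟨(LinearMap.liftBaseChange R G).comp (Pres k R).cotangentEquiv.symm.toLinearMap,
    fun x ↦ ?_⟩
  have h : (Pres k R).cotangentEquiv.symm (Algebra.Extension.Cotangent.mk x) = 1 ⊗ₜ x := by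
    rw [LinearEquiv.symm_apply_eq, Algebra.Extension.contangentEquiv_tmul, one_smul]
  rw [LinearMap.comp_apply, LinearEquiv.coe_coe, h, LinearMap.liftBaseChange_tmul, one_smul]
  exact hg x

/-- The obstruction map `ob_Φ : HS^A(R) → T¹_{R/k}`: take a lift `E ∈ HS^B(T)` of `D` and the class
of the homomorphism `f_E : I/I² → R` it induces. (The class is independent of the choice of `E`.) -/
def ob (Φ : SmallExtension k B A) (D : HS k A R) : T1 k R :=
  T1.mk (exists_isInduced Φ D _ (exists_isLift Φ D).choose_spec).choose

variable (R) in
/-- The obstruction module `Ob^Φ_R ⊆ T¹_{R/k}`, the image of `ob_Φ`. -/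
def Ob (Φ : SmallExtension k B A) : Set (T1 k R) := Set.range (ob Φ)

end Ob

section Scheme

variable {k : Type u} [Field k] {X₀ : Scheme.{u}} [X₀.Over (Spec (.of k))]

/-- Sections of a `k`-scheme form a `k`-algebra. -/
instance algebraSections (U : X₀.Opens) : Algebra k Γ(X₀, U) :=
  ((Scheme.ΓSpecIso (.of k)).inv ≫
    (X₀ ↘ Spec (.of k)).appLE ⊤ U (le_of_le_of_eq le_top rfl)).hom.toAlgebra

variable (k) in
/-- The restriction map `Γ(X₀, U) → Γ(X₀, V)`. -/
def resHom {U V : X₀.Opens} (h : V ≤ U) : Γ(X₀, U) →ₐ[k] Γ(X₀, V) :=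
  { (X₀.presheaf.map (homOfLE h).op).hom with
    commutes' := fun c ↦ by
      change (((Scheme.ΓSpecIso (.of k)).inv ≫
        (X₀ ↘ Spec (.of k)).appLE ⊤ U _) ≫ X₀.presheaf.map (homOfLE h).op).hom c = _
      rw [Category.assoc, Scheme.Hom.appLE_map]
      rfl }

lemma formallyEtale_resHom {U V : X₀.affineOpens} (h : V ≤ U) :
    (resHom k (show (V : X₀.Opens) ≤ U from h) : Γ(X₀, U) →+* Γ(X₀, V)).FormallyEtale := by
  have h1 := Etale.etale_appLE (𝟙 X₀) U.2 V.2 h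
  have h2 : (𝟙 X₀ : X₀ ⟶ X₀).appLE U V h =
      X₀.presheaf.map (homOfLE (show (V : X₀.Opens) ≤ U from h)).op := by
    change (𝟙 X₀ : X₀ ⟶ X₀).app U ≫ X₀.presheaf.map _ = _
    rw [Scheme.Hom.id_app]
    exact Category.id_comp _
  rw [h2] at h1
  change RingHom.FormallyEtale (X₀.presheaf.map (homOfLE _).op).hom
  algebraize [(X₀.presheaf.map (homOfLE (show (V : X₀.Opens) ≤ U from h)).op).hom]
  exact Algebra.Etale.formallyEtale

variable (k) in
lemma isAffineOpen_inf [IsSeparated (X₀ ↘ Spec (.of k))] {U V : X₀.Opens}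
    (hU : IsAffineOpen U) (hV : IsAffineOpen V) : IsAffineOpen (U ⊓ V) :=
  (isAffineHom_diagonal_iff (f := X₀ ↘ Spec (.of k))).mp inferInstance ⊤ (isAffineOpen_top _)
    U (by simp) V (by simp) hU hV

end Scheme


section Deformations

variable (k : Type u) [Field k] (X₀ : Scheme.{u}) [X₀.Over (Spec (.of k))]
  (A : Type u) [CommRing A] [Algebra k A] [ArtinLocal k A]

/-- A deformation of `X₀` over `A`: a flat `A`-scheme `X` with a cartesian square
exhibiting `X₀` as its fibre over `Spec k = Spec (A / 𝔪_A)`. -/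
structure Deformation where
  X : Scheme.{u}
  f : X ⟶ Spec (.of A)
  i : X₀ ⟶ X
  flat : Flat f
  isPullback : IsPullback i (X₀ ↘ Spec (.of k)) f
    (Spec.map (CommRingCat.ofHom (residue k A : A →+* k)))

variable {k X₀ A}

/-- An isomorphism of deformations: an isomorphism over `Spec A` restricting to the identity
of `X₀`. -/
def Deformation.IsIso (𝒳 𝒴 : Deformation k X₀ A) : Prop :=
  ∃ e : 𝒳.X ≅ 𝒴.X, e.hom ≫ 𝒴.f = 𝒳.f ∧ 𝒳.i ≫ e.hom = 𝒴.i

/-- `𝒳` is locally trivial: every `x : X₀` has an open neighbourhood `U`, corresponding to the open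
`V` of the deformation, such that `V` is isomorphic, as a deformation of `U`, to the
trivial deformation `U ×_k Spec A`. The isomorphism is given by its component `r : V ⟶ U`. -/
def Deformation.IsLocallyTrivial (𝒳 : Deformation k X₀ A) : Prop :=
  ∀ x : X₀, ∃ (U : X₀.Opens) (V : 𝒳.X.Opens) (h : 𝒳.i ⁻¹ᵁ V = U) (r : V.toScheme ⟶ U.toScheme),
    x ∈ U ∧
    IsPullback r (V.ι ≫ 𝒳.f) (U.ι ≫ X₀ ↘ Spec (.of k))
      (Spec.map (CommRingCat.ofHom (algebraMap k A))) ∧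
    𝒳.i.resLE V U h.ge ≫ r = 𝟙 _

variable (k X₀ A) in
/-- Isomorphism of locally trivial deformations. -/
def locTrivSetoid : Setoid {𝒳 : Deformation k X₀ A // 𝒳.IsLocallyTrivial} where
  r 𝒳 𝒴 := 𝒳.1.IsIso 𝒴.1
  iseqv :=
    { refl := fun 𝒳 ↦ ⟨Iso.refl _, by simp, by simp⟩
      symm := by
        rintro 𝒳 𝒴 ⟨e, h₁, h₂⟩
        exact ⟨e.symm, by simp [← h₁], by simp [← h₂]⟩
      trans := by
        rintro 𝒳 𝒴 𝒵 ⟨e, h₁, h₂⟩ ⟨e', h₁', h₂'⟩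
        exact ⟨e ≪≫ e', by simp [← h₁, ← h₁'], by simp [← h₂', ← h₂]⟩ }

variable (k X₀ A) in
/-- `Def'_{X₀}(A)`: the set of isomorphism classes of locally trivial deformations of `X₀`
over `A`. -/
def LTDef : Type _ := Quotient (locTrivSetoid k X₀ A)

variable {B : Type u} [CommRing B] [Algebra k B] [ArtinLocal k B]

/-- The base change of a deformation along `φ : B → A`. -/
def Deformation.baseChange (φ : B →ₐ[k] A) (𝒴 : Deformation k X₀ B) : Deformation k X₀ A :=
  have hφ : Spec.map (CommRingCat.ofHom (residue k A : A →+* k)) ≫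
      Spec.map (CommRingCat.ofHom (φ : B →+* A)) =
      Spec.map (CommRingCat.ofHom (residue k B : B →+* k)) := by
    rw [← Spec.map_comp, ← CommRingCat.ofHom_comp]
    congr 2
    ext b
    exact residue_map φ b
  { X := pullback 𝒴.f (Spec.map (CommRingCat.ofHom (φ : B →+* A)))
    f := pullback.snd _ _
    i := pullback.lift 𝒴.i
      ((X₀ ↘ Spec (.of k)) ≫ Spec.map (CommRingCat.ofHom (residue k A : A →+* k))) (by
        rw [Category.assoc, hφ, 𝒴.isPullback.w])
    flat := by
      have := 𝒴.flat
      infer_instance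
    isPullback := by
      refine IsPullback.of_right (h₁₁ := pullback.lift _ _ _) (h₁₂ := pullback.fst _ _)
        (h₂₂ := Spec.map (CommRingCat.ofHom (φ : B →+* A))) (v₁₃ := 𝒴.f) ?_ (pullback.lift_snd _ _ _)
        (IsPullback.of_hasPullback _ _)
      rw [pullback.lift_fst, hφ]
      exact 𝒴.isPullback }

lemma Deformation.baseChange_i_fst (φ : B →ₐ[k] A) (𝒴 : Deformation k X₀ B) :
    (𝒴.baseChange φ).i ≫ pullback.fst 𝒴.f (Spec.map (CommRingCat.ofHom (φ : B →+* A))) = 𝒴.i :=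
  pullback.lift_fst _ _ _

lemma resLE_comp_morphismRestrict {X Y Z : Scheme.{u}} (i' : X ⟶ Z) (q : Z ⟶ Y) (i : X ⟶ Y)
    (h : i' ≫ q = i) (U : X.Opens) (V : Y.Opens) (h₁ : U ≤ i' ⁻¹ᵁ q ⁻¹ᵁ V) (h₂ : U ≤ i ⁻¹ᵁ V) :
    i'.resLE (q ⁻¹ᵁ V) U h₁ ≫ (q ∣_ V) = i.resLE V U h₂ := by
  rw [← cancel_mono V.ι]
  simp [h]

lemma Deformation.IsLocallyTrivial.baseChange (φ : B →ₐ[k] A) {𝒴 : Deformation k X₀ B}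
    (h : 𝒴.IsLocallyTrivial) : (𝒴.baseChange φ).IsLocallyTrivial := by
  intro x
  obtain ⟨U, V, hUV, r, hx, hr, hir⟩ := h x
  let q : (𝒴.baseChange φ).X ⟶ 𝒴.X :=
    pullback.fst 𝒴.f (Spec.map (CommRingCat.ofHom (φ : B →+* A)))
  have hpre : (𝒴.baseChange φ).i ⁻¹ᵁ (q ⁻¹ᵁ V) = U := by
    rw [← hUV, ← 𝒴.baseChange_i_fst φ]; rfl
  refine ⟨U, q ⁻¹ᵁ V, hpre, (q ∣_ V) ≫ r, hx, ?_, ?_⟩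
  · have h1 : IsPullback (q ∣_ V) ((q ⁻¹ᵁ V).ι ≫ (𝒴.baseChange φ).f) (V.ι ≫ 𝒴.f)
        (Spec.map (CommRingCat.ofHom (φ : B →+* A))) := by
      have h2 : IsPullback (q ∣_ V) (q ⁻¹ᵁ V).ι V.ι q := isPullback_morphismRestrict q V
      have h3 : IsPullback q (𝒴.baseChange φ).f 𝒴.f
        (Spec.map (CommRingCat.ofHom (φ : B →+* A))) := IsPullback.of_hasPullback _ _
      exact h2.paste_vert h3
    have h3 := h1.paste_horiz hr
    have h4 : Spec.map (CommRingCat.ofHom (φ : B →+* A)) ≫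
        Spec.map (CommRingCat.ofHom (algebraMap k B)) =
        Spec.map (CommRingCat.ofHom (algebraMap k A)) := by
      rw [← Spec.map_comp, ← CommRingCat.ofHom_comp]
      congr 2
      ext c
      exact φ.commutes c
    rw [h4] at h3
    exact h3
  · have h1 := resLE_comp_morphismRestrict (𝒴.baseChange φ).i q 𝒴.i (𝒴.baseChange_i_fst φ) U V
      hpre.ge hUV.ge
    rw [← Category.assoc, h1, hir]

/-- The restriction map `α : Def'_{X₀}(B) → Def'_{X₀}(A)` along `φ : B → A`. -/
def LTDef.map (φ : B →ₐ[k] A) : LTDef k X₀ B → LTDef k X₀ A :=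
  Quotient.map' (s₁ := locTrivSetoid k X₀ B) (s₂ := locTrivSetoid k X₀ A)
    (fun 𝒴 ↦ ⟨𝒴.1.baseChange φ, 𝒴.2.baseChange φ⟩) (by
      rintro 𝒴 𝒴' ⟨e, h₁, h₂⟩
      have he : IsIso e.hom := inferInstance
      have h₁' : (𝒴.1.f ≫ 𝟙 _ : _ ⟶ Spec (.of B)) = e.hom ≫ 𝒴'.1.f := by rw [h₁, Category.comp_id]
      have hmap : IsIso (pullback.map 𝒴.1.f (Spec.map (CommRingCat.ofHom (φ : B →+* A)))
          𝒴'.1.f (Spec.map (CommRingCat.ofHom (φ : B →+* A))) e.hom (𝟙 _) (𝟙 _) h₁'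
          (by simp)) := inferInstance
      refine ⟨@asIso _ _ _ _ _ hmap, ?_, ?_⟩
      · exact (pullback.lift_snd _ _ _).trans (Category.comp_id _)
      · apply pullback.hom_ext
        · change (pullback.lift _ _ _ ≫ pullback.map _ _ _ _ e.hom (𝟙 _) (𝟙 _) h₁' (by simp)) ≫ _ = _
          rw [Category.assoc, pullback.lift_fst, pullback.lift_fst_assoc, h₂]
          exact (pullback.lift_fst _ _ _).symm
        · change (pullback.lift _ _ _ ≫ pullback.map _ _ _ _ e.hom (𝟙 _) (𝟙 _) h₁' (by simp)) ≫ _ = _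
          rw [Category.assoc, pullback.lift_snd, pullback.lift_snd_assoc, Category.comp_id]
          exact (pullback.lift_snd _ _ _).symm)

end Deformations

section Cech

variable (k : Type u) [Field k] {X₀ : Scheme.{u}} [X₀.Over (Spec (.of k))]
  [IsSeparated (X₀ ↘ Spec (.of k))] {ι : Type*} (U : ι → X₀.affineOpens)

/-- The affine open `U_α ∩ U_β`. -/
def inter₂ (α β : ι) : X₀.affineOpens :=
  ⟨U α ⊓ U β, isAffineOpen_inf k (U α).2 (U β).2⟩

/-- The affine open `U_α ∩ U_β ∩ U_γ`. -/
def inter₃ (α β γ : ι) : X₀.affineOpens :=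
  ⟨U α ⊓ U β ⊓ U γ, isAffineOpen_inf k (inter₂ k U α β).2 (U γ).2⟩

variable {k U}

lemma inter₂_le_left (α β : ι) : inter₂ k U α β ≤ U α :=
  show (U α : X₀.Opens) ⊓ U β ≤ U α from inf_le_left

lemma inter₂_le_right (α β : ι) : inter₂ k U α β ≤ U β :=
  show (U α : X₀.Opens) ⊓ U β ≤ U β from inf_le_right

lemma le_inter₂ {W : X₀.affineOpens} {α β : ι} (hα : W ≤ U α) (hβ : W ≤ U β) :
    W ≤ inter₂ k U α β :=
  show (W : X₀.Opens) ≤ (U α : X₀.Opens) ⊓ U β from le_inf hα hβ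

lemma inter₃_le_fst (α β γ : ι) : inter₃ k U α β γ ≤ U α :=
  show (U α : X₀.Opens) ⊓ U β ⊓ U γ ≤ U α from inf_le_left.trans inf_le_left

lemma inter₃_le_snd (α β γ : ι) : inter₃ k U α β γ ≤ U β :=
  show (U α : X₀.Opens) ⊓ U β ⊓ U γ ≤ U β from inf_le_left.trans inf_le_right

lemma inter₃_le_thd (α β γ : ι) : inter₃ k U α β γ ≤ U γ :=
  show (U α : X₀.Opens) ⊓ U β ⊓ U γ ≤ U γ from inf_le_right

variable (k) in
/-- `Der_k(𝒪_{X₀})(W) = Der_k(Γ(X₀, W))` for an affine open `W`. -/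
abbrev DerSec (W : X₀.affineOpens) : Type u := Derivation k Γ(X₀, W) Γ(X₀, W)

/-- The restriction maps of the sheaf `Der_k(𝒪_{X₀})`. -/
def derRes {V W : X₀.affineOpens} (h : W ≤ V) : DerSec k V →+ DerSec k W :=
  derRestrict (resHom k h) (formallyEtale_resHom h)

/-- The restriction maps of the sheaf of groups `HS^A(𝒪_{X₀})`. -/
def HS.res {A : Type u} [CommRing A] [Algebra k A] [ArtinLocal k A] {V W : X₀.affineOpens}
    (h : W ≤ V) (D : HS k A Γ(X₀, V)) : HS k A Γ(X₀, W) :=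
  HS.restrict (resHom k h) (formallyEtale_resHom h) D

variable (k U)

/-- Families `d_α ∈ Der_k(𝒪_{X₀})(U_α)`. -/
abbrev DerC0 := ∀ α, DerSec k (U α)

/-- Families `d_{αβ} ∈ Der_k(𝒪_{X₀})(U_α ∩ U_β)`. -/
abbrev DerC1 := ∀ α β, DerSec k (inter₂ k U α β)

/-- Families `d_{αβγ} ∈ Der_k(𝒪_{X₀})(U_α ∩ U_β ∩ U_γ)`. -/
abbrev DerC2 := ∀ α β γ, DerSec k (inter₃ k U α β γ)

/-- The Čech differential `(δ d)_{αβ} = d_β - d_α`. -/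
def derδ0 : DerC0 k U →+ DerC1 k U where
  toFun d α β := derRes (inter₂_le_right α β) (d β) - derRes (inter₂_le_left α β) (d α)
  map_zero' := by funext α β; simp
  map_add' d d' := by funext α β; simp only [Pi.add_apply, map_add]; abel

/-- The Čech differential `(δ d)_{αβγ} = d_{βγ} - d_{αγ} + d_{αβ}`. -/
def derδ1 : DerC1 k U →+ DerC2 k U where
  toFun d α β γ :=
    derRes (le_inter₂ (inter₃_le_snd α β γ) (inter₃_le_thd α β γ)) (d β γ) -
    derRes (le_inter₂ (inter₃_le_fst α β γ) (inter₃_le_thd α β γ)) (d α γ) +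
    derRes (le_inter₂ (inter₃_le_fst α β γ) (inter₃_le_snd α β γ)) (d α β)
  map_zero' := by funext α β γ; simp
  map_add' d d' := by funext α β γ; simp only [Pi.add_apply, map_add]; abel

/-- Alternating families: `d_{αα} = 0` and `d_{βα} = - d_{αβ}`. -/
def derAlt : AddSubgroup (DerC1 k U) where
  carrier := {d | (∀ α, d α α = 0) ∧
    ∀ α β, derRes (le_inter₂ (inter₂_le_right α β) (inter₂_le_left α β)) (d β α) = - d α β}
  zero_mem' := ⟨fun _ ↦ rfl, fun α β ↦ by simp⟩
  add_mem' {d d'} h h' := ⟨fun α ↦ by simp [h.1, h'.1], fun α β ↦ by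
    simp only [Pi.add_apply, map_add, h.2, h'.2]; abel⟩
  neg_mem' {d} h := ⟨fun α ↦ by simp [h.1], fun α β ↦ by
    simp only [Pi.neg_apply, map_neg, h.2]⟩

/-- Alternating `1`-cocycles. -/
def derZ1 : AddSubgroup (DerC1 k U) := derAlt k U ⊓ (derδ1 k U).ker

/-- The Čech cohomology group `Ȟ¹(𝔘, Der_k(𝒪_{X₀}))`. -/
abbrev DerH1 := derZ1 k U ⧸ (derδ0 k U).range.addSubgroupOf (derZ1 k U)

/-- All families `(d_{αβγ})` modulo coboundaries of alternating families. The Čech cohomology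
group `Ȟ²(𝔘, Der_k(𝒪_{X₀}))` is the subgroup of the classes of alternating cocycles. -/
abbrev DerH2 := DerC2 k U ⧸ (derAlt k U).map (derδ1 k U)

end Cech

section Couples

variable {k : Type u} [Field k] {X₀ : Scheme.{u}} [X₀.Over (Spec (.of k))]
  [IsSeparated (X₀ ↘ Spec (.of k))] {ι : Type*} {U : ι → X₀.affineOpens}
  {A : Type u} [CommRing A] [Algebra k A] [ArtinLocal k A]
  {B : Type u} [CommRing B] [Algebra k B] [ArtinLocal k B]

variable (k U A) in
/-- Families `D^{αβ} ∈ HS^A(R_{αβ})`, where `U_α ∩ U_β = Spec R_{αβ}`. -/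
abbrev Gluing := ∀ α β, HS k A Γ(X₀, inter₂ k U α β)

/-- The image of `D^{αβ}` in `HS^A(Γ(X₀, W))`, for `W ⊆ U_α ∩ U_β`. -/
def Gluing.on (D : Gluing k U A) (α β : ι) {W : X₀.affineOpens} (hα : W ≤ U α) (hβ : W ≤ U β) :
    HS k A Γ(X₀, W) :=
  HS.res (le_inter₂ hα hβ) (D α β)

/-- A couple over `A`: `D^{αα} = id` and `D^{αβ} = (D^{βα})⁻¹`. -/
def Gluing.IsCouple (D : Gluing k U A) : Prop :=
  (∀ α, D α α = 1) ∧
    ∀ α β, D α β = (D.on β α (inter₂_le_right α β) (inter₂_le_left α β))⁻¹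

/-- The cocycle conditions `D^{βγ} ∘ D^{αβ} = D^{αγ}` on `U_α ∩ U_β ∩ U_γ`. -/
def Gluing.IsCocycle (D : Gluing k U A) : Prop :=
  ∀ α β γ, D.on β γ (inter₃_le_snd (k := k) α β γ) (inter₃_le_thd (k := k) α β γ) *
    D.on α β (inter₃_le_fst (k := k) α β γ) (inter₃_le_snd (k := k) α β γ) =
    D.on α γ (inter₃_le_fst (k := k) α β γ) (inter₃_le_thd (k := k) α β γ)

/-- `E^α ∈ HS^A(R_α)` form an isomorphism of couples from `D` to `D'`:
`E^β ∘ D^{αβ} = D'^{αβ} ∘ E^α` on `U_α ∩ U_β`. -/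
def Gluing.IsHom (D D' : Gluing k U A) (E : ∀ α, HS k A Γ(X₀, U α)) : Prop :=
  ∀ α β, HS.res (inter₂_le_right α β) (E β) * D α β =
    D' α β * HS.res (inter₂_le_left α β) (E α)

/-- The couple `Y ⊗_B A`. -/
def Gluing.baseChange (φ : B →ₐ[k] A) (Y : Gluing k U B) : Gluing k U A :=
  fun α β ↦ HS.baseChange φ (Y α β)

/-- A lift `(Y, λ)` to `B` of a couple `x` over `A`: a couple `Y` over `B` with an isomorphism of
couples `λ : Y ⊗_B A ≅ x`, given by `E^α ∈ HS^A(R_α)`. -/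
structure CoupleLift (Φ : SmallExtension k B A) (x : Gluing k U A) where
  Y : Gluing k U B
  isCouple : Y.IsCouple
  E : ∀ α, HS k A Γ(X₀, U α)
  isHom : (Y.baseChange Φ.φ).IsHom x E

/-- The action of families of derivations: `d · Y` is given by `d_{αβ}⟨t⟩ ∘ D^{αβ}_Y`. -/
def Gluing.act (Φ : SmallExtension k B A) (d : DerC1 k U) (Y : Gluing k U B) : Gluing k U B :=
  fun α β ↦ bracket Φ (d α β) * Y α β

variable (U) in
/-- `Ȟ⁰(𝔘, Ob^Φ_{X₀})`: families `m_α ∈ Ob^Φ_{R_α} ⊆ T¹_{R_α/k}` that agree on all `U_α ∩ U_β`. -/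
def ObH0 (Φ : SmallExtension k B A) : Set (∀ α, T1 k Γ(X₀, U α)) :=
  {m | (∀ α, m α ∈ Ob Γ(X₀, U α) Φ) ∧
    ∀ α β, ∃ c : T1 k Γ(X₀, inter₂ k U α β),
      T1.IsRestriction (resHom k (inter₂_le_left (k := k) α β)) (m α) c ∧
      T1.IsRestriction (resHom k (inter₂_le_right (k := k) α β)) (m β) c}

/-- The obstruction map on families. -/
def obFamily (Φ : SmallExtension k B A) (E : ∀ α, HS k A Γ(X₀, U α)) :
    ∀ α, T1 k Γ(X₀, U α) :=
  fun α ↦ ob Φ (E α)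

/-- `h_Y(Z) = {ob((E^α_Y)⁻¹ ∘ E^α_Z)}_α`. -/
def CoupleLift.h {Φ : SmallExtension k B A} {x : Gluing k U A} (Y Z : CoupleLift Φ x) :
    ∀ α, T1 k Γ(X₀, U α) :=
  obFamily Φ fun α ↦ (Y.E α)⁻¹ * Z.E α

/-- `L(x)`: the image of the group of automorphisms of the couple `x` under the obstruction
map. -/
def autObs (Φ : SmallExtension k B A) (x : Gluing k U A) : Set (∀ α, T1 k Γ(X₀, U α)) :=
  obFamily Φ '' {E | x.IsHom x E}

/-- The derivations `d_{αβγ}` with `d_{αβγ}⟨t⟩ = D^{γα} ∘ D^{βγ} ∘ D^{αβ}`. (They exist if `Z` lifts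
a couple over `A` satisfying the cocycle conditions, and are unique.) -/
def Gluing.defect (Φ : SmallExtension k B A) (Z : Gluing k U B) : DerC2 k U :=
  fun α β γ ↦ Function.invFun (bracket Φ)
    (Z.on γ α (inter₃_le_thd α β γ) (inter₃_le_fst α β γ) *
      Z.on β γ (inter₃_le_snd α β γ) (inter₃_le_thd α β γ) *
      Z.on α β (inter₃_le_fst α β γ) (inter₃_le_snd α β γ))

/-- The second obstruction class `v²(x, Z)`. -/
def CoupleLift.v2 {Φ : SmallExtension k B A} {x : Gluing k U A} (Z : CoupleLift Φ x) :
    DerH2 k U :=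
  QuotientAddGroup.mk (Z.Y.defect Φ)

/-- The map `g_Y : Ȟ⁰(𝔘, Ob^Φ_{X₀}) → Ȟ²(𝔘, Der_k(𝒪_{X₀}))`: `g_Y(m) = v²(x, Z)` for a lift `Z` with
`h_Y(Z) = m`. (Such a `Z` exists for `m ∈ Ȟ⁰(𝔘, Ob^Φ_{X₀})`, and the value does not depend on it.) -/
def CoupleLift.g {Φ : SmallExtension k B A} {x : Gluing k U A} (Y : CoupleLift Φ x)
    (m : ∀ α, T1 k Γ(X₀, U α)) : DerH2 k U :=
  haveI : Nonempty (CoupleLift Φ x) := ⟨Y⟩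
  (Function.invFun Y.h m).v2

/-- `V_Y(x) = g_Y⁻¹(0) ⊆ Ȟ⁰(𝔘, Ob^Φ_{X₀})`. -/
def CoupleLift.V {Φ : SmallExtension k B A} {x : Gluing k U A} (Y : CoupleLift Φ x) :
    Set (∀ α, T1 k Γ(X₀, U α)) :=
  {m | m ∈ ObH0 U Φ ∧ Y.g m = 0}

/-- The quotient `V_Y(x) / L(x)`, where `L(x)` acts by addition. -/
def CoupleLift.VmodL {Φ : SmallExtension k B A} {x : Gluing k U A} (Y : CoupleLift Φ x) :=
  Quot fun m m' : Y.V ↦ m.1 - m'.1 ∈ autObs Φ x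

/-- The deformation `𝒳` is glued from the `Spec (A ⊗ R_α)` along the `D^{αβ}`: there are
affine opens `V_α` of `𝒳` restricting to `U_α` and isomorphisms `θ_α : A ⊗ R_α ≅ Γ(𝒳, V_α)` of
`A`-algebras inducing the identity of `R_α` modulo `𝔪_A`, which differ by `D^{αβ}` on
`V_α ∩ V_β`. -/
def Gluing.Induces (D : Gluing k U A) (𝒳 : Deformation k X₀ A) : Prop :=
  ∃ (V : ι → 𝒳.X.affineOpens) (hV : ∀ α, 𝒳.i ⁻¹ᵁ (V α : 𝒳.X.Opens) = U α)
    (θ : ∀ α, A ⊗[k] Γ(X₀, U α) ≃+* Γ(𝒳.X, V α)),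
    (∀ α (a : A), θ α (a ⊗ₜ 1) =
      (𝒳.f.appLE ⊤ (V α) (le_of_le_of_eq le_top rfl)).hom
        ((Scheme.ΓSpecIso (.of A)).inv.hom a)) ∧
    (∀ α x, (𝒳.i.appLE (V α) (U α) (hV α).ge).hom (θ α x) = red k A Γ(X₀, U α) x) ∧
    ∀ α β, ∃ e : A ⊗[k] Γ(X₀, inter₂ k U α β) ≃+* Γ(𝒳.X, (V α : 𝒳.X.Opens) ⊓ V β),
      (∀ x : A ⊗[k] Γ(X₀, U β),
        e (Algebra.TensorProduct.map (AlgHom.id k A)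
          (resHom k (inter₂_le_right (k := k) α β)) x) =
        (𝒳.X.presheaf.map (homOfLE inf_le_right).op).hom (θ β x)) ∧
      (∀ x : A ⊗[k] Γ(X₀, U α),
        e ((D α β).1 (Algebra.TensorProduct.map (AlgHom.id k A)
          (resHom k (inter₂_le_left (k := k) α β)) x)) =
        (𝒳.X.presheaf.map (homOfLE inf_le_left).op).hom (θ α x))

/-- The class `X ∈ Def'_{X₀}(A)` is induced by `D`. -/
def Gluing.InducesClass (D : Gluing k U A) (X : LTDef k X₀ A) : Prop :=
  ∃ 𝒳 : {𝒳 : Deformation k X₀ A // 𝒳.IsLocallyTrivial},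
    Quotient.mk (locTrivSetoid k X₀ A) 𝒳 = X ∧ D.Induces 𝒳.1

/-- The fibre `α⁻¹(X)` of the restriction map `α : Def'_{X₀}(B) → Def'_{X₀}(A)`. -/
def SmallExtension.fiber (Φ : SmallExtension k B A) (X : LTDef k X₀ A) :
    Set (LTDef k X₀ B) :=
  LTDef.map Φ.φ ⁻¹' {X}

end Couples

end LocTriv

end

open LocTriv

universe u

noncomputable section

set_option linter.unusedSectionVars false

namespace LocTriv

/-! ### Hasse–Schmidt groups: functoriality in the base and in the ring. -/

section HSBasic

variable {k A B C R R' R'' : Type*} [Field k] [CommRing A] [Algebra k A] [ArtinLocal k A]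
  [CommRing B] [Algebra k B] [ArtinLocal k B] [CommRing C] [Algebra k C] [ArtinLocal k C]
  [CommRing R] [Algebra k R] [CommRing R'] [Algebra k R'] [CommRing R''] [Algebra k R'']

/-! The crux is that a locally trivial deformation is trivial over every affine open. The kernel of
HS^B → HS^A is the quasi-coherent sheaf of derivations, but the image is the kernel of ob_Φ, and
Ob^Φ is a priori only a subsheaf of groups of T¹. Dévissage along small extensions is replaced by an
explicit description of HS^A(R) and a patching argument in the style of Quillen.

Generation (`curveSubgroup_eq_top`). Call H ∈ HS^{k[s]/s^m}(R) a curve; it has a value at every x ∈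
A with x^m = 0. Over an algebraically closed field of characteristic p these values generate
HS^A(R). The proof is by induction on dim B along a small extension B → A with kernel k·t. Modulo
values that lift to B, a curve with m not a power of p can be replaced by values at multiples of x²,
because m-th powers are not additive and the failure of additivity can be used to cancel the
obstruction. If m is a power of p, Frobenius is additive and a curve can be moved to a curve in one
fixed element φ(b₀), where b₀ is a p-power root of t of highest order. An element that reduces to a
value at φ(b₀) is itself a value at b₀.

Patching (`HS.exists_splitting`). Replacing x by xX joins every D ∈ HS^A(S) to the identity by a
family over S[X]. If S = R_{fg} with f, g coprime, such a family, after X ↦ g^N X, is defined over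
R_f (`IsHomotopy.exists_descent`), and symmetrically over R_g. Evaluating at the two terms of a
partition of unity, chosen to be p^e-th powers so that HS^A(S) fixes them, writes D as a product of
an element from R_g and an element from R_f. Hence trivializations over D(f) and D(g) can be
corrected until they glue, and the f with a trivialization over D(f) form an ideal. This gives
`Deformation.IsLocallyTrivial.exists_isTriv`, so cocycle couples up to isomorphism are the same as
classes of deformations (`Gluing.InducesClass.eq_iff`).

The remainder is formal. The map ob_Φ is a homomorphism whose kernel is the image of HS^B(R)
(`ob_mul`, `ob_baseChange`, `exists_baseChange_eq_of_ob_eq_zero`), and the d⟨t⟩ are central and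
exhaust the kernel of φ_*. Two lifts of x with equal h_Y therefore differ, up to isomorphism, by an
alternating family of derivations, whose Čech differential is the change of the defect of the
cocycle conditions. Automorphisms of x shift h_Y by L(x). Every section of Ob^Φ occurs as some
h_Y(Z), which uses that restriction in T¹ along an open immersion is single-valued
(`T1.IsRestriction.unique`). -/

lemma HS.tmul_eq (D : HS k A R) (a : A) (r : R) : D.1 (a ⊗ₜ r) = a • D.1 (1 ⊗ₜ r) := by
  rw [← map_smul, smul_tmul', smul_eq_mul, mul_one]

lemma HS.ext_one_tmul {D E : HS k A R} (h : ∀ r, D.1 (1 ⊗ₜ r) = E.1 (1 ⊗ₜ r)) : D = E := by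
  refine Subtype.ext (AlgEquiv.ext fun y ↦ ?_)
  induction y with
  | zero => simp
  | tmul a r => rw [HS.tmul_eq, HS.tmul_eq E, h]
  | add x y hx hy => rw [map_add, map_add, hx, hy]

/-- `D` and `D'` are intertwined by `φ ⊗ ρ : B ⊗ R → A ⊗ R'`. -/
def HS.Compat (φ : B →ₐ[k] A) (ρ : R →ₐ[k] R') (D : HS k B R) (D' : HS k A R') : Prop :=
  ∀ y, Algebra.TensorProduct.map φ ρ (D.1 y) = D'.1 (Algebra.TensorProduct.map φ ρ y)

lemma map_smul_tmul (φ : B →ₐ[k] A) (ρ : R →ₐ[k] R') (b : B) (y : B ⊗[k] R) :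
    Algebra.TensorProduct.map φ ρ (b • y) = φ b • Algebra.TensorProduct.map φ ρ y := by
  induction y with
  | zero => simp
  | tmul a r => simp [smul_tmul']
  | add x y hx hy => simp only [smul_add, map_add, hx, hy]

lemma map_map_tmul (φ : B →ₐ[k] A) (ρ : R →ₐ[k] R') (ψ : A →ₐ[k] C) (σ : R' →ₐ[k] R'')
    (y : B ⊗[k] R) :
    Algebra.TensorProduct.map ψ σ (Algebra.TensorProduct.map φ ρ y) =
      Algebra.TensorProduct.map (ψ.comp φ) (σ.comp ρ) y := by
  induction y with
  | zero => simp
  | tmul a r => simp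
  | add x y hx hy => simp only [map_add, hx, hy]

lemma HS.Compat.of_one_tmul {φ : B →ₐ[k] A} {ρ : R →ₐ[k] R'} {D : HS k B R} {D' : HS k A R'}
    (h : ∀ r, Algebra.TensorProduct.map φ ρ (D.1 (1 ⊗ₜ r)) = D'.1 (1 ⊗ₜ ρ r)) :
    HS.Compat φ ρ D D' := by
  intro y
  induction y with
  | zero => simp
  | tmul a r =>
    rw [HS.tmul_eq, map_smul_tmul, h, Algebra.TensorProduct.map_tmul, HS.tmul_eq D' (φ a)]
  | add x y hx hy => simp only [map_add, hx, hy]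

namespace HS.Compat

variable {φ : B →ₐ[k] A} {ρ : R →ₐ[k] R'} {D E : HS k B R} {D' E' : HS k A R'}

lemma one : HS.Compat φ ρ (1 : HS k B R) (1 : HS k A R') := fun _ ↦ rfl

lemma mul (h : HS.Compat φ ρ D D') (h' : HS.Compat φ ρ E E') :
    HS.Compat φ ρ (D * E) (D' * E') := fun y ↦ (h _).trans (congrArg D'.1 (h' y))

lemma inv (h : HS.Compat φ ρ D D') : HS.Compat φ ρ D⁻¹ D'⁻¹ := fun y ↦ by
  refine D'.1.injective ?_
  rw [← h]
  change Algebra.TensorProduct.map φ ρ (D.1 (D.1.symm y)) = D'.1 (D'.1.symm _)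
  rw [AlgEquiv.apply_symm_apply, AlgEquiv.apply_symm_apply]

lemma comp {ψ : A →ₐ[k] C} {σ : R' →ₐ[k] R''} {D'' : HS k C R''} (h : HS.Compat φ ρ D D')
    (h' : HS.Compat ψ σ D' D'') : HS.Compat (ψ.comp φ) (σ.comp ρ) D D'' := fun y ↦ by
  rw [← map_map_tmul, ← map_map_tmul]
  exact (congrArg _ (h y)).trans (h' _)

lemma right_unique {F F' : HS k A R} (h : HS.Compat φ (AlgHom.id k R) D F')
    (h' : HS.Compat φ (AlgHom.id k R) D F) : F' = F :=
  HS.ext_one_tmul fun r ↦ by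
    have h1 := h (1 ⊗ₜ r)
    have h2 := h' (1 ⊗ₜ r)
    rw [Algebra.TensorProduct.map_tmul, map_one, AlgHom.id_apply] at h1 h2
    rw [← h1, h2]

end HS.Compat

lemma HS.compat_baseChange (φ : B →ₐ[k] A) (D : HS k B R) :
    HS.Compat φ (AlgHom.id k R) D (HS.baseChange φ D) :=
  .of_one_tmul fun r ↦ by
    rw [HS.baseChange, HS.ofAlgHom_tmul, one_smul]; rfl

lemma HS.eq_baseChange {φ : B →ₐ[k] A} {D : HS k B R} {E : HS k A R}
    (h : HS.Compat φ (AlgHom.id k R) D E) : E = HS.baseChange φ D :=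
  h.right_unique (HS.compat_baseChange φ D)

lemma HS.baseChange_one_tmul (φ : B →ₐ[k] A) (D : HS k B R) (r : R) :
    (HS.baseChange φ D).1 (1 ⊗ₜ r) =
      Algebra.TensorProduct.map φ (AlgHom.id k R) (D.1 (1 ⊗ₜ r)) := by
  rw [HS.compat_baseChange]; simp

/-- `φ_* : HS^B(R) → HS^A(R)` as a group morphism. -/
def HS.baseChangeHom (φ : B →ₐ[k] A) : HS k B R →* HS k A R where
  toFun := HS.baseChange φ
  map_one' := (HS.eq_baseChange .one).symm
  map_mul' D E :=
    (HS.eq_baseChange ((HS.compat_baseChange φ D).mul (HS.compat_baseChange φ E))).symm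

lemma HS.baseChange_mul (φ : B →ₐ[k] A) (D E : HS k B R) :
    HS.baseChange φ (D * E) = HS.baseChange φ D * HS.baseChange φ E :=
  map_mul (HS.baseChangeHom φ) D E

lemma HS.baseChange_one (φ : B →ₐ[k] A) : HS.baseChange φ (1 : HS k B R) = 1 :=
  map_one (HS.baseChangeHom φ)

lemma HS.baseChange_inv (φ : B →ₐ[k] A) (D : HS k B R) :
    HS.baseChange φ D⁻¹ = (HS.baseChange φ D)⁻¹ :=
  map_inv (HS.baseChangeHom φ) D

lemma HS.baseChange_comp (ψ : A →ₐ[k] C) (φ : B →ₐ[k] A) (D : HS k B R) :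
    HS.baseChange (ψ.comp φ) D = HS.baseChange ψ (HS.baseChange φ D) := by
  have h := (HS.compat_baseChange φ D).comp (HS.compat_baseChange ψ (HS.baseChange φ D))
  rw [AlgHom.id_comp] at h
  exact (HS.eq_baseChange h).symm

end HSBasic

/-! ### Small extensions and the central subgroup of derivations. -/

section Small

variable {k A B R R' : Type*} [Field k] [CommRing A] [Algebra k A] [ArtinLocal k A]
  [CommRing B] [Algebra k B] [ArtinLocal k B]
  [CommRing R] [Algebra k R] [CommRing R'] [Algebra k R'] (Φ : SmallExtension k B A)

lemma SmallExtension.mul_t (b : B) : b * Φ.t = residue k B b • Φ.t := by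
  have := Φ.maximalIdeal_mul (b - algebraMap k B (residue k B b))
    ((residue_eq_zero_iff (k := k) _).1 (by simp))
  rw [sub_mul, sub_eq_zero] at this
  rw [this, Algebra.smul_def]

lemma SmallExtension.φ_t : Φ.φ Φ.t = 0 := (Φ.ker_eq _).2 ⟨1, by simp⟩

/-- Multiplication by t annihilates 𝔪_B, so t · D(1 ⊗ r) depends only on the reduction of D(1 ⊗ r),
which is r. -/
lemma HS.apply_t_tmul (D : HS k B R) (r : R) : D.1 (Φ.t ⊗ₜ r) = Φ.t ⊗ₜ r := by
  rw [HS.tmul_eq]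
  have h := mul_t_tmul Φ (D.1 (1 ⊗ₜ r)) (1 : R)
  rw [D.2, red_tmul, map_one, one_smul, mul_one] at h
  rw [← h, mul_comm, Algebra.smul_def]
  rfl

lemma bracket_t_mul (d : Derivation k R R) (y : B ⊗[k] R) :
    (bracket Φ d).1 y = y + Φ.t ⊗ₜ d (red k B R y) := by
  induction y with
  | zero => simp
  | tmul b r =>
    rw [HS.tmul_eq, bracket_apply, smul_add, smul_tmul', smul_tmul', smul_eq_mul, mul_one,
      smul_eq_mul, Φ.mul_t, red_tmul, d.map_smul, tmul_smul, smul_tmul']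
  | add x y hx hy => rw [map_add, hx, hy, map_add, map_add, tmul_add]; abel

lemma bracket_add (d d' : Derivation k R R) :
    bracket Φ (d + d') = bracket Φ d * bracket Φ d' := by
  refine HS.ext_one_tmul fun r ↦ ?_
  change _ = (bracket Φ d).1 ((bracket Φ d').1 _)
  rw [bracket_t_mul, bracket_t_mul, bracket_t_mul, map_add, red_tmul, red_tmul,
    (residue_eq_zero_iff (k := k) _).2 Φ.t_mem]
  simp [tmul_add]
  abel

/-- `d ↦ d⟨t⟩` as a morphism of groups. -/
def bracketHom : Multiplicative (Derivation k R R) →* HS k B R :=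
  MonoidHom.mk' (fun d ↦ bracket Φ d.toAdd) fun d d' ↦ bracket_add Φ d.toAdd d'.toAdd

lemma bracket_zero : bracket Φ (0 : Derivation k R R) = 1 := map_one (bracketHom Φ)

lemma bracket_neg (d : Derivation k R R) : bracket Φ (-d) = (bracket Φ d)⁻¹ :=
  map_inv (bracketHom Φ) (Multiplicative.ofAdd d)

lemma bracket_injective : Function.Injective (bracket Φ : Derivation k R R → HS k B R) := by
  intro d d' h
  ext r
  have := congrArg (fun D : HS k B R ↦ D.1 (1 ⊗ₜ r)) h
  simp only [bracket_apply, add_right_inj] at this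
  exact Φ.tmul_injective this

/-- D fixes t ⊗ R and preserves reductions, so the correction t ⊗ d(r) is the same on either side.
This centrality is what makes the loops of a couple additive in d. -/
lemma bracket_commute (d : Derivation k R R) (D : HS k B R) : Commute (bracket Φ d) D := by
  refine HS.ext_one_tmul fun r ↦ ?_
  change (bracket Φ d).1 (D.1 _) = D.1 ((bracket Φ d).1 _)
  rw [bracket_t_mul, D.2, bracket_t_mul, map_add, HS.apply_t_tmul]

lemma baseChange_bracket (d : Derivation k R R) : HS.baseChange Φ.φ (bracket Φ d) = 1 := by
  refine HS.ext_one_tmul fun r ↦ ?_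
  rw [HS.baseChange_one_tmul, bracket_apply, map_add]
  simp [Φ.φ_t]

/-- Two algebra morphisms `ψ₁, ψ₂ : T → B ⊗ R'` agreeing modulo `t` differ by a derivation. -/
lemma exists_derivation_of_eq {T : Type*} [CommRing T] [Algebra k T] [Algebra T R']
    [IsScalarTower k T R'] (ψ₁ ψ₂ : T →ₐ[k] B ⊗[k] R')
    (h : ∀ p, Algebra.TensorProduct.map Φ.φ (AlgHom.id k R') (ψ₁ p) =
      Algebra.TensorProduct.map Φ.φ (AlgHom.id k R') (ψ₂ p))
    (hred : ∀ p, red k B R' (ψ₂ p) = algebraMap T R' p) :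
    ∃ d : Derivation k T R', ∀ p, ψ₁ p = ψ₂ p + Φ.t ⊗ₜ d p := by
  have hred' : ∀ p, red k B R' (ψ₁ p) = algebraMap T R' p := fun p ↦ by
    have h1 := congrArg (red k A R') (h p)
    rw [red_map, red_map] at h1
    exact h1.trans (hred p)
  have key : ∀ p, ∃ r : R', ψ₁ p - ψ₂ p = Φ.t ⊗ₜ r := fun p ↦
    Φ.exists_tmul _ (by rw [map_sub, h, sub_self])
  choose g hg using key
  have hg' : ∀ p, ψ₁ p = ψ₂ p + Φ.t ⊗ₜ g p := fun p ↦ by rw [← hg]; abel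
  refine ⟨Derivation.mk'
    { toFun := g
      map_add' := fun x y ↦ Φ.tmul_injective (by
        simp only [tmul_add, ← hg, map_add]; abel)
      map_smul' := fun c x ↦ Φ.tmul_injective (by
        simp only [RingHom.id_apply, tmul_smul, ← hg, map_smul, smul_sub]) }
    (fun x y ↦ Φ.tmul_injective ?_), hg'⟩
  change Φ.t ⊗ₜ g (x * y) = Φ.t ⊗ₜ (x • g y + y • g x)
  rw [← hg, map_mul, map_mul, tmul_add, Algebra.smul_def, Algebra.smul_def, ← hred', ← hred,
    ← mul_t_tmul, ← mul_t_tmul, ← hg, ← hg]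
  ring

/-- Exactness of Der_k(R) → HS^B(R) → HS^A(R) at the middle term: restrictions to R that agree
modulo t differ by t times a derivation. -/
lemma exists_bracket_of_baseChange_eq {D E : HS k B R}
    (h : HS.baseChange Φ.φ D = HS.baseChange Φ.φ E) : ∃ d, D = bracket Φ d * E := by
  obtain ⟨d, hd⟩ := exists_derivation_of_eq Φ (HS.toAlgHom D) (HS.toAlgHom E)
    (fun r ↦ by
      have := congrArg (fun D : HS k A R ↦ D.1 (1 ⊗ₜ r)) h
      simp only [HS.baseChange_one_tmul] at this
      exact this) (fun r ↦ HS.red_toAlgHom E r)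
  refine ⟨d, HS.ext_one_tmul fun r ↦ ?_⟩
  change _ = (bracket Φ d).1 (E.1 _)
  rw [bracket_t_mul, E.2, red_tmul, map_one, one_smul]
  exact hd r

lemma bracket_compat (ρ : R →ₐ[k] R') {d : Derivation k R R} {d' : Derivation k R' R'}
    (h : ∀ r, d' (ρ r) = ρ (d r)) :
    HS.Compat (AlgHom.id k B) ρ (bracket Φ d) (bracket Φ d') :=
  .of_one_tmul fun r ↦ by rw [bracket_apply, bracket_apply, h]; simp

end Small

/-! ### The obstruction map as a homomorphism whose kernel consists of the liftable elements. -/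

section ObTheory

variable {k A B R R' : Type*} [Field k] [CommRing A] [Algebra k A] [ArtinLocal k A]
  [CommRing B] [Algebra k B] [ArtinLocal k B]
  [CommRing R] [Algebra k R] [CommRing R'] [Algebra k R'] (Φ : SmallExtension k B A)

lemma exists_cotangentSpace_hom [Algebra R R'] [Algebra (Pres k R).Ring R']
    [IsScalarTower (Pres k R).Ring R R'] [IsScalarTower k (Pres k R).Ring R'] (d : Derivation k (Pres k R).Ring R') :
    ∃ v : (Pres k R).CotangentSpace →ₗ[R] R',
      ∀ p, v (1 ⊗ₜ KaehlerDifferential.D k (Pres k R).Ring p) = d p :=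
  ⟨LinearMap.liftBaseChange R d.liftKaehlerDifferential, fun p ↦ by
    rw [LinearMap.liftBaseChange_tmul, one_smul, d.liftKaehlerDifferential_comp_D]⟩

/-- `ψ : T → B ⊗ R` lifts `T → R → A ⊗ R`, where the second morphism is `D|_R`. -/
def IsPresLift (D : HS k A R) (ψ : (Pres k R).Ring →ₐ[k] B ⊗[k] R) : Prop :=
  ∀ p, Algebra.TensorProduct.map Φ.φ (AlgHom.id k R) (ψ p) = D.1 (1 ⊗ₜ presProj k R p)

/-- `ψ` restricts to `t ⊗ f` on the ideal of relations. -/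
def IsPresInduced (ψ : (Pres k R).Ring →ₐ[k] B ⊗[k] R)
    (f : (Pres k R).Cotangent →ₗ[R] R) : Prop :=
  ∀ x : (Pres k R).ker, ψ x = Φ.t ⊗ₜ f (Algebra.Extension.Cotangent.mk x)

variable {Φ}

lemma IsPresLift.red {D : HS k A R} {ψ : (Pres k R).Ring →ₐ[k] B ⊗[k] R}
    (h : IsPresLift Φ D ψ) (p : (Pres k R).Ring) : red k B R (ψ p) = presProj k R p := by
  have h1 := congrArg (LocTriv.red k A R) (h p)
  rw [red_map, D.2, red_tmul, map_one, one_smul] at h1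
  exact h1

/-- The composition of `E|_T` with `B ⊗ T → B ⊗ R`. -/
def presComp (E : HS k B (Pres k R).Ring) : (Pres k R).Ring →ₐ[k] B ⊗[k] R :=
  (Algebra.TensorProduct.map (AlgHom.id k B) (presProj k R)).comp (HS.toAlgHom E)

lemma presComp_apply (E : HS k B (Pres k R).Ring) (p) : presComp E p =
    Algebra.TensorProduct.map (AlgHom.id k B) (presProj k R) (E.1 (1 ⊗ₜ p)) := rfl

lemma IsLift.isPresLift {D : HS k A R} {E : HS k B (Pres k R).Ring} (h : IsLift Φ D E) :
    IsPresLift Φ D (presComp E) := fun p ↦ by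
  rw [presComp_apply, map_map_tmul, AlgHom.comp_id, AlgHom.id_comp, h,
    Algebra.TensorProduct.map_tmul, map_one]

lemma T1.mk_eq_mk {f g : (Pres k R).Cotangent →ₗ[R] R} :
    T1.mk f = T1.mk g ↔ ∃ v : (Pres k R).CotangentSpace →ₗ[R] R,
      ∀ y, f y = g y + v ((Pres k R).cotangentComplex y) := by
  rw [T1.mk, T1.mk, Submodule.Quotient.eq]
  constructor
  · rintro ⟨v, hv⟩
    refine ⟨v, fun y ↦ ?_⟩
    have := LinearMap.congr_fun hv y
    change v _ = f y - g y at this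
    rw [this]; ring
  · rintro ⟨v, hv⟩
    refine ⟨v, LinearMap.ext fun y ↦ ?_⟩
    change v _ = f y - g y
    rw [hv]; ring

/-- Two lifts differ by t ⊗ d with d : T → R a derivation, and d changes f only by a map that
factors through the cotangent complex. Besides independence of choices, this frees the computation
from automorphisms of B ⊗ T: an algebra map T → B ⊗ R suffices. -/
lemma ob_eq_of_isPresLift {D : HS k A R} {ψ : (Pres k R).Ring →ₐ[k] B ⊗[k] R}
    (hψ : IsPresLift Φ D ψ) {f : (Pres k R).Cotangent →ₗ[R] R} (hf : IsPresInduced Φ ψ f) :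
    ob Φ D = T1.mk f := by
  have hE := (exists_isLift Φ D).choose_spec
  have hg := (exists_isInduced Φ D _ hE).choose_spec
  change T1.mk (exists_isInduced Φ D _ hE).choose = _
  rw [T1.mk_eq_mk]
  obtain ⟨d, hd⟩ := exists_derivation_of_eq Φ (presComp (exists_isLift Φ D).choose) ψ
    (fun p ↦ by rw [hE.isPresLift, hψ]) hψ.red
  obtain ⟨v, hv⟩ := exists_cotangentSpace_hom d
  refine ⟨v, fun y ↦ ?_⟩
  obtain ⟨x, rfl⟩ := Algebra.Extension.Cotangent.mk_surjective y
  rw [Algebra.Extension.cotangentComplex_mk, hv]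
  refine Φ.tmul_injective ?_
  change Φ.t ⊗ₜ _ = Φ.t ⊗ₜ (_ + _)
  rw [tmul_add, ← hf, ← hd]
  exact (hg x).symm

variable (Φ) in
lemma exists_isPresLift (D : HS k A R) : ∃ (E : HS k B (Pres k R).Ring)
    (f : (Pres k R).Cotangent →ₗ[R] R), IsLift Φ D E ∧ IsPresInduced Φ (presComp E) f ∧
      ob Φ D = T1.mk f := by
  obtain ⟨E, hE⟩ := exists_isLift Φ D
  obtain ⟨f, hf⟩ := exists_isInduced Φ D E hE
  have hf' : IsPresInduced Φ (presComp E) f := hf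
  exact ⟨E, f, hE, hf', ob_eq_of_isPresLift hE.isPresLift hf'⟩

variable (Φ) in
-- The composite of T → R with E|_R is a lift that kills the ideal of relations, so 0 is a
-- representative.
lemma ob_baseChange (E : HS k B R) : ob Φ (HS.baseChange Φ.φ E) = 0 := by
  have h : IsPresLift Φ (HS.baseChange Φ.φ E) ((HS.toAlgHom E).comp (presProj k R)) := fun p ↦ by
    rw [HS.baseChange_one_tmul]; rfl
  rw [ob_eq_of_isPresLift h (f := 0) fun x ↦ ?_]
  · rfl
  · have : presProj k R (x : (Pres k R).Ring) = 0 := x.2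
    rw [AlgHom.comp_apply, this]; simp

/-- If the representative f comes from a derivation δ : T → R, subtracting t ⊗ δ from the lift T → B
⊗ R gives an algebra map that kills I. It descends to R and defines the lift of D. -/
lemma exists_baseChange_eq_of_ob_eq_zero {D : HS k A R} (h : ob Φ D = 0) :
    ∃ E : HS k B R, HS.baseChange Φ.φ E = D := by
  obtain ⟨E, f, hE, hf, hD⟩ := exists_isPresLift Φ D
  have h0 : T1.mk f = T1.mk 0 := by rw [← hD, h]; rfl
  obtain ⟨v, hv⟩ := T1.mk_eq_mk.1 h0
  let ψ := presComp E
  have hψ : IsPresLift Φ D ψ := hE.isPresLift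
  let δ (p : (Pres k R).Ring) : R := v (1 ⊗ₜ KaehlerDifferential.D k (Pres k R).Ring p)
  have hδm : ∀ p q, δ (p * q) = presProj k R p * δ q + presProj k R q * δ p := fun p q ↦ by
    have h1 : ∀ (p : (Pres k R).Ring) (w : Ω[(Pres k R).Ring⁄k]),
        v (1 ⊗ₜ (p • w)) = presProj k R p * v (1 ⊗ₜ w) := fun p w ↦ by
      rw [← smul_eq_mul, ← map_smul, smul_tmul', tmul_smul, smul_tmul', smul_eq_mul, mul_one,
        Algebra.smul_def, mul_one]
      rfl
    simp only [δ, Derivation.leibniz, tmul_add, map_add, h1]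
  let χ : (Pres k R).Ring →ₐ[k] B ⊗[k] R := AlgHom.ofLinearMap
    (ψ.toLinearMap - (TensorProduct.mk k B R Φ.t).comp
      ((v.restrictScalars k).comp ((TensorProduct.mk (Pres k R).Ring R _ 1).restrictScalars k
        ∘ₗ (KaehlerDifferential.D k (Pres k R).Ring).toLinearMap)))
    (by
      change ψ 1 - Φ.t ⊗ₜ δ 1 = 1
      simp [δ])
    (fun x y ↦ by
      change ψ (x * y) - Φ.t ⊗ₜ δ (x * y) = (ψ x - Φ.t ⊗ₜ δ x) * (ψ y - Φ.t ⊗ₜ δ y)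
      have h1 : Φ.t ⊗ₜ δ (x * y) = ψ x * (Φ.t ⊗ₜ[k] δ y) + ψ y * (Φ.t ⊗ₜ[k] δ x) := by
        rw [mul_t_tmul, mul_t_tmul, hψ.red, hψ.red, ← tmul_add, hδm]
      have h2 : (Φ.t ⊗ₜ[k] δ x) * (Φ.t ⊗ₜ[k] δ y) = 0 := by
        rw [Algebra.TensorProduct.tmul_mul_tmul, Φ.t_mul_t, zero_tmul]
      rw [h1, map_mul]
      linear_combination -h2)
  have hχ : ∀ p, χ p = ψ p - Φ.t ⊗ₜ δ p := fun _ ↦ rfl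
  have hker : ∀ p, presProj k R p = 0 → χ p = 0 := fun p hp ↦ by
    have h1 := hf ⟨p, hp⟩
    have h2 := hv (Algebra.Extension.Cotangent.mk ⟨p, hp⟩)
    rw [Algebra.Extension.cotangentComplex_mk, LinearMap.zero_apply, zero_add] at h2
    rw [hχ]
    change presComp E p - _ = 0
    rw [h1, h2, sub_self]
  let g : R →ₐ[k] B ⊗[k] R := Ideal.Quotient.liftₐ (RingHom.ker (presProj k R)) χ hker |>.comp
    (Ideal.quotientKerAlgEquivOfSurjective presProj_surjective).symm.toAlgHom
  have hg : ∀ p, g (presProj k R p) = χ p := fun p ↦ by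
    have : (Ideal.quotientKerAlgEquivOfSurjective (presProj_surjective (k := k) (R := R))).symm
        (presProj k R p) = Ideal.Quotient.mk _ p := by
      rw [AlgEquiv.symm_apply_eq]; rfl
    change Ideal.Quotient.liftₐ _ χ hker
      ((Ideal.quotientKerAlgEquivOfSurjective presProj_surjective).symm (presProj k R p)) = _
    rw [this]
    rfl
  have hm : ∀ p, Algebra.TensorProduct.map Φ.φ (AlgHom.id k R) (χ p) =
      D.1 (1 ⊗ₜ presProj k R p) := fun p ↦ by
    rw [hχ, map_sub, hψ, Algebra.TensorProduct.map_tmul, Φ.φ_t, zero_tmul, sub_zero]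
  have hred : ∀ r, red k B R (g r) = r := fun r ↦ by
    obtain ⟨p, rfl⟩ := presProj_surjective (k := k) r
    rw [hg, hχ, map_sub, hψ.red, red_tmul, (residue_eq_zero_iff (k := k) _).2 Φ.t_mem]
    simp
  refine ⟨HS.ofAlgHom g hred, HS.ext_one_tmul fun r ↦ ?_⟩
  obtain ⟨p, rfl⟩ := presProj_surjective (k := k) r
  rw [HS.baseChange_one_tmul, HS.ofAlgHom_tmul, one_smul, hg, hm]

/-- The kernel of B ⊗ T → B ⊗ R is the ideal generated by 1 ⊗ I, and B ⊗ R acts on t ⊗ R through its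
reduction. So the formula for E on I propagates to this kernel, as needed to compose two lifts. -/
lemma presInduced_of_mem_ker {E : HS k B (Pres k R).Ring} {f : (Pres k R).Cotangent →ₗ[R] R}
    (hf : IsPresInduced Φ (presComp E) f) (w : B ⊗[k] (Pres k R).Ring)
    (hw : Algebra.TensorProduct.map (AlgHom.id k B) (presProj k R) w = 0) :
    ∃ x : (Pres k R).ker, (x : (Pres k R).Ring) = red k B _ w ∧
      Algebra.TensorProduct.map (AlgHom.id k B) (presProj k R) (E.1 w) =
        Φ.t ⊗ₜ f (Algebra.Extension.Cotangent.mk x) := by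
  have hw' : w ∈ (RingHom.ker (presProj k R)).map
      (Algebra.TensorProduct.includeRight : _ →ₐ[k] B ⊗[k] (Pres k R).Ring) := by
    rw [← Algebra.TensorProduct.lTensor_ker _ presProj_surjective]
    exact hw
  clear hw
  refine Submodule.span_induction (p := fun w _ ↦ ∃ x : (Pres k R).ker,
      (x : (Pres k R).Ring) = red k B _ w ∧
      Algebra.TensorProduct.map (AlgHom.id k B) (presProj k R) (E.1 w) =
        Φ.t ⊗ₜ f (Algebra.Extension.Cotangent.mk x)) ?_ ?_ ?_ ?_ hw'
  · rintro _ ⟨x, hx, rfl⟩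
    exact ⟨⟨x, hx⟩, by simp, hf ⟨x, hx⟩⟩
  · exact ⟨0, by simp, by simp⟩
  · rintro x y _ _ ⟨x', hx, hx'⟩ ⟨y', hy, hy'⟩
    refine ⟨x' + y', by rw [map_add, ← hx, ← hy]; rfl, ?_⟩
    rw [map_add, map_add, hx', hy', ← tmul_add, ← map_add, ← map_add]
  · rintro y x _ ⟨x', hx, hx'⟩
    refine ⟨red k B _ y • x', by rw [smul_eq_mul, map_mul, ← hx]; rfl, ?_⟩
    rw [smul_eq_mul, map_mul, map_mul, hx', mul_t_tmul, red_map, E.2]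
    rw [map_smul, ← algebraMap_smul R, map_smul]
    rfl

variable (Φ) in
lemma ob_mul (D D' : HS k A R) : ob Φ (D * D') = ob Φ D + ob Φ D' := by
  obtain ⟨E, f, hE, hf, hD⟩ := exists_isPresLift Φ D
  obtain ⟨E', f', hE', hf', hD'⟩ := exists_isPresLift Φ D'
  have hEE : IsLift Φ (D * D') (E * E') := HS.Compat.mul hE hE'
  rw [ob_eq_of_isPresLift hEE.isPresLift (f := f + f') fun x ↦ ?_, hD, hD']
  · rfl
  -- The element E'(1 ⊗ x) is in the kernel of B ⊗ T → B ⊗ R only after subtracting t ⊗ g, with g ∈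
  -- T over f'(x). The automorphism E fixes t ⊗ g, and the difference still reduces to x, so it
  -- contributes t ⊗ f(x).
  · obtain ⟨g, hg⟩ := presProj_surjective (k := k)
      (f' (Algebra.Extension.Cotangent.mk x))
    have h1 := hf' x
    rw [presComp_apply] at h1
    obtain ⟨x', h3, h2⟩ := presInduced_of_mem_ker hf
      (E'.1 (1 ⊗ₜ (x : (Pres k R).Ring)) - Φ.t ⊗ₜ g) (by
        rw [map_sub, h1, Algebra.TensorProduct.map_tmul, hg]; simp)
    rw [map_sub, E'.2, red_tmul, red_tmul, (residue_eq_zero_iff (k := k) _).2 Φ.t_mem, map_one,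
      one_smul, zero_smul, sub_zero] at h3
    rw [Subtype.ext h3, map_sub, map_sub, HS.apply_t_tmul, Algebra.TensorProduct.map_tmul, hg,
      sub_eq_iff_eq_add] at h2
    rw [LinearMap.add_apply, tmul_add]
    exact h2

variable (Φ R) in
/-- The obstruction map as a morphism of groups. -/
def obHom : HS k A R →* Multiplicative (T1 k R) :=
  MonoidHom.mk' (fun D ↦ Multiplicative.ofAdd (ob Φ D)) (ob_mul Φ)

variable (Φ) in
lemma ob_one : ob Φ (1 : HS k A R) = 0 := map_one (obHom R Φ)

variable (Φ) in
lemma ob_inv (D : HS k A R) : ob Φ D⁻¹ = - ob Φ D := map_inv (obHom R Φ) D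

/-- Functoriality of the obstruction in the small extension. -/
lemma ob_baseChange_of_map {A' B' : Type*} [CommRing A'] [Algebra k A'] [ArtinLocal k A']
    [CommRing B'] [Algebra k B'] [ArtinLocal k B'] (Φ' : SmallExtension k B' A')
    (α : A →ₐ[k] A') (β : B →ₐ[k] B') (hαβ : ∀ b, α (Φ.φ b) = Φ'.φ (β b)) (c : k)
    (hc : β Φ.t = c • Φ'.t) (D : HS k A R) :
    ob Φ' (HS.baseChange α D) = algebraMap k R c • ob Φ D := by
  obtain ⟨E, f, hE, hf, hD⟩ := exists_isPresLift Φ D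
  have hl : IsPresLift Φ' (HS.baseChange α D)
      ((Algebra.TensorProduct.map β (AlgHom.id k R)).comp (presComp E)) := fun p ↦ by
    have h1 := hE.isPresLift p
    rw [HS.baseChange_one_tmul, ← h1, AlgHom.comp_apply, map_map_tmul, map_map_tmul]
    congr 2
    ext b
    exact (hαβ b).symm
  rw [ob_eq_of_isPresLift hl (f := algebraMap k R c • f) fun x ↦ ?_, hD]
  · rfl
  · rw [AlgHom.comp_apply, hf, Algebra.TensorProduct.map_tmul, hc, LinearMap.smul_apply,
      algebraMap_smul, smul_tmul]
    rfl

end ObTheory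

/-! ### Obstructions and restriction. -/

section Restriction

variable {k A B R R' : Type*} [Field k] [CommRing A] [Algebra k A] [ArtinLocal k A]
  [CommRing B] [Algebra k B] [ArtinLocal k B]
  [CommRing R] [Algebra k R] [CommRing R'] [Algebra k R'] (Φ : SmallExtension k B A)

/-- The obstruction commutes with restriction. -/
lemma ob_isRestriction (ρ : R →ₐ[k] R') {D : HS k A R} {D' : HS k A R'}
    (h : HS.Compat (AlgHom.id k A) ρ D D') : T1.IsRestriction ρ (ob Φ D) (ob Φ D') := by
  obtain ⟨E, f, hE, hf, hD⟩ := exists_isPresLift Φ D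
  obtain ⟨E', f', hE', hf', hD'⟩ := exists_isPresLift Φ D'
  let _ := (ρ : R →+* R').toAlgebra
  have : IsScalarTower k R R' := .of_algebraMap_eq fun c ↦ (ρ.commutes c).symm
  let F := (Algebra.Generators.defaultHom (Algebra.Generators.self k R)
    (Algebra.Generators.self k R')).toExtensionHom
  let π : (Pres k R).Ring →ₐ[k] (Pres k R').Ring := F.toAlgHom
  have hπ : ∀ p, presProj k R' (π p) = ρ (presProj k R p) := fun p ↦ F.algebraMap_toRingHom p
  let _ : Algebra (Pres k R).Ring R' := ((ρ : R →+* R').comp (presProj k R : _ →+* R)).toAlgebra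
  have : IsScalarTower (Pres k R).Ring R R' := .of_algebraMap_eq fun _ ↦ rfl
  have : IsScalarTower k (Pres k R).Ring R' := .of_algebraMap_eq fun c ↦ by
    change _ = ρ (presProj k R _)
    rw [AlgHom.commutes, AlgHom.commutes]
  -- The two ways from T to B ⊗ R' agree modulo t because D and D' are compatible. Their difference
  -- is a derivation T → R', which supplies the correction v.
  obtain ⟨d, hd⟩ := exists_derivation_of_eq Φ ((presComp E').comp π)
    ((Algebra.TensorProduct.map (AlgHom.id k B) ρ).comp (presComp E))
    (fun p ↦ by
      have h1 := hE'.isPresLift (π p)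
      have h2 := hE.isPresLift p
      have h3 := h (1 ⊗ₜ presProj k R p)
      rw [← h2, map_map_tmul, Algebra.TensorProduct.map_tmul, map_one, ← hπ, ← h1] at h3
      rw [AlgHom.comp_apply, AlgHom.comp_apply, map_map_tmul, ← h3]
      rfl)
    (fun p ↦ by
      rw [AlgHom.comp_apply, red_map, hE.isPresLift.red]
      rfl)
  obtain ⟨v, hv⟩ := exists_cotangentSpace_hom d
  refine ⟨f, f', v, hD.symm, hD'.symm, fun y ↦ ?_⟩
  obtain ⟨x, rfl⟩ := Algebra.Extension.Cotangent.mk_surjective y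
  rw [Algebra.Extension.cotangentComplex_mk, hv, Algebra.Extension.Cotangent.map_mk]
  refine Φ.tmul_injective ?_
  change Φ.t ⊗ₜ _ = Φ.t ⊗ₜ (_ + _)
  rw [tmul_add, ← hf']
  have h1 := hd x
  rw [AlgHom.comp_apply, AlgHom.comp_apply, hf, Algebra.TensorProduct.map_tmul] at h1
  exact h1

end Restriction

/-! ### Uniqueness of restrictions in T¹ along formally étale maps. -/

section Unique

variable {k R R' : Type*} [Field k] [CommRing R] [Algebra k R] [CommRing R'] [Algebra k R']

lemma isNilpotent_of_forall_mul_eq_zero {C : Type*} [CommRing C] (I : Ideal C)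
    (h : ∀ z ∈ I, ∀ w ∈ I, z * w = 0) : IsNilpotent I :=
  ⟨2, by rw [Ideal.zero_eq_bot, eq_bot_iff, sq, Ideal.mul_le]; exact fun z hz w hw ↦ h z hz w hw⟩

lemma exists_factor_of_surjective {S S' C : Type*} [CommRing S] [CommRing S'] [CommRing C]
    (pr : S →+* S') (hpr : Function.Surjective pr) (χ : S →+* C)
    (h : ∀ p, pr p = 0 → χ p = 0) : ∃ f : S' →+* C, ∀ p, f (pr p) = χ p :=
  ⟨RingHom.liftOfSurjective pr hpr ⟨χ, h⟩, fun p ↦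
    RingHom.liftOfRightInverse_comp_apply pr _ (Function.rightInverse_surjInv hpr) ⟨χ, h⟩ p⟩

/-- The pushout of `0 → I'/I'² → T'/I'² → R' → 0` along `F : I'/I'² → R'`, as a quotient of a ring
`S = T' ⊕ T' ε ⊕ ...`. -/
lemma exists_pushout {T' : Type*} {S : Type u} [CommRing T'] [Algebra T' R'] [CommRing S]
    (F : RingHom.ker (algebraMap T' R') →ₗ[T'] R') (c₀ : S →+* T') (c₁ : S →+ T')
    (hc : ∀ z w, c₁ (z * w) = c₀ z * c₁ w + c₁ z * c₀ w) :
    ∃ (V : S → R' → Prop) (C : Type u) (_ : CommRing C) (mk : S →+* C) (q : C →+* R'),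
    (∀ z r, V z r ↔ ∃ x : RingHom.ker (algebraMap T' R'),
      c₀ z = x ∧ r = F x + algebraMap T' R' (c₁ z)) ∧
    (∀ z w r s, V z r → V w s → V (z + w) (r + s)) ∧
    (∀ w z r, V z r → V (w * z) (algebraMap T' R' (c₀ w) * r)) ∧
    (∀ z r s, V z r → V z s → r = s) ∧
    Function.Surjective mk ∧ (∀ z, mk z = 0 ↔ V z 0) ∧
    (∀ z, q (mk z) = algebraMap T' R' (c₀ z)) ∧ IsNilpotent (RingHom.ker q) := by
  -- V z r expresses that the class of z in the pushout is the image of r ∈ R'. Here c₀ and c₁ play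
  -- the role of the constant term and the ε-coefficient of z.
  let V : S → R' → Prop := fun z r ↦ ∃ x : RingHom.ker (algebraMap T' R'),
      c₀ z = x ∧ r = F x + algebraMap T' R' (c₁ z)
  have V_add : ∀ z w r s, V z r → V w s → V (z + w) (r + s) := by
    rintro z w _ _ ⟨x, hx, rfl⟩ ⟨y, hy, rfl⟩
    exact ⟨x + y, by rw [map_add, hx, hy]; rfl, by simp only [map_add]; ring⟩
  have V_mul : ∀ w z r, V z r → V (w * z) (algebraMap T' R' (c₀ w) * r) := by
    rintro w z _ ⟨x, hx, rfl⟩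
    refine ⟨c₀ w • x, by rw [map_mul, hx]; rfl, ?_⟩
    have hk : algebraMap T' R' (x : T') = 0 := x.2
    rw [map_smul, hc, map_add, map_mul, map_mul, hx, hk, Algebra.smul_def]
    ring
  have V_zero : V 0 0 := ⟨0, by simp, by simp⟩
  have V_unique : ∀ z r s, V z r → V z s → r = s := by
    rintro z _ _ ⟨x, hx, rfl⟩ ⟨y, hy, rfl⟩
    rw [Subtype.ext (hx.symm.trans hy)]
  let J : Ideal S :=
    { carrier := {z | V z 0}
      add_mem' := fun {z w} hz hw ↦ by
        have := V_add z w 0 0 hz hw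
        rwa [add_zero] at this
      zero_mem' := V_zero
      smul_mem' := fun c z hz ↦ by
        have := V_mul c z 0 hz
        rwa [mul_zero] at this }
  have hJ : ∀ z, z ∈ J ↔ V z 0 := fun _ ↦ Iff.rfl
  have hJ' : ∀ z ∈ J, ((algebraMap T' R').comp c₀) z = 0 := by
    rintro z ⟨x, hx, -⟩
    exact (congrArg _ hx).trans x.2
  clear_value J
  refine ⟨V, S ⧸ J, Ideal.Quotient.commRing J, Ideal.Quotient.mk J, Ideal.Quotient.lift J _ hJ',
    fun _ _ ↦ Iff.rfl, V_add, V_mul, V_unique, Ideal.Quotient.mk_surjective,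
    fun z ↦ Ideal.Quotient.eq_zero_iff_mem.trans (hJ z), fun z ↦ Ideal.Quotient.lift_mk _ _ _,
    isNilpotent_of_forall_mul_eq_zero _ fun z hz w hw ↦ ?_⟩
  obtain ⟨z, rfl⟩ := Ideal.Quotient.mk_surjective z
  obtain ⟨w, rfl⟩ := Ideal.Quotient.mk_surjective w
  rw [RingHom.mem_ker, Ideal.Quotient.lift_mk] at hz hw
  have := V_mul z w _ ⟨⟨c₀ w, hw⟩, rfl, rfl⟩
  have hz' : algebraMap T' R' (c₀ z) = 0 := hz
  rw [hz', zero_mul, ← hJ] at this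
  rw [← map_mul, Ideal.Quotient.eq_zero_iff_mem]
  exact this

/-- If `F : I' → R'` is, on `I`, the restriction of a derivation, then so is `F`, provided
`R = T/I → R' = T'/I'` is formally étale and `T` is a polynomial ring. -/
lemma exists_derivation_extension {σ T' : Type*} [CommRing T'] [Algebra k T'] [Algebra T' R']
    [IsScalarTower k T' R'] (hT' : Function.Surjective (algebraMap T' R'))
    (ρ : R →ₐ[k] R') (hρ : (ρ : R →+* R').FormallyEtale)
    (pr : MvPolynomial σ k →ₐ[k] R) (hpr : Function.Surjective pr)
    (π : MvPolynomial σ k →ₐ[k] T') (hπ : ∀ p, algebraMap T' R' (π p) = ρ (pr p))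
    (F : RingHom.ker (algebraMap T' R') →ₗ[T'] R') (D : MvPolynomial σ k → R')
    (hD0 : ∀ p q, D (p + q) = D p + D q) (hD1 : ∀ p q, D (p * q) = ρ (pr p) * D q + ρ (pr q) * D p)
    (hD2 : ∀ c, D (algebraMap k _ c) = 0)
    (hF : ∀ (p : MvPolynomial σ k) (x : RingHom.ker (algebraMap T' R')), pr p = 0 → π p = x →
      F x = D p) :
    ∃ d : Derivation k T' R', ∀ x : RingHom.ker (algebraMap T' R'), d x = F x := by
  have hk : ∀ x : RingHom.ker (algebraMap T' R'), algebraMap T' R' (x : T') = 0 := fun x ↦ x.2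
  -- C is an extension of R' by a square-zero ideal in which x ∈ I' is identified with F(x)ε. The
  -- polynomial ring over T' stands in for dual numbers: only the coefficients in degrees 0 and 1
  -- enter.
  obtain ⟨V, C, _, mk, q, hV, V_add, V_mul, V_unique, hmk, hmk0, hq, hqn⟩ := exists_pushout F
    Polynomial.constantCoeff (Polynomial.lcoeff T' 1).toAddMonoidHom
    (fun z w ↦ by simp [Polynomial.mul_coeff_one])
  have V_zero : V 0 0 := (hV _ _).2 ⟨0, by simp, by simp⟩
  have V_inl : ∀ x : RingHom.ker (algebraMap T' R'), V (Polynomial.C (x : T')) (F x) := fun x ↦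
    (hV _ _).2 ⟨x, by simp, by simp⟩
  have hq : ∀ z, q (mk z) = algebraMap T' R' (z.coeff 0) := hq
  have hqs : Function.Surjective q := fun r ↦ by
    obtain ⟨p, hp⟩ := hT' r
    exact ⟨mk (Polynomial.C p), by rw [hq, Polynomial.coeff_C_zero, hp]⟩
  -- The aim is χ(p) = π(p) − D(p)ε. With this sign χ(p) vanishes in C for p in the ideal of
  -- relations, where F(π(p)) = D(p).
  choose y hy using fun i : σ ↦ hT' (- D (MvPolynomial.X i))
  let χ : MvPolynomial σ k →ₐ[k] Polynomial T' :=
    MvPolynomial.aeval fun i ↦ (Polynomial.C (π (MvPolynomial.X i)) + Polynomial.C (y i) * Polynomial.X : Polynomial T')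
  have hχX : ∀ i, χ (MvPolynomial.X i) = Polynomial.C (π (MvPolynomial.X i)) + Polynomial.C (y i) * Polynomial.X := fun i ↦
    MvPolynomial.aeval_X _ _
  have hχ1 : ∀ p, (Polynomial.coeff (χ p) 0) = π p := fun p ↦ by
    have : ((Polynomial.aeval (0 : T')).restrictScalars k).comp χ = π :=
      MvPolynomial.algHom_ext fun i ↦ by
        rw [AlgHom.comp_apply, hχX]; simp
    rw [← this, AlgHom.comp_apply, Polynomial.coeff_zero_eq_aeval_zero]
    rfl
  have hχ2 : ∀ p, algebraMap T' R' (Polynomial.coeff (χ p) 1) = - D p := fun p ↦ by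
    induction p using MvPolynomial.induction_on with
    | C c =>
      have h1 : χ (algebraMap k _ c) = algebraMap k _ c := χ.commutes c
      change algebraMap T' R' ((χ (algebraMap k _ c)).coeff 1) = - D (algebraMap k _ c)
      rw [h1, hD2, neg_zero, Polynomial.algebraMap_apply, Polynomial.coeff_C_succ, map_zero]
    | add p p' hp hp' => rw [map_add, Polynomial.coeff_add, map_add, hp, hp', hD0]; ring
    | mul_X p i hp =>
      rw [map_mul, Polynomial.mul_coeff_one, map_add, map_mul, map_mul, hp, hχ1, hχ1, hχX, Polynomial.coeff_add,
        Polynomial.coeff_C_succ, Polynomial.coeff_C_mul_X, if_pos rfl, zero_add, hπ, hπ, hy, hD1]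
      ring
  clear_value χ
  have hχk : ∀ p : MvPolynomial σ k, p ∈ RingHom.ker pr →
      ((mk).comp (χ : _ →+* Polynomial T')) p = 0 := by
    intro p hp
    rw [RingHom.comp_apply, hmk0]
    have h0 : algebraMap T' R' (π p) = 0 := (hπ p).trans (by rw [(hp : pr p = 0), map_zero])
    refine (hV _ _).2 ⟨⟨π p, h0⟩, hχ1 p, by
      rw [hF p ⟨π p, h0⟩ hp rfl]
      exact ((congrArg (D p + ·) (hχ2 p)).trans (add_neg_cancel _)).symm⟩
  obtain ⟨f₀, hf₀⟩ := exists_factor_of_surjective pr.toRingHom hpr (mk.comp χ.toRingHom) hχk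
  have hf₀ : ∀ p, f₀ (pr p) = mk (χ p) := hf₀
  -- Formal étaleness extends R → C to a section g of C → R'. The derivation sought is p ↦ [p] −
  -- g(p), which has values in the ideal of C parametrized by R' and agrees with F on I', where g
  -- contributes nothing.
  obtain ⟨g, hg, hg'⟩ := exists_lift_of_formallyEtale (ρ : R →+* R') hρ f₀ q hqs hqn (by
    ext r
    obtain ⟨p, rfl⟩ := hpr r
    rw [RingHom.comp_apply, hf₀, hq, hχ1]
    exact hπ p)
  have V_of_q : ∀ z, algebraMap T' R' (z.coeff 0) = 0 → ∃ r, V z r := fun z hz ↦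
    ⟨_, (hV _ _).2 ⟨⟨z.coeff 0, hz⟩, rfl, rfl⟩⟩
  have key : ∀ p : T' , ∃ r z, V z r ∧
      mk (Polynomial.C p) - g (algebraMap T' R' p) = mk z := by
    intro p
    obtain ⟨z, hz⟩ := hmk
      (mk (Polynomial.C p) - g (algebraMap T' R' p))
    obtain ⟨r, hr⟩ := V_of_q z (by
      rw [← hq, hz, map_sub, hq, Polynomial.coeff_C_zero, sub_eq_zero]
      exact (RingHom.congr_fun hg _).symm)
    exact ⟨r, z, hr, hz.symm⟩
  choose d w hdw hw using key
  have hd : ∀ p z r, V z r → mk (Polynomial.C p) - g (algebraMap T' R' p) =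
      mk z → d p = r := by
    intro p z r hr hz
    rw [hw, ← sub_eq_zero, ← map_sub, hmk0] at hz
    have := V_add _ _ _ _ hz hr
    rw [sub_add_cancel, zero_add] at this
    exact V_unique _ _ _ (hdw p) this
  have hwfst : ∀ p, algebraMap T' R' (Polynomial.coeff (w p) 0) = 0 := fun p ↦ by
    obtain ⟨x, hx, -⟩ := (hV _ _).1 (hdw p)
    exact (congrArg _ hx).trans (hk x)
  have hadd : ∀ p p', d (p + p') = d p + d p' := fun p p' ↦
    hd _ _ _ (V_add _ _ _ _ (hdw p) (hdw p')) (by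
      simp only [map_add]
      linear_combination hw p + hw p')
  have hmul : ∀ p p', d (p * p') = algebraMap T' R' p * d p' + algebraMap T' R' p' * d p :=
    fun p p' ↦ by
    have h1 := V_mul (Polynomial.C p) _ _ (hdw p')
    -- C p' − w p' represents g(p'). The identity behind the Leibniz rule is pp' − g(p)g(p') = p(p'
    -- − g(p')) + g(p')(p − g(p)).
    have h2 := V_mul (Polynomial.C p' - w p') _ _ (hdw p)
    rw [Polynomial.constantCoeff_apply, Polynomial.coeff_sub, Polynomial.coeff_C_zero, map_sub, hwfst, sub_zero] at h2
    rw [Polynomial.constantCoeff_apply, Polynomial.coeff_C_zero] at h1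
    refine hd _ _ _ (V_add _ _ _ _ h1 h2) ?_
    simp only [map_add, map_mul, map_sub]
    linear_combination mk (Polynomial.C p) * hw p' +
      g (algebraMap T' R' p') * hw p - mk (w p) * hw p'
  have hdF : ∀ x : RingHom.ker (algebraMap T' R'), d x = F x := fun x ↦
    hd _ _ _ (V_inl x) (by rw [hk, map_zero, sub_zero])
  have hconst : ∀ c : k, d (algebraMap k T' c) = 0 := fun c ↦
    hd _ _ _ V_zero (by
      have h1 := RingHom.congr_fun hg' (algebraMap k R c)
      have h2 := hf₀ (algebraMap k _ c)
      rw [AlgHom.commutes] at h2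
      rw [RingHom.comp_apply, h2, AlgHom.commutes] at h1
      change g (ρ (algebraMap k R c)) = _ at h1
      rw [AlgHom.commutes] at h1
      rw [← IsScalarTower.algebraMap_apply, h1, map_zero, sub_eq_zero]
      rfl)
  refine ⟨Derivation.mk'
    { toFun := d
      map_add' := hadd
      map_smul' := fun c p ↦ by
        rw [Algebra.smul_def, hmul, hconst, mul_zero, add_zero, RingHom.id_apply,
          Algebra.smul_def, ← IsScalarTower.algebraMap_apply] }
    (fun p p' ↦ ?_), hdF⟩
  change d (p * p') = p • d p' + p' • d p
  rw [hmul, Algebra.smul_def, Algebra.smul_def]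

/-- On I the difference of the two representatives over R' is given by a derivation of T. By
`exists_derivation_extension` it is then given on I' by a derivation of T', so its class is zero. -/
lemma T1.IsRestriction.unique {ρ : R →ₐ[k] R'} (hρ : (ρ : R →+* R').FormallyEtale)
    {c : T1 k R} {c₁ c₂ : T1 k R'} (h₁ : T1.IsRestriction ρ c c₁)
    (h₂ : T1.IsRestriction ρ c c₂) : c₁ = c₂ := by
  let _ := (ρ : R →+* R').toAlgebra
  have : IsScalarTower k R R' := .of_algebraMap_eq fun c ↦ (ρ.commutes c).symm
  obtain ⟨f, f', v, hf, hf', hv⟩ := h₁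
  obtain ⟨g, g', w, hg, hg', hw⟩ := h₂
  obtain ⟨u, hu⟩ := T1.mk_eq_mk.1 (hf.trans hg.symm)
  let E := (Algebra.Generators.defaultHom (Algebra.Generators.self k R)
    (Algebra.Generators.self k R')).toExtensionHom
  let π : (Pres k R).Ring →ₐ[k] (Pres k R').Ring := E.toAlgHom
  have hπ : ∀ p, presProj k R' (π p) = ρ (presProj k R p) := fun p ↦ E.algebraMap_toRingHom p
  let D (p : (Pres k R).Ring) : R' :=
    ρ (u (1 ⊗ₜ KaehlerDifferential.D k _ p)) + v (1 ⊗ₜ KaehlerDifferential.D k _ p) -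
      w (1 ⊗ₜ KaehlerDifferential.D k _ p)
  have hs : ∀ (p : (Pres k R).Ring) (x : Ω[(Pres k R).Ring⁄k]),
      ((1 : R) ⊗ₜ[(Pres k R).Ring] (p • x) : (Pres k R).CotangentSpace) =
        presProj k R p • (1 ⊗ₜ x) := fun p x ↦ by
    rw [tmul_smul, smul_tmul', smul_tmul', smul_eq_mul, mul_one, Algebra.smul_def, mul_one]; rfl
  have hD0 : ∀ p q, D (p + q) = D p + D q := fun p q ↦ by
    simp only [D, map_add, tmul_add]; ring
  have hD1 : ∀ p q, D (p * q) = ρ (presProj k R p) * D q + ρ (presProj k R q) * D p :=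
    fun p q ↦ by
    have e1 : ∀ (r : R) (y : R'), r • y = ρ r * y := fun _ _ ↦ rfl
    simp only [D, Derivation.leibniz, tmul_add, hs, map_add, map_smul, e1, smul_eq_mul, map_mul]
    ring
  have hD2 : ∀ c, D (algebraMap k _ c) = 0 := fun c ↦ by simp [D]
  have hk : (algebraMap (Pres k R').Ring R' : _ →+* R') = (presProj k R' : _ →+* R') := rfl
  let F : RingHom.ker (algebraMap (Pres k R').Ring R') →ₗ[(Pres k R').Ring] R' :=
    ((f' - g').restrictScalars (Pres k R').Ring).comp Algebra.Extension.Cotangent.mk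
  have hF : ∀ x, F x = f' (Algebra.Extension.Cotangent.mk x) -
    g' (Algebra.Extension.Cotangent.mk x) := fun _ ↦ rfl
  obtain ⟨d, hd⟩ := exists_derivation_extension (σ := R) (T' := (Pres k R').Ring)
    presProj_surjective ρ hρ (presProj k R) presProj_surjective π hπ F D
    hD0 hD1 hD2
    (fun p x hp hx ↦ by
      have h1 := hv (Algebra.Extension.Cotangent.mk ⟨p, hp⟩)
      have h2 := hw (Algebra.Extension.Cotangent.mk ⟨p, hp⟩)
      rw [hu] at h1
      rw [Algebra.Extension.Cotangent.map_mk, Algebra.Extension.cotangentComplex_mk] at h1 h2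
      rw [map_add] at h1
      have h3 : x = ⟨π p, hx.symm ▸ x.2⟩ := Subtype.ext hx.symm
      rw [hF, h3]
      refine (congrArg₂ (· - ·) h1 h2).trans ?_
      simp only [D]
      ring)
  obtain ⟨z, hz⟩ := exists_cotangentSpace_hom d
  rw [← hf', ← hg', T1.mk_eq_mk]
  refine ⟨z, fun y ↦ ?_⟩
  obtain ⟨x, rfl⟩ := Algebra.Extension.Cotangent.mk_surjective y
  rw [Algebra.Extension.cotangentComplex_mk, hz]
  have h1 := hd x
  rw [hF] at h1
  refine (sub_eq_iff_eq_add'.1 h1.symm)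

end Unique

/-! ### Local artinian algebras: finite dimension, subalgebras, quotients, and k + 𝔪². -/

section ArtinConstructions

variable {k : Type*} [Field k]

lemma artinLocal_of_algHom {S : Type*} [CommRing S] [Algebra k S] [IsArtinianRing S]
    (r : S →ₐ[k] k) (h : ∀ s, r s = 0 → IsNilpotent s) : ArtinLocal k S := by
  have hn : Nontrivial S := (r : S →+* k).domain_nontrivial
  have hs : ∀ s, IsNilpotent (s - algebraMap k S (r s)) := fun s ↦ h _ (by simp)
  have hl : IsLocalRing S := by
    refine .of_isUnit_or_isUnit_one_sub_self fun a ↦ ?_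
    by_cases ha : r a = 0
    · exact .inr (h a ha).isUnit_one_sub
    · left
      have h1 : IsUnit (algebraMap k S (r a)) := (IsUnit.mk0 _ ha).map _
      have := (hs a).isUnit_add_right_of_commute h1 (Commute.all _ _)
      rwa [sub_add_cancel] at this
  refine { hl, (inferInstance : IsArtinianRing S) with residue_bijective := ?_ }
  refine ⟨(algebraMap k (IsLocalRing.ResidueField S)).injective, fun y ↦ ?_⟩
  obtain ⟨s, rfl⟩ := IsLocalRing.residue_surjective y
  refine ⟨r s, ?_⟩
  rw [IsScalarTower.algebraMap_apply k S, eq_comm]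
  change IsLocalRing.residue S s = IsLocalRing.residue S _
  rw [← sub_eq_zero, ← map_sub, IsLocalRing.residue_eq_zero_iff, IsLocalRing.mem_maximalIdeal,
    mem_nonunits_iff]
  exact (hs s).not_isUnit

variable {A : Type*} [CommRing A] [Algebra k A] [ArtinLocal k A]

lemma ArtinLocal.isNilpotent_maximalIdeal : IsNilpotent (IsLocalRing.maximalIdeal A) := by
  have := IsArtinianRing.isNilpotent_jacobson_bot (R := A)
  rwa [IsLocalRing.jacobson_eq_maximalIdeal _ bot_ne_top] at this

lemma isNilpotent_of_residue_eq_zero {a : A} (h : residue k A a = 0) : IsNilpotent a := by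
  obtain ⟨n, hn⟩ := ArtinLocal.isNilpotent_maximalIdeal (k := k) (A := A)
  exact ⟨n, by simpa [hn] using Ideal.pow_mem_pow ((residue_eq_zero_iff a).1 h) n⟩

lemma residue_eq_zero_of_isNilpotent {a : A} (h : IsNilpotent a) : residue k A a = 0 :=
  (h.map (residue k A)).eq_zero

variable (k A) in
-- The maximal ideal acts by zero on simple modules, which are therefore spanned over k by any
-- nonzero element; A has finite length. This permits induction on dim_k and shows that subalgebras
-- are artinian.
lemma ArtinLocal.finite : Module.Finite k A := by
  have key : ∀ (M : Type _) [AddCommGroup M] [Module A M], IsFiniteLength A M →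
      ∀ [Module k M] [IsScalarTower k A M], Module.Finite k M := by
    intro M _ _ h
    induction h with
    | of_subsingleton => intros; infer_instance
    | @of_simple_quotient M _ _ N hs _ ih =>
      intro _ _
      have h1 : Module.Finite k N := ih
      have h2 : Module.Finite k (M ⧸ N) := by
        have := IsSimpleModule.nontrivial A (M ⧸ N)
        obtain ⟨x, hx⟩ := exists_ne (0 : M ⧸ N)
        refine .of_surjective (LinearMap.toSpanSingleton k (M ⧸ N) x) fun y ↦ ?_
        obtain ⟨a, rfl⟩ := IsSimpleModule.toSpanSingleton_surjective A hx y
        have hm : ∀ b ∈ IsLocalRing.maximalIdeal A, b • x = 0 := by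
          intro b hb
          by_contra hbx
          obtain ⟨c, hc⟩ := IsSimpleModule.toSpanSingleton_surjective A hbx x
          have h3 : (1 - c * b) • x = 0 := by
            rw [sub_smul, mul_smul, one_smul, sub_eq_zero]; exact hc.symm
          have h4 : IsUnit (1 - c * b) :=
            (isNilpotent_of_residue_eq_zero (k := k)
              ((residue_eq_zero_iff _).2 (Ideal.mul_mem_left _ c hb))).isUnit_one_sub
          exact hx ((h4.smul_eq_zero).1 h3)
        refine ⟨residue k A a, ?_⟩
        have h5 := hm (a - algebraMap k A (residue k A a))
          ((residue_eq_zero_iff (k := k) _).1 (by simp))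
        rw [sub_smul, sub_eq_zero, algebraMap_smul] at h5
        exact h5.symm
      have h3 : Module.Finite k (N.restrictScalars k) := h1
      have h4 : Module.Finite k (M ⧸ N.restrictScalars k) := h2
      exact Module.Finite.of_submodule_quotient (N.restrictScalars k)
  exact key A (isFiniteLength_iff_isNoetherian_isArtinian.2 ⟨inferInstance, inferInstance⟩)

instance subalgebraArtinLocal (S : Subalgebra k A) : ArtinLocal k S := by
  have := ArtinLocal.finite k A
  have : IsArtinianRing S := IsArtinianRing.of_finite k S
  refine artinLocal_of_algHom ((residue k A).comp S.val) fun s hs ↦ ?_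
  exact (IsNilpotent.map_iff (f := S.val) Subtype.val_injective).1
    (isNilpotent_of_residue_eq_zero hs)

lemma artinLocal_quotient (I : Ideal A) (hI : I ≠ ⊤) : ArtinLocal k (A ⧸ I) := by
  have := ArtinLocal.finite k A
  have : IsArtinianRing (A ⧸ I) := IsArtinianRing.of_finite k _
  refine artinLocal_of_algHom (Ideal.Quotient.liftₐ I (residue k A) fun a ha ↦
    (residue_eq_zero_iff a).2 (IsLocalRing.le_maximalIdeal hI ha)) fun s hs ↦ ?_
  obtain ⟨a, rfl⟩ := Ideal.Quotient.mk_surjective s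
  exact (isNilpotent_of_residue_eq_zero (k := k) (a := a) hs).map _

instance artinLocalQuotientSq : ArtinLocal k (A ⧸ IsLocalRing.maximalIdeal A ^ 2) :=
  artinLocal_quotient _ fun h ↦ Ideal.IsPrime.ne_top' (I := IsLocalRing.maximalIdeal A)
    (top_le_iff.1 (h ▸ Ideal.pow_le_self two_ne_zero))

variable (k A) in
/-- The projection `A → A / 𝔪_A²`. -/
def modSq : A →ₐ[k] A ⧸ IsLocalRing.maximalIdeal A ^ 2 := Ideal.Quotient.mkₐ k _

lemma modSq_surjective : Function.Surjective (modSq k A) := Ideal.Quotient.mk_surjective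

lemma modSq_eq_zero_iff {a : A} : modSq k A a = 0 ↔ a ∈ IsLocalRing.maximalIdeal A ^ 2 :=
  Ideal.Quotient.eq_zero_iff_mem

lemma mul_eq_zero_modSq {x y : A ⧸ IsLocalRing.maximalIdeal A ^ 2}
    (hx : x ∈ IsLocalRing.maximalIdeal _) (hy : y ∈ IsLocalRing.maximalIdeal _) : x * y = 0 := by
  obtain ⟨a, rfl⟩ := modSq_surjective (k := k) x
  obtain ⟨b, rfl⟩ := modSq_surjective (k := k) y
  rw [← residue_eq_zero_iff (k := k), residue_map, residue_eq_zero_iff] at hx hy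
  rw [← map_mul, modSq_eq_zero_iff, sq]
  exact Ideal.mul_mem_mul hx hy

variable (k A) in
/-- The subalgebra `k + 𝔪_A²`. -/
def constSq : Subalgebra k A := (⊥ : Subalgebra k (A ⧸ IsLocalRing.maximalIdeal A ^ 2)).comap
  (modSq k A)

lemma exists_residue_of_mem_constSq {a : A} (h : a ∈ constSq k A) (h0 : residue k A a = 0) :
    a ∈ IsLocalRing.maximalIdeal A ^ 2 := by
  obtain ⟨c, hc⟩ := Algebra.mem_bot.1 h
  have h1 : residue k _ (modSq k A a) = c := by
    change algebraMap k _ c = modSq k A a at hc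
    rw [← hc, AlgHom.commutes]; rfl
  rw [residue_map, h0] at h1
  rw [← modSq_eq_zero_iff (k := k), show modSq k A a = _ from hc.symm, ← h1, map_zero]

end ArtinConstructions

/-! ### Left exactness: descending elements of HS to a subalgebra of the base. -/

section LeftExact

variable {k A A₀ Q R : Type*} [Field k] [CommRing A] [Algebra k A] [ArtinLocal k A]
  [CommRing A₀] [Algebra k A₀] [ArtinLocal k A₀] [CommRing Q] [Algebra k Q] [ArtinLocal k Q]
  [CommRing R] [Algebra k R]

lemma map_id_injective {A₀ A : Type*} [CommRing A₀] [Algebra k A₀] [CommRing A] [Algebra k A]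
    (ι : A₀ →ₐ[k] A) (hι : Function.Injective ι) :
    Function.Injective (Algebra.TensorProduct.map ι (AlgHom.id k R)) :=
  Module.Flat.rTensor_preserves_injective_linearMap (M := R) ι.toLinearMap hι

/-- `HS^{A₀}(R)` is the subgroup of the `D ∈ HS^A(R)` that map `R` to `A₀ ⊗ R`. -/
lemma HS.exists_baseChange_eq (ι : A₀ →ₐ[k] A) (hι : Function.Injective ι) (D : HS k A R)
    (h : ∀ r, ∃ w, Algebra.TensorProduct.map ι (AlgHom.id k R) w = D.1 (1 ⊗ₜ r)) :
    ∃ D₀ : HS k A₀ R, HS.baseChange ι D₀ = D := by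
  choose w hw using h
  have hinj := map_id_injective (R := R) ι hι
  let f : R →ₐ[k] A₀ ⊗[k] R := AlgHom.ofLinearMap
    { toFun := w
      map_add' := fun x y ↦ hinj (by rw [map_add, hw, hw, hw, tmul_add, map_add])
      map_smul' := fun c x ↦ hinj (by
        rw [map_smul, hw, hw, tmul_smul, ← algebraMap_smul A c, map_smul, algebraMap_smul]
        rfl) }
    (hinj (by
      change Algebra.TensorProduct.map ι (AlgHom.id k R) (w 1) = _
      rw [hw, map_one]; exact map_one D.1))
    (fun x y ↦ hinj (by
      change Algebra.TensorProduct.map ι (AlgHom.id k R) (w _) =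
        Algebra.TensorProduct.map ι (AlgHom.id k R) (w _ * w _)
      rw [map_mul, hw, hw, hw, ← map_mul, Algebra.TensorProduct.tmul_mul_tmul, mul_one]))
  have hf : ∀ r, red k A₀ R (f r) = r := fun r ↦ by
    change red k A₀ R (w r) = r
    have := red_map ι (AlgHom.id k R) (w r)
    rw [hw, D.2, red_tmul, map_one, one_smul] at this
    exact this.symm
  refine ⟨HS.ofAlgHom f hf, HS.ext_one_tmul fun r ↦ ?_⟩
  rw [HS.baseChange_one_tmul, HS.ofAlgHom_tmul, one_smul]
  exact hw r

lemma exists_map_eq_of_map_eq_zero (ι : A₀ →ₐ[k] A) (π : A →ₐ[k] Q)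
    (hπ : Function.Surjective π) (h : ∀ a, π a = 0 → ∃ b, ι b = a) (z : A ⊗[k] R)
    (hz : Algebra.TensorProduct.map π (AlgHom.id k R) z = 0) :
    ∃ w, Algebra.TensorProduct.map ι (AlgHom.id k R) w = z := by
  have hex : Function.Exact (LinearMap.ker π.toLinearMap).subtype π.toLinearMap :=
    LinearMap.exact_subtype_ker_map _
  obtain ⟨w, rfl⟩ := (rTensor_exact R hex hπ z).1 hz
  induction w with
  | zero => exact ⟨0, by simp⟩
  | tmul x r =>
    obtain ⟨b, hb⟩ := h x x.2
    exact ⟨b ⊗ₜ r, by simp [hb]⟩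
  | add x y hx hy =>
    obtain ⟨a, ha⟩ := hx (by
      have := LinearMap.congr_fun (LinearMap.rTensor_comp R π.toLinearMap
        (LinearMap.ker π.toLinearMap).subtype) x
      rw [LinearMap.comp_ker_subtype] at this
      rw [LinearMap.rTensor_zero] at this
      exact this.symm)
    obtain ⟨b, hb⟩ := hy (by
      have := LinearMap.congr_fun (LinearMap.rTensor_comp R π.toLinearMap
        (LinearMap.ker π.toLinearMap).subtype) y
      rw [LinearMap.comp_ker_subtype] at this
      rw [LinearMap.rTensor_zero] at this
      exact this.symm)
    exact ⟨a + b, by rw [map_add, map_add, ha, hb]⟩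

/-- Left exactness: a `D ∈ HS^A(R)` comes from `A₀ ⊆ A` if it does so modulo an ideal
contained in `A₀`. -/
lemma HS.exists_baseChange_eq_of_quotient (ι : A₀ →ₐ[k] A) (hι : Function.Injective ι)
    (π : A →ₐ[k] Q) (hπ : Function.Surjective π) (h : ∀ a, π a = 0 → ∃ b, ι b = a) (D : HS k A R)
    (hD : ∀ r, ∃ w, Algebra.TensorProduct.map π (AlgHom.id k R) (D.1 (1 ⊗ₜ r)) =
      Algebra.TensorProduct.map π (AlgHom.id k R)
        (Algebra.TensorProduct.map ι (AlgHom.id k R) w)) :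
    ∃ D₀ : HS k A₀ R, HS.baseChange ι D₀ = D := by
  refine HS.exists_baseChange_eq ι hι D fun r ↦ ?_
  obtain ⟨w, hw⟩ := hD r
  obtain ⟨w', hw'⟩ := exists_map_eq_of_map_eq_zero ι π hπ h
    (D.1 (1 ⊗ₜ r) - Algebra.TensorProduct.map ι (AlgHom.id k R) w) (by rw [map_sub, hw, sub_self])
  exact ⟨w' + w, by rw [map_add, hw', sub_add_cancel]⟩

/-- The kernel 𝔪² of the projection is contained in k + 𝔪², and modulo 𝔪² the identity certainly
comes from constants. -/
lemma HS.exists_of_baseChange_modSq_eq_one {D : HS k A R}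
    (hD : HS.baseChange (modSq k A) D = 1) :
    ∃ D₀ : HS k (constSq k A) R, HS.baseChange (constSq k A).val D₀ = D := by
  refine HS.exists_baseChange_eq_of_quotient _ Subtype.val_injective (modSq k A) modSq_surjective
    (fun a ha ↦ ⟨⟨a, ?_⟩, rfl⟩) D fun r ↦ ⟨1 ⊗ₜ r, ?_⟩
  · rw [← HS.baseChange_one_tmul, hD]
    simp
  · change modSq k A a ∈ (⊥ : Subalgebra k _)
    rw [ha]; exact zero_mem _

end LeftExact

/-! ### HS over a base with 𝔪² = 0 is commutative. -/

section SquareZero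

variable {k Q R : Type*} [Field k] [CommRing Q] [Algebra k Q] [ArtinLocal k Q]
  [CommRing R] [Algebra k R]

lemma smul_eq_zero_of_red_eq_zero
    (hQ : ∀ x ∈ IsLocalRing.maximalIdeal Q, ∀ y ∈ IsLocalRing.maximalIdeal Q, x * y = 0)
    {a : Q} (ha : a ∈ IsLocalRing.maximalIdeal Q) {z : Q ⊗[k] R} (hz : red k Q R z = 0) :
    a • z = 0 := by
  refine Submodule.smul_induction_on (p := fun z ↦ a • z = 0) (ker_red_le z hz) ?_ ?_
  · intro b hb y _
    rw [smul_smul, hQ a ha b hb, zero_smul]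
  · intro x y hx hy
    rw [smul_add, hx, hy, add_zero]

/-- The kernel of the reduction is 𝔪_Q · (Q ⊗ R), and D moves b · y by b times an element of this
kernel, which is zero. Hence composition in HS^Q(R) is addition of the deviations from the identity.
-/
lemma HS.apply_eq_self
    (hQ : ∀ x ∈ IsLocalRing.maximalIdeal Q, ∀ y ∈ IsLocalRing.maximalIdeal Q, x * y = 0)
    (D : HS k Q R) {z : Q ⊗[k] R} (hz : red k Q R z = 0) : D.1 z = z := by
  refine Submodule.smul_induction_on (p := fun z ↦ D.1 z = z) (ker_red_le z hz) ?_ ?_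
  · intro b hb y _
    rw [map_smul, ← sub_eq_zero, ← smul_sub]
    exact smul_eq_zero_of_red_eq_zero hQ hb (by rw [map_sub, D.2, sub_self])
  · intro x y hx hy
    rw [map_add, hx, hy]

lemma HS.mul_apply_one_tmul
    (hQ : ∀ x ∈ IsLocalRing.maximalIdeal Q, ∀ y ∈ IsLocalRing.maximalIdeal Q, x * y = 0)
    (D E : HS k Q R) (r : R) :
    (D * E).1 (1 ⊗ₜ r) = D.1 (1 ⊗ₜ r) + E.1 (1 ⊗ₜ r) - 1 ⊗ₜ r := by
  have h := HS.apply_eq_self hQ D (z := E.1 (1 ⊗ₜ r) - 1 ⊗ₜ r) (by rw [map_sub, E.2, sub_self])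
  rw [map_sub, sub_eq_iff_eq_add] at h
  change D.1 (E.1 _) = _
  rw [h]; ring

lemma HS.commute_of_sq_zero
    (hQ : ∀ x ∈ IsLocalRing.maximalIdeal Q, ∀ y ∈ IsLocalRing.maximalIdeal Q, x * y = 0)
    (D E : HS k Q R) : D * E = E * D :=
  HS.ext_one_tmul fun r ↦ by rw [HS.mul_apply_one_tmul hQ, HS.mul_apply_one_tmul hQ]; ring

end SquareZero

/-! ### The truncated polynomial rings k[s]/s^m. -/

section Curve

variable (k : Type u) [Field k] (m : ℕ)

/-- The truncated polynomial ring `k[s] / s^m`. -/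
def Curve : Type u := AdjoinRoot (Polynomial.X ^ m : Polynomial k)

instance : CommRing (Curve k m) := inferInstanceAs (CommRing (AdjoinRoot _))
instance : Algebra k (Curve k m) := inferInstanceAs (Algebra k (AdjoinRoot _))

/-- The class of a polynomial in `k[s] / s^m`. -/
def Curve.mk : Polynomial k →ₐ[k] Curve k m := AdjoinRoot.mkₐ _

/-- The class `s`. -/
def Curve.s : Curve k m := Curve.mk k m Polynomial.X

variable {k m}

lemma Curve.mk_surjective : Function.Surjective (Curve.mk k m) := AdjoinRoot.mk_surjective

lemma Curve.mk_eq_zero {p : Polynomial k} : Curve.mk k m p = 0 ↔ Polynomial.X ^ m ∣ p :=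
  AdjoinRoot.mk_eq_zero

lemma Curve.s_pow : (Curve.s k m) ^ m = 0 := by
  rw [Curve.s, ← map_pow, Curve.mk_eq_zero]

variable {A A' : Type*} [CommRing A] [Algebra k A] [CommRing A'] [Algebra k A']

/-- The morphism `k[s] / s^m → A`, `s ↦ x`. -/
def Curve.ev (x : A) (hx : x ^ m = 0) : Curve k m →ₐ[k] A :=
  AdjoinRoot.liftAlgHom _ (Algebra.ofId k A) x (by simp [hx])

lemma Curve.ev_mk (x : A) (hx : x ^ m = 0) (p : Polynomial k) :
    Curve.ev x hx (Curve.mk k m p) = Polynomial.aeval x p :=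
  AdjoinRoot.liftAlgHom_mk _ _ _ _ p

lemma Curve.ev_s (x : A) (hx : x ^ m = 0) : Curve.ev (k := k) x hx (Curve.s k m) = x := by
  rw [Curve.s, Curve.ev_mk, Polynomial.aeval_X]

lemma Curve.algHom_ext {f g : Curve k m →ₐ[k] A} (h : f (Curve.s k m) = g (Curve.s k m)) :
    f = g := by
  refine AlgHom.ext fun c ↦ ?_
  obtain ⟨p, rfl⟩ := Curve.mk_surjective c
  have : f.comp (Curve.mk k m) = g.comp (Curve.mk k m) := Polynomial.algHom_ext h
  exact DFunLike.congr_fun this p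

lemma Curve.aeval_s (p : Polynomial k) : Polynomial.aeval (Curve.s k m) p = Curve.mk k m p := by
  have : Polynomial.aeval (Curve.s k m) = Curve.mk k m :=
    Polynomial.algHom_ext (Polynomial.aeval_X _)
  rw [this]

lemma Curve.comp_ev (f : A →ₐ[k] A') (x : A) (hx : x ^ m = 0) :
    f.comp (Curve.ev x hx) = Curve.ev (f x) (by rw [← map_pow, hx, map_zero]) :=
  Curve.algHom_ext (by rw [AlgHom.comp_apply, Curve.ev_s, Curve.ev_s])

instance : Module.Finite k (Curve k m) :=
  (AdjoinRoot.powerBasis' (Polynomial.monic_X_pow m)).finite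

lemma Curve.exists_eq_s_mul {c : Curve k m} (f : Curve k m →ₐ[k] k) (hf : f (Curve.s k m) = 0)
    (hc : f c = 0) : ∃ c', c = Curve.s k m * c' := by
  obtain ⟨p, rfl⟩ := Curve.mk_surjective c
  have h : f.comp (Curve.mk k m) = Polynomial.aeval (0 : k) :=
    Polynomial.algHom_ext (by rw [Polynomial.aeval_X]; exact hf)
  have h2 := DFunLike.congr_fun h p
  rw [AlgHom.comp_apply, hc, ← Polynomial.coeff_zero_eq_aeval_zero, eq_comm,
    ← Polynomial.X_dvd_iff] at h2
  obtain ⟨q, rfl⟩ := h2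
  exact ⟨Curve.mk k m q, map_mul _ _ _⟩

instance [NeZero m] : ArtinLocal k (Curve k m) := by
  have : IsArtinianRing (Curve k m) := IsArtinianRing.of_finite k _
  refine artinLocal_of_algHom (Curve.ev (0 : k) (zero_pow (NeZero.ne m))) fun c hc ↦ ?_
  obtain ⟨c', rfl⟩ := Curve.exists_eq_s_mul _ (Curve.ev_s _ _) hc
  exact Commute.isNilpotent_mul_right (Commute.all _ _) ⟨m, Curve.s_pow⟩

lemma Curve.exists_eq_s_mul_of_mem [NeZero m] {c : Curve k m}
    (hc : c ∈ IsLocalRing.maximalIdeal (Curve k m)) : ∃ c', c = Curve.s k m * c' :=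
  Curve.exists_eq_s_mul (residue k _) (residue_eq_zero_of_isNilpotent ⟨m, Curve.s_pow⟩)
    ((residue_eq_zero_iff _).2 hc)

lemma Curve.exists_eq_s_sq_mul_of_mem [NeZero m] {c : Curve k m}
    (hc : c ∈ IsLocalRing.maximalIdeal (Curve k m) ^ 2) : ∃ c', c = Curve.s k m ^ 2 * c' := by
  rw [sq] at hc
  refine Submodule.mul_induction_on hc ?_ ?_
  · intro a ha b hb
    obtain ⟨a', rfl⟩ := Curve.exists_eq_s_mul_of_mem ha
    obtain ⟨b', rfl⟩ := Curve.exists_eq_s_mul_of_mem hb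
    exact ⟨a' * b', by ring⟩
  · rintro _ _ ⟨a, rfl⟩ ⟨b, rfl⟩
    exact ⟨a + b, by ring⟩

lemma Curve.s_pow_succ : (Curve.s k m) ^ (m + 1) = 0 := by
  rw [pow_succ, Curve.s_pow, zero_mul]

variable (k m) in
/-- The small extension `k[s] / s^{m+1} → k[s] / s^m`. -/
def curveExt [NeZero m] : SmallExtension k (Curve k (m + 1)) (Curve k m) where
  φ := Curve.ev (Curve.s k m) Curve.s_pow_succ
  surjective c := by
    obtain ⟨p, rfl⟩ := Curve.mk_surjective c
    refine ⟨Curve.mk k _ p, ?_⟩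
    rw [Curve.ev_mk, Curve.aeval_s]
  t := Curve.s k (m + 1) ^ m
  t_ne_zero h := by
    rw [Curve.s, ← map_pow, Curve.mk_eq_zero,
      pow_dvd_pow_iff Polynomial.X_ne_zero Polynomial.not_isUnit_X] at h
    omega
  ker_eq b := by
    constructor
    · intro h
      obtain ⟨p, rfl⟩ := Curve.mk_surjective b
      rw [Curve.ev_mk, Curve.aeval_s,
        Curve.mk_eq_zero] at h
      obtain ⟨q, rfl⟩ := h
      refine ⟨q.coeff 0, ?_⟩
      rw [← sub_eq_zero, Curve.s, ← map_pow, ← map_smul, ← map_sub, Curve.mk_eq_zero,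
        Polynomial.smul_eq_C_mul, mul_comm (Polynomial.C _), ← mul_sub, pow_succ]
      refine mul_dvd_mul_left _ (Polynomial.X_dvd_iff.2 (by simp))
    · rintro ⟨c, rfl⟩
      rw [map_smul, map_pow, Curve.ev_s, Curve.s_pow, smul_zero]
  maximalIdeal_mul b hb := by
    obtain ⟨c, rfl⟩ := Curve.exists_eq_s_mul_of_mem hb
    rw [mul_right_comm, ← pow_succ', Curve.s_pow, zero_mul]

/-- A nonzero class is represented by X^i q with i ≤ m and q(0) ≠ 0. Multiplying its value by
x^{m−i} gives q(0) x^m ≠ 0. -/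
lemma Curve.ev_injective (x : A) (hx : x ^ (m + 1) = 0) (hx' : x ^ m ≠ 0) :
    Function.Injective (Curve.ev (k := k) x hx) := by
  refine (injective_iff_map_eq_zero _).2 fun c hc ↦ ?_
  obtain ⟨p, rfl⟩ := Curve.mk_surjective c
  by_contra hp
  have hp0 : p ≠ 0 := fun h ↦ hp (by rw [h, map_zero])
  obtain ⟨q, hq, hq'⟩ := Polynomial.exists_eq_pow_rootMultiplicity_mul_and_not_dvd p hp0 0
  rw [map_zero, sub_zero] at hq hq'
  set i := p.rootMultiplicity 0
  have hi : i ≤ m := by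
    by_contra hi
    refine hp (Curve.mk_eq_zero.2 ?_)
    rw [hq]
    exact Dvd.dvd.mul_right (pow_dvd_pow _ (by omega)) _
  rw [Curve.ev_mk, hq, map_mul, map_pow, Polynomial.aeval_X] at hc
  have h2 : x ^ m * Polynomial.aeval x q = 0 := by
    rw [← Nat.sub_add_cancel hi, pow_add, mul_assoc, hc, mul_zero]
  have h3 : x ^ m * Polynomial.aeval x q = q.coeff 0 • x ^ m := by
    conv_lhs => rw [← Polynomial.divX_mul_X_add q]
    rw [map_add, map_mul, Polynomial.aeval_X, Polynomial.aeval_C, mul_add, ← mul_assoc,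
      mul_right_comm, ← pow_succ, hx, zero_mul, zero_add, mul_comm, Algebra.smul_def]
  rw [h3, smul_eq_zero] at h2
  rcases h2 with h2 | h2
  · exact hq' (Polynomial.X_dvd_iff.2 h2)
  · exact hx' h2

end Curve

/-! ### Values of curves and their obstructions. -/

section CurveValues

variable {k : Type u} [Field k] {m : ℕ} [NeZero m] {A A' B R : Type*} [CommRing A] [Algebra k A]
  [ArtinLocal k A] [CommRing A'] [Algebra k A'] [ArtinLocal k A']
  [CommRing B] [Algebra k B] [ArtinLocal k B] [CommRing R] [Algebra k R]

/-- The value at `x` of the curve `H` in `HS(R)`. -/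
def curveVal (x : A) (hx : x ^ m = 0) (H : HS k (Curve k m) R) : HS k A R :=
  HS.baseChange (Curve.ev x hx) H

lemma curveVal_congr {x y : A} (h : x = y) (hx : x ^ m = 0) (hy : y ^ m = 0)
    (H : HS k (Curve k m) R) : curveVal x hx H = curveVal y hy H := by
  subst h; rfl

lemma baseChange_curveVal (φ : A →ₐ[k] A') (x : A) (hx : x ^ m = 0) (H : HS k (Curve k m) R) :
    HS.baseChange φ (curveVal x hx H) =
      curveVal (φ x) (by rw [← map_pow, hx, map_zero]) H := by
  rw [curveVal, curveVal, ← HS.baseChange_comp, Curve.comp_ev]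

lemma curveVal_mul (x : A) (hx : x ^ m = 0) (H H' : HS k (Curve k m) R) :
    curveVal x hx (H * H') = curveVal x hx H * curveVal x hx H' := HS.baseChange_mul _ _ _

lemma residue_eq_zero_of_pow {x : A} {n : ℕ} (hx : x ^ n = 0) : residue k A x = 0 :=
  residue_eq_zero_of_isNilpotent ⟨n, hx⟩

lemma mem_maximalIdeal_of_pow {x : A} {n : ℕ} (hx : x ^ n = 0) :
    x ∈ IsLocalRing.maximalIdeal A :=
  (residue_eq_zero_iff (k := k) _).1 (residue_eq_zero_of_pow hx)

lemma Curve.residue_mk (p : Polynomial k) : residue k (Curve k m) (Curve.mk k m p) = p.coeff 0 := by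
  have h0 : residue k (Curve k m) (Curve.s k m) = 0 :=
    residue_eq_zero_of_pow (x := Curve.s k m) (n := m) Curve.s_pow
  have : (residue k (Curve k m)).comp (Curve.mk k m) = Polynomial.aeval (0 : k) :=
    Polynomial.algHom_ext (by rw [Polynomial.aeval_X, AlgHom.comp_apply, ← h0]; rfl)
  rw [Polynomial.coeff_zero_eq_aeval_zero, ← this, AlgHom.comp_apply]

/-- Curves are additive modulo `𝔪²`. -/
lemma curveVal_add (hQ : ∀ x ∈ IsLocalRing.maximalIdeal A, ∀ y ∈ IsLocalRing.maximalIdeal A,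
    x * y = 0) (x y : A) (hx : x ^ m = 0) (hy : y ^ m = 0) (hxy : (x + y) ^ m = 0)
    (H : HS k (Curve k m) R) :
    curveVal (x + y) hxy H = curveVal x hx H * curveVal y hy H := by
  have hx' := mem_maximalIdeal_of_pow (k := k) hx
  have hy' := mem_maximalIdeal_of_pow (k := k) hy
  have h1 := hQ x hx' x hx'
  have h2 := hQ x hx' y hy'
  have h3 := hQ y hy' y hy'
  -- Only terms of degree at most one survive evaluation, since all products of x and y vanish.
  have key : ∀ p : Polynomial k, Polynomial.aeval (x + y) p =
      Polynomial.aeval x p + Polynomial.aeval y p - algebraMap k A (p.coeff 0) := by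
    intro p
    induction p using Polynomial.induction_on' with
    | add p q hp hq => rw [map_add, map_add, map_add, hp, hq, Polynomial.coeff_add, map_add]; ring
    | monomial n a =>
      simp only [Polynomial.aeval_monomial]
      rcases n with _ | _ | n
      · simp
      · simp [mul_add]
      · have e : ∀ z : A, z * z = 0 → z ^ (n + 2) = 0 := fun z hz ↦ by
          rw [pow_add, sq, hz, mul_zero]
        rw [e _ (by linear_combination h1 + 2 * h2 + h3), e x h1, e y h3]
        simp
  have key2 : ∀ w : Curve k m ⊗[k] R,
      Algebra.TensorProduct.map (Curve.ev (x + y) hxy) (AlgHom.id k R) w =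
      Algebra.TensorProduct.map (Curve.ev x hx) (AlgHom.id k R) w +
        Algebra.TensorProduct.map (Curve.ev y hy) (AlgHom.id k R) w - 1 ⊗ₜ red k _ R w := by
    intro w
    induction w with
    | zero => simp
    | add v w hv hw => simp only [map_add, hv, hw, tmul_add]; ring
    | tmul c r =>
      obtain ⟨p, rfl⟩ := Curve.mk_surjective c
      rw [Algebra.TensorProduct.map_tmul, Algebra.TensorProduct.map_tmul,
        Algebra.TensorProduct.map_tmul, Curve.ev_mk, Curve.ev_mk, Curve.ev_mk, key, red_tmul, Curve.residue_mk,
        sub_tmul, add_tmul, AlgHom.id_apply, Algebra.algebraMap_eq_smul_one, smul_tmul]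
  refine HS.ext_one_tmul fun r ↦ ?_
  rw [HS.mul_apply_one_tmul hQ, curveVal, curveVal, curveVal, HS.baseChange_one_tmul,
    HS.baseChange_one_tmul, HS.baseChange_one_tmul, key2, H.2, red_tmul, map_one, one_smul]

/-- The obstruction of a curve at a point. -/
lemma ob_curveVal (Φ : SmallExtension k B A) (x : B) (τ : k) (h : x ^ m = τ • Φ.t) (y : A)
    (hy : y ^ m = 0) (hxy : Φ.φ x = y) (H : HS k (Curve k m) R) :
    ob Φ (curveVal y hy H) = algebraMap k R τ • ob (curveExt k m) H := by
  have hx : x ^ (m + 1) = 0 := by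
    have h2 : residue k B x = 0 := by rw [← residue_map Φ.φ, hxy]; exact residue_eq_zero_of_pow hy
    rw [pow_succ', h, mul_smul_comm, Φ.mul_t, h2, zero_smul, smul_zero]
  subst hxy
  -- Sending s to x is a morphism from the extension k[s]/s^{m+1} → k[s]/s^m to Φ which maps s^m to
  -- τt; the obstruction is multiplied by τ accordingly.
  refine ob_baseChange_of_map Φ (Curve.ev _ hy) (Curve.ev x hx) ?_ τ ?_ H
  · intro b
    have : (Curve.ev (Φ.φ x) hy).comp (curveExt k m).φ = Φ.φ.comp (Curve.ev x hx) :=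
      Curve.algHom_ext (by
        rw [AlgHom.comp_apply, AlgHom.comp_apply, Curve.ev_s]
        exact (congrArg _ (Curve.ev_s _ Curve.s_pow_succ)).trans (Curve.ev_s _ _))
    exact DFunLike.congr_fun this b
  · change Curve.ev x hx (Curve.s k (m + 1) ^ m) = _
    rw [map_pow, Curve.ev_s, h]

variable (k A R) in
/-- The subgroup generated by the values of curves. -/
def curveSubgroup : Subgroup (HS k A R) :=
  Subgroup.closure {D | ∃ (m : ℕ) (_ : NeZero m) (x : A) (hx : x ^ m = 0)
    (H : HS k (Curve k m) R), D = curveVal x hx H}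

lemma curveVal_mem (x : A) (hx : x ^ m = 0) (H : HS k (Curve k m) R) :
    curveVal x hx H ∈ curveSubgroup k A R :=
  Subgroup.subset_closure ⟨m, inferInstance, x, hx, H, rfl⟩

lemma baseChange_mem_curveSubgroup (φ : A →ₐ[k] A') {D : HS k A R}
    (hD : D ∈ curveSubgroup k A R) : HS.baseChange φ D ∈ curveSubgroup k A' R := by
  have : curveSubgroup k A R ≤ (curveSubgroup k A' R).comap (HS.baseChangeHom φ) := by
    refine (Subgroup.closure_le _).2 ?_
    rintro _ ⟨m, _, x, hx, H, rfl⟩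
    change HS.baseChange φ (curveVal x hx H) ∈ curveSubgroup k A' R
    rw [baseChange_curveVal]
    exact curveVal_mem _ _ _
  exact this hD

end CurveValues

/-! ### HS^B(R) is generated by values of curves. -/

section Generation

variable {k : Type u} [Field k] {A B : Type u} {R : Type*} [CommRing A] [Algebra k A]
  [ArtinLocal k A] [CommRing B] [Algebra k B] [ArtinLocal k B] [CommRing R] [Algebra k R]

lemma HS.eq_one_of_maximalIdeal_eq_bot (h : IsLocalRing.maximalIdeal A = ⊥) (D : HS k A R) :
    D = 1 := by
  refine HS.ext_one_tmul fun r ↦ ?_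
  have := ker_red_le (k := k) (D.1 (1 ⊗ₜ r) - 1 ⊗ₜ r) (by rw [map_sub, D.2, sub_self])
  rw [h, Submodule.bot_smul, Submodule.mem_bot, sub_eq_zero] at this
  exact this

/-- If A = k + 𝔪² then 𝔪 = 𝔪², and a nilpotent idempotent ideal is zero. -/
lemma maximalIdeal_eq_bot_of_constSq (h : constSq k A = ⊤) : IsLocalRing.maximalIdeal A = ⊥ := by
  have h1 : IsLocalRing.maximalIdeal A ≤ IsLocalRing.maximalIdeal A ^ 2 := fun a ha ↦
    exists_residue_of_mem_constSq (k := k) (h ▸ Algebra.mem_top) ((residue_eq_zero_iff a).2 ha)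
  obtain ⟨n, hn⟩ := ArtinLocal.isNilpotent_maximalIdeal (k := k) (A := A)
  have h2 : ∀ n, IsLocalRing.maximalIdeal A ≤ IsLocalRing.maximalIdeal A ^ (n + 1) := by
    intro n
    induction n with
    | zero => simp
    | succ n ih =>
      refine h1.trans ?_
      rw [sq, pow_succ]
      exact Ideal.mul_mono_left ih
  have h3 := (h2 n).trans (Ideal.pow_le_pow_right (Nat.le_succ n))
  rw [hn] at h3
  exact le_bot_iff.1 h3

lemma SmallExtension.finrank_lt (Φ : SmallExtension k B A) :
    Module.finrank k A < Module.finrank k B := by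
  have := ArtinLocal.finite k B
  have h := LinearMap.finrank_range_add_finrank_ker Φ.φ.toLinearMap
  rw [LinearMap.range_eq_top.2 Φ.surjective, finrank_top] at h
  have h2 : 0 < Module.finrank k (LinearMap.ker Φ.φ.toLinearMap) := by
    rw [Module.finrank_pos_iff_exists_ne_zero]
    exact ⟨⟨Φ.t, Φ.φ_t⟩, fun h ↦ Φ.t_ne_zero (congrArg Subtype.val h)⟩
  omega

lemma finrank_subalgebra_lt {S : Subalgebra k B} (hS : S ≠ ⊤) :
    Module.finrank k S < Module.finrank k B := by
  have := ArtinLocal.finite k B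
  exact Submodule.finrank_lt (s := Subalgebra.toSubmodule S)
    (fun h ↦ hS (Algebra.toSubmodule_eq_top.1 h))

lemma finrank_subalgebra_le (S : Subalgebra k A) : Module.finrank k S ≤ Module.finrank k A := by
  have := ArtinLocal.finite k A
  exact Submodule.finrank_le (Subalgebra.toSubmodule S)

variable (Φ : SmallExtension k B A)

variable (R) in
/-- The image in `HS^A(R)` of the subgroup of `HS^B(R)` generated by curves. -/
def curveImage : Subgroup (HS k A R) := (curveSubgroup k B R).map (HS.baseChangeHom Φ.φ)

variable {Φ}

lemma mem_curveImage_of_mem {D : HS k B R} (h : D ∈ curveSubgroup k B R) :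
    HS.baseChange Φ.φ D ∈ curveImage R Φ := ⟨D, h, rfl⟩

lemma curveVal_mem_curveImage {m : ℕ} [NeZero m] (x : B) (hx : x ^ m = 0) {y : A}
    (hy : y ^ m = 0) (h : Φ.φ x = y) (H : HS k (Curve k m) R) :
    curveVal y hy H ∈ curveImage R Φ := by
  subst h
  rw [← baseChange_curveVal Φ.φ x hx]
  exact mem_curveImage_of_mem (curveVal_mem _ _ _)

/-- An unobstructed element that is trivial modulo `𝔪²` is the image of a product of curves. -/
lemma mem_curveImage_of_ob_eq_zero
    (IH : ∀ S : Subalgebra k B, S ≠ ⊤ → curveSubgroup k S R = ⊤) {D : HS k A R}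
    (hD : HS.baseChange (modSq k A) D = 1) (hob : ob Φ D = 0) : D ∈ curveImage R Φ := by
  obtain ⟨E, rfl⟩ := exists_baseChange_eq_of_ob_eq_zero hob
  -- Since D is trivial modulo 𝔪_A², its lift E is defined over the preimage S of k + 𝔪_A². The
  -- induction hypothesis covers S unless S = B, in which case 𝔪_A = 0 and D = 1.
  let S : Subalgebra k B := (constSq k A).comap Φ.φ
  by_cases hS : S = ⊤
  · have htop : constSq k A = ⊤ := by
      rw [eq_top_iff]
      intro a _
      obtain ⟨b, rfl⟩ := Φ.surjective a
      exact (show b ∈ S from hS ▸ Algebra.mem_top)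
    rw [HS.eq_one_of_maximalIdeal_eq_bot (maximalIdeal_eq_bot_of_constSq (k := k) htop)
      (HS.baseChange Φ.φ E)]
    exact one_mem _
  · obtain ⟨E₀, rfl⟩ : ∃ E₀ : HS k S R, HS.baseChange S.val E₀ = E := by
      refine HS.exists_baseChange_eq_of_quotient _ Subtype.val_injective
        ((modSq k A).comp Φ.φ) ((modSq_surjective (k := k)).comp Φ.surjective)
        (fun b hb ↦ ⟨⟨b, ?_⟩, rfl⟩) E fun r ↦ ⟨1 ⊗ₜ r, ?_⟩
      swap
      · change modSq k A (Φ.φ b) ∈ (⊥ : Subalgebra k _)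
        rw [show modSq k A (Φ.φ b) = 0 from hb]
        exact zero_mem _
      · rw [← HS.baseChange_comp] at hD
        rw [← HS.baseChange_one_tmul, hD]
        simp
    refine mem_curveImage_of_mem (baseChange_mem_curveSubgroup _ ?_)
    rw [IH S hS]
    trivial

/-- A commutator is trivial modulo 𝔪², where HS is commutative, and unobstructed, because
obstructions lie in an abelian group. -/
lemma commutator_mem_curveImage
    (IH : ∀ S : Subalgebra k B, S ≠ ⊤ → curveSubgroup k S R = ⊤) (D E : HS k A R) :
    D * E * D⁻¹ * E⁻¹ ∈ curveImage R Φ := by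
  refine mem_curveImage_of_ob_eq_zero IH ?_ ?_
  · have := HS.commute_of_sq_zero (fun x hx y hy ↦ mul_eq_zero_modSq (k := k) hx hy)
      (HS.baseChange (modSq k A) D) (HS.baseChange (modSq k A) E)
    rw [HS.baseChange_mul, HS.baseChange_mul, HS.baseChange_mul, HS.baseChange_inv,
      HS.baseChange_inv, this, mul_inv_cancel_right, mul_inv_cancel]
  · rw [ob_mul, ob_mul, ob_mul, ob_inv, ob_inv]
    abel

lemma curveImage_normal (IH : ∀ S : Subalgebra k B, S ≠ ⊤ → curveSubgroup k S R = ⊤) :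
    (curveImage R Φ).Normal := ⟨fun n hn g ↦ by
  have := mul_mem (commutator_mem_curveImage (Φ := Φ) IH g n) hn
  rwa [inv_mul_cancel_right] at this⟩

/-- Curves are additive modulo `curveImage`, if obstructions are. -/
lemma curveVal_add_mem (IH : ∀ S : Subalgebra k B, S ≠ ⊤ → curveSubgroup k S R = ⊤)
    {m : ℕ} [NeZero m] (x y : A) (hx : x ^ m = 0) (hy : y ^ m = 0) (hxy : (x + y) ^ m = 0)
    (H : HS k (Curve k m) R)
    (hob : ob Φ (curveVal (x + y) hxy H) = ob Φ (curveVal x hx H) + ob Φ (curveVal y hy H)) :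
    curveVal (x + y) hxy H * (curveVal x hx H * curveVal y hy H)⁻¹ ∈ curveImage R Φ := by
  refine mem_curveImage_of_ob_eq_zero IH ?_ ?_
  · rw [HS.baseChange_mul, HS.baseChange_inv, HS.baseChange_mul, baseChange_curveVal,
      baseChange_curveVal, baseChange_curveVal, mul_inv_eq_one]
    have h := map_add (modSq k A) x y
    rw [curveVal_congr h _ (by rw [← map_add, ← map_pow, hxy, map_zero])]
    exact curveVal_add (fun x hx y hy ↦ mul_eq_zero_modSq (k := k) hx hy) _ _ _ _ _ _
  · rw [ob_mul, ob_inv, ob_mul, hob]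
    abel

lemma exists_pow_lift (Φ : SmallExtension k B A) {m : ℕ} (x : A) (hx : x ^ m = 0) :
    ∃ (b : B) (τ : k), Φ.φ b = x ∧ b ^ m = τ • Φ.t := by
  obtain ⟨b, rfl⟩ := Φ.surjective x
  rw [← map_pow] at hx
  obtain ⟨τ, h⟩ := (Φ.ker_eq _).1 hx
  exact ⟨b, τ, rfl, h⟩

lemma smul_pow_eq_zero {m : ℕ} {x : A} (hx : x ^ m = 0) (c : k) : (c • x) ^ m = 0 := by
  rw [smul_pow, hx, smul_zero]

/-- A curve over `k[s]/s^m`, composed with `s ↦ c s`. -/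
def curveScale {m : ℕ} [NeZero m] (c : k) (H : HS k (Curve k m) R) : HS k (Curve k m) R :=
  curveVal (c • Curve.s k m) (smul_pow_eq_zero Curve.s_pow c) H

lemma curveVal_curveScale {m : ℕ} [NeZero m] (x : A) (hx : x ^ m = 0) (c : k)
    (H : HS k (Curve k m) R) :
    curveVal x hx (curveScale c H) = curveVal (c • x) (smul_pow_eq_zero hx c) H := by
  rw [curveVal, curveScale, baseChange_curveVal]
  exact curveVal_congr (by rw [map_smul, Curve.ev_s]) _ _ _

lemma ob_curveScale {m : ℕ} [NeZero m] (c : k) (H : HS k (Curve k m) R) :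
    ob (curveExt k m) (curveScale c H) = algebraMap k R (c ^ m) • ob (curveExt k m) H :=
  ob_curveVal (curveExt k m) (c • Curve.s k (m + 1)) (c ^ m) (smul_pow _ _ _) _ _
    (by rw [map_smul]; exact congrArg _ (Curve.ev_s _ Curve.s_pow_succ)) H

/-- Write m = p^v l with p ∤ l. The expression is the p^v-th power of 1 + c^l − (1 + c)^l, a
polynomial in c whose linear coefficient is −l ≠ 0, since l ≠ 1. It has a non-root in the infinite
field k. -/
lemma exists_pow_add_ne [Infinite k] (p : ℕ) [Fact p.Prime] [CharP k p] {m : ℕ}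
    (hm0 : m ≠ 0) (h : ∀ j, m ≠ p ^ j) : ∃ c : k, 1 + c ^ m - (1 + c) ^ m ≠ 0 := by
  by_contra! hc
  obtain ⟨v, l, hl, rfl⟩ := Nat.exists_eq_pow_mul_and_not_dvd hm0 p (Fact.out : p.Prime).ne_one
  have hl1 : l ≠ 1 := fun h1 ↦ h v (by rw [h1, mul_one])
  have hc' : ∀ c : k, 1 + c ^ l - (1 + c) ^ l = 0 := fun c ↦ by
    have := hc c
    rw [mul_comm, pow_mul, pow_mul, ← one_pow (M := k) (p ^ v), ← add_pow_char_pow,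
      ← sub_pow_char_pow, one_pow] at this
    exact eq_zero_of_pow_eq_zero this
  have h2 : (1 + Polynomial.X ^ l - (1 + Polynomial.X) ^ l : Polynomial k) = 0 :=
    Polynomial.funext fun c ↦ by simpa using hc' c
  have h3 := congrArg (fun q ↦ Polynomial.coeff q 1) h2
  simp only [Polynomial.coeff_sub, Polynomial.coeff_add, Polynomial.coeff_one,
    Polynomial.coeff_X_pow, Polynomial.coeff_one_add_X_pow, Polynomial.coeff_zero] at h3
  rw [if_neg (by norm_num), if_neg hl1.symm, Nat.choose_one_right, add_zero, zero_sub,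
    neg_eq_zero, CharP.cast_eq_zero_iff k p] at h3
  exact hl h3

/-- A curve over `k[s]/s^m` with `m` not a power of `p` is, modulo `curveImage`, a product of
curves in elements of smaller order. -/
lemma curveVal_mem_of_not_pow [IsAlgClosed k] (p : ℕ) [Fact p.Prime] [CharP k p]
    (hA : ∀ S : Subalgebra k A, curveSubgroup k S R = ⊤)
    (M : Subgroup (HS k A R)) (hM : curveImage R Φ ≤ M) {m : ℕ} [NeZero m]
    (hm : ∀ j, m ≠ p ^ j) (x : A) (hx : x ^ m = 0) (H : HS k (Curve k m) R)
    (IHx : ∀ y z : A, y = x ^ 2 * z → ∀ (m : ℕ) [NeZero m] (hy : y ^ m = 0)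
      (H : HS k (Curve k m) R), curveVal y hy H ∈ M) : curveVal x hx H ∈ M := by
  have hm0 : m ≠ 0 := NeZero.ne m
  obtain ⟨c, hc⟩ := exists_pow_add_ne (k := k) p hm0 hm
  obtain ⟨ν, hν⟩ := IsAlgClosed.exists_pow_nat_eq (1 + c ^ m - (1 + c) ^ m)⁻¹
    (Nat.pos_of_ne_zero hm0)
  -- E measures the failure of s ↦ H(s) to be additive on the multiples 1 and c of s. It is trivial
  -- modulo 𝔪² and its obstruction is a nonzero scalar times that of H. Substituting νs multiplies
  -- obstructions by ν^m, the inverse of that scalar, so E(νs) has the obstruction of H.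
  let E := curveScale 1 H * curveScale c H * (curveScale (1 + c) H)⁻¹
  have hE : HS.baseChange (modSq k _) E = 1 := by
    simp only [E, curveScale]
    rw [HS.baseChange_mul, HS.baseChange_inv, HS.baseChange_mul, baseChange_curveVal,
      baseChange_curveVal, baseChange_curveVal, mul_inv_eq_one]
    have h := map_add (modSq k _) ((1 : k) • Curve.s k m) (c • Curve.s k m)
    rw [← add_smul] at h
    rw [curveVal_congr h _ (by
      rw [← h, ← map_pow, smul_pow_eq_zero Curve.s_pow, map_zero])]
    exact (curveVal_add (fun x hx y hy ↦ mul_eq_zero_modSq (k := k) hx hy) _ _ _ _ _ _).symm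
  have hobE : ob (curveExt k m) E =
      algebraMap k R (1 + c ^ m - (1 + c) ^ m) • ob (curveExt k m) H := by
    simp only [E]
    rw [ob_mul, ob_inv, ob_mul, ob_curveScale, ob_curveScale, ob_curveScale, one_pow, map_sub,
      map_add, sub_smul, add_smul, sub_eq_add_neg]
  have hF : ob (curveExt k m) (H * (curveScale ν E)⁻¹) = 0 := by
    rw [ob_mul, ob_inv, ob_curveScale, hobE, smul_smul, ← map_mul, hν, inv_mul_cancel₀ hc, map_one,
      one_smul, add_neg_cancel]
  obtain ⟨F, hF'⟩ := exists_baseChange_eq_of_ob_eq_zero hF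
  -- This factor is unobstructed, so it extends to a curve F over k[s]/s^{m+1}. Any b over x has
  -- b^{m+1} = 0, because b^m ∈ k·t and b is in 𝔪_B, so F has a value at b.
  have h1 : curveVal x hx (H * (curveScale ν E)⁻¹) ∈ M := by
    obtain ⟨b, τ, hb, hτ⟩ := exists_pow_lift Φ x hx
    have hb' : b ^ (m + 1) = 0 := by
      have h2 : residue k B b = 0 := by
        rw [← residue_map Φ.φ, hb]; exact residue_eq_zero_of_pow hx
      rw [pow_succ', hτ, mul_smul_comm, Φ.mul_t, h2, zero_smul, smul_zero]
    have h3 : curveVal x hx (H * (curveScale ν E)⁻¹) = curveVal x (by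
        rw [pow_succ, hx, zero_mul]) F := by
      rw [← hF']
      change HS.baseChange _ (curveVal (Curve.s k m) Curve.s_pow_succ F) = _
      rw [baseChange_curveVal]
      exact curveVal_congr (Curve.ev_s _ _) _ _ _
    rw [h3]
    exact hM (curveVal_mem_curveImage b hb' _ hb F)
  -- E is defined over k + (s²), hence its value at νx over the image S of this algebra. HS^S is
  -- generated by curves, and they are evaluated at elements of S of residue zero, which are
  -- multiples of x²; there `IHx` applies.
  have h2 : curveVal x hx (curveScale ν E) ∈ M := by
    obtain ⟨E₀, hE₀⟩ := HS.exists_of_baseChange_modSq_eq_one hE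
    let f : Curve k m →ₐ[k] A := Curve.ev (ν • x) (smul_pow_eq_zero hx ν)
    let S : Subalgebra k A := (constSq k (Curve k m)).map f
    let g : constSq k (Curve k m) →ₐ[k] S :=
      (f.comp (constSq k (Curve k m)).val).codRestrict S fun a ↦ ⟨a, a.2, rfl⟩
    have hg : S.val.comp g = f.comp (constSq k (Curve k m)).val := rfl
    have h4 : curveVal x hx (curveScale ν E) = HS.baseChange S.val (HS.baseChange g E₀) := by
      rw [← HS.baseChange_comp, hg, HS.baseChange_comp, hE₀, curveVal_curveScale]
      rfl
    rw [h4]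
    have h5 : curveSubgroup k S R ≤ M.comap (HS.baseChangeHom S.val) := by
      refine (Subgroup.closure_le _).2 ?_
      rintro _ ⟨m', _, y, hy, G, rfl⟩
      change HS.baseChange S.val (curveVal y hy G) ∈ M
      rw [baseChange_curveVal]
      obtain ⟨⟨_, a, ha, rfl⟩, hya⟩ : ∃ y' : S, y' = y := ⟨y, rfl⟩
      have h6 : residue k _ a = 0 := by
        rw [← residue_map f]
        have := residue_eq_zero_of_pow (k := k) hy
        rw [← residue_map S.val, ← hya] at this
        exact this
      obtain ⟨z, rfl⟩ := Curve.exists_eq_s_sq_mul_of_mem (exists_residue_of_mem_constSq ha h6)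
      refine IHx _ (ν ^ 2 • f z) ?_ m' _ G
      rw [← hya]
      change f _ = _
      rw [map_mul, map_pow, Curve.ev_s, smul_pow, mul_smul_comm, smul_mul_assoc]
    refine h5 ?_
    rw [hA S]
    trivial
  have h3 : curveVal x hx H = curveVal x hx (H * (curveScale ν E)⁻¹) *
      curveVal x hx (curveScale ν E) := by
    rw [← curveVal_mul, inv_mul_cancel_right]
  rw [h3]
  exact mul_mem h1 h2

/-- A curve over `k[s]/s^q` with `q` a power of `p` is, modulo `curveImage`, a curve in a fixed
element. -/
lemma curveVal_mem_of_pow [IsAlgClosed k] (p : ℕ) [Fact p.Prime] [CharP k p]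
    (IH : ∀ S : Subalgebra k B, S ≠ ⊤ → curveSubgroup k S R = ⊤)
    (j₀ : ℕ) (b₀ : B) (hb₀ : b₀ ^ p ^ j₀ = Φ.t) (hmax : ∀ (j : ℕ) (b : B), b ^ p ^ j = Φ.t → j ≤ j₀)
    (M : Subgroup (HS k A R)) (hM : curveImage R Φ ≤ M)
    (hM' : ∀ (h : Φ.φ b₀ ^ p ^ j₀ = 0) (H : HS k (Curve k (p ^ j₀)) R), curveVal _ h H ∈ M)
    (j : ℕ) (x : A) (hx : x ^ p ^ j = 0) (H : HS k (Curve k (p ^ j)) R) :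
    curveVal x hx H ∈ M := by
  have hB : CharP B p := charP_of_injective_algebraMap (algebraMap k B).injective p
  obtain ⟨b, τ, rfl, hτ⟩ := exists_pow_lift Φ x hx
  by_cases h0 : τ = 0
  · rw [h0, zero_smul] at hτ
    exact hM (curveVal_mem_curveImage b hτ _ rfl H)
  obtain ⟨σ, hσ⟩ := IsAlgClosed.exists_pow_nat_eq τ
    (pow_pos (Fact.out : p.Prime).pos j)
  have hσ0 : σ ≠ 0 := by
    rintro rfl
    rw [zero_pow (pow_ne_zero _ (Fact.out : p.Prime).ne_zero)] at hσ
    exact h0 hσ.symm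
  -- For τ ≠ 0 the element σ⁻¹b is a p^j-th root of t, so j is bounded by the maximal exponent.
  have hj : j ≤ j₀ := hmax j (σ⁻¹ • b) (by
    rw [smul_pow, hτ, inv_pow, hσ, smul_smul, inv_mul_cancel₀ h0, one_smul])
  have e : (b₀ ^ p ^ (j₀ - j)) ^ p ^ j = Φ.t := by
    rw [← pow_mul, ← pow_add, Nat.sub_add_cancel hj, hb₀]
  have hφ0 : Φ.φ b₀ ^ p ^ j₀ = 0 := by rw [← map_pow, hb₀, Φ.φ_t]
  -- Both b and σy have p^j-th power τt. By additivity of Frobenius their difference has p^j-th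
  -- power zero, so the curve has a value there over B; the value at σy is a curve in b₀.
  let y := b₀ ^ p ^ (j₀ - j)
  have hz : (b - σ • y) ^ p ^ j = 0 := by
    rw [sub_pow_char_pow, hτ, smul_pow, e, hσ, sub_self]
  have hz' : Φ.φ (b - σ • y) ^ p ^ j = 0 := by rw [← map_pow, hz, map_zero]
  have hy' : Φ.φ (σ • y) ^ p ^ j = 0 := by
    rw [← map_pow, smul_pow, e, hσ, map_smul, Φ.φ_t, smul_zero]
  have hsum : Φ.φ (b - σ • y) + Φ.φ (σ • y) = Φ.φ b := by rw [← map_add, sub_add_cancel]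
  have hyM : curveVal _ hy' H ∈ M := by
    have h1 : (σ • Curve.s k (p ^ j₀) ^ p ^ (j₀ - j)) ^ p ^ j = 0 := by
      rw [smul_pow, ← pow_mul, ← pow_add, Nat.sub_add_cancel hj, Curve.s_pow, smul_zero]
    have h2 := hM' hφ0 (curveVal _ h1 H)
    rw [curveVal, baseChange_curveVal] at h2
    rw [curveVal_congr _ hy' _ H]
    · exact h2
    · rw [map_smul (Curve.ev _ hφ0), map_pow (Curve.ev _ hφ0), Curve.ev_s, map_smul Φ.φ, map_pow]
  have hzM : curveVal _ hz' H ∈ M := hM (curveVal_mem_curveImage _ hz _ rfl H)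
  -- With ω the obstruction of H itself, the obstructions at b, b − σy and σy are τω, 0 and τω, so
  -- they add up.
  have h3 := hM (curveVal_add_mem (Φ := Φ) IH _ _ hz' hy' (by rw [hsum]; exact hx) H (by
    rw [ob_curveVal Φ b τ hτ _ _ hsum.symm, ob_curveVal Φ _ 0 (by rw [hz, zero_smul]) _ _ rfl,
      ob_curveVal Φ (σ • y) τ (by rw [smul_pow, e, hσ]) _ _ rfl, map_zero, zero_smul, zero_add]))
  have h4 := mul_mem h3 (mul_mem hzM hyM)
  rw [inv_mul_cancel_right] at h4
  rwa [curveVal_congr hsum] at h4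

/-- Any nonzero t in the last nonzero power of 𝔪_B is annihilated by 𝔪_B; the quotient by it is the
required extension. -/
lemma exists_smallExtension (h : IsLocalRing.maximalIdeal B ≠ ⊥) :
    ∃ (A : Type u) (_ : CommRing A) (_ : Algebra k A) (_ : ArtinLocal k A),
      Nonempty (SmallExtension k B A) := by
  classical
  have hex := ArtinLocal.isNilpotent_maximalIdeal (k := k) (A := B)
  let n := Nat.find hex
  have hn : IsLocalRing.maximalIdeal B ^ n = 0 := Nat.find_spec hex
  have hn0 : n ≠ 0 := fun h0 ↦ by
    rw [h0, pow_zero, Ideal.one_eq_top, Ideal.zero_eq_bot] at hn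
    exact top_ne_bot hn
  have hn1 : n ≠ 1 := fun h1 ↦ by
    rw [h1, pow_one] at hn
    exact h hn
  have hlt : IsLocalRing.maximalIdeal B ^ (n - 1) ≠ 0 := Nat.find_min hex (by omega)
  obtain ⟨t, ht, ht0⟩ := Submodule.exists_mem_ne_zero_of_ne_bot hlt
  have htm : t ∈ IsLocalRing.maximalIdeal B := Ideal.pow_le_self (by omega) ht
  have hmul : ∀ b ∈ IsLocalRing.maximalIdeal B, b * t = 0 := fun b hb ↦ by
    have := Ideal.mul_mem_mul hb ht
    rw [← pow_succ', Nat.sub_add_cancel (by omega), hn] at this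
    exact this
  have hI : Ideal.span {t} ≠ ⊤ := fun h1 ↦ by
    have h2 : Ideal.span {t} ≤ IsLocalRing.maximalIdeal B := by
      rw [Ideal.span_le]; simpa using htm
    rw [h1, top_le_iff] at h2
    exact Ideal.IsPrime.ne_top' h2
  have := artinLocal_quotient (k := k) _ hI
  refine ⟨B ⧸ Ideal.span {t}, inferInstance, inferInstance, this, ⟨
    { φ := Ideal.Quotient.mkₐ k _
      surjective := Ideal.Quotient.mk_surjective
      t := t
      t_ne_zero := ht0
      ker_eq := fun b ↦ ?_
      maximalIdeal_mul := hmul }⟩⟩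
  change Ideal.Quotient.mk _ b = 0 ↔ _
  rw [Ideal.Quotient.eq_zero_iff_mem, Ideal.mem_span_singleton']
  constructor
  · rintro ⟨a, rfl⟩
    refine ⟨residue k B a, ?_⟩
    have h1 := hmul (a - algebraMap k B (residue k B a)) ((residue_eq_zero_iff (k := k) _).1 (by simp))
    rw [sub_mul, sub_eq_zero] at h1
    rw [h1, Algebra.smul_def]
  · rintro ⟨c, rfl⟩
    exact ⟨algebraMap k B c, (Algebra.smul_def _ _).symm⟩

/-- Over an algebraically closed field of characteristic `p`, the group `HS^B(R)` is generated by
the values of the curves `H ∈ HS^{k[s]/s^m}(R)` at the `x ∈ B` with `x^m = 0`. -/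
theorem curveSubgroup_eq_top [IsAlgClosed k] (p : ℕ) [Fact p.Prime] [CharP k p] :
    curveSubgroup k B R = ⊤ := by
  obtain ⟨n, hn⟩ : ∃ n, Module.finrank k B < n := ⟨_, Nat.lt_succ_self _⟩
  induction n generalizing B with
  | zero => omega
  | succ n ih =>
    by_cases hB : IsLocalRing.maximalIdeal B = ⊥
    · rw [eq_top_iff]
      intro D _
      rw [HS.eq_one_of_maximalIdeal_eq_bot hB D]
      exact one_mem _
    obtain ⟨A, _, _, _, ⟨Φ⟩⟩ := exists_smallExtension (k := k) hB
    have hAB := Φ.finrank_lt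
    have IHB : ∀ S : Subalgebra k B, S ≠ ⊤ → curveSubgroup k S R = ⊤ := fun S hS ↦
      ih ((finrank_subalgebra_lt hS).trans_le (by omega))
    have IHA : ∀ S : Subalgebra k A, curveSubgroup k S R = ⊤ := fun S ↦
      ih ((finrank_subalgebra_le S).trans_lt (by omega))
    have hA : curveSubgroup k A R = ⊤ := ih (by omega)
    -- b₀ is a p-power root of t of the highest possible order. Such roots lie in 𝔪_B, so t ≠ 0
    -- bounds p^j by the nilpotency exponent of 𝔪_B; the trivial root t itself handles j = 0.
    obtain ⟨j₀, b₀, hb₀, hmax⟩ : ∃ (j₀ : ℕ) (b₀ : B), b₀ ^ p ^ j₀ = Φ.t ∧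
        ∀ (j : ℕ) (b : B), b ^ p ^ j = Φ.t → j ≤ j₀ := by
      classical
      obtain ⟨L, hL⟩ := ArtinLocal.isNilpotent_maximalIdeal (k := k) (A := B)
      have hbd : ∀ j, (∃ b : B, b ^ p ^ j = Φ.t) → j ≤ L := by
        rintro j ⟨b, hb⟩
        by_contra! hj
        have h1 : b ∈ IsLocalRing.maximalIdeal B :=
          (IsLocalRing.maximalIdeal.isMaximal B).isPrime.mem_of_pow_mem _ (hb ▸ Φ.t_mem)
        have h2 : b ^ L = 0 := by
          have := Ideal.pow_mem_pow h1 L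
          rw [hL] at this
          exact this
        have h3 : L ≤ p ^ j := hj.le.trans (Nat.lt_pow_self (Fact.out : p.Prime).one_lt).le
        apply Φ.t_ne_zero
        rw [← hb, ← Nat.sub_add_cancel h3, pow_add, h2, mul_zero]
      have hP0 : ∃ b : B, b ^ p ^ 0 = Φ.t := ⟨Φ.t, by simp⟩
      obtain ⟨b₀, hb₀⟩ := Nat.findGreatest_spec (P := fun j ↦ ∃ b : B, b ^ p ^ j = Φ.t)
        (Nat.zero_le L) hP0
      exact ⟨_, b₀, hb₀, fun j b hb ↦ Nat.le_findGreatest (hbd j ⟨b, hb⟩) ⟨b, hb⟩⟩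
    have hφ0 : Φ.φ b₀ ^ p ^ j₀ = 0 := by rw [← map_pow, hb₀, Φ.φ_t]
    let M : Subgroup (HS k A R) := curveImage R Φ ⊔
      (HS.baseChangeHom (R := R) (Curve.ev (k := k) (Φ.φ b₀) hφ0)).range
    have hM : curveImage R Φ ≤ M := le_sup_left
    have hM' : ∀ (h : Φ.φ b₀ ^ p ^ j₀ = 0) (H : HS k (Curve k (p ^ j₀)) R),
        curveVal _ h H ∈ M := fun h H ↦ (le_sup_right : _ ≤ M) ⟨H, rfl⟩
    -- Induction on a nilpotency exponent of x: a multiple of x² has exponent (n + 1)/2, which is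
    -- smaller than n once n ≥ 2.
    have key : ∀ (n : ℕ) (x : A), x ^ n = 0 → ∀ (m : ℕ) [NeZero m] (hx : x ^ m = 0)
        (H : HS k (Curve k m) R), curveVal x hx H ∈ M := by
      intro n
      induction n using Nat.strong_induction_on with
      | _ n IHn =>
        intro x hxn m _ hx H
        by_cases hm : ∃ j, m = p ^ j
        · obtain ⟨j, rfl⟩ := hm
          exact curveVal_mem_of_pow p IHB j₀ b₀ hb₀ hmax M hM hM' j x hx H
        · push Not at hm
          by_cases hn1 : n ≤ 1
          · have hx0 : x = 0 := by
              rcases Nat.le_one_iff_eq_zero_or_eq_one.1 hn1 with rfl | rfl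
              · rw [pow_zero] at hxn; exact absurd hxn one_ne_zero
              · rwa [pow_one] at hxn
            exact hM (curveVal_mem_curveImage 0 (zero_pow (NeZero.ne m)) _
              (by rw [map_zero, hx0]) H)
          · refine curveVal_mem_of_not_pow p IHA M hM hm x hx H ?_
            rintro y z rfl m' _ hy G
            refine IHn ((n + 1) / 2) (by omega) _ ?_ m' hy G
            have h1 : n ≤ 2 * ((n + 1) / 2) := by omega
            rw [mul_pow, ← pow_mul, ← Nat.sub_add_cancel h1, pow_add, hxn, mul_zero, zero_mul]
    have hMtop : M = ⊤ := by
      rw [eq_top_iff, ← hA, curveSubgroup, Subgroup.closure_le]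
      rintro _ ⟨m, _, x, hx, H, rfl⟩
      exact key m x hx m hx H
    rw [eq_top_iff]
    intro D _
    -- Normality makes every element of M a product N · H(φ(b₀)) with N the image of a product of
    -- curve values over B. After dividing by it, D reduces to a value at φ(b₀).
    have hN := curveImage_normal (Φ := Φ) (R := R) IHB
    have hD : HS.baseChange Φ.φ D ∈ M := hMtop ▸ Subgroup.mem_top _
    rw [← SetLike.mem_coe, Subgroup.normal_mul] at hD
    obtain ⟨_, ⟨N, hN, rfl⟩, _, ⟨H, rfl⟩, hNH⟩ := hD
    have hG : HS.baseChange Φ.φ (N⁻¹ * D) = HS.baseChange (Curve.ev (Φ.φ b₀) hφ0) H := by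
      rw [HS.baseChange_mul, HS.baseChange_inv, inv_mul_eq_iff_eq_mul]
      exact hNH.symm
    have hb1 : b₀ ^ (p ^ j₀ + 1) = 0 := by
      rw [pow_succ', hb₀, Φ.mul_t, ← residue_map Φ.φ, residue_eq_zero_of_pow hφ0, zero_smul]
    -- The map s ↦ b₀ embeds k[s]/s^{p^{j₀}+1} in B and sends s^{p^{j₀}} to t, so its image contains
    -- the kernel of φ. Left exactness then shows that N⁻¹D, and not just its reduction, is the
    -- value of a curve at b₀.
    obtain ⟨G, hG'⟩ : ∃ G, HS.baseChange (Curve.ev (k := k) b₀ hb1) G = N⁻¹ * D := by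
      refine HS.exists_baseChange_eq_of_quotient _
        (Curve.ev_injective b₀ hb1 (by rw [hb₀]; exact Φ.t_ne_zero)) Φ.φ Φ.surjective ?_ _ ?_
      · intro a ha
        obtain ⟨c, rfl⟩ := (Φ.ker_eq a).1 ha
        exact ⟨c • Curve.s k _ ^ p ^ j₀, by rw [map_smul, map_pow, Curve.ev_s, hb₀]⟩
      · intro r
        have hsurj : Function.Surjective
            (Algebra.TensorProduct.map (curveExt k (p ^ j₀)).φ (AlgHom.id k R)) :=
          TensorProduct.map_surjective (g' := LinearMap.id) (curveExt k (p ^ j₀)).surjective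
            Function.surjective_id
        obtain ⟨w, hw⟩ := hsurj (H.1 (1 ⊗ₜ r))
        refine ⟨w, ?_⟩
        rw [← HS.baseChange_one_tmul, hG, HS.baseChange_one_tmul, map_map_tmul, ← hw]
        change Algebra.TensorProduct.map _ (AlgHom.id k R)
          (Algebra.TensorProduct.map (curveExt k (p ^ j₀)).φ (AlgHom.id k R) w) = _
        rw [map_map_tmul]
        congr 2
        exact Curve.algHom_ext (by
          rw [AlgHom.comp_apply, AlgHom.comp_apply, Curve.ev_s]
          exact (congrArg _ (Curve.ev_s _ Curve.s_pow_succ)).trans (Curve.ev_s _ _))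
    have h1 : D = N * (N⁻¹ * D) := by rw [mul_inv_cancel_left]
    rw [h1, ← hG']
    exact mul_mem hN (curveVal_mem _ _ _)

end Generation

/-! ### Denominators under tensor products and polynomial extensions. -/

section Away

variable {k : Type*} [Field k] {P P' : Type*} [CommRing P] [Algebra k P] [CommRing P']
  [Algebra k P'] (A : Type*) [CommRing A] [Algebra k A]

/-- Up to powers of `f`, every element of `P'` comes from `P`, and elements of the kernel of
`P → P'` vanish. -/
structure IsAwayHom (τ : P →ₐ[k] P') (f : P) : Prop where
  exists_eq : ∀ y, ∃ e x, τ x = τ f ^ e * y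
  exists_pow_mul : ∀ x, τ x = 0 → ∃ e, f ^ e * x = 0

variable {A} {τ : P →ₐ[k] P'} {f : P}

lemma IsAwayHom.of_isLocalization [Algebra P P'] (h : ∀ x, algebraMap P P' x = τ x)
    [IsLocalization.Away f P'] : IsAwayHom τ f where
  exists_eq y := by
    obtain ⟨e, x, hx⟩ := IsLocalization.Away.surj f y
    exact ⟨e, x, by rw [← h, ← h, ← hx, mul_comm]⟩
  exists_pow_mul x hx := by
    rw [← h] at hx
    obtain ⟨⟨_, e, rfl⟩, he⟩ := (IsLocalization.map_eq_zero_iff (.powers f) P' x).1 hx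
    exact ⟨e, he⟩

lemma IsAwayHom.tensor (h : IsAwayHom τ f) :
    IsAwayHom (Algebra.TensorProduct.map (AlgHom.id k A) τ) (1 ⊗ₜ f) where
  exists_eq y := by
    induction y with
    | zero => exact ⟨0, 0, by simp⟩
    | tmul a p =>
      obtain ⟨e, x, hx⟩ := h.exists_eq p
      exact ⟨e, a ⊗ₜ x, by simp [hx]⟩
    | add y z hy hz =>
      obtain ⟨e, x, hx⟩ := hy
      obtain ⟨e', x', hx'⟩ := hz
      refine ⟨e + e', (1 ⊗ₜ f) ^ e' * x + (1 ⊗ₜ f) ^ e * x', ?_⟩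
      rw [map_add, map_mul, map_mul, hx, hx', map_pow, map_pow]
      ring
  exists_pow_mul z hz := by
    classical
    -- In coordinates with respect to a k-basis of A only finitely many components are nonzero, so
    -- one exponent serves them all.
    let b := Module.Basis.ofVectorSpace k A
    let E := TensorProduct.equivFinsuppOfBasisLeft (N := P) b
    let E' := TensorProduct.equivFinsuppOfBasisLeft (N := P') b
    have hE : ∀ z : A ⊗[k] P, ∀ i,
        E' (Algebra.TensorProduct.map (AlgHom.id k A) τ z) i = τ (E z i) := by
      intro z i
      induction z with
      | zero => simp
      | tmul a p => simp [E, E', TensorProduct.equivFinsuppOfBasisLeft_apply_tmul_apply]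
      | add x y hx hy => simp only [map_add, Finsupp.add_apply, hx, hy]
    have hm : ∀ (c : P) (z : A ⊗[k] P), ∀ i, E ((1 ⊗ₜ c) * z) i = c * E z i := by
      intro c z i
      induction z with
      | zero => simp
      | tmul a p => simp [E, TensorProduct.equivFinsuppOfBasisLeft_apply_tmul_apply]
      | add x y hx hy => simp only [mul_add, map_add, Finsupp.add_apply, hx, hy]
    have h1 : ∀ i, ∃ e, f ^ e * E z i = 0 := fun i ↦
      h.exists_pow_mul _ (by rw [← hE, hz, map_zero, Finsupp.zero_apply])
    choose e he using h1
    refine ⟨(E z).support.sup e, E.injective (Finsupp.ext fun i ↦ ?_)⟩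
    rw [Algebra.TensorProduct.tmul_pow, one_pow, hm, map_zero, Finsupp.zero_apply]
    by_cases hi : i ∈ (E z).support
    · obtain ⟨d, hd⟩ := Nat.exists_eq_add_of_le (Finset.le_sup (f := e) hi)
      rw [hd, pow_add, mul_right_comm, he, zero_mul]
    · rw [Finsupp.notMem_support_iff.1 hi, mul_zero]

lemma IsAwayHom.polynomial (h : IsAwayHom τ f) :
    IsAwayHom (Polynomial.mapAlgHom τ) (Polynomial.C f) where
  exists_eq y := by
    induction y using Polynomial.induction_on' with
    | add y z hy hz =>
      obtain ⟨e, x, hx⟩ := hy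
      obtain ⟨e', x', hx'⟩ := hz
      refine ⟨e + e', (Polynomial.C f) ^ e' * x + (Polynomial.C f) ^ e * x', ?_⟩
      rw [map_add, map_mul, map_mul, hx, hx', map_pow, map_pow]
      ring
    | monomial n p =>
      obtain ⟨e, x, hx⟩ := h.exists_eq p
      refine ⟨e, Polynomial.monomial n x, ?_⟩
      simp only [Polynomial.coe_mapAlgHom, Polynomial.map_monomial, Polynomial.map_C,
        AlgHom.coe_toRingHom, hx]
      rw [← Polynomial.C_pow, Polynomial.C_mul_monomial]
  exists_pow_mul z hz := by
    classical
    have h1 : ∀ i, ∃ e, f ^ e * z.coeff i = 0 := fun i ↦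
      h.exists_pow_mul _ (by
        have := congrArg (fun q ↦ Polynomial.coeff q i) hz
        simpa using this)
    choose e he using h1
    refine ⟨z.support.sup e, Polynomial.ext fun i ↦ ?_⟩
    rw [← map_pow, Polynomial.coeff_C_mul, Polynomial.coeff_zero]
    by_cases hi : i ∈ z.support
    · obtain ⟨d, hd⟩ := Nat.exists_eq_add_of_le (Finset.le_sup (f := e) hi)
      rw [hd, pow_add, mul_right_comm, he, zero_mul]
    · rw [Polynomial.notMem_support_iff.1 hi, mul_zero]

end Away

/-! ### Evaluation and rescaling of the variable in A ⊗ R[X]. -/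

section PolynomialTensor

open Polynomial

variable (k : Type*) [Field k] {R S : Type*} [CommRing R] [Algebra k R] [CommRing S]
  [Algebra k S] (A : Type*) [CommRing A] [Algebra k A]

/-- Evaluation `R[X] → R` at `c`, as a morphism of `k`-algebras. -/
def evAt (c : R) : R[X] →ₐ[k] R := (aeval (R := R) c).restrictScalars k

/-- The morphism `R[X] → R[X]`, `X ↦ c X`. -/
def scaleX (c : R) : R[X] →ₐ[k] R[X] := (aeval (R := R) (C c * X)).restrictScalars k

variable {k}

@[simp] lemma evAt_C (c r : R) : evAt k c (C r) = r := aeval_C _ _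
@[simp] lemma evAt_X (c : R) : evAt k c X = c := aeval_X _
@[simp] lemma scaleX_C (c r : R) : scaleX k c (C r) = C r := aeval_C _ _
@[simp] lemma scaleX_X (c : R) : scaleX k c X = C c * X := aeval_X _

/-- The morphism `R[X] → S` that extends `f` and maps `X` to `x`. -/
def polyLift (f : R →ₐ[k] S) (x : S) : R[X] →ₐ[k] S :=
  { eval₂RingHom (f : R →+* S) x with
    commutes' := fun c ↦ by
      change eval₂ (f : R →+* S) x (algebraMap k R[X] c) = _
      rw [IsScalarTower.algebraMap_apply k R R[X], algebraMap_eq, eval₂_C]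
      exact f.commutes c }

@[simp] lemma polyLift_C (f : R →ₐ[k] S) (x : S) (r : R) : polyLift f x (C r) = f r :=
  eval₂_C _ _

@[simp] lemma polyLift_X (f : R →ₐ[k] S) (x : S) : polyLift f x X = x := eval₂_X _ _

lemma polynomial_algHom_ext {f g : R[X] →ₐ[k] S} (h : ∀ r, f (C r) = g (C r)) (hX : f X = g X) :
    f = g :=
  AlgHom.ext fun p ↦ by
    induction p using Polynomial.induction_on' with
    | add p q hp hq => rw [map_add, map_add, hp, hq]
    | monomial n r =>
      rw [← C_mul_X_pow_eq_monomial, map_mul, map_mul, map_pow, map_pow, h, hX]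

variable (k) in
/-- The inclusion `R → R[X]`. -/
def polyC : R →ₐ[k] R[X] := (Polynomial.CAlgHom : R →ₐ[R] R[X]).restrictScalars k

@[simp] lemma polyC_apply (r : R) : polyC k r = C r := rfl

lemma exists_X_mul (z : A ⊗[k] R[X])
    (hz : Algebra.TensorProduct.map (AlgHom.id k A) (evAt k (0 : R)) z = 0) :
    ∃ v, z = (1 ⊗ₜ X) * v := by
  have key : ∀ z : A ⊗[k] R[X], ∃ v, z = Algebra.TensorProduct.map (AlgHom.id k A) (polyC k)
      (Algebra.TensorProduct.map (AlgHom.id k A) (evAt k (0 : R)) z) + (1 ⊗ₜ X) * v := by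
    intro z
    induction z with
    | zero => exact ⟨0, by simp⟩
    | tmul a p =>
      refine ⟨a ⊗ₜ p.divX, ?_⟩
      have : evAt k (0 : R) p = p.coeff 0 := (coeff_zero_eq_aeval_zero p).symm
      rw [Algebra.TensorProduct.map_tmul, Algebra.TensorProduct.map_tmul, this,
        Algebra.TensorProduct.tmul_mul_tmul, one_mul, AlgHom.id_apply, AlgHom.id_apply,
        ← tmul_add, polyC_apply, add_comm, X_mul_divX_add]
    | add x y hx hy =>
      obtain ⟨v, hv⟩ := hx
      obtain ⟨w, hw⟩ := hy
      refine ⟨v + w, ?_⟩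
      rw [map_add, map_add, mul_add, add_add_add_comm, ← hv, ← hw]
  obtain ⟨v, hv⟩ := key z
  rw [hz, map_zero, zero_add] at hv
  exact ⟨v, hv⟩

lemma X_mul_injective {z : A ⊗[k] R[X]} (hz : (1 ⊗ₜ X) * z = 0) : z = 0 := by
  have h : Function.Injective (LinearMap.mulLeft k (X : R[X])) := fun p q h ↦
    (isRegular_X (R := R)).left h
  have h2 := Module.Flat.lTensor_preserves_injective_linearMap (M := A) _ h
  have h3 : ∀ z : A ⊗[k] R[X], (LinearMap.mulLeft k (X : R[X])).lTensor A z = (1 ⊗ₜ X) * z := by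
    intro z
    induction z with
    | zero => simp
    | tmul a p => simp
    | add x y hx hy => rw [map_add, hx, hy, mul_add]
  exact h2 (by rw [h3, hz, map_zero])

end PolynomialTensor

/-! ### Homotopies from the identity to an element of HS. -/

section Homotopy

open Polynomial

variable {k : Type u} [Field k] {A : Type u} [CommRing A] [Algebra k A] [ArtinLocal k A]
  {R S : Type*} [CommRing R] [Algebra k R] [CommRing S] [Algebra k S]

/-- `H ∈ HS^A(S[X])` is a homotopy from the identity to `D ∈ HS^A(S)`. -/
structure IsHomotopy (H : HS k A S[X]) (D : HS k A S) : Prop where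
  apply_X : H.1 (1 ⊗ₜ X) = 1 ⊗ₜ X
  zero : HS.Compat (AlgHom.id k A) (evAt k 0) H 1
  one : HS.Compat (AlgHom.id k A) (evAt k 1) H D

lemma HS.inv_apply_eq {D : HS k A S} {x : A ⊗[k] S} (h : D.1 x = x) : (D⁻¹).1 x = x :=
  D.1.symm_apply_eq.2 h.symm

lemma IsHomotopy.refl : IsHomotopy (1 : HS k A S[X]) 1 := ⟨rfl, .one, .one⟩

lemma IsHomotopy.mul {H H' : HS k A S[X]} {D D' : HS k A S} (h : IsHomotopy H D)
    (h' : IsHomotopy H' D') : IsHomotopy (H * H') (D * D') where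
  apply_X := (congrArg H.1 h'.apply_X).trans h.apply_X
  zero := mul_one (1 : HS k A S) ▸ h.zero.mul h'.zero
  one := h.one.mul h'.one

lemma IsHomotopy.inv {H : HS k A S[X]} {D : HS k A S} (h : IsHomotopy H D) :
    IsHomotopy H⁻¹ D⁻¹ where
  apply_X := HS.inv_apply_eq h.apply_X
  zero := inv_one (G := HS k A S) ▸ h.zero.inv
  one := h.one.inv

lemma red_polyLift (f : S →ₐ[k] A ⊗[k] S[X]) (hf : ∀ s, red k A S[X] (f s) = C s) (q : S[X]) :
    red k A S[X] (polyLift f (1 ⊗ₜ X) q) = q := by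
  have : (red k A S[X]).comp (polyLift f (1 ⊗ₜ X)) = AlgHom.id k S[X] :=
    polynomial_algHom_ext (fun r ↦ by simp [hf]) (by simp)
  exact DFunLike.congr_fun this q

/-- The element of `HS^A(S[X])` that fixes `X` and is given on `S` by `f`. -/
def HS.ofPolynomial (f : S →ₐ[k] A ⊗[k] S[X]) (hf : ∀ s, red k A S[X] (f s) = C s) :
    HS k A S[X] :=
  HS.ofAlgHom (polyLift f (1 ⊗ₜ X)) (red_polyLift f hf)

lemma HS.ofPolynomial_C (f : S →ₐ[k] A ⊗[k] S[X]) (hf) (s : S) :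
    (HS.ofPolynomial f hf).1 (1 ⊗ₜ C s) = f s := by
  rw [HS.ofPolynomial, HS.ofAlgHom_tmul, one_smul, polyLift_C]

lemma HS.ofPolynomial_X (f : S →ₐ[k] A ⊗[k] S[X]) (hf) :
    (HS.ofPolynomial f hf).1 (1 ⊗ₜ X) = 1 ⊗ₜ X := by
  rw [HS.ofPolynomial, HS.ofAlgHom_tmul, one_smul, polyLift_X]

lemma HS.compat_of_polynomial {σ : S[X] →ₐ[k] R} {H : HS k A S[X]} {D : HS k A R}
    (h : ∀ s, Algebra.TensorProduct.map (AlgHom.id k A) σ (H.1 (1 ⊗ₜ C s)) = D.1 (1 ⊗ₜ σ (C s)))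
    (hX : Algebra.TensorProduct.map (AlgHom.id k A) σ (H.1 (1 ⊗ₜ X)) = D.1 (1 ⊗ₜ σ X)) :
    HS.Compat (AlgHom.id k A) σ H D := by
  have : (Algebra.TensorProduct.map (AlgHom.id k A) σ).comp (HS.toAlgHom H) =
      (HS.toAlgHom D).comp σ := polynomial_algHom_ext h hX
  exact .of_one_tmul fun r ↦ DFunLike.congr_fun this r

/-- Evaluate the curve at x ⊗ X instead of x, which is allowed because (x ⊗ X)^m = 0. Setting X = 0
gives the identity and X = 1 gives the value at x. -/
lemma exists_isHomotopy_curveVal {m : ℕ} [NeZero m] (x : A) (hx : x ^ m = 0)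
    (H : HS k (Curve k m) S) : ∃ H', IsHomotopy H' (curveVal x hx H) := by
  have hxX : (x ⊗ₜ[k] (X : S[X])) ^ m = 0 := by
    rw [Algebra.TensorProduct.tmul_pow, hx, zero_tmul]
  let g : Curve k m ⊗[k] S →ₐ[k] A ⊗[k] S[X] :=
    Algebra.TensorProduct.lift (Curve.ev _ hxX)
      (Algebra.TensorProduct.includeRight.comp (polyC k)) fun _ _ ↦ Commute.all _ _
  have hg : ∀ c r, g (c ⊗ₜ r) = Curve.ev _ hxX c * (1 ⊗ₜ C r) := fun c r ↦ by simp [g]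
  have hred : ∀ y, red k A S[X] (g y) = C (red k (Curve k m) S y) := by
    have h0 : (red k A S[X]).comp (Curve.ev _ hxX) =
        (Algebra.ofId k S[X]).comp (residue k (Curve k m)) := Curve.algHom_ext (by
      rw [AlgHom.comp_apply, Curve.ev_s, red_tmul, residue_eq_zero_of_pow hx,
        AlgHom.comp_apply, residue_eq_zero_of_pow Curve.s_pow, map_zero, zero_smul])
    intro y
    induction y with
    | zero => simp
    | tmul c r =>
      have := DFunLike.congr_fun h0 c
      rw [AlgHom.comp_apply] at this
      rw [hg, map_mul, this, red_tmul, red_tmul, map_one, one_smul, AlgHom.comp_apply,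
        Algebra.ofId_apply, ← Algebra.smul_def, Polynomial.smul_C]
    | add y z hy hz => rw [map_add, map_add, hy, hz, map_add, map_add]
  -- The evaluations X = 0 and X = 1 are handled together: c and c' are the same scalar viewed in S
  -- and in A.
  have hev : ∀ (c : S) (c' : A) (h1 : (x * c') ^ m = 0)
      (hc : 1 ⊗ₜ[k] c = c' ⊗ₜ[k] (1 : S)) y,
      Algebra.TensorProduct.map (AlgHom.id k A) (evAt k c) (g y) =
      Algebra.TensorProduct.map (Curve.ev (x * c') h1) (AlgHom.id k S) y := by
    intro c c' h1 hc y
    have h0 : (Algebra.TensorProduct.map (AlgHom.id k A) (evAt k c)).comp (Curve.ev _ hxX) =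
        Algebra.TensorProduct.includeLeft.comp (Curve.ev (x * c') h1) := Curve.algHom_ext (by
      rw [AlgHom.comp_apply, Curve.ev_s, AlgHom.comp_apply, Curve.ev_s]
      simp only [Algebra.TensorProduct.map_tmul, AlgHom.id_apply, evAt_X,
        Algebra.TensorProduct.includeLeft_apply]
      rw [← mul_one x, ← one_mul c, ← Algebra.TensorProduct.tmul_mul_tmul, hc,
        Algebra.TensorProduct.tmul_mul_tmul]
      simp)
    induction y with
    | zero => simp
    | tmul d r =>
      have := DFunLike.congr_fun h0 d
      rw [AlgHom.comp_apply] at this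
      rw [hg, map_mul, this]
      simp
    | add y z hy hz => rw [map_add, map_add, hy, hz, map_add]
  refine ⟨HS.ofPolynomial (g.comp (HS.toAlgHom H)) fun s ↦ ?_, HS.ofPolynomial_X _ _,
    HS.compat_of_polynomial (fun s ↦ ?_) ?_, HS.compat_of_polynomial (fun s ↦ ?_) ?_⟩
  · rw [AlgHom.comp_apply, hred, HS.red_toAlgHom]
  · rw [HS.ofPolynomial_C, AlgHom.comp_apply, hev 0 0 (by simp [NeZero.ne m]) (by simp),
      HS.toAlgHom_apply, evAt_C]
    have h2 : Curve.ev (k := k) (x * 0) (by simp [NeZero.ne m]) =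
        (Algebra.ofId k A).comp (residue k (Curve k m)) := Curve.algHom_ext (by
      rw [Curve.ev_s, AlgHom.comp_apply, residue_eq_zero_of_pow Curve.s_pow, map_zero, mul_zero])
    have h3 : ∀ y : Curve k m ⊗[k] S, Algebra.TensorProduct.map
        ((Algebra.ofId k A).comp (residue k (Curve k m))) (AlgHom.id k S) y =
        1 ⊗ₜ red k (Curve k m) S y := by
      intro y
      induction y with
      | zero => simp
      | tmul a r => 
        rw [red_tmul, Algebra.TensorProduct.map_tmul, AlgHom.comp_apply, Algebra.ofId_apply,
          Algebra.algebraMap_eq_smul_one, smul_tmul]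
        rfl
      | add y z hy hz => rw [map_add, map_add, hy, hz, tmul_add]
    rw [h2, h3, H.2, red_tmul, map_one, one_smul]
    rfl
  · rw [HS.ofPolynomial_X]
    simp
  · rw [HS.ofPolynomial_C, AlgHom.comp_apply, hev 1 1 (by simpa using hx) rfl,
      HS.toAlgHom_apply, evAt_C, curveVal, HS.baseChange_one_tmul]
    simp
  · rw [HS.ofPolynomial_X, Algebra.TensorProduct.map_tmul, evAt_X,
      ← Algebra.TensorProduct.one_def, map_one, map_one]
    rfl

/-- Homotopies can be multiplied and inverted, so it is enough to have them on the generators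
provided by `curveSubgroup_eq_top`. -/
theorem exists_isHomotopy [IsAlgClosed k] (p : ℕ) [Fact p.Prime] [CharP k p] (D : HS k A S) :
    ∃ H, IsHomotopy H D := by
  have hD : D ∈ curveSubgroup k A S := curveSubgroup_eq_top (k := k) (B := A) (R := S) p ▸ Subgroup.mem_top D
  refine Subgroup.closure_induction (p := fun D _ ↦ ∃ H, IsHomotopy H D) ?_ ⟨_, .refl⟩ ?_ ?_ hD
  · rintro D ⟨m, _, x, hx, H, rfl⟩
    exact exists_isHomotopy_curveVal x hx H
  · rintro D E _ _ ⟨H, hH⟩ ⟨H', hH'⟩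
    exact ⟨_, hH.mul hH'⟩
  · rintro D _ ⟨H, hH⟩
    exact ⟨_, hH.inv⟩

end Homotopy

/-! ### Clearing denominators in homotopies, and splitting of HS over R_{fg}. -/

section Clearing

open Polynomial

variable {k : Type u} [Field k] {A : Type u} [CommRing A] [Algebra k A] [ArtinLocal k A]
  {R S : Type*} [CommRing R] [Algebra k R] [CommRing S] [Algebra k S]

lemma scaleX_comp (c d : R) : (scaleX k c).comp (scaleX k d) = scaleX k (d * c) :=
  polynomial_algHom_ext (fun _ ↦ by simp) (by simp [mul_assoc])

lemma mapAlgHom_comp_scaleX (ρ : R →ₐ[k] S) (c : R) :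
    (mapAlgHom ρ).comp (scaleX k c) = (scaleX k (ρ c)).comp (mapAlgHom ρ) :=
  polynomial_algHom_ext (fun _ ↦ by simp) (by simp)

lemma comp_evAt (ρ : R →ₐ[k] S) (c : R) :
    ρ.comp (evAt k c) = (evAt k (ρ c)).comp (mapAlgHom ρ) :=
  polynomial_algHom_ext (fun _ ↦ by simp) (by simp)

lemma evAt_comp_scaleX (c d : R) : (evAt k c).comp (scaleX k d) = evAt k (d * c) :=
  polynomial_algHom_ext (fun _ ↦ by simp) (by simp)

/-- At X = 0 the homotopy is the identity, so H(s) − s is divisible by X. Under X ↦ f^N X this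
factor produces the powers of f that clear denominators. -/
lemma IsHomotopy.exists_eq {H : HS k A S[X]} {D : HS k A S} (h : IsHomotopy H D) (s : S) :
    ∃ w, H.1 (1 ⊗ₜ C s) = 1 ⊗ₜ C s + (1 ⊗ₜ X) * w ∧ red k A S[X] w = 0 := by
  obtain ⟨w, hw⟩ := exists_X_mul A (H.1 (1 ⊗ₜ C s) - 1 ⊗ₜ C s) (by
    rw [map_sub, h.zero, Algebra.TensorProduct.map_tmul]
    exact sub_self _)
  refine ⟨w, by rw [← hw, add_sub_cancel], ?_⟩
  have := congrArg (red k A S[X]) hw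
  rw [map_sub, H.2, sub_self, map_mul, red_tmul, map_one, one_smul] at this
  exact (isRegular_X (R := S)).left (this.symm.trans (mul_zero _).symm)

/-- A power of f clears the denominators of w. Every larger exponent does as well, so that one
exponent can be used for finitely many generators. -/
lemma exists_scaled_preimage {ρ : R →ₐ[k] S} {f : R} (hρ : IsAwayHom ρ f) {w : A ⊗[k] S[X]}
    (hw : red k A S[X] w = 0) :
    ∃ M, ∀ L, M ≤ L → ∃ z, red k A R[X] z = 0 ∧
      Algebra.TensorProduct.map (AlgHom.id k A) (mapAlgHom ρ) z =
      (1 ⊗ₜ C (ρ f)) ^ L * Algebra.TensorProduct.map (AlgHom.id k A) (scaleX k (ρ f ^ L)) w := by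
  obtain ⟨e, x, hx⟩ := (hρ.polynomial.tensor (A := A)).exists_eq w
  refine ⟨e, fun L hL ↦ ?_⟩
  obtain ⟨d, rfl⟩ := Nat.exists_eq_add_of_le hL
  have h0 : Algebra.TensorProduct.map (AlgHom.id k A) (mapAlgHom ρ) (1 ⊗ₜ C f) =
      1 ⊗ₜ C (ρ f) := by simp
  rw [h0] at hx
  have h1 := congrArg (Algebra.TensorProduct.map (AlgHom.id k A) (scaleX k (ρ f ^ (e + d)))) hx
  rw [map_mul, map_pow, map_map_tmul, ← map_pow ρ, ← mapAlgHom_comp_scaleX, ← map_map_tmul,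
    Algebra.TensorProduct.map_tmul, scaleX_C, AlgHom.id_apply] at h1
  obtain ⟨z, hz⟩ : ∃ z, Algebra.TensorProduct.map (AlgHom.id k A) (mapAlgHom ρ) z =
      (1 ⊗ₜ C (ρ f)) ^ (e + d) *
        Algebra.TensorProduct.map (AlgHom.id k A) (scaleX k (ρ f ^ (e + d))) w :=
    ⟨(1 ⊗ₜ C f) ^ d * Algebra.TensorProduct.map (AlgHom.id k A) (scaleX k (f ^ (e + d))) x, by
      rw [map_mul, h1, map_pow, h0, map_pow ρ]; ring⟩
  -- The reduction of z may be nonzero over R, but it dies in S[X] because w reduces to zero;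
  -- subtracting it leaves the image unchanged.
  refine ⟨z - 1 ⊗ₜ red k A R[X] z, by simp, ?_⟩
  have h2 : mapAlgHom ρ (red k A R[X] z) = 0 := by
    rw [← red_map (AlgHom.id k A), hz, map_mul, red_map, hw, map_zero, mul_zero]
  rw [map_sub, hz, Algebra.TensorProduct.map_tmul, h2, tmul_zero, sub_zero]

/-- A homotopy over a localization `R_f`, composed with `X ↦ f^N X` for large `N`, is defined
over `R`. -/
theorem IsHomotopy.exists_descent [Algebra.FiniteType k R] {ρ : R →ₐ[k] S} {f : R}
    (hρ : IsAwayHom ρ f) {H : HS k A S[X]} {D : HS k A S} (h : IsHomotopy H D) :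
    ∃ (N : ℕ) (G : R →ₐ[k] A ⊗[k] R[X]), (∀ r, red k A R[X] (G r) = C r) ∧
      ∀ r, Algebra.TensorProduct.map (AlgHom.id k A) (mapAlgHom ρ) (G r) =
        Algebra.TensorProduct.map (AlgHom.id k A) (scaleX k (ρ f ^ N))
          (H.1 (1 ⊗ₜ C (ρ r))) := by
  have := Algebra.FinitePresentation.of_finiteType.1 ‹Algebra.FiniteType k R›
  obtain ⟨n, π, hπ, s, hs⟩ := this
  let x : Fin n → R := fun i ↦ π (MvPolynomial.X i)
  choose w hw hw0 using fun i ↦ h.exists_eq (ρ (x i))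
  choose M₀ hM₀ using fun i ↦ exists_scaled_preimage hρ (hw0 i)
  let M := Finset.univ.sup M₀
  choose z hz0 hz using fun i ↦ hM₀ i M (Finset.le_sup (Finset.mem_univ i))
  let ℓ := Algebra.TensorProduct.map (AlgHom.id k A) (mapAlgHom ρ)
  have hℓ : IsAwayHom ℓ (1 ⊗ₜ C f) := hρ.polynomial.tensor
  -- After X ↦ f^M X the equation H(x_i) = x_i + X w_i becomes x_i + X f^M w_i(f^M X), and z_i is a
  -- lift of f^M w_i(f^M X) to R[X].
  let G₀ : MvPolynomial (Fin n) k →ₐ[k] A ⊗[k] R[X] :=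
    MvPolynomial.aeval fun i ↦ 1 ⊗ₜ C (x i) + (1 ⊗ₜ X) * z i
  have hG₀ : ∀ i, G₀ (MvPolynomial.X i) = 1 ⊗ₜ C (x i) + (1 ⊗ₜ X) * z i := fun i ↦
    MvPolynomial.aeval_X _ _
  have hG₁ : ∀ P, ℓ (G₀ P) = Algebra.TensorProduct.map (AlgHom.id k A) (scaleX k (ρ f ^ M))
      (H.1 (1 ⊗ₜ C (ρ (π P)))) := by
    have : ℓ.comp G₀ = ((Algebra.TensorProduct.map (AlgHom.id k A) (scaleX k (ρ f ^ M))).comp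
        (HS.toAlgHom H)).comp ((polyC k).comp (ρ.comp π)) := MvPolynomial.algHom_ext fun i ↦ by
      change ℓ (G₀ _) = Algebra.TensorProduct.map (AlgHom.id k A) (scaleX k (ρ f ^ M))
        (H.1 (1 ⊗ₜ C (ρ (x i))))
      rw [hG₀, hw, map_add, map_mul, map_add, map_mul]
      change Algebra.TensorProduct.map _ _ _ +  Algebra.TensorProduct.map _ _ _ *
        Algebra.TensorProduct.map _ _ _ = _
      rw [hz]
      simp only [Algebra.TensorProduct.map_tmul, AlgHom.id_apply, coe_mapAlgHom, map_C, map_X,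
        AlgHom.coe_toRingHom, scaleX_C, scaleX_X]
      rw [← mul_assoc, Algebra.TensorProduct.tmul_pow, Algebra.TensorProduct.tmul_mul_tmul,
        one_pow, one_mul, X_mul, C_pow]
    exact fun P ↦ DFunLike.congr_fun this P
  have hG₂ : ∀ P, red k A R[X] (G₀ P) = C (π P) := by
    have : (red k A R[X]).comp G₀ = (polyC k).comp π := MvPolynomial.algHom_ext fun i ↦ by
      rw [AlgHom.comp_apply, hG₀, map_add, map_mul, hz0]
      simp [x]
    exact fun P ↦ DFunLike.congr_fun this P
  have hG₃ : ∀ P, Algebra.TensorProduct.map (AlgHom.id k A) (evAt k (0 : R)) (G₀ P) =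
      1 ⊗ₜ π P := by
    have : (Algebra.TensorProduct.map (AlgHom.id k A) (evAt k (0 : R))).comp G₀ =
        Algebra.TensorProduct.includeRight.comp π := MvPolynomial.algHom_ext fun i ↦ by
      rw [AlgHom.comp_apply, hG₀, map_add, map_mul]
      simp [x]
    exact fun P ↦ DFunLike.congr_fun this P
  -- G₀ respects the relations of R only after inverting f. For a relation P the value G₀(P)
  -- vanishes at X = 0, so it is X v with v killed by some f^e; a further X ↦ f^L X extracts f^L
  -- from the factor X. Finite presentation bounds L.
  have key : ∀ P, π P = 0 → ∃ e, ∀ L, e ≤ L →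
      Algebra.TensorProduct.map (AlgHom.id k A) (scaleX k (f ^ L)) (G₀ P) = 0 := by
    intro P hP
    obtain ⟨v, hv⟩ := exists_X_mul A (G₀ P) (by rw [hG₃, hP, tmul_zero])
    have h1 : ℓ v = 0 := by
      refine X_mul_injective A ?_
      have h2 : ℓ (1 ⊗ₜ X) = 1 ⊗ₜ X := by simp [ℓ]
      rw [← h2, ← map_mul, ← hv, hG₁, hP, map_zero, C_0, tmul_zero, map_zero, map_zero]
    obtain ⟨e, he⟩ := hℓ.exists_pow_mul v h1
    refine ⟨e, fun L hL ↦ ?_⟩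
    obtain ⟨d, rfl⟩ := Nat.exists_eq_add_of_le hL
    have h2 := congrArg (Algebra.TensorProduct.map (AlgHom.id k A) (scaleX k (f ^ (e + d)))) he
    rw [map_mul, map_pow, Algebra.TensorProduct.map_tmul, scaleX_C, AlgHom.id_apply,
      map_zero] at h2
    have h3 : Algebra.TensorProduct.map (AlgHom.id k A) (scaleX k (f ^ (e + d)))
        ((1 : A) ⊗ₜ X) = (1 ⊗ₜ X) * (1 ⊗ₜ C f) ^ d * (1 ⊗ₜ C f) ^ e := by
      rw [Algebra.TensorProduct.map_tmul, scaleX_X, mul_assoc, ← pow_add,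
        Algebra.TensorProduct.tmul_pow, Algebra.TensorProduct.tmul_mul_tmul, one_pow, mul_one,
        AlgHom.id_apply, X_mul, C_pow, add_comm]
    rw [hv, map_mul, h3, mul_assoc, h2, mul_zero]
  choose! e he using key
  let L := s.sup e
  let G₁ := (Algebra.TensorProduct.map (AlgHom.id k A) (scaleX k (f ^ L))).comp G₀
  have hker : ∀ P, π P = 0 → G₁ P = 0 := by
    have hle : RingHom.ker (π : MvPolynomial (Fin n) k →+* R) ≤
        RingHom.ker (G₁ : MvPolynomial (Fin n) k →+* A ⊗[k] R[X]) := by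
      change RingHom.ker π.toRingHom ≤ _
      rw [← hs, Ideal.span_le]
      intro P hP
      exact he P (show P ∈ RingHom.ker π.toRingHom from hs ▸ Ideal.subset_span hP) L
        (Finset.le_sup hP)
    exact fun P hP ↦ hle hP
  obtain ⟨g, hg⟩ := exists_factor_of_surjective (π : MvPolynomial (Fin n) k →+* R) hπ
    (G₁ : MvPolynomial (Fin n) k →+* A ⊗[k] R[X]) hker
  have hg : ∀ P, g (π P) = G₁ P := hg
  let G : R →ₐ[k] A ⊗[k] R[X] := { g with
    commutes' := fun c ↦ by
      have := hg (algebraMap k _ c)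
      rw [AlgHom.commutes, AlgHom.commutes] at this
      exact this }
  have hG : ∀ P, G (π P) = G₁ P := hg
  refine ⟨M + L, G, fun r ↦ ?_, fun r ↦ ?_⟩
  · obtain ⟨P, rfl⟩ := hπ r
    rw [hG, AlgHom.comp_apply, red_map, hG₂, scaleX_C]
  · obtain ⟨P, rfl⟩ := hπ r
    rw [hG, AlgHom.comp_apply, map_map_tmul, mapAlgHom_comp_scaleX, ← map_map_tmul,
      show Algebra.TensorProduct.map (AlgHom.id k A) (mapAlgHom ρ) (G₀ P) = _ from hG₁ P,
      map_map_tmul, scaleX_comp, map_pow ρ, pow_add]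
    rfl

/-- Setting X = c is compatible with automorphisms only if the resulting D fixes 1 ⊗ c, because H
fixes X. This is the reason for using p^e-th powers as parameters. -/
lemma exists_compat_evAt {H : HS k A S[X]} (hX : H.1 (1 ⊗ₜ X) = 1 ⊗ₜ X) {c : S}
    (hc : ∀ D : HS k A S, D.1 (1 ⊗ₜ c) = 1 ⊗ₜ c) :
    ∃ D : HS k A S, HS.Compat (AlgHom.id k A) (evAt k c) H D := by
  refine ⟨HS.ofAlgHom ((Algebra.TensorProduct.map (AlgHom.id k A) (evAt k c)).comp
    ((HS.toAlgHom H).comp (polyC k))) fun r ↦ ?_, HS.compat_of_polynomial (fun s ↦ ?_) ?_⟩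
  · rw [AlgHom.comp_apply, red_map, AlgHom.comp_apply, HS.red_toAlgHom, polyC_apply, evAt_C]
  · rw [HS.ofAlgHom_tmul, one_smul, evAt_C]
    rfl
  · rw [hX, evAt_X, hc, Algebra.TensorProduct.map_tmul, evAt_X, AlgHom.id_apply]

/-- The descended family is H after X ↦ f^N X, so its value at c descends the value of H at f^N c.
-/
lemma IsHomotopy.exists_compat [Algebra.FiniteType k R] {ρ : R →ₐ[k] S} {f : R}
    (hρ : IsAwayHom ρ f) {H : HS k A S[X]} {D : HS k A S} (h : IsHomotopy H D) :
    ∃ N, ∀ (c : R) (F : HS k A S), HS.Compat (AlgHom.id k A) (evAt k (ρ (f ^ N * c))) H F →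
      ∃ E : HS k A R, HS.Compat (AlgHom.id k A) ρ E F := by
  obtain ⟨N, G, hG, hG'⟩ := h.exists_descent hρ
  refine ⟨N, fun c F hF ↦ ⟨HS.ofAlgHom
    ((Algebra.TensorProduct.map (AlgHom.id k A) (evAt k c)).comp G) fun r ↦ ?_,
    .of_one_tmul fun r ↦ ?_⟩⟩
  · rw [AlgHom.comp_apply, red_map, hG, evAt_C]
  · rw [HS.ofAlgHom_tmul, one_smul, AlgHom.comp_apply, map_map_tmul, comp_evAt, ← map_map_tmul,
      hG', map_map_tmul, evAt_comp_scaleX, ← map_pow ρ, ← map_mul, AlgHom.id_comp, hF,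
      Algebra.TensorProduct.map_tmul, evAt_C, AlgHom.id_apply]

/-- D(s) − s lies in the kernel of the reduction, a nilpotent ideal with an exponent independent of
D and s. A high enough power of Frobenius kills it. -/
lemma exists_pow_fixed (p : ℕ) [Fact p.Prime] [CharP k p] (A S : Type*) [CommRing A]
    [Algebra k A] [ArtinLocal k A] [CommRing S] [Algebra k S] :
    ∃ e, ∀ (D : HS k A S) (s : S), D.1 (1 ⊗ₜ (s ^ p ^ e)) = 1 ⊗ₜ (s ^ p ^ e) := by
  obtain ⟨n, hn⟩ := isNilpotent_ker_red (k := k) (A := A) (R := S)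
  rcases subsingleton_or_nontrivial (A ⊗[k] S) with _ | _
  · exact ⟨0, fun _ _ ↦ Subsingleton.elim _ _⟩
  have : CharP (A ⊗[k] S) p := charP_of_injective_algebraMap (algebraMap k (A ⊗[k] S)).injective p
  refine ⟨n, fun D s ↦ ?_⟩
  have h1 : (D.1 (1 ⊗ₜ s) - 1 ⊗ₜ s) ^ n = 0 := by
    have h2 : D.1 (1 ⊗ₜ s) - 1 ⊗ₜ s ∈ RingHom.ker (red k A S : A ⊗[k] S →+* S) := by
      change red k A S _ = 0
      rw [map_sub, D.2, sub_self]
    simpa [hn] using Ideal.pow_mem_pow h2 n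
  have h3 := pow_eq_zero_of_le (Nat.lt_pow_self (Fact.out : p.Prime).one_lt).le h1
  rw [sub_pow_char_pow, sub_eq_zero, ← map_pow, Algebra.TensorProduct.tmul_pow, one_pow] at h3
  exact h3

/-- Over a localization `R_{fg}` with `(f, g) = 1`, every element of `HS^A` is a product of
elements coming from `R_g` and `R_f`. -/
theorem HS.exists_splitting [IsAlgClosed k] (p : ℕ) [Fact p.Prime] [CharP k p]
    {R₁ R₂ : Type*} [CommRing R₁] [Algebra k R₁] [CommRing R₂] [Algebra k R₂]
    [Algebra.FiniteType k R₁] [Algebra.FiniteType k R₂] {f g : R} (hfg : IsCoprime f g)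
    {σ₁ : R →ₐ[k] R₁} {σ₂ : R →ₐ[k] R₂} {ρ₁ : R₁ →ₐ[k] S} {ρ₂ : R₂ →ₐ[k] S}
    (hσ : ∀ r, ρ₁ (σ₁ r) = ρ₂ (σ₂ r)) (h₁ : IsAwayHom ρ₁ (σ₁ g)) (h₂ : IsAwayHom ρ₂ (σ₂ f))
    (D : HS k A S) :
    ∃ (E₁ : HS k A R₁) (E₂ : HS k A R₂) (F₁ F₂ : HS k A S),
      HS.Compat (AlgHom.id k A) ρ₁ E₁ F₁ ∧ HS.Compat (AlgHom.id k A) ρ₂ E₂ F₂ ∧ D = F₂ * F₁ := by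
  obtain ⟨H, hH⟩ := exists_isHomotopy p D
  -- K is H with X replaced by 1 − X, and `Dc` is the constant family D.
  let K : HS k A S[X] := HS.ofPolynomial ((Algebra.TensorProduct.map (AlgHom.id k A)
    (polyLift (polyC k) (1 - X))).comp ((HS.toAlgHom H).comp (polyC k))) fun s ↦ by
      rw [AlgHom.comp_apply, red_map, AlgHom.comp_apply, HS.red_toAlgHom, polyC_apply, polyLift_C]
      rfl
  have hK : ∀ s, K.1 (1 ⊗ₜ C s) = Algebra.TensorProduct.map (AlgHom.id k A)
    (polyLift (polyC k) (1 - X)) (H.1 (1 ⊗ₜ C s)) := HS.ofPolynomial_C _ _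
  let Dc : HS k A S[X] := HS.ofPolynomial ((Algebra.TensorProduct.map (AlgHom.id k A)
    (polyC k)).comp (HS.toAlgHom D)) fun s ↦ by
      rw [AlgHom.comp_apply, red_map, HS.red_toAlgHom, polyC_apply]
  have hDc : ∀ s, Dc.1 (1 ⊗ₜ C s) = Algebra.TensorProduct.map (AlgHom.id k A)
    (polyC k) (D.1 (1 ⊗ₜ s)) := HS.ofPolynomial_C _ _
  have hDa : ∀ a : S, D.1 (1 ⊗ₜ a) = 1 ⊗ₜ a → HS.Compat (AlgHom.id k A) (evAt k a) Dc D := by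
    intro a ha
    refine HS.compat_of_polynomial (fun s ↦ ?_) ?_
    · have : (evAt k a).comp (polyC k) = AlgHom.id k S := AlgHom.ext fun s ↦ by simp
      rw [hDc, map_map_tmul, this, evAt_C, AlgHom.id_comp, Algebra.TensorProduct.map_id]
      rfl
    · rw [HS.ofPolynomial_X, Algebra.TensorProduct.map_tmul, evAt_X, ha]; rfl
  have hKa : ∀ (a b : S) (F : HS k A S), a + b = 1 → F.1 (1 ⊗ₜ a) = 1 ⊗ₜ a →
      HS.Compat (AlgHom.id k A) (evAt k b) H F → HS.Compat (AlgHom.id k A) (evAt k a) K F := by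
    intro a b F hab ha hF
    refine HS.compat_of_polynomial (fun s ↦ ?_) ?_
    · have : (evAt k a).comp (polyLift (polyC k) (1 - X)) = evAt k b :=
        polynomial_algHom_ext (fun s ↦ by simp) (by simp [← hab])
      rw [hK, map_map_tmul, this, AlgHom.id_comp, hF, Algebra.TensorProduct.map_tmul]
      simp
    · rw [HS.ofPolynomial_X, Algebra.TensorProduct.map_tmul, evAt_X, ha]; rfl
  have fix0 : ∀ F : HS k A S, F.1 (1 ⊗ₜ 0) = 1 ⊗ₜ 0 := fun F ↦ by simp
  have fix1 : ∀ F : HS k A S, F.1 (1 ⊗ₜ 1) = 1 ⊗ₜ 1 := fun F ↦ by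
    rw [← Algebra.TensorProduct.one_def, map_one]
  -- The family D · H(1 − X)⁻¹ is again a homotopy from the identity to D: its values at 0 and 1 are
  -- D · H(1)⁻¹ = 1 and D · H(0)⁻¹ = D.
  have hE : IsHomotopy (Dc * K⁻¹) D :=
    { apply_X := (congrArg Dc.1 (HS.inv_apply_eq (HS.ofPolynomial_X _ _))).trans
        (HS.ofPolynomial_X _ _)
      zero := mul_inv_cancel D ▸ (hDa 0 (fix0 _)).mul (hKa 0 1 D (zero_add 1) (fix0 _) hH.one).inv
      one := by
        have := (hDa 1 (fix1 _)).mul (hKa 1 0 1 (add_zero 1) (fix1 _) hH.zero).inv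
        rwa [inv_one, mul_one] at this }
  obtain ⟨N₁, hN₁⟩ := hH.exists_compat h₁
  obtain ⟨N₂, hN₂⟩ := hE.exists_compat h₂
  obtain ⟨e, he⟩ := exists_pow_fixed (k := k) p A S
  -- This gives a' + b' = 1 with a' divisible by f^{N₂} and b' by g^{N₁}. Raising the two terms to
  -- the power p^e preserves the sum and makes them fixed by HS^A(S).
  obtain ⟨a, b, hab⟩ := hfg.pow (m := N₂) (n := N₁)
  have hab' : (a * f ^ N₂) ^ p ^ e + (b * g ^ N₁) ^ p ^ e = 1 := by
    rcases subsingleton_or_nontrivial R with _ | _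
    · exact Subsingleton.elim _ _
    have : CharP R p := charP_of_injective_algebraMap (algebraMap k R).injective p
    rw [← add_pow_char_pow, hab, one_pow]
  let a' : S := ρ₂ (σ₂ ((a * f ^ N₂) ^ p ^ e))
  let b' : S := ρ₂ (σ₂ ((b * g ^ N₁) ^ p ^ e))
  have ha' : ∀ F : HS k A S, F.1 (1 ⊗ₜ a') = 1 ⊗ₜ a' := fun F ↦ by
    simp only [a', map_pow]; exact he F _
  have hb' : ∀ F : HS k A S, F.1 (1 ⊗ₜ b') = 1 ⊗ₜ b' := fun F ↦ by
    simp only [b', map_pow]; exact he F _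
  have hsum : a' + b' = 1 := by rw [← map_add, ← map_add, hab', map_one, map_one]
  -- F = H(b') descends to R₁ since g^{N₁} divides b'. The second homotopy at a' = 1 − b' is D ·
  -- F⁻¹, which descends to R₂.
  obtain ⟨F, hF⟩ := exists_compat_evAt hH.apply_X hb'
  have hF' := (hDa a' (ha' _)).mul (hKa a' b' F hsum (ha' _) hF).inv
  obtain ⟨q, hq⟩ : ∃ q, p ^ e = q + 1 :=
    ⟨p ^ e - 1, (Nat.sub_add_cancel (Nat.one_le_pow _ _ (Fact.out : p.Prime).pos)).symm⟩
  have hpow : ∀ x y : R, (x * y) ^ p ^ e = y * ((x * y) ^ q * x) := fun x y ↦ by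
    rw [hq, pow_succ]; ring
  obtain ⟨E₁, hE₁⟩ := hN₁ (σ₁ ((b * g ^ N₁) ^ q * b)) F (by
    rwa [← map_pow σ₁, ← map_mul σ₁, ← hpow, hσ])
  obtain ⟨E₂, hE₂⟩ := hN₂ (σ₂ ((a * f ^ N₂) ^ q * a)) (D * F⁻¹) (by
    rwa [← map_pow σ₂, ← map_mul σ₂, ← hpow])
  exact ⟨E₁, E₂, F, D * F⁻¹, hE₁, hE₂, by rw [inv_mul_cancel_right]⟩

end Clearing

/-! ### Spectra of the algebras A ⊗ R and their cartesian squares. -/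

section SpecMaps

variable {k : Type u} [Field k] {R R' S : Type u} [CommRing R] [Algebra k R] [CommRing R']
  [Algebra k R'] [CommRing S] [Algebra k S]

/-- The morphism of spectra given by a morphism of `k`-algebras. -/
def sp (f : R →ₐ[k] S) : Spec (.of S) ⟶ Spec (.of R) :=
  Spec.map (CommRingCat.ofHom (f : R →+* S))

lemma sp_comp (f : R →ₐ[k] R') (g : R' →ₐ[k] S) : sp g ≫ sp f = sp (g.comp f) := by
  rw [sp, sp, ← Spec.map_comp, ← CommRingCat.ofHom_comp]
  rfl

lemma sp_comp_assoc (f : R →ₐ[k] R') (g : R' →ₐ[k] S) {Z : Scheme.{u}}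
    (h : Spec (.of R) ⟶ Z) : sp g ≫ sp f ≫ h = sp (g.comp f) ≫ h := by
  rw [← Category.assoc, sp_comp]

lemma sp_id : sp (AlgHom.id k R) = 𝟙 _ := Spec.map_id (CommRingCat.of R)

lemma sp_injective {f g : R →ₐ[k] S} (h : sp f = sp g) : f = g := by
  have := Spec.map_injective h
  exact AlgHom.ext fun x ↦ DFunLike.congr_fun (CommRingCat.hom_ext_iff.1 this) x

lemma exists_sp_eq (w : Spec (.of S) ⟶ Spec (.of R))
    (hw : w ≫ sp (Algebra.ofId k R) = sp (Algebra.ofId k S)) : ∃ f : R →ₐ[k] S, sp f = w := by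
  obtain ⟨f, rfl⟩ := Spec.map_surjective w
  have h := Spec.map_injective ((Spec.map_comp _ _).trans hw)
  exact ⟨{ f.hom with
    commutes' := fun c ↦ DFunLike.congr_fun (CommRingCat.hom_ext_iff.1 h) c }, rfl⟩

lemma sp_ofId_comp (f : R →ₐ[k] S) : sp f ≫ sp (Algebra.ofId k R) = sp (Algebra.ofId k S) := by
  rw [sp_comp]
  congr 1
  ext

variable {A B : Type u} [CommRing A] [Algebra k A] [CommRing B] [Algebra k B]

lemma isPullback_tensor : IsPullback (sp (Algebra.TensorProduct.includeRight : R →ₐ[k] A ⊗[k] R))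
    (sp (Algebra.TensorProduct.includeLeft : A →ₐ[k] A ⊗[k] R)) (sp (Algebra.ofId k R))
    (sp (Algebra.ofId k A)) :=
  (isPullback_SpecMap_of_isPushout _ _ _ _
    (CommRingCat.isPushout_tensorProduct k A R)).flip

lemma isPullback_tensor_map (ρ : R →ₐ[k] R') :
    IsPullback (sp (Algebra.TensorProduct.includeRight : R' →ₐ[k] A ⊗[k] R'))
    (sp (Algebra.TensorProduct.map (AlgHom.id k A) ρ)) (sp ρ)
    (sp (Algebra.TensorProduct.includeRight : R →ₐ[k] A ⊗[k] R)) := by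
  have h1 : (Algebra.TensorProduct.map (AlgHom.id k A) ρ).comp
      (Algebra.TensorProduct.includeLeft : A →ₐ[k] A ⊗[k] R) =
      Algebra.TensorProduct.includeLeft := by ext; simp
  have h2 : (Algebra.TensorProduct.map (AlgHom.id k A) ρ).comp
      (Algebra.TensorProduct.includeRight : R →ₐ[k] A ⊗[k] R) =
      Algebra.TensorProduct.includeRight.comp ρ := by ext; simp
  have h3 := isPullback_tensor (k := k) (A := A) (R := R')
  rw [← sp_ofId_comp ρ, ← h1, ← sp_comp] at h3
  exact IsPullback.of_bot h3 (by rw [sp_comp, sp_comp, h2])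
    (isPullback_tensor (k := k) (A := A) (R := R))

lemma isPullback_tensor_baseChange (φ : B →ₐ[k] A) :
    IsPullback (sp (Algebra.TensorProduct.map φ (AlgHom.id k R)))
    (sp (Algebra.TensorProduct.includeLeft : A →ₐ[k] A ⊗[k] R))
    (sp (Algebra.TensorProduct.includeLeft : B →ₐ[k] B ⊗[k] R)) (sp φ) := by
  have h1 : (Algebra.TensorProduct.map φ (AlgHom.id k R)).comp
      (Algebra.TensorProduct.includeRight : R →ₐ[k] B ⊗[k] R) =
      Algebra.TensorProduct.includeRight := by ext; simp
  have h2 : (Algebra.TensorProduct.map φ (AlgHom.id k R)).comp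
      (Algebra.TensorProduct.includeLeft : B →ₐ[k] B ⊗[k] R) =
      Algebra.TensorProduct.includeLeft.comp φ := by ext; simp
  have h3 := isPullback_tensor (k := k) (A := A) (R := R)
  rw [← sp_ofId_comp φ, ← h1, ← sp_comp] at h3
  exact IsPullback.of_right h3 (by rw [sp_comp, sp_comp, h2])
    (isPullback_tensor (k := k) (A := B) (R := R))

lemma isOpenImmersion_sp_tensor {ρ : R →ₐ[k] R'} [IsOpenImmersion (sp ρ)] :
    IsOpenImmersion (sp (Algebra.TensorProduct.map (AlgHom.id k A) ρ)) :=
  MorphismProperty.of_isPullback (P := @IsOpenImmersion) (isPullback_tensor_map ρ) inferInstance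

variable [ArtinLocal k A] [ArtinLocal k B]

lemma isPullback_red : IsPullback (sp (red k A R)) (sp (Algebra.ofId k R))
    (sp (Algebra.TensorProduct.includeLeft : A →ₐ[k] A ⊗[k] R)) (sp (residue k A)) := by
  have h1 : (red k A R).comp Algebra.TensorProduct.includeRight = AlgHom.id k R := by
    ext; simp
  have h2 : (residue k A).comp (Algebra.ofId k A) = AlgHom.id k k := by ext
  have h3 : IsPullback (sp (red k A R) ≫
      sp (Algebra.TensorProduct.includeRight : R →ₐ[k] A ⊗[k] R))
      (sp (Algebra.ofId k R)) (sp (Algebra.ofId k R))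
      (sp (residue k A) ≫ sp (Algebra.ofId k A)) := by
    rw [sp_comp, sp_comp, h1, h2, sp_id, sp_id]
    exact IsPullback.of_horiz_isIso ⟨by simp⟩
  refine IsPullback.of_right h3 ?_ (isPullback_tensor (k := k) (A := A) (R := R))
  rw [sp_comp, sp_comp]
  congr 1
  ext a
  simp [Algebra.ofId_apply, Algebra.algebraMap_eq_smul_one]

lemma surjective_sp_of_isNilpotent_ker (f : R →ₐ[k] S) (hf : Function.Surjective f)
    (h : IsNilpotent (RingHom.ker (f : R →+* S))) : Surjective (sp f) := by
  refine ⟨fun x ↦ ?_⟩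
  have hx : x ∈ Set.range (PrimeSpectrum.comap (f : R →+* S)) := by
    refine (range_comap_of_surjective _ (f : R →+* S) hf).symm ▸ ?_
    change PrimeSpectrum R at x
    change (RingHom.ker (f : R →+* S) : Set R) ⊆ x.asIdeal
    obtain ⟨n, hn⟩ := h
    intro y hy
    have : y ^ n ∈ x.asIdeal := by
      have h2 := Ideal.pow_mem_pow hy n
      rw [hn] at h2
      rw [show y ^ n = 0 from h2]
      exact zero_mem _
    exact x.2.mem_of_pow_mem n this
  exact hx

instance surjective_sp_red : Surjective (sp (red k A R)) :=
  surjective_sp_of_isNilpotent_ker _ red_surjective isNilpotent_ker_red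

instance surjective_sp_residue : Surjective (sp (residue k A)) := by
  refine surjective_sp_of_isNilpotent_ker _ (fun c ↦ ⟨algebraMap k A c, by simp⟩) ?_
  rw [show RingHom.ker (residue k A : A →+* k) = IsLocalRing.maximalIdeal A from ker_residue]
  exact ArtinLocal.isNilpotent_maximalIdeal (k := k)

instance isClosedImmersion_sp_residue : IsClosedImmersion (sp (residue k A)) :=
  IsClosedImmersion.spec_of_surjective _ fun c ↦ ⟨algebraMap k A c, by simp⟩

/-- `D ∈ HS^A(R)` as a morphism of `k`-algebras. -/
def HS.hom (D : HS k A R) : A ⊗[k] R →ₐ[k] A ⊗[k] R :=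
  (D.1 : A ⊗[k] R →ₐ[A] A ⊗[k] R).restrictScalars k

lemma HS.hom_apply (D : HS k A R) (x) : (HS.hom D) x = D.1 x := rfl

lemma HS.hom_one : HS.hom (1 : HS k A R) = AlgHom.id k _ := rfl

lemma HS.hom_mul (D E : HS k A R) : HS.hom (D * E) = (HS.hom D).comp (HS.hom E) := rfl

lemma HS.hom_injective {D E : HS k A R} (h : (HS.hom D) = (HS.hom E)) : D = E :=
  HS.ext_one_tmul fun r ↦ DFunLike.congr_fun h _

lemma HS.red_comp_hom (D : HS k A R) : (red k A R).comp (HS.hom D) = red k A R :=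
  AlgHom.ext fun x ↦ D.2 x

lemma HS.hom_comp_includeLeft (D : HS k A R) :
    (HS.hom D).comp Algebra.TensorProduct.includeLeft =
      (Algebra.TensorProduct.includeLeft : A →ₐ[k] A ⊗[k] R) :=
  AlgHom.ext fun a ↦ D.1.commutes a

lemma HS.exists_hom_eq (f : A ⊗[k] R →ₐ[k] A ⊗[k] R) (hf : (red k A R).comp f = red k A R)
    (hf' : f.comp Algebra.TensorProduct.includeLeft =
      (Algebra.TensorProduct.includeLeft : A →ₐ[k] A ⊗[k] R)) : ∃ D : HS k A R, (HS.hom D) = f := by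
  refine ⟨HS.ofAlgHom (f.comp Algebra.TensorProduct.includeRight) fun r ↦ ?_, ?_⟩
  · have := DFunLike.congr_fun hf (1 ⊗ₜ r)
    simpa using this
  · refine Algebra.TensorProduct.ext' fun a r ↦ ?_
    rw [HS.hom_apply, HS.ofAlgHom_tmul, Algebra.smul_def]
    have := DFunLike.congr_fun hf' a
    rw [show algebraMap A (A ⊗[k] R) a = f (a ⊗ₜ 1) from this.symm]
    rw [AlgHom.comp_apply, ← map_mul]
    simp

lemma HS.Compat.comp_hom {φ : B →ₐ[k] A} {ρ : R →ₐ[k] R'} {D : HS k B R} {D' : HS k A R'}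
    (h : HS.Compat φ ρ D D') : (Algebra.TensorProduct.map φ ρ).comp (HS.hom D) =
      (HS.hom D').comp (Algebra.TensorProduct.map φ ρ) :=
  AlgHom.ext h

instance isIso_sp_hom (D : HS k A R) : IsIso (sp (HS.hom D)) :=
  ⟨sp (HS.hom D⁻¹), by rw [sp_comp, ← HS.hom_mul, mul_inv_cancel, HS.hom_one, sp_id],
    by rw [sp_comp, ← HS.hom_mul, inv_mul_cancel, HS.hom_one, sp_id]⟩

end SpecMaps

/-! ### Gluing morphisms and recognizing open immersions. -/

section Schemes

variable {X Y Z T : Scheme.{u}}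

/-- A morphism that is injective and locally on the source an open immersion is an open
immersion. -/
lemma isOpenImmersion_of_cover {ι : Type*} {C : ι → Scheme.{u}} (σ : ∀ i, C i ⟶ X)
    (hσo : ∀ i, IsOpenImmersion (σ i)) (hσ : ∀ x, ∃ i y, σ i y = x) (f : X ⟶ Y)
    (h : ∀ i, IsOpenImmersion (σ i ≫ f)) (hf : Function.Injective f) : IsOpenImmersion f := by
  have hopen : IsOpenMap f := by
    intro U hU
    have : f '' U = ⋃ i, (σ i ≫ f) '' (σ i ⁻¹' U) := by
      ext y
      simp only [Set.mem_image, Set.mem_iUnion, Set.mem_preimage]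
      constructor
      · rintro ⟨x, hx, rfl⟩
        obtain ⟨i, c, rfl⟩ := hσ x
        exact ⟨i, c, hx, rfl⟩
      · rintro ⟨i, c, hc, rfl⟩
        exact ⟨_, hc, rfl⟩
    rw [this]
    exact isOpen_iUnion fun i ↦
      (σ i ≫ f).isOpenEmbedding.isOpenMap _ (hU.preimage (σ i).continuous)
  have : ∀ x, IsIso (f.stalkMap x) := by
    intro x
    obtain ⟨i, c, rfl⟩ := hσ x
    have h1 : IsIso ((σ i ≫ f).stalkMap c) := inferInstance
    rw [Scheme.Hom.stalkMap_comp] at h1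
    exact @IsIso.of_isIso_comp_right _ _ _ _ _ _ ((σ i).stalkMap c) inferInstance h1
  exact IsOpenImmersion.of_isIso_stalkMap f
    (.of_continuous_injective_isOpenMap f.continuous hf hopen)

/-- The comparison map from V to the fibre product is an open immersion, and the condition on ranges
makes it surjective. -/
lemma isPullback_of_range {V : Scheme.{u}} (p : V ⟶ X) (q : V ⟶ Y) (a : X ⟶ Z) (b : Y ⟶ Z)
    [IsOpenImmersion a] [IsOpenImmersion b] [IsOpenImmersion (p ≫ a)] (h : p ≫ a = q ≫ b)
    (hr : Set.range a ∩ Set.range b ⊆ Set.range (p ≫ a)) : IsPullback p q a b := by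
  let w : V ⟶ pullback a b := pullback.lift p q h
  have hw : w ≫ pullback.fst a b ≫ a = p ≫ a := by rw [pullback.lift_fst_assoc]
  have : IsOpenImmersion (w ≫ pullback.fst a b ≫ a) := hw ▸ inferInstance
  have h1 : IsOpenImmersion w := .of_comp w (pullback.fst a b ≫ a)
  have h2 : Surjective w := ⟨fun x ↦ by
    obtain ⟨v, hv⟩ := hr ⟨⟨pullback.fst a b x, rfl⟩, ⟨pullback.snd a b x, by
      rw [← Scheme.Hom.comp_apply, ← Scheme.Hom.comp_apply, pullback.condition]⟩⟩
    refine ⟨v, (pullback.fst a b ≫ a).isOpenEmbedding.injective ?_⟩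
    rw [← Scheme.Hom.comp_apply, hw, hv]
    rfl⟩
  have h3 : IsIso w := (isIso_iff_isOpenImmersion_and_surjective w).2 ⟨h1, h2⟩
  exact .of_iso_pullback ⟨h⟩ (asIso w) (pullback.lift_fst _ _ _) (pullback.lift_snd _ _ _)

lemma exists_glue {ι : Type*} {C : ι → Scheme.{u}} (σ : ∀ i, C i ⟶ X)
    (hσo : ∀ i, IsOpenImmersion (σ i)) (hσ : ∀ x, ∃ i y, σ i y = x) (g : ∀ i, C i ⟶ Y)
    (h : ∀ i j, ∃ (V : Scheme.{u}) (p : V ⟶ C i) (q : V ⟶ C j),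
      IsPullback p q (σ i) (σ j) ∧ p ≫ g i = q ≫ g j) : ∃ m : X ⟶ Y, ∀ i, σ i ≫ m = g i := by
  let 𝒰 : X.OpenCover := {
    I₀ := ι, X := C, f := σ,
    mem₀ := by
      rw [Scheme.presieve₀_mem_precoverage_iff]
      exact ⟨fun x ↦ by obtain ⟨i, y, hy⟩ := hσ x; exact ⟨i, y, hy⟩, hσo⟩ }
  refine ⟨𝒰.glueMorphisms g fun i j ↦ ?_, fun i ↦ 𝒰.ι_glueMorphisms g _ i⟩
  obtain ⟨V, p, q, hpq, hg⟩ := h i j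
  rw [← cancel_epi hpq.isoPullback.hom]
  change hpq.isoPullback.hom ≫ pullback.fst (σ i) (σ j) ≫ g i =
    hpq.isoPullback.hom ≫ pullback.snd (σ i) (σ j) ≫ g j
  rw [IsPullback.isoPullback_hom_fst_assoc, IsPullback.isoPullback_hom_snd_assoc, hg]

lemma hom_ext_of_cover {ι : Type*} {C : ι → Scheme.{u}} (σ : ∀ i, C i ⟶ X)
    (hσo : ∀ i, IsOpenImmersion (σ i)) (hσ : ∀ x, ∃ i y, σ i y = x) {f g : X ⟶ Y}
    (h : ∀ i, σ i ≫ f = σ i ≫ g) : f = g := by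
  let 𝒰 : X.OpenCover := {
    I₀ := ι, X := C, f := σ,
    mem₀ := by
      rw [Scheme.presieve₀_mem_precoverage_iff]
      exact ⟨fun x ↦ by obtain ⟨i, y, hy⟩ := hσ x; exact ⟨i, y, hy⟩, hσo⟩ }
  exact 𝒰.hom_ext _ _ h

end Schemes

/-! ### Restriction of HS between affine opens. -/

section Sections

variable {k : Type u} [Field k] {X₀ : Scheme.{u}} [X₀.Over (Spec (.of k))]

/-- The inclusion of an affine open. -/
def fs (W : X₀.affineOpens) : Spec (.of Γ(X₀, W)) ⟶ X₀ := W.2.fromSpec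

instance (W : X₀.affineOpens) : IsOpenImmersion (fs W) := W.2.isOpenImmersion_fromSpec

lemma range_fs (W : X₀.affineOpens) : Set.range (fs W) = (W : X₀.Opens) := W.2.range_fromSpec

lemma fs_over (W : X₀.affineOpens) :
    fs W ≫ (X₀ ↘ Spec (.of k)) = sp (Algebra.ofId k Γ(X₀, W)) := by
  have h := IsAffineOpen.SpecMap_appLE_fromSpec (X₀ ↘ Spec (.of k)) (isAffineOpen_top _) W.2
    (le_of_le_of_eq le_top rfl)
  refine h.symm.trans ?_
  rw [IsAffineOpen.fromSpec_top, Scheme.isoSpec_Spec_inv, ← Spec.map_comp]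
  rfl

lemma sp_resHom_fs {V W : X₀.affineOpens} (h : W ≤ V) :
    sp (resHom k (show (W : X₀.Opens) ≤ V from h)) ≫ fs V = fs W :=
  IsAffineOpen.map_fromSpec V.2 W.2 (homOfLE (show (W : X₀.Opens) ≤ V from h)).op

instance isOpenImmersion_sp_resHom {V W : X₀.affineOpens} (h : W ≤ V) :
    IsOpenImmersion (sp (resHom k (show (W : X₀.Opens) ≤ V from h))) := by
  have : IsOpenImmersion (sp (resHom k (show (W : X₀.Opens) ≤ V from h)) ≫ fs V) := by
    rw [sp_resHom_fs h]; infer_instance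
  exact .of_comp _ (fs V)

lemma resHom_comp {U V W : X₀.Opens} (h : V ≤ U) (h' : W ≤ V) :
    (resHom k h').comp (resHom k h) = resHom k (h'.trans h) := by
  refine AlgHom.ext fun x ↦ ?_
  exact DFunLike.congr_fun (CommRingCat.hom_ext_iff.1
    (X₀.presheaf.map_comp (homOfLE h).op (homOfLE h').op)).symm x

lemma resHom_self {U : X₀.Opens} : resHom k (le_refl U) = AlgHom.id k Γ(X₀, U) :=
  AlgHom.ext fun x ↦ DFunLike.congr_fun (CommRingCat.hom_ext_iff.1
    (X₀.presheaf.map_id (Opposite.op U))) x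

variable {A : Type u} [CommRing A] [Algebra k A]

variable (k A) in
/-- The restriction `A ⊗ Γ(X₀, V) → A ⊗ Γ(X₀, W)`. -/
def tres {V W : X₀.affineOpens} (h : W ≤ V) : A ⊗[k] Γ(X₀, V) →ₐ[k] A ⊗[k] Γ(X₀, W) :=
  Algebra.TensorProduct.map (AlgHom.id k A) (resHom k (show (W : X₀.Opens) ≤ V from h))

instance {V W : X₀.affineOpens} (h : W ≤ V) : IsOpenImmersion (sp (tres k A h)) :=
  haveI := isOpenImmersion_sp_resHom (k := k) h
  isOpenImmersion_sp_tensor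

variable [ArtinLocal k A]

lemma tres_comp {U V W : X₀.affineOpens} (h : V ≤ U) (h' : W ≤ V) :
    (tres k A h').comp (tres k A h) = tres k A (h'.trans h) :=
  AlgHom.ext fun x ↦ (map_map_tmul _ _ _ _ x).trans (by rw [resHom_comp]; rfl)

lemma tres_self (U : X₀.affineOpens) : tres k A (le_refl U) = AlgHom.id k _ := by
  rw [tres, resHom_self, Algebra.TensorProduct.map_id]

lemma sp_tres_tres {U V W : X₀.affineOpens} (h : V ≤ U) (h' : W ≤ V) :
    sp (tres k A h') ≫ sp (tres k A h) = sp (tres k A (h'.trans h)) := by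
  rw [sp_comp, tres_comp]

lemma HS.compat_res {V W : X₀.affineOpens} (h : W ≤ V) (D : HS k A Γ(X₀, V)) :
    HS.Compat (AlgHom.id k A) (resHom k (show (W : X₀.Opens) ≤ V from h)) D (HS.res h D) :=
  fun y ↦ (HS.restrict_apply (resHom k h) (formallyEtale_resHom h) D y).symm

lemma sp_tres_hom {V W : X₀.affineOpens} (h : W ≤ V) (D : HS k A Γ(X₀, V)) :
    sp (tres k A h) ≫ sp (HS.hom D) = sp (HS.hom (HS.res h D)) ≫ sp (tres k A h) := by
  rw [sp_comp, sp_comp]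
  exact congrArg sp (HS.compat_res h D).comp_hom

lemma sp_red_tres {V W : X₀.affineOpens} (h : W ≤ V) :
    sp (red k A Γ(X₀, W)) ≫ sp (tres k A h) =
      sp (resHom k (show (W : X₀.Opens) ≤ V from h)) ≫ sp (red k A Γ(X₀, V)) := by
  rw [sp_comp, sp_comp]
  refine congrArg sp (AlgHom.ext fun x ↦ ?_)
  exact red_map (AlgHom.id k A) _ x

lemma sp_red_hom {R : Type u} [CommRing R] [Algebra k R] (D : HS k A R) :
    sp (red k A R) ≫ sp (HS.hom D) = sp (red k A R) := by
  rw [sp_comp, HS.red_comp_hom]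

/-- Spec of the restriction map is an open immersion, hence a monomorphism, so compatibility
determines the restricted element. Multiplicativity and transitivity of `HS.res` are consequences.
-/
lemma HS.eq_res {V W : X₀.affineOpens} (h : W ≤ V) {D : HS k A Γ(X₀, V)} {E : HS k A Γ(X₀, W)}
    (hE : HS.Compat (AlgHom.id k A) (resHom k (show (W : X₀.Opens) ≤ V from h)) D E) :
    E = HS.res h D := by
  refine HS.hom_injective (sp_injective ?_)
  rw [← cancel_mono (sp (tres k A h)), ← sp_tres_hom, sp_comp, sp_comp]
  exact congrArg sp hE.comp_hom.symm

lemma HS.res_mul {V W : X₀.affineOpens} (h : W ≤ V) (D E : HS k A Γ(X₀, V)) :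
    HS.res h (D * E) = HS.res h D * HS.res h E :=
  (HS.eq_res h ((HS.compat_res h D).mul (HS.compat_res h E))).symm

lemma HS.res_one {V W : X₀.affineOpens} (h : W ≤ V) : HS.res h (1 : HS k A Γ(X₀, V)) = 1 :=
  (HS.eq_res h .one).symm

lemma HS.res_inv {V W : X₀.affineOpens} (h : W ≤ V) (D : HS k A Γ(X₀, V)) :
    HS.res h D⁻¹ = (HS.res h D)⁻¹ :=
  (HS.eq_res h (HS.compat_res h D).inv).symm

lemma HS.res_res {U V W : X₀.affineOpens} (h : V ≤ U) (h' : W ≤ V) (D : HS k A Γ(X₀, U)) :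
    HS.res h' (HS.res h D) = HS.res (h'.trans h) D := by
  refine HS.eq_res _ ?_
  have := (HS.compat_res h D).comp (HS.compat_res h' (HS.res h D))
  rwa [resHom_comp, AlgHom.id_comp] at this

lemma HS.res_self {U : X₀.affineOpens} (D : HS k A Γ(X₀, U)) : HS.res le_rfl D = D := by
  refine (HS.eq_res _ ?_).symm
  rw [resHom_self]
  intro y
  rw [Algebra.TensorProduct.map_id]
  rfl

end Sections

/-! ### Trivializations of a deformation over affine opens. -/

section Trivializations

variable {k : Type u} [Field k] {X₀ : Scheme.{u}} [X₀.Over (Spec (.of k))]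
  {A : Type u} [CommRing A] [Algebra k A] [ArtinLocal k A]
  {B : Type u} [CommRing B] [Algebra k B] [ArtinLocal k B]
  {𝒳 : Deformation k X₀ A} {R : Type u} [CommRing R] [Algebra k R]

instance : Surjective 𝒳.i :=
  MorphismProperty.of_isPullback (P := @Surjective) 𝒳.isPullback.flip
    (surjective_sp_residue (k := k) (A := A))

instance : IsClosedImmersion 𝒳.i :=
  MorphismProperty.of_isPullback (P := @IsClosedImmersion) 𝒳.isPullback.flip
    (isClosedImmersion_sp_residue (k := k) (A := A))

lemma Deformation.i_injective : Function.Injective 𝒳.i :=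
  𝒳.i.isClosedEmbedding.injective

lemma Deformation.w : 𝒳.i ≫ 𝒳.f = (X₀ ↘ Spec (.of k)) ≫ sp (residue k A) := 𝒳.isPullback.w

variable (𝒳) in
/-- `τ` is a trivialization of `𝒳` over the open subscheme `v : Spec R ⟶ X₀`: an isomorphism of
`Spec (A ⊗ R)` with the corresponding open subscheme of `𝒳`. -/
structure IsTriv (v : Spec (.of R) ⟶ X₀) (τ : Spec (.of (A ⊗[k] R)) ⟶ 𝒳.X) : Prop where
  isOpenImmersion : IsOpenImmersion τ
  comp_f : τ ≫ 𝒳.f = sp (Algebra.TensorProduct.includeLeft : A →ₐ[k] A ⊗[k] R)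
  red_comp : sp (red k A R) ≫ τ = v ≫ 𝒳.i

namespace IsTriv

variable {v : Spec (.of R) ⟶ X₀} {τ τ' : Spec (.of (A ⊗[k] R)) ⟶ 𝒳.X}

lemma range_eq (h : IsTriv 𝒳 v τ) : Set.range τ = 𝒳.i '' Set.range v := by
  have h1 : Set.range τ = Set.range (sp (red k A R) ≫ τ) := by
    have := (sp (red k A R)).surjective.range_comp τ
    exact this.symm
  rw [h1, h.red_comp]
  exact Set.range_comp 𝒳.i v

lemma act (h : IsTriv 𝒳 v τ) (D : HS k A R) : IsTriv 𝒳 v (sp (HS.hom D) ≫ τ) where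
  isOpenImmersion := have := h.isOpenImmersion; inferInstance
  comp_f := by rw [Category.assoc, h.comp_f, sp_comp, HS.hom_comp_includeLeft]
  red_comp := by rw [← Category.assoc, sp_red_hom, h.red_comp]

/-- The closed fibre determines the range, so τ' factors through τ. Compatibility with the structure
morphism and with the closed fibre puts the factor in HS^A(R). -/
lemma exists_eq (h : IsTriv 𝒳 v τ) (h' : IsTriv 𝒳 v τ') : ∃ D, sp (HS.hom D) ≫ τ = τ' := by
  have := h.isOpenImmersion
  obtain ⟨w, hw⟩ : ∃ w, w ≫ τ = τ' :=
    ⟨IsOpenImmersion.lift τ τ' (by rw [h.range_eq, h'.range_eq]), IsOpenImmersion.lift_fac _ _ _⟩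
  have hleft : w ≫ sp (Algebra.TensorProduct.includeLeft : A →ₐ[k] A ⊗[k] R) =
      sp (Algebra.TensorProduct.includeLeft : A →ₐ[k] A ⊗[k] R) := by
    calc _ = (w ≫ τ) ≫ 𝒳.f := by rw [Category.assoc, h.comp_f]
      _ = _ := by rw [hw, h'.comp_f]
  obtain ⟨f, rfl⟩ := exists_sp_eq (k := k) w (by
    rw [← sp_ofId_comp (Algebra.TensorProduct.includeLeft : A →ₐ[k] A ⊗[k] R), ← Category.assoc,
      hleft])
  obtain ⟨D, rfl⟩ := HS.exists_hom_eq f (sp_injective (by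
    rw [← sp_comp, ← cancel_mono τ, Category.assoc, hw, h.red_comp, h'.red_comp]))
    (sp_injective (by rw [← sp_comp, hleft]))
  exact ⟨D, hw⟩

lemma eq_of_act (h : IsTriv 𝒳 v τ) {D E : HS k A R}
    (hDE : sp (HS.hom D) ≫ τ = sp (HS.hom E) ≫ τ) : D = E := by
  have := h.isOpenImmersion
  exact HS.hom_injective (sp_injective ((cancel_mono τ).1 hDE))

lemma res {V W : X₀.affineOpens} {τ : Spec (.of (A ⊗[k] Γ(X₀, V))) ⟶ 𝒳.X}
    (h : IsTriv 𝒳 (fs V) τ) (hWV : W ≤ V) : IsTriv 𝒳 (fs W) (sp (tres k A hWV) ≫ τ) where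
  isOpenImmersion := have := h.isOpenImmersion; inferInstance
  comp_f := by
    rw [Category.assoc, h.comp_f, sp_comp]
    congr 1
    ext; simp [tres]
  red_comp := by
    rw [← Category.assoc, sp_red_tres, Category.assoc, h.red_comp, ← Category.assoc,
      sp_resHom_fs hWV]

lemma preimage_range {W : X₀.affineOpens} {τ : Spec (.of (A ⊗[k] Γ(X₀, W))) ⟶ 𝒳.X}
    (h : IsTriv 𝒳 (fs W) τ) : 𝒳.i ⁻¹' Set.range τ = (W : X₀.Opens) := by
  rw [h.range_eq, Set.preimage_image_eq _ 𝒳.i_injective, range_fs]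

end IsTriv

lemma range_tres_eq {V W : X₀.affineOpens} (h : W ≤ V) :
    Set.range (sp (tres k A h)) = sp (red k A Γ(X₀, V)) '' (fs V ⁻¹' (W : X₀.Opens)) := by
  have h1 : Set.range (sp (tres k A h)) =
      Set.range (sp (red k A Γ(X₀, W)) ≫ sp (tres k A h)) :=
    ((sp (red k A Γ(X₀, W))).surjective.range_comp (sp (tres k A h))).symm
  rw [h1, sp_red_tres]
  refine (Set.range_comp (sp (red k A Γ(X₀, V))) _).trans ?_
  congr 1
  rw [← range_fs W, ← sp_resHom_fs (k := k) h]
  change _ = fs V ⁻¹' Set.range (fs V ∘ _)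
  rw [Set.range_comp, Set.preimage_image_eq _ (fs V).isOpenEmbedding.injective]

lemma sp_red_injective : Function.Injective (sp (red k A R)) :=
  have : IsClosedImmersion (sp (red k A R)) := IsClosedImmersion.spec_of_surjective _ red_surjective
  (sp (red k A R)).isClosedEmbedding.injective

lemma isPullback_tres {U V W I : X₀.affineOpens} (hV : V ≤ U) (hW : W ≤ U) (hIV : I ≤ V)
    (hIW : I ≤ W) (hI : (V : X₀.Opens) ⊓ W ≤ I) :
    IsPullback (sp (tres k A hIV)) (sp (tres k A hIW)) (sp (tres k A hV)) (sp (tres k A hW)) := by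
  have h1 := sp_tres_tres (k := k) (A := A) hV hIV
  have h2 := sp_tres_tres (k := k) (A := A) hW hIW
  have : IsOpenImmersion (sp (tres k A hIV) ≫ sp (tres k A hV)) := inferInstance
  refine isPullback_of_range _ _ _ _ (h1.trans h2.symm) ?_
  rw [h1, range_tres_eq, range_tres_eq, range_tres_eq,
    ← Set.image_inter (sp_red_injective (k := k) (A := A)), ← Set.preimage_inter]
  exact Set.image_mono (Set.preimage_mono hI)

/-- Trivializations over two affine opens that agree on the intersection glue to a trivialization
over the union. -/
lemma IsTriv.exists_glue {U V W I : X₀.affineOpens} (hV : V ≤ U) (hW : W ≤ U) (hIV : I ≤ V)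
    (hIW : I ≤ W) (hI : (V : X₀.Opens) ⊓ W ≤ I) (hU : (U : X₀.Opens) ≤ (V : X₀.Opens) ⊔ W)
    {τ₁ : Spec (.of (A ⊗[k] Γ(X₀, V))) ⟶ 𝒳.X} {τ₂ : Spec (.of (A ⊗[k] Γ(X₀, W))) ⟶ 𝒳.X}
    (h₁ : IsTriv 𝒳 (fs V) τ₁) (h₂ : IsTriv 𝒳 (fs W) τ₂)
    (h : sp (tres k A hIV) ≫ τ₁ = sp (tres k A hIW) ≫ τ₂) : ∃ τ, IsTriv 𝒳 (fs U) τ := by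
  let C : Bool → Scheme.{u} := fun b ↦
    bif b then Spec (.of (A ⊗[k] Γ(X₀, V))) else Spec (.of (A ⊗[k] Γ(X₀, W)))
  let σ : ∀ b, C b ⟶ Spec (.of (A ⊗[k] Γ(X₀, U))) :=
    Bool.rec (sp (tres k A hW)) (sp (tres k A hV))
  let g : ∀ b, C b ⟶ 𝒳.X := Bool.rec τ₂ τ₁
  have hσo : ∀ b, IsOpenImmersion (σ b) := by
    rintro (_ | _)
    · exact inferInstanceAs (IsOpenImmersion (sp (tres k A hW)))
    · exact inferInstanceAs (IsOpenImmersion (sp (tres k A hV)))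
  have hσ : ∀ x, ∃ b y, σ b y = x := by
    intro x
    obtain ⟨y, rfl⟩ := (sp (red k A Γ(X₀, U))).surjective x
    have hy : fs U y ∈ (U : X₀.Opens) := by
      rw [← SetLike.mem_coe, ← range_fs]; exact ⟨y, rfl⟩
    rcases hU hy with hy | hy
    · obtain ⟨z, hz⟩ := (range_tres_eq (k := k) (A := A) hV).ge ⟨y, hy, rfl⟩
      exact ⟨true, z, hz⟩
    · obtain ⟨z, hz⟩ := (range_tres_eq (k := k) (A := A) hW).ge ⟨y, hy, rfl⟩
      exact ⟨false, z, hz⟩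
  have hmono : ∀ {P Q : X₀.affineOpens} (hPQ : P ≤ Q), IsPullback (𝟙 _) (𝟙 _)
      (sp (tres k A hPQ)) (sp (tres k A hPQ)) := fun hPQ ↦ IsKernelPair.id_of_mono _
  obtain ⟨τ, hτ⟩ := LocTriv.exists_glue σ hσo hσ g (by
    rintro (_ | _) (_ | _)
    · exact ⟨_, 𝟙 _, 𝟙 _, hmono hW, rfl⟩
    · exact ⟨_, _, _, (isPullback_tres hV hW hIV hIW hI).flip, h.symm⟩
    · exact ⟨_, _, _, isPullback_tres hV hW hIV hIW hI, h⟩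
    · exact ⟨_, 𝟙 _, 𝟙 _, hmono hV, rfl⟩)
  have hτ₁ : sp (tres k A hV) ≫ τ = τ₁ := hτ true
  have hτ₂ : sp (tres k A hW) ≫ τ = τ₂ := hτ false
  have hred : sp (red k A _) ≫ τ = fs U ≫ 𝒳.i := by
    let C' : Bool → Scheme.{u} := fun b ↦
      bif b then Spec (.of Γ(X₀, V)) else Spec (.of Γ(X₀, W))
    let σ' : ∀ b, C' b ⟶ Spec (.of Γ(X₀, U)) :=
      Bool.rec (sp (resHom k hW)) (sp (resHom k hV))
    have hσo' : ∀ b, IsOpenImmersion (σ' b) := by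
      rintro (_ | _)
      · exact isOpenImmersion_sp_resHom hW
      · exact isOpenImmersion_sp_resHom hV
    refine hom_ext_of_cover σ' hσo' (fun y ↦ ?_) ?_
    · have hy : fs U y ∈ (U : X₀.Opens) := by
        rw [← SetLike.mem_coe, ← range_fs]; exact ⟨y, rfl⟩
      rcases hU hy with hy | hy
      · obtain ⟨z, hz⟩ := (range_fs V).ge hy
        refine ⟨true, z, (fs U).isOpenEmbedding.injective ?_⟩
        rw [← hz, ← sp_resHom_fs (k := k) hV]
        rfl
      · obtain ⟨z, hz⟩ := (range_fs W).ge hy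
        refine ⟨false, z, (fs U).isOpenEmbedding.injective ?_⟩
        rw [← hz, ← sp_resHom_fs (k := k) hW]
        rfl
    · rintro (_ | _)
      · change sp (resHom k hW) ≫ _ = sp (resHom k hW) ≫ _
        rw [← Category.assoc, ← sp_red_tres hW, Category.assoc, hτ₂, h₂.red_comp,
          ← Category.assoc, sp_resHom_fs hW]
      · change sp (resHom k hV) ≫ _ = sp (resHom k hV) ≫ _
        rw [← Category.assoc, ← sp_red_tres hV, Category.assoc, hτ₁, h₁.red_comp,
          ← Category.assoc, sp_resHom_fs hV]
  have hgo : ∀ b, IsOpenImmersion (σ b ≫ τ) := by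
    intro b
    rw [hτ]
    rcases b with _ | _
    · exact h₂.isOpenImmersion
    · exact h₁.isOpenImmersion
  refine ⟨τ, isOpenImmersion_of_cover σ hσo hσ τ hgo ?_, ?_, hred⟩
  -- Reduction and 𝒳.i are bijective on points, so injectivity can be tested on U ⊆ X₀.
  · intro x y hxy
    obtain ⟨x, rfl⟩ := (sp (red k A Γ(X₀, U))).surjective x
    obtain ⟨y, rfl⟩ := (sp (red k A Γ(X₀, U))).surjective y
    rw [← Scheme.Hom.comp_apply, ← Scheme.Hom.comp_apply, hred] at hxy
    rw [(fs U).isOpenEmbedding.injective (𝒳.i_injective hxy)]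
  · refine hom_ext_of_cover σ hσo hσ ?_
    have aux : ∀ {P : X₀.affineOpens} (hP : P ≤ U),
        sp (tres k A hP) ≫ sp (Algebra.TensorProduct.includeLeft : A →ₐ[k] A ⊗[k] Γ(X₀, U)) =
        sp (Algebra.TensorProduct.includeLeft : A →ₐ[k] A ⊗[k] Γ(X₀, P)) := fun hP ↦ by
      rw [sp_comp]
      congr 1
      ext; simp [tres]
    rintro (_ | _)
    · change sp (tres k A hW) ≫ _ = sp (tres k A hW) ≫ _
      rw [← Category.assoc, hτ₂, h₂.comp_f, aux]
    · change sp (tres k A hV) ≫ _ = sp (tres k A hV) ≫ _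
      rw [← Category.assoc, hτ₁, h₁.comp_f, aux]

end Trivializations

/-! ### Affine opens described by rings of sections. -/

section AffineOpens

variable {X Y : Scheme.{u}} {S S' : Type u} [CommRing S] [CommRing S']

/-- The morphism `Spec S ⟶ X` given by an isomorphism of `S` with the ring of sections over an affine
open. -/
def ofSections {V : X.Opens} (hV : IsAffineOpen V) (θ : S ≃+* Γ(X, V)) : Spec (.of S) ⟶ X :=
  Spec.map (CommRingCat.ofHom (θ.symm : Γ(X, V) →+* S)) ≫ hV.fromSpec

variable {V : X.Opens} (hV : IsAffineOpen V) (θ : S ≃+* Γ(X, V))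

instance : IsOpenImmersion (ofSections hV θ) := by
  have : IsIso (CommRingCat.ofHom (θ.symm : Γ(X, V) →+* S)) :=
    (RingEquiv.toCommRingCatIso θ.symm).isIso_hom
  have := hV.isOpenImmersion_fromSpec
  unfold ofSections
  infer_instance

lemma exists_ofSections_eq (f : Spec (.of S) ⟶ X) [IsOpenImmersion f] (hf : Set.range f = V) :
    ∃ θ : S ≃+* Γ(X, V), ofSections hV θ = f := by
  have := hV.isOpenImmersion_fromSpec
  let e := IsOpenImmersion.isoOfRangeEq f hV.fromSpec (by rw [hf, hV.range_fromSpec])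
  refine ⟨(Iso.commRingCatIsoToRingEquiv (Scheme.Spec.preimageIso (X := Opposite.op (.of S))
    (Y := Opposite.op Γ(X, V)) e).unop).symm, ?_⟩
  refine Eq.trans ?_ (IsOpenImmersion.isoOfRangeEq_hom_fac f hV.fromSpec
    (by rw [hf, hV.range_fromSpec]))
  refine congrArg (· ≫ hV.fromSpec) ?_
  exact Scheme.Spec.map_preimage (X := Opposite.op (.of S)) (Y := Opposite.op Γ(X, V)) e.hom

lemma ofSections_eq_iff (g : S →+* S') (ψ : Γ(X, V) →+* S') :
    Spec.map (CommRingCat.ofHom g) ≫ ofSections hV θ =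
      Spec.map (CommRingCat.ofHom ψ) ≫ hV.fromSpec ↔ ∀ x, ψ (θ x) = g x := by
  have := hV.isOpenImmersion_fromSpec
  rw [ofSections, ← Category.assoc, cancel_mono, ← Spec.map_comp, Spec.map_inj]
  constructor
  · intro h x
    have := DFunLike.congr_fun (CommRingCat.hom_ext_iff.1 h) (θ x)
    refine this.symm.trans (congrArg g (θ.symm_apply_apply x))
  · intro h
    ext x
    refine (h _).symm.trans (congrArg ψ (θ.apply_symm_apply x))

lemma ofSections_comp_eq_iff {A : Type u} [CommRing A] (f : X ⟶ Spec (.of A)) (g : A →+* S) :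
    ofSections hV θ ≫ f = Spec.map (CommRingCat.ofHom g) ↔
      ∀ a, θ (g a) = (f.appLE ⊤ V (le_of_le_of_eq le_top rfl)).hom
        ((Scheme.ΓSpecIso (.of A)).inv.hom a) := by
  have h := IsAffineOpen.SpecMap_appLE_fromSpec f (isAffineOpen_top _) hV
    (le_of_le_of_eq le_top rfl)
  rw [IsAffineOpen.fromSpec_top, Scheme.isoSpec_Spec_inv, ← Spec.map_comp] at h
  rw [ofSections, Category.assoc, ← h, ← Spec.map_comp, Spec.map_inj]
  constructor
  · intro h a
    have := DFunLike.congr_fun (CommRingCat.hom_ext_iff.1 h) a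
    exact (θ.symm_apply_eq.1 this).symm
  · intro h
    ext a
    exact θ.symm_apply_eq.2 (h a).symm

end AffineOpens

/-! ### Atlases with prescribed transition maps. -/

section Induces

variable {k : Type u} [Field k] {X₀ : Scheme.{u}} [X₀.Over (Spec (.of k))]
  [IsSeparated (X₀ ↘ Spec (.of k))] {ι : Type*} {U : ι → X₀.affineOpens}
  {A : Type u} [CommRing A] [Algebra k A] [ArtinLocal k A]
  {B : Type u} [CommRing B] [Algebra k B] [ArtinLocal k B]

/-- The trivializations `τ` over the cover form an atlas of `𝒳` with transition maps `D`. -/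
structure IsAtlas (D : Gluing k U A) (𝒳 : Deformation k X₀ A)
    (τ : ∀ α, Spec (.of (A ⊗[k] Γ(X₀, U α))) ⟶ 𝒳.X) : Prop where
  isTriv : ∀ α, IsTriv 𝒳 (fs (U α)) (τ α)
  glue : ∀ α β, sp (HS.hom (D α β)) ≫ sp (tres k A (inter₂_le_left α β)) ≫ τ α =
    sp (tres k A (inter₂_le_right α β)) ≫ τ β

lemma range_eq_of_preimage {𝒳 : Deformation k X₀ A} {S : Set 𝒳.X} {T : Set X₀}
    (h : 𝒳.i ⁻¹' S = T) : S = 𝒳.i '' T := by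
  rw [← h, Set.image_preimage_eq _ 𝒳.i.surjective]

lemma IsTriv.range_eq' {𝒳 : Deformation k X₀ A} {W : X₀.affineOpens}
    {τ : Spec (.of (A ⊗[k] Γ(X₀, W))) ⟶ 𝒳.X} (h : IsTriv 𝒳 (fs W) τ) {V : 𝒳.X.Opens}
    (hV : 𝒳.i ⁻¹ᵁ V = W) : Set.range τ = V := by
  rw [range_eq_of_preimage h.preimage_range]
  refine (range_eq_of_preimage ?_).symm
  exact congrArg (fun O : X₀.Opens ↦ (O : Set X₀)) hV

lemma isTriv_ofSections_iff {𝒳 : Deformation k X₀ A} {W : X₀.affineOpens} {V : 𝒳.X.Opens}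
    (hVa : IsAffineOpen V) (hV : 𝒳.i ⁻¹ᵁ V = W) (θ : A ⊗[k] Γ(X₀, W) ≃+* Γ(𝒳.X, V)) :
    IsTriv 𝒳 (fs W) (ofSections hVa θ) ↔
    (∀ a : A, θ (a ⊗ₜ 1) = (𝒳.f.appLE ⊤ V (le_of_le_of_eq le_top rfl)).hom
        ((Scheme.ΓSpecIso (.of A)).inv.hom a)) ∧
    (∀ x, (𝒳.i.appLE V W hV.ge).hom (θ x) = red k A Γ(X₀, W) x) := by
  have h1 := ofSections_comp_eq_iff hVa θ 𝒳.f
    ((Algebra.TensorProduct.includeLeft : A →ₐ[k] A ⊗[k] Γ(X₀, W)) : A →+* _)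
  have h2 := ofSections_eq_iff hVa θ ((red k A Γ(X₀, W) : _ →+* _)) (𝒳.i.appLE V W hV.ge).hom
  have h3 : Spec.map (CommRingCat.ofHom (𝒳.i.appLE V W hV.ge).hom) ≫ hVa.fromSpec =
      fs W ≫ 𝒳.i := IsAffineOpen.SpecMap_appLE_fromSpec 𝒳.i hVa W.2 hV.ge
  rw [h3] at h2
  exact ⟨fun h ↦ ⟨h1.1 h.comp_f, h2.1 h.red_comp⟩, fun h ↦ ⟨inferInstance, h1.2 h.1, h2.2 h.2⟩⟩

lemma ofSections_res_iff {X : Scheme.{u}} {V W : X.Opens} (hV : IsAffineOpen V)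
    (hW : IsAffineOpen W) (h : W ≤ V) {S S' : Type u} [CommRing S] [CommRing S']
    (θ : S ≃+* Γ(X, V)) (e : S' ≃+* Γ(X, W)) (g : S →+* S') :
    Spec.map (CommRingCat.ofHom g) ≫ ofSections hV θ = ofSections hW e ↔
      ∀ x, e (g x) = (X.presheaf.map (homOfLE h).op).hom (θ x) := by
  have h1 := ofSections_eq_iff hV θ g
    ((e.symm : Γ(X, W) →+* S').comp (X.presheaf.map (homOfLE h).op).hom)
  have h2 : Spec.map (CommRingCat.ofHom
      ((e.symm : Γ(X, W) →+* S').comp (X.presheaf.map (homOfLE h).op).hom)) ≫ hV.fromSpec =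
      ofSections hW e := by
    rw [ofSections, ← IsAffineOpen.map_fromSpec hV hW (homOfLE h).op, ← Category.assoc,
      ← Spec.map_comp]
    rfl
  rw [h2] at h1
  rw [h1]
  exact forall_congr' fun x ↦ ⟨fun h ↦ by rw [← h]; exact e.apply_symm_apply _,
    fun h ↦ e.symm_apply_eq.2 h.symm⟩

lemma sp_gluing {D : Gluing k U A} {α β : ι} :
    sp (HS.hom (D α β)) ≫ sp (tres k A (inter₂_le_left α β)) =
      Spec.map (CommRingCat.ofHom (((HS.hom (D α β)).comp (tres k A (inter₂_le_left α β)) :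
        _ →ₐ[k] _) : A ⊗[k] Γ(X₀, U α) →+* A ⊗[k] Γ(X₀, inter₂ k U α β))) :=
  sp_comp _ _

/-- Translates rings of sections into open immersions Spec (A ⊗ R_α) ⟶ 𝒳, the language in which
restricting, comparing and gluing are done. -/
lemma induces_iff {D : Gluing k U A} {𝒳 : Deformation k X₀ A} :
    D.Induces 𝒳 ↔ ∃ τ, IsAtlas D 𝒳 τ := by
  constructor
  · rintro ⟨V, hV, θ, h1, h2, h3⟩
    have ht : ∀ α, IsTriv 𝒳 (fs (U α)) (ofSections (V α).2 (θ α)) := fun α ↦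
      (isTriv_ofSections_iff (V α).2 (hV α) (θ α)).2 ⟨h1 α, h2 α⟩
    refine ⟨fun α ↦ ofSections (V α).2 (θ α), ht, fun α β ↦ ?_⟩
    obtain ⟨e, he1, he2⟩ := h3 α β
    have hVV : 𝒳.i ⁻¹ᵁ ((V α : 𝒳.X.Opens) ⊓ V β) = inter₂ k U α β := by
      rw [Scheme.Hom.preimage_inf, hV, hV]; rfl
    have hr := ((ht α).res (inter₂_le_left α β)).range_eq' hVV
    have hVa : IsAffineOpen ((V α : 𝒳.X.Opens) ⊓ V β) := by
      have := ((ht α).res (inter₂_le_left (k := k) α β)).isOpenImmersion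
      have h4 := isAffineOpen_opensRange (sp (tres k A (inter₂_le_left (k := k) α β)) ≫
        ofSections (V α).2 (θ α))
      rwa [show ((V α : 𝒳.X.Opens) ⊓ V β) = Scheme.Hom.opensRange _ from
        TopologicalSpace.Opens.ext hr.symm]
    have h5 : sp (tres k A (inter₂_le_right α β)) ≫ ofSections (V β).2 (θ β) = ofSections hVa e :=
      (ofSections_res_iff (V β).2 hVa inf_le_right (θ β) e _).2 he1
    have h6 := (ofSections_res_iff (V α).2 hVa inf_le_left (θ α) e
      (((HS.hom (D α β)).comp (tres k A (inter₂_le_left α β)) : _ →ₐ[k] _) : _ →+* _)).2 he2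
    rw [← sp_gluing] at h6
    rw [← Category.assoc, h6]
    exact h5.symm
  · rintro ⟨τ, ht, hg⟩
    have := fun α ↦ (ht α).isOpenImmersion
    let V : ι → 𝒳.X.affineOpens := fun α ↦ ⟨(τ α).opensRange, isAffineOpen_opensRange _⟩
    have hV : ∀ α, 𝒳.i ⁻¹ᵁ (V α : 𝒳.X.Opens) = U α := fun α ↦
      TopologicalSpace.Opens.ext (ht α).preimage_range
    choose θ hθ using fun α ↦ exists_ofSections_eq (V α).2 (τ α) rfl
    have ht' : ∀ α, IsTriv 𝒳 (fs (U α)) (ofSections (V α).2 (θ α)) := fun α ↦ by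
      rw [hθ]; exact ht α
    have ht'' := fun α ↦ (isTriv_ofSections_iff (V α).2 (hV α) (θ α)).1 (ht' α)
    refine ⟨V, hV, θ, fun α ↦ (ht'' α).1, fun α ↦ (ht'' α).2, fun α β ↦ ?_⟩
    have hVV : 𝒳.i ⁻¹ᵁ ((V α : 𝒳.X.Opens) ⊓ V β) = inter₂ k U α β := by
      rw [Scheme.Hom.preimage_inf, hV, hV]; rfl
    have hr := ((ht β).res (inter₂_le_right α β)).range_eq' hVV
    have ho := ((ht β).res (inter₂_le_right (k := k) α β)).isOpenImmersion
    have hVa : IsAffineOpen ((V α : 𝒳.X.Opens) ⊓ V β) := by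
      have h4 := isAffineOpen_opensRange (sp (tres k A (inter₂_le_right (k := k) α β)) ≫ τ β)
      rwa [show ((V α : 𝒳.X.Opens) ⊓ V β) = Scheme.Hom.opensRange _ from
        TopologicalSpace.Opens.ext hr.symm]
    obtain ⟨e, he⟩ := exists_ofSections_eq hVa
      (sp (tres k A (inter₂_le_right (k := k) α β)) ≫ τ β) hr
    refine ⟨e, ?_, ?_⟩
    · refine (ofSections_res_iff (V β).2 hVa inf_le_right (θ β) e
        (tres k A (inter₂_le_right (k := k) (U := U) α β) :
          A ⊗[k] Γ(X₀, U β) →+* A ⊗[k] Γ(X₀, inter₂ k U α β))).1 ?_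
      rw [he, hθ]
      rfl
    · refine (ofSections_res_iff (V α).2 hVa inf_le_left (θ α) e
        (((HS.hom (D α β)).comp (tres k A (inter₂_le_left α β)) : _ →ₐ[k] _) : _ →+* _)).1 ?_
      rw [he, hθ, ← sp_gluing, Category.assoc]
      exact hg α β

end Induces

/-! ### Base change of trivializations and atlases. -/

section BaseChange

variable {k : Type u} [Field k] {X₀ : Scheme.{u}} [X₀.Over (Spec (.of k))]
  {A : Type u} [CommRing A] [Algebra k A] [ArtinLocal k A]
  {B : Type u} [CommRing B] [Algebra k B] [ArtinLocal k B]
  {𝒴 : Deformation k X₀ B} {R : Type u} [CommRing R] [Algebra k R]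

/-- The projection of a base change of a deformation. -/
def Deformation.proj (φ : B →ₐ[k] A) (𝒴 : Deformation k X₀ B) : (𝒴.baseChange φ).X ⟶ 𝒴.X :=
  pullback.fst _ _

lemma Deformation.isPullback_proj (φ : B →ₐ[k] A) (𝒴 : Deformation k X₀ B) :
    IsPullback (𝒴.proj φ) (𝒴.baseChange φ).f 𝒴.f (sp φ) :=
  IsPullback.of_hasPullback _ _

lemma Deformation.baseChange_i_proj (φ : B →ₐ[k] A) (𝒴 : Deformation k X₀ B) :
    (𝒴.baseChange φ).i ≫ 𝒴.proj φ = 𝒴.i :=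
  𝒴.baseChange_i_fst φ

lemma IsTriv.comp_over {v : Spec (.of R) ⟶ X₀}
    {τ : Spec (.of (B ⊗[k] R)) ⟶ 𝒴.X} (h : IsTriv 𝒴 v τ) :
    v ≫ (X₀ ↘ Spec (.of k)) = sp (Algebra.ofId k R) := by
  have h5 : (red k B R).comp Algebra.TensorProduct.includeLeft =
      (Algebra.ofId k R).comp (residue k B) := by
    ext a; simp [Algebra.ofId_apply, Algebra.algebraMap_eq_smul_one]
  have : Mono (sp (residue k B)) := inferInstance
  rw [← cancel_mono (sp (residue k B)), Category.assoc, ← Deformation.w (𝒳 := 𝒴),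
    ← Category.assoc, ← h.red_comp, Category.assoc, h.comp_f, sp_comp, sp_comp, h5]

/-- The base change of a trivialization. -/
lemma IsTriv.exists_baseChange (φ : B →ₐ[k] A) {v : Spec (.of R) ⟶ X₀}
    {τ : Spec (.of (B ⊗[k] R)) ⟶ 𝒴.X} (h : IsTriv 𝒴 v τ) :
    ∃ τ', IsTriv (𝒴.baseChange φ) v τ' ∧
      τ' ≫ 𝒴.proj φ = sp (Algebra.TensorProduct.map φ (AlgHom.id k R)) ≫ τ := by
  have hp := isPullback_tensor_baseChange (R := R) φ
  rw [← h.comp_f] at hp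
  have hq := 𝒴.isPullback_proj φ
  let τ' : Spec (.of (A ⊗[k] R)) ⟶ (𝒴.baseChange φ).X :=
    hq.lift (sp (Algebra.TensorProduct.map φ (AlgHom.id k R)) ≫ τ)
      (sp (Algebra.TensorProduct.includeLeft : A →ₐ[k] A ⊗[k] R)) (by
        rw [Category.assoc]; exact hp.w)
  have h1 : τ' ≫ 𝒴.proj φ = sp (Algebra.TensorProduct.map φ (AlgHom.id k R)) ≫ τ :=
    hq.lift_fst _ _ _
  have h2 : τ' ≫ (𝒴.baseChange φ).f = sp Algebra.TensorProduct.includeLeft := hq.lift_snd _ _ _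
  refine ⟨τ', ⟨?_, h2, ?_⟩, h1⟩
  · rw [← h2] at hp
    have h3 : IsPullback (sp (Algebra.TensorProduct.map φ (AlgHom.id k R))) τ' τ (𝒴.proj φ) :=
      IsPullback.of_bot hp h1.symm hq
    exact MorphismProperty.of_isPullback (P := @IsOpenImmersion) h3 h.isOpenImmersion
  · refine hq.hom_ext ?_ ?_
    · rw [Category.assoc, h1, Category.assoc, 𝒴.baseChange_i_proj, ← h.red_comp, ← Category.assoc,
        sp_comp]
      congr 2
      refine AlgHom.ext fun x ↦ ?_
      exact red_map φ (AlgHom.id k R) x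
    · have h4 : (residue k A).comp φ = residue k B := AlgHom.ext fun b ↦ residue_map φ b
      have h5 : (red k A R).comp Algebra.TensorProduct.includeLeft =
          (Algebra.ofId k R).comp (residue k A) := by
        ext a; simp [Algebra.ofId_apply, Algebra.algebraMap_eq_smul_one]
      rw [Category.assoc, h2, Category.assoc, Deformation.w, sp_comp, h5, ← sp_comp,
        ← h.comp_over, Category.assoc]

lemma IsAtlas.exists_baseChange [IsSeparated (X₀ ↘ Spec (.of k))] {ι : Type*}
    {U : ι → X₀.affineOpens} {D : Gluing k U B} (φ : B →ₐ[k] A)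
    {τ : ∀ α, Spec (.of (B ⊗[k] Γ(X₀, U α))) ⟶ 𝒴.X} (h : IsAtlas D 𝒴 τ) :
    ∃ τ', IsAtlas (D.baseChange φ) (𝒴.baseChange φ) τ' := by
  choose τ' ht hp using fun α ↦ (h.isTriv α).exists_baseChange φ
  refine ⟨τ', ht, fun α β ↦ ?_⟩
  have key : ∀ {V W : X₀.affineOpens} (hWV : W ≤ V),
      (Algebra.TensorProduct.map φ (AlgHom.id k _)).comp (tres k B hWV) =
      (tres k A hWV).comp (Algebra.TensorProduct.map φ (AlgHom.id k _)) := fun hWV ↦ by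
    ext <;> simp [tres]
  refine (𝒴.isPullback_proj φ).hom_ext ?_ ?_
  · simp only [Category.assoc, hp]
    rw [sp_comp_assoc _ (tres k A _), ← key, ← sp_comp_assoc, sp_comp_assoc _ (tres k A _), ← key,
      ← sp_comp_assoc, ← h.glue, sp_comp_assoc _ (HS.hom _),
      sp_comp_assoc (HS.hom (D α β))]
    congr 2
    exact (HS.compat_baseChange φ (D α β)).comp_hom.symm
  · have aux : ∀ {V W : X₀.affineOpens} (hWV : W ≤ V),
      (tres k A hWV).comp Algebra.TensorProduct.includeLeft =
        (Algebra.TensorProduct.includeLeft : A →ₐ[k] A ⊗[k] Γ(X₀, W)) := fun hWV ↦ by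
      ext; simp [tres]
    simp only [Category.assoc, (ht _).comp_f, sp_comp, aux, HS.hom_comp_includeLeft]

end BaseChange

/-! ### Locally trivial deformations are trivial over affine opens. -/

section LocallyTrivial

variable {k : Type u} [Field k] {X₀ : Scheme.{u}} [X₀.Over (Spec (.of k))]
  {A : Type u} [CommRing A] [Algebra k A] [ArtinLocal k A]
  {𝒳 : Deformation k X₀ A}

lemma red_comp_includeRight {R : Type u} [CommRing R] [Algebra k R] :
    (red k A R).comp Algebra.TensorProduct.includeRight = AlgHom.id k R := by
  ext; simp

lemma red_comp_includeLeft {R : Type u} [CommRing R] [Algebra k R] :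
    (red k A R).comp Algebra.TensorProduct.includeLeft =
      (Algebra.ofId k R).comp (residue k A) := by
  ext a; simp [Algebra.ofId_apply, Algebra.algebraMap_eq_smul_one]

/-- A product structure V = U × Spec A restricts: the part of V over an affine W ⊆ U is Spec (A ⊗
Γ(X₀, W)). -/
lemma exists_isTriv_of_isPullback {U : X₀.Opens} {V : 𝒳.X.Opens} (h : 𝒳.i ⁻¹ᵁ V = U)
    {r : V.toScheme ⟶ U.toScheme}
    (hr : IsPullback r (V.ι ≫ 𝒳.f) (U.ι ≫ X₀ ↘ Spec (.of k)) (sp (Algebra.ofId k A)))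
    (hri : 𝒳.i.resLE V U h.ge ≫ r = 𝟙 _) {W : X₀.affineOpens} (hW : (W : X₀.Opens) ≤ U) :
    ∃ τ, IsTriv 𝒳 (fs W) τ := by
  obtain ⟨w, hw⟩ : ∃ w : Spec (.of Γ(X₀, W)) ⟶ U.toScheme, w ≫ U.ι = fs W :=
    ⟨IsOpenImmersion.lift U.ι (fs W) (by rw [range_fs, Scheme.Opens.range_ι]; exact hW),
      IsOpenImmersion.lift_fac _ _ _⟩
  have hwo : IsOpenImmersion w := by
    have : IsOpenImmersion (w ≫ U.ι) := hw ▸ inferInstance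
    exact .of_comp w U.ι
  have hp := isPullback_tensor (k := k) (A := A) (R := Γ(X₀, W))
  rw [← fs_over, ← hw, Category.assoc] at hp
  let τ' : Spec (.of (A ⊗[k] Γ(X₀, W))) ⟶ V.toScheme := hr.lift
    (sp Algebra.TensorProduct.includeRight ≫ w) (sp Algebra.TensorProduct.includeLeft)
    (by rw [Category.assoc]; exact hp.w)
  have h1 : τ' ≫ r = sp Algebra.TensorProduct.includeRight ≫ w := hr.lift_fst _ _ _
  have h2 : τ' ≫ V.ι ≫ 𝒳.f = sp Algebra.TensorProduct.includeLeft := hr.lift_snd _ _ _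
  have ho : IsOpenImmersion τ' := by
    rw [← h2] at hp
    exact MorphismProperty.of_isPullback (P := @IsOpenImmersion)
      (IsPullback.of_bot hp h1.symm hr) hwo
  have h3 : sp (red k A Γ(X₀, W)) ≫ τ' = w ≫ 𝒳.i.resLE V U h.ge := by
    refine hr.hom_ext ?_ ?_
    · rw [Category.assoc, h1, ← Category.assoc, sp_comp, red_comp_includeRight, sp_id,
        Category.assoc, hri, Category.id_comp, Category.comp_id]
    · rw [Category.assoc, h2, Category.assoc, Scheme.Hom.resLE_comp_ι_assoc, 𝒳.w, ← Category.assoc,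
        hw, ← Category.assoc, fs_over, sp_comp, sp_comp, red_comp_includeLeft]
  refine ⟨τ' ≫ V.ι, inferInstance, by rw [Category.assoc, h2], ?_⟩
  rw [← Category.assoc, h3, Category.assoc, Scheme.Hom.resLE_comp_ι, ← Category.assoc, hw]

lemma Deformation.IsLocallyTrivial.exists_isTriv_nhd (h : 𝒳.IsLocallyTrivial) (x : X₀) :
    ∃ W : X₀.affineOpens, x ∈ (W : X₀.Opens) ∧ ∃ τ, IsTriv 𝒳 (fs W) τ := by
  obtain ⟨U, V, hV, r, hx, hr, hri⟩ := h x
  obtain ⟨W, hW, hxW, hWU⟩ := 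
    TopologicalSpace.Opens.isBasis_iff_nbhd.1 X₀.isBasis_affineOpens hx
  exact ⟨⟨W, hW⟩, hxW, exists_isTriv_of_isPullback hV hr hri (W := ⟨W, hW⟩) hWU⟩

lemma Deformation.IsLocallyTrivial.of_exists_isTriv
    (h : ∀ x : X₀, ∃ W : X₀.affineOpens, x ∈ (W : X₀.Opens) ∧ ∃ τ, IsTriv 𝒳 (fs W) τ) :
    𝒳.IsLocallyTrivial := by
  intro x
  obtain ⟨W, hx, τ, hτ⟩ := h x
  have := hτ.isOpenImmersion
  let V := τ.opensRange
  have hV : 𝒳.i ⁻¹ᵁ V = W := TopologicalSpace.Opens.ext hτ.preimage_range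
  let e : Spec (.of (A ⊗[k] Γ(X₀, W))) ≅ V.toScheme :=
    IsOpenImmersion.isoOfRangeEq τ V.ι (by rw [Scheme.Opens.range_ι]; rfl)
  have he : e.hom ≫ V.ι = τ := IsOpenImmersion.isoOfRangeEq_hom_fac _ _ _
  let d : Spec (.of Γ(X₀, W)) ≅ (W : X₀.Opens).toScheme :=
    IsOpenImmersion.isoOfRangeEq (fs W) (W : X₀.Opens).ι
      (by rw [Scheme.Opens.range_ι, range_fs])
  have hd : d.hom ≫ (W : X₀.Opens).ι = fs W := IsOpenImmersion.isoOfRangeEq_hom_fac _ _ _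
  refine ⟨W, V, hV, e.inv ≫ sp Algebra.TensorProduct.includeRight ≫ d.hom, hx, ?_, ?_⟩
  · refine IsPullback.of_iso (isPullback_tensor (k := k) (A := A) (R := Γ(X₀, W))) e d (Iso.refl _)
      (Iso.refl _) ?_ ?_ ?_ ?_
    · simp
    · rw [← Category.assoc, he, hτ.comp_f, Iso.refl_hom, Category.comp_id]
    · rw [← Category.assoc, hd, fs_over, Iso.refl_hom, Category.comp_id]
    · rw [Iso.refl_hom, Iso.refl_hom, Category.comp_id, Category.id_comp]
      rfl
  · have h1 : d.hom ≫ 𝒳.i.resLE V W hV.ge = sp (red k A Γ(X₀, W)) ≫ e.hom := by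
      rw [← cancel_mono V.ι, Category.assoc, Category.assoc, he, hτ.red_comp,
        Scheme.Hom.resLE_comp_ι, ← Category.assoc, hd]
    rw [← cancel_epi d.hom, ← Category.assoc, h1, Category.assoc, e.hom_inv_id_assoc,
      sp_comp_assoc, red_comp_includeRight, sp_id, Category.id_comp, Category.comp_id]

lemma isAwayHom_resHom {U V : X₀.affineOpens} (h : V ≤ U) {f : Γ(X₀, U)}
    (hV : (V : X₀.Opens) = X₀.basicOpen f) :
    IsAwayHom (resHom k (show (V : X₀.Opens) ≤ U from h)) f := by
  let i : (V : X₀.Opens) ⟶ (U : X₀.Opens) := homOfLE h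
  letI : Algebra Γ(X₀, U) Γ(X₀, V) := (X₀.presheaf.map i.op).hom.toAlgebra
  have : IsLocalization.Away f Γ(X₀, V) := U.2.isLocalization_of_eq_basicOpen f i hV
  exact .of_isLocalization fun x ↦ rfl

instance finiteType_sections [LocallyOfFiniteType (X₀ ↘ Spec (.of k))] (V : X₀.affineOpens) :
    Algebra.FiniteType k Γ(X₀, V) := by
  have h1 := Scheme.Hom.finiteType_appLE (X₀ ↘ Spec (.of k)) (isAffineOpen_top _) V.2
    (le_of_le_of_eq le_top rfl)
  have h2 : (Scheme.ΓSpecIso (.of k)).inv.hom.FiniteType :=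
    .of_surjective _ (ConcreteCategory.bijective_of_isIso (Scheme.ΓSpecIso (.of k)).inv).2
  exact h1.comp h2

/-- On D(fg) the two trivializations differ by an element of HS^A. Splitting it into factors from
D(f) and D(g) allows each trivialization to be corrected so that they agree and glue. -/
lemma exists_isTriv_of_isCoprime [IsAlgClosed k] (p : ℕ) [Fact p.Prime] [CharP k p]
    [LocallyOfFiniteType (X₀ ↘ Spec (.of k))] {U : X₀.affineOpens} {f g : Γ(X₀, U)}
    (hfg : IsCoprime f g) (hf : ∃ τ, IsTriv 𝒳 (fs (X₀.affineBasicOpen f)) τ)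
    (hg : ∃ τ, IsTriv 𝒳 (fs (X₀.affineBasicOpen g)) τ) : ∃ τ, IsTriv 𝒳 (fs U) τ := by
  obtain ⟨τ₁, h₁⟩ := hf
  obtain ⟨τ₂, h₂⟩ := hg
  set V := X₀.affineBasicOpen f
  set W := X₀.affineBasicOpen g
  have hV : V ≤ U := X₀.affineBasicOpen_le f
  have hW : W ≤ U := X₀.affineBasicOpen_le g
  let I : X₀.affineOpens := X₀.affineBasicOpen (f * g)
  have hI : (I : X₀.Opens) = (V : X₀.Opens) ⊓ W := X₀.basicOpen_mul f g
  have hIV : I ≤ V := show (I : X₀.Opens) ≤ V from hI ▸ inf_le_left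
  have hIW : I ≤ W := show (I : X₀.Opens) ≤ W from hI ▸ inf_le_right
  obtain ⟨D, hD⟩ := (h₁.res hIV).exists_eq (h₂.res hIW)
  have a₁ : IsAwayHom (resHom k (show (I : X₀.Opens) ≤ V from hIV))
      (resHom k (show (V : X₀.Opens) ≤ U from hV) g) :=
    isAwayHom_resHom hIV (by
      rw [hI]
      exact (X₀.basicOpen_res g (homOfLE (show (V : X₀.Opens) ≤ U from hV)).op).symm)
  have a₂ : IsAwayHom (resHom k (show (I : X₀.Opens) ≤ W from hIW))
      (resHom k (show (W : X₀.Opens) ≤ U from hW) f) :=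
    isAwayHom_resHom hIW (by
      rw [hI, inf_comm]
      exact (X₀.basicOpen_res f (homOfLE (show (W : X₀.Opens) ≤ U from hW)).op).symm)
  obtain ⟨E₁, E₂, F₁, F₂, c₁, c₂, rfl⟩ := HS.exists_splitting p hfg (fun r ↦ by
    rw [← AlgHom.comp_apply, ← AlgHom.comp_apply, resHom_comp, resHom_comp]) a₁ a₂ D
  obtain rfl := HS.eq_res hIV c₁
  obtain rfl := HS.eq_res hIW c₂
  refine IsTriv.exists_glue hV hW hIV hIW hI.ge ?_ (h₁.act E₁) (h₂.act E₂⁻¹) ?_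
  · have hs : Ideal.span {f, g} = ⊤ := by
      obtain ⟨a, b, hab⟩ := hfg
      exact (Ideal.eq_top_iff_one _).2 (Ideal.mem_span_pair.2 ⟨a, b, hab⟩)
    refine (U.2.self_le_iSup_basicOpen_iff.2 hs).trans (iSup_le ?_)
    rintro ⟨x, rfl | rfl⟩
    · exact le_sup_left
    · exact le_sup_right
  · rw [← Category.assoc, sp_tres_hom, ← Category.assoc (sp (tres k A hIW)), sp_tres_hom,
      Category.assoc, Category.assoc, ← hD, HS.res_inv, sp_comp_assoc (HS.hom (_ * _)),
      ← HS.hom_mul, inv_mul_cancel_left]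

/-- A locally trivial deformation of an algebraic scheme is trivial over every affine open. -/
theorem Deformation.IsLocallyTrivial.exists_isTriv [IsAlgClosed k] (p : ℕ) [Fact p.Prime]
    [CharP k p] [LocallyOfFiniteType (X₀ ↘ Spec (.of k))] (h : 𝒳.IsLocallyTrivial)
    (V : X₀.affineOpens) : ∃ τ, IsTriv 𝒳 (fs V) τ := by
  choose W hxW hW using h.exists_isTriv_nhd
  have mono : ∀ {V V' : X₀.affineOpens} (_ : V' ≤ V), (∃ τ, IsTriv 𝒳 (fs V) τ) →
      ∃ τ, IsTriv 𝒳 (fs V') τ := fun hle ⟨τ, hτ⟩ ↦ ⟨_, hτ.res hle⟩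
  refine of_affine_open_cover (P := fun V ↦ ∃ τ, IsTriv 𝒳 (fs V) τ) W ?_ V
    (fun U f ↦ mono (X₀.affineBasicOpen_le f)) ?_ hW
  · exact top_le_iff.1 fun x _ ↦ TopologicalSpace.Opens.mem_iSup.2 ⟨x, hxW x⟩
  intro U s hs hP
  -- The f over whose basic open 𝒳 is trivial form an ideal: on D(f + g) the restrictions of f and g
  -- are coprime, which gives closure under addition. As J contains generators of the unit ideal, it
  -- contains 1.
  let J : Ideal Γ(X₀, U) :=
    { carrier := {f | ∃ τ, IsTriv 𝒳 (fs (X₀.affineBasicOpen f)) τ}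
      add_mem' := by
        intro f g hf hg
        let U' := X₀.affineBasicOpen (f + g)
        have hU' : U' ≤ U := X₀.affineBasicOpen_le _
        let ρ := resHom k (show (U' : X₀.Opens) ≤ U from hU')
        have hle : ∀ x : Γ(X₀, U), X₀.affineBasicOpen (ρ x) ≤ X₀.affineBasicOpen x := fun x ↦
          (X₀.basicOpen_res x (homOfLE (show (U' : X₀.Opens) ≤ U from hU')).op).trans_le
            inf_le_right
        refine exists_isTriv_of_isCoprime p (f := ρ f) (g := ρ g) ?_ (mono (hle f) hf)
          (mono (hle g) hg)
        have hu : IsUnit (ρ (f + g)) := RingedSpace.isUnit_res_basicOpen _ (f + g)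
        obtain ⟨u, hu⟩ := hu.exists_left_inv
        exact ⟨u, u, by rw [← mul_add, ← map_add, hu]⟩
      zero_mem' := by
        let Z := X₀.affineBasicOpen (0 : Γ(X₀, U))
        have hZ : (Z : X₀.Opens) = ⊥ := X₀.basicOpen_zero U
        have e₁ : IsEmpty (Spec (.of Γ(X₀, Z))) := ⟨fun y ↦ by
          have hy : fs Z y ∈ (Z : X₀.Opens) := (range_fs Z).le ⟨y, rfl⟩
          exact hZ.le hy⟩
        have e₂ : IsEmpty (Spec (.of (A ⊗[k] Γ(X₀, Z)))) := ⟨fun y ↦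
          e₁.false ((sp (red k A Γ(X₀, Z))).surjective y).choose⟩
        exact ⟨isInitialOfIsEmpty.to _, inferInstance, isInitialOfIsEmpty.hom_ext _ _,
          isInitialOfIsEmpty.hom_ext _ _⟩
      smul_mem' := fun c f hf ↦ mono (show X₀.basicOpen (c * f) ≤ X₀.basicOpen f by
        rw [Scheme.basicOpen_mul]; exact inf_le_right) hf }
  have hJ : (1 : Γ(X₀, U)) ∈ J := by
    have : Ideal.span (s : Set Γ(X₀, U)) ≤ J := Ideal.span_le.2 fun f hf ↦ hP ⟨f, hf⟩
    exact this (hs ▸ trivial)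
  refine mono (show (U : X₀.Opens) ≤ X₀.basicOpen 1 from ?_) hJ
  rw [Scheme.basicOpen_of_isUnit _ isUnit_one]

end LocallyTrivial

/-! ### Gluing a deformation from a cocycle couple. -/

section Existence

variable {k : Type u} [Field k] {X₀ : Scheme.{u}} [X₀.Over (Spec (.of k))]
  [IsSeparated (X₀ ↘ Spec (.of k))] {ι : Type u} {U : ι → X₀.affineOpens}
  {A : Type u} [CommRing A] [Algebra k A] [ArtinLocal k A]

lemma Gluing.res_on (D : Gluing k U A) {α β : ι} {V W : X₀.affineOpens} (hα : V ≤ U α)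
    (hβ : V ≤ U β) (h : W ≤ V) :
    HS.res h (D.on α β hα hβ) = D.on α β (h.trans hα) (h.trans hβ) :=
  HS.res_res _ _ _

lemma Gluing.IsCocycle.on_mul_on {D : Gluing k U A} (hD : D.IsCocycle) {α β γ : ι}
    {W : X₀.affineOpens} (hα : W ≤ U α) (hβ : W ≤ U β) (hγ : W ≤ U γ) :
    D.on β γ hβ hγ * D.on α β hα hβ = D.on α γ hα hγ := by
  have hW : W ≤ inter₃ k U α β γ :=
    show (W : X₀.Opens) ≤ (U α : X₀.Opens) ⊓ U β ⊓ U γ from le_inf (le_inf hα hβ) hγ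
  have := congrArg (HS.res hW) (hD α β γ)
  rwa [HS.res_mul, Gluing.res_on, Gluing.res_on, Gluing.res_on] at this

variable (U) in
/-- The affine opens contained in a member of the cover. -/
structure SmallOpen where
  W : X₀.affineOpens
  α : ι
  le : W ≤ U α

/-- The order forgets α. One open with two indices gives two isomorphic objects of the gluing
diagram, the isomorphism being given by the couple, so a single diagram encodes both restriction and
transition maps. -/
instance : Preorder (SmallOpen U) := Preorder.lift SmallOpen.W

lemma SmallOpen.W_le {a b : SmallOpen U} (h : a ≤ b) : a.W ≤ b.W := h

/-- The transition morphism of the gluing. -/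
def Gluing.trans (D : Gluing k U A) {a b : SmallOpen U} (h : a ≤ b) :
    Spec (.of (A ⊗[k] Γ(X₀, a.W))) ⟶ Spec (.of (A ⊗[k] Γ(X₀, b.W))) :=
  sp (HS.hom (D.on b.α a.α ((SmallOpen.W_le h).trans b.le) a.le)) ≫ sp (tres k A (SmallOpen.W_le h))

instance (D : Gluing k U A) {a b : SmallOpen U} (h : a ≤ b) : IsOpenImmersion (D.trans h) := by
  unfold Gluing.trans; infer_instance

lemma Gluing.trans_comp {D : Gluing k U A} (hD : D.IsCocycle) {a b c : SmallOpen U} (h : a ≤ b)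
    (h' : b ≤ c) : D.trans h ≫ D.trans h' = D.trans (h.trans h') := by
  simp only [Gluing.trans, Category.assoc]
  rw [← Category.assoc (sp (tres k A _)), sp_tres_hom, Category.assoc, sp_tres_tres,
    ← Category.assoc, sp_comp, ← HS.hom_mul, Gluing.res_on, hD.on_mul_on]

lemma Gluing.trans_self {D : Gluing k U A} (hD : D.IsCouple) (a : SmallOpen U) :
    D.trans (le_refl a) = 𝟙 _ := by
  rw [Gluing.trans, Gluing.on, hD.1, HS.res_one, HS.hom_one, sp_id, Category.id_comp]
  exact (congrArg sp (tres_self a.W)).trans sp_id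

lemma Gluing.red_trans (D : Gluing k U A) {a b : SmallOpen U} (h : a ≤ b) :
    sp (red k A Γ(X₀, a.W)) ≫ D.trans h =
      sp (resHom k (show (a.W : X₀.Opens) ≤ b.W from h)) ≫ sp (red k A Γ(X₀, b.W)) := by
  rw [Gluing.trans, ← Category.assoc, sp_red_hom, sp_red_tres]

lemma Gluing.trans_left (D : Gluing k U A) {a b : SmallOpen U} (h : a ≤ b) :
    D.trans h ≫ sp (Algebra.TensorProduct.includeLeft : A →ₐ[k] A ⊗[k] Γ(X₀, b.W)) =
      sp (Algebra.TensorProduct.includeLeft : A →ₐ[k] A ⊗[k] Γ(X₀, a.W)) := by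
  have aux : (tres k A (SmallOpen.W_le h)).comp Algebra.TensorProduct.includeLeft =
      (Algebra.TensorProduct.includeLeft : A →ₐ[k] A ⊗[k] Γ(X₀, a.W)) := by
    ext; simp [tres]
  rw [Gluing.trans, Category.assoc, sp_comp, aux, sp_comp, HS.hom_comp_includeLeft]

/-- The gluing diagram of a couple satisfying the cocycle conditions. -/
def Gluing.diagram (D : Gluing k U A) (h : D.IsCouple) (hD : D.IsCocycle) :
    SmallOpen U ⥤ Scheme.{u} where
  obj a := Spec (.of (A ⊗[k] Γ(X₀, a.W)))
  map f := D.trans (leOfHom f)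
  map_id a := D.trans_self h a
  map_comp _ _ := (Gluing.trans_comp hD _ _).symm

variable {D : Gluing k U A} (h : D.IsCouple) (hD : D.IsCocycle)

instance {a b : SmallOpen U} (f : a ⟶ b) : IsOpenImmersion ((D.diagram h hD).map f) :=
  inferInstanceAs (IsOpenImmersion (D.trans (leOfHom f)))

lemma exists_red_eq {W : X₀.affineOpens} (y : Spec (.of (A ⊗[k] Γ(X₀, W)))) :
    ∃ x ∈ (W : X₀.Opens), ∃ z, fs W z = x ∧ sp (red k A Γ(X₀, W)) z = y := by
  obtain ⟨z, rfl⟩ := (sp (red k A Γ(X₀, W))).surjective y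
  exact ⟨fs W z, (range_fs W).le ⟨z, rfl⟩, z, rfl, rfl⟩

lemma fs_injective (W : X₀.affineOpens) : Function.Injective (fs W) :=
  (fs W).isOpenEmbedding.injective

lemma Gluing.trans_red_apply {a b : SmallOpen U} (hab : a ≤ b) {z : Spec (.of Γ(X₀, a.W))}
    {z' : Spec (.of Γ(X₀, b.W))} (hz : fs a.W z = fs b.W z') :
    D.trans hab (sp (red k A Γ(X₀, a.W)) z) = sp (red k A Γ(X₀, b.W)) z' := by
  rw [← Scheme.Hom.comp_apply, D.red_trans hab, Scheme.Hom.comp_apply]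
  congr 1
  refine fs_injective _ ?_
  rw [← hz, ← Scheme.Hom.comp_apply, sp_resHom_fs (SmallOpen.W_le hab)]

/-- The points of each chart are those of an open of X₀. Points of two charts with the same image in
a third are one point of X₀, which lies in the intersection; this is affine since X₀ is separated.
-/
instance : ((D.diagram h hD) ⋙ Scheme.forget).IsLocallyDirected where
  cond {a b c} fa fb xa xb hx := by
    obtain ⟨x, hxa, za, rfl, rfl⟩ := exists_red_eq xa
    obtain ⟨y, hyb, zb, rfl, rfl⟩ := exists_red_eq xb
    have hx' : D.trans (leOfHom fa) (sp (red k A Γ(X₀, a.W)) za) =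
      D.trans (leOfHom fb) (sp (red k A Γ(X₀, b.W)) zb) := hx
    have key : fs a.W za = fs b.W zb := by
      rw [← Scheme.Hom.comp_apply, ← Scheme.Hom.comp_apply, Gluing.red_trans, Gluing.red_trans,
        Scheme.Hom.comp_apply, Scheme.Hom.comp_apply] at hx'
      have := congrArg (fs c.W) (sp_red_injective hx')
      rwa [← Scheme.Hom.comp_apply, ← Scheme.Hom.comp_apply,
        sp_resHom_fs (SmallOpen.W_le (leOfHom fa)),
        sp_resHom_fs (SmallOpen.W_le (leOfHom fb))] at this
    let I : X₀.affineOpens := ⟨a.W ⊓ b.W, isAffineOpen_inf k a.W.2 b.W.2⟩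
    have hIa : I ≤ a.W := show (I : X₀.Opens) ≤ a.W from inf_le_left
    have hIb : I ≤ b.W := show (I : X₀.Opens) ≤ b.W from inf_le_right
    let l : SmallOpen U := ⟨I, a.α, hIa.trans a.le⟩
    obtain ⟨z, hz⟩ := (range_fs I).ge
      (show fs a.W za ∈ (I : X₀.Opens) from ⟨hxa, key ▸ hyb⟩)
    refine ⟨l, homOfLE (show l ≤ a from hIa), homOfLE (show l ≤ b from hIb),
      sp (red k A Γ(X₀, I)) z, ?_, ?_⟩
    · exact Gluing.trans_red_apply (D := D) (a := l) (b := a) hIa hz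
    · exact Gluing.trans_red_apply (D := D) (a := l) (b := b) hIb (hz.trans key)

/-- The scheme glued from the `Spec (A ⊗ R_α)`. -/
def glued : Scheme.{u} := colimit (D.diagram h hD)

/-- The chart of the glued scheme. -/
def chart (a : SmallOpen U) : Spec (.of (A ⊗[k] Γ(X₀, a.W))) ⟶ glued h hD :=
  colimit.ι (D.diagram h hD) a

instance (a : SmallOpen U) : IsOpenImmersion (chart h hD a) :=
  inferInstanceAs (IsOpenImmersion (colimit.ι (D.diagram h hD) a))

lemma trans_chart {a b : SmallOpen U} (hab : a ≤ b) : D.trans hab ≫ chart h hD b = chart h hD a :=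
  colimit.w (D.diagram h hD) (homOfLE hab)

lemma exists_chart_eq (x : glued h hD) : ∃ a y, chart h hD a y = x :=
  Scheme.IsLocallyDirected.ι_jointly_surjective (D.diagram h hD) x

/-- The structure morphism of the glued scheme. -/
def gluedStr : glued h hD ⟶ Spec (.of A) :=
  colimit.desc (D.diagram h hD)
    { pt := Spec (.of A)
      ι := { app := fun a ↦ sp (Algebra.TensorProduct.includeLeft : A →ₐ[k] A ⊗[k] Γ(X₀, a.W))
             naturality := fun _ _ f ↦ (Gluing.trans_left D (leOfHom f)).trans (Category.comp_id _).symm } }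

lemma chart_gluedStr (a : SmallOpen U) : chart h hD a ≫ gluedStr h hD =
    sp (Algebra.TensorProduct.includeLeft : A →ₐ[k] A ⊗[k] Γ(X₀, a.W)) :=
  colimit.ι_desc (F := D.diagram h hD) _ a

lemma fs_cover (hU : ⨆ α, (U α : X₀.Opens) = ⊤) (x : X₀) :
    ∃ (a : SmallOpen U) (z : Spec (.of Γ(X₀, a.W))), fs a.W z = x := by
  obtain ⟨α, hα⟩ := TopologicalSpace.Opens.mem_iSup.1 (hU.ge (Set.mem_univ x))
  obtain ⟨z, hz⟩ := (range_fs (U α)).ge hα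
  exact ⟨⟨U α, α, le_rfl⟩, z, hz⟩

lemma isPullback_fs {V W I : X₀.affineOpens} (hV : I ≤ V) (hW : I ≤ W)
    (hI : (V : X₀.Opens) ⊓ W ≤ I) :
    IsPullback (sp (resHom k (show (I : X₀.Opens) ≤ V from hV)))
      (sp (resHom k (show (I : X₀.Opens) ≤ W from hW))) (fs V) (fs W) := by
  have h1 := sp_resHom_fs (k := k) hV
  have h2 := sp_resHom_fs (k := k) hW
  have : IsOpenImmersion (sp (resHom k (show (I : X₀.Opens) ≤ V from hV)) ≫ fs V) := by
    rw [h1]; infer_instance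
  refine isPullback_of_range _ _ _ _ (h1.trans h2.symm) ?_
  rw [h1, range_fs, range_fs, range_fs]
  exact hI

lemma exists_gluedIncl (hU : ⨆ α, (U α : X₀.Opens) = ⊤) : ∃ i : X₀ ⟶ glued h hD,
    ∀ a : SmallOpen U, fs a.W ≫ i = sp (red k A Γ(X₀, a.W)) ≫ chart h hD a := by
  refine exists_glue (fun a : SmallOpen U ↦ fs a.W) (fun a ↦ inferInstance) (fs_cover hU) _
    fun a b ↦ ?_
  let I : X₀.affineOpens := ⟨a.W ⊓ b.W, isAffineOpen_inf k a.W.2 b.W.2⟩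
  have hIa : I ≤ a.W := show (I : X₀.Opens) ≤ a.W from inf_le_left
  have hIb : I ≤ b.W := show (I : X₀.Opens) ≤ b.W from inf_le_right
  let l : SmallOpen U := ⟨I, a.α, hIa.trans a.le⟩
  refine ⟨_, _, _, isPullback_fs (k := k) hIa hIb le_rfl, ?_⟩
  rw [← Category.assoc, ← Category.assoc]
  have e₁ := D.red_trans (a := l) (b := a) hIa
  have e₂ := D.red_trans (a := l) (b := b) hIb
  rw [← e₁, ← e₂, Category.assoc, Category.assoc, trans_chart, trans_chart]

/-- The comparison of X₀ with the closed fibre is an open immersion on each chart, by the reduction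
square of A ⊗ R, and it is bijective on points. -/
lemma isPullback_glued (hU : ⨆ α, (U α : X₀.Opens) = ⊤) {i : X₀ ⟶ glued h hD}
    (hi : ∀ a : SmallOpen U, fs a.W ≫ i = sp (red k A Γ(X₀, a.W)) ≫ chart h hD a) :
    IsPullback i (X₀ ↘ Spec (.of k)) (gluedStr h hD) (sp (residue k A)) := by
  have hw : i ≫ gluedStr h hD = (X₀ ↘ Spec (.of k)) ≫ sp (residue k A) := by
    refine hom_ext_of_cover (fun a : SmallOpen U ↦ fs a.W) (fun a ↦ inferInstance) (fs_cover hU)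
      fun a ↦ ?_
    rw [← Category.assoc, hi, Category.assoc, chart_gluedStr, ← Category.assoc, fs_over, sp_comp,
      sp_comp, red_comp_includeLeft]
  let w := pullback.lift i (X₀ ↘ Spec (.of k)) hw
  have hw₁ : w ≫ pullback.fst _ _ = i := pullback.lift_fst _ _ _
  have hw₂ : w ≫ pullback.snd _ _ = X₀ ↘ Spec (.of k) := pullback.lift_snd _ _ _
  have hfst : Function.Injective (pullback.fst (gluedStr h hD) (sp (residue k A))) :=
    (pullback.fst (gluedStr h hD) (sp (residue k A))).isClosedEmbedding.injective
  have hinj : Function.Injective i := by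
    intro x y hxy
    obtain ⟨a, za, rfl⟩ := fs_cover hU x
    obtain ⟨b, zb, rfl⟩ := fs_cover hU y
    rw [← Scheme.Hom.comp_apply, ← Scheme.Hom.comp_apply, hi, hi] at hxy
    obtain ⟨l, fa, fb, y, hy₁, hy₂⟩ := (Scheme.IsLocallyDirected.ι_eq_ι_iff
      (F := D.diagram h hD)).1 hxy
    obtain ⟨x, hx, z, rfl, rfl⟩ := exists_red_eq (W := l.W) y
    have aux : ∀ {c : SmallOpen U} (f : l ⟶ c) {zc : Spec (.of Γ(X₀, c.W))},
        (D.diagram h hD).map f (sp (red k A Γ(X₀, l.W)) z) = sp (red k A Γ(X₀, c.W)) zc →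
        fs l.W z = fs c.W zc := by
      intro c f zc hc
      change D.trans (leOfHom f) (sp (red k A Γ(X₀, l.W)) z) = _ at hc
      rw [← Scheme.Hom.comp_apply, D.red_trans, Scheme.Hom.comp_apply] at hc
      rw [← sp_red_injective hc, ← Scheme.Hom.comp_apply,
        sp_resHom_fs (SmallOpen.W_le (leOfHom f))]
    exact (aux fa hy₁).symm.trans (aux fb hy₂)
  have hwo : ∀ a : SmallOpen U, IsOpenImmersion (fs a.W ≫ w) := by
    intro a
    have h1 : IsPullback (fs a.W ≫ w) (sp (red k A Γ(X₀, a.W)))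
        (pullback.fst (gluedStr h hD) (sp (residue k A))) (chart h hD a) := by
      have h2 := isPullback_red (k := k) (A := A) (R := Γ(X₀, a.W))
      have h3 : (fs a.W ≫ w) ≫ pullback.snd _ _ = sp (Algebra.ofId k Γ(X₀, a.W)) := by
        rw [Category.assoc, hw₂, fs_over]
      rw [← chart_gluedStr h hD a, ← h3] at h2
      exact (IsPullback.of_bot h2 (by rw [Category.assoc, hw₁, hi])
        (IsPullback.of_hasPullback _ _)).flip
    exact MorphismProperty.of_isPullback (P := @IsOpenImmersion) h1.flip inferInstance
  have hwi : Function.Injective w := fun x y hxy ↦ hinj (by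
    rw [← hw₁, Scheme.Hom.comp_apply, hxy, Scheme.Hom.comp_apply])
  have h1 : IsOpenImmersion w := isOpenImmersion_of_cover (fun a : SmallOpen U ↦ fs a.W)
    (fun a ↦ inferInstance) (fs_cover hU) w hwo hwi
  have h2 : Surjective w := ⟨fun y ↦ by
    obtain ⟨a, z, hz⟩ := exists_chart_eq h hD
      (pullback.fst (gluedStr h hD) (sp (residue k A)) y)
    obtain ⟨z, rfl⟩ := (sp (red k A Γ(X₀, a.W))).surjective z
    refine ⟨fs a.W z, hfst ?_⟩
    rw [← Scheme.Hom.comp_apply w, hw₁, ← Scheme.Hom.comp_apply, hi, ← hz, Scheme.Hom.comp_apply]⟩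
  have h3 : IsIso w := (isIso_iff_isOpenImmersion_and_surjective w).2 ⟨h1, h2⟩
  exact .of_iso_pullback ⟨hw⟩ (asIso w) hw₁ hw₂

lemma isZariskiLocalAtSource_flat : IsZariskiLocalAtSource (@Flat.{u}) :=
  HasRingHomProperty.instIsZariskiLocalAtSource (P := @Flat.{u}) (Q := RingHom.Flat)

lemma flat_sp_includeLeft {R : Type u} [CommRing R] [Algebra k R] :
    Flat (sp (Algebra.TensorProduct.includeLeft : A →ₐ[k] A ⊗[k] R)) := by
  rw [sp, Flat.SpecMap_iff]
  change RingHom.Flat (algebraMap A (A ⊗[k] R))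
  rw [RingHom.flat_algebraMap_iff]
  infer_instance

lemma flat_chart (a : SmallOpen U) : Flat (chart h hD a ≫ gluedStr h hD) := by
  rw [chart_gluedStr]
  exact flat_sp_includeLeft

/-- A couple satisfying the cocycle conditions is the couple of an atlas of a locally trivial
deformation. -/
theorem Gluing.exists_isAtlas {D : Gluing k U A} (h : D.IsCouple) (hD : D.IsCocycle)
    (hU : ⨆ α, (U α : X₀.Opens) = ⊤) :
    ∃ 𝒳 : Deformation k X₀ A, 𝒳.IsLocallyTrivial ∧ ∃ τ, IsAtlas D 𝒳 τ := by
  obtain ⟨i, hi⟩ := exists_gluedIncl h hD hU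
  let 𝒳 : Deformation k X₀ A :=
    { X := glued h hD
      f := gluedStr h hD
      i := i
      flat := by
        have := isZariskiLocalAtSource_flat.{u}
        refine (IsZariskiLocalAtSource.iff_of_openCover (P := @Flat)
          (Scheme.IsLocallyDirected.openCover (D.diagram h hD))).2 fun a ↦ ?_
        exact flat_chart h hD a
      isPullback := isPullback_glued h hD hU hi }
  have ht : ∀ a : SmallOpen U, IsTriv 𝒳 (fs a.W) (chart h hD a) := fun a ↦
    ⟨inferInstance, chart_gluedStr h hD a, (hi a).symm⟩
  let top : ι → SmallOpen U := fun α ↦ ⟨U α, α, le_rfl⟩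
  refine ⟨𝒳, .of_exists_isTriv fun x ↦ ?_, fun α ↦ chart h hD (top α), fun α ↦ ht (top α),
    fun α β ↦ ?_⟩
  · obtain ⟨a, z, hz⟩ := fs_cover hU x
    exact ⟨a.W, (range_fs a.W).le ⟨z, hz⟩, _, ht a⟩
  · let a : SmallOpen U := ⟨inter₂ k U α β, β, inter₂_le_right (k := k) α β⟩
    have e₁ := trans_chart h hD (show a ≤ top α from inter₂_le_left (k := k) α β)
    have e₂ := trans_chart h hD (show a ≤ top β from inter₂_le_right (k := k) α β)
    have e₃ := e₁.trans e₂.symm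
    have o₁ : D.on α β (inter₂_le_left (k := k) α β) (inter₂_le_right (k := k) α β) = D α β := HS.res_self _
    have o₂ : D.on β β (inter₂_le_right (k := k) α β) (inter₂_le_right (k := k) α β) = 1 := by
      rw [Gluing.on, h.1, HS.res_one]
    simp only [Gluing.trans, Category.assoc] at e₃
    change sp (HS.hom (D.on α β _ _)) ≫ _ = sp (HS.hom (D.on β β _ _)) ≫ _ at e₃
    rw [o₁, o₂, HS.hom_one, sp_id, Category.id_comp] at e₃
    exact e₃

end Existence

/-! ### Couples up to isomorphism and classes of deformations. -/

section Classes

variable {k : Type u} [Field k] {X₀ : Scheme.{u}} [X₀.Over (Spec (.of k))]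
  [IsSeparated (X₀ ↘ Spec (.of k))] {ι : Type u} {U : ι → X₀.affineOpens}
  {A : Type u} [CommRing A] [Algebra k A] [ArtinLocal k A]
  {B : Type u} [CommRing B] [Algebra k B] [ArtinLocal k B]
  {D D' : Gluing k U A} {𝒳 𝒳' : Deformation k X₀ A}
  {τ : ∀ α, Spec (.of (A ⊗[k] Γ(X₀, U α))) ⟶ 𝒳.X} {τ' : ∀ α, Spec (.of (A ⊗[k] Γ(X₀, U α))) ⟶ 𝒳'.X}

lemma IsAtlas.cover (hU : ⨆ α, (U α : X₀.Opens) = ⊤) (h : IsAtlas D 𝒳 τ) (x : 𝒳.X) :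
    ∃ α y, τ α y = x := by
  obtain ⟨x, rfl⟩ := 𝒳.i.surjective x
  obtain ⟨α, hα⟩ := TopologicalSpace.Opens.mem_iSup.1 (hU.ge (Set.mem_univ x))
  exact ⟨α, (h.isTriv α).preimage_range.ge hα⟩

lemma IsAtlas.isPullback (h : IsAtlas D 𝒳 τ) (α β : ι) :
    IsPullback (sp (HS.hom (D α β)) ≫ sp (tres k A (inter₂_le_left α β)))
      (sp (tres k A (inter₂_le_right α β))) (τ α) (τ β) := by
  have := (h.isTriv α).isOpenImmersion
  have := (h.isTriv β).isOpenImmersion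
  have h1 := h.glue α β
  rw [← Category.assoc] at h1
  refine isPullback_of_range _ _ _ _ h1 ?_
  rw [h1, ((h.isTriv β).res (inter₂_le_right α β)).range_eq, (h.isTriv α).range_eq,
    (h.isTriv β).range_eq, ← Set.image_inter 𝒳.i_injective, range_fs, range_fs, range_fs]
  rfl

lemma IsAtlas.exists_hom (hU : ⨆ α, (U α : X₀.Opens) = ⊤) (h : IsAtlas D 𝒳 τ)
    (h' : IsAtlas D' 𝒳' τ') {E : ∀ α, HS k A Γ(X₀, U α)} (hE : D.IsHom D' E) :
    𝒳.IsIso 𝒳' := by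
  have ho := fun α ↦ (h.isTriv α).isOpenImmersion
  -- The charts use (E^α)⁻¹ because Spec reverses the order: agreement on overlaps amounts to D^{αβ}
  -- (E^α)⁻¹ = (E^β)⁻¹ D'^{αβ}.
  obtain ⟨m, hm⟩ := exists_glue τ ho (h.cover hU) (fun α ↦ sp (HS.hom (E α)⁻¹) ≫ τ' α)
    fun α β ↦ ⟨_, _, _, h.isPullback α β, by
      have h1 := hE α β
      have h2 : D α β * HS.res (inter₂_le_left α β) (E α)⁻¹ =
          HS.res (inter₂_le_right α β) (E β)⁻¹ * D' α β := by
        rw [HS.res_inv, HS.res_inv, eq_inv_mul_iff_mul_eq, ← mul_assoc, h1, mul_inv_cancel_right]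
      rw [Category.assoc, ← Category.assoc (sp (tres k A _)), sp_tres_hom, Category.assoc,
        ← Category.assoc (sp (HS.hom _)), sp_comp, ← HS.hom_mul, h2, ← Category.assoc (sp (tres k A _)),
        sp_tres_hom, Category.assoc, ← h'.glue, HS.hom_mul, ← sp_comp, Category.assoc]⟩
  have hmf : m ≫ 𝒳'.f = 𝒳.f := by
    refine hom_ext_of_cover τ ho (h.cover hU) fun α ↦ ?_
    rw [← Category.assoc, hm, Category.assoc, (h'.isTriv α).comp_f, (h.isTriv α).comp_f, sp_comp,
      HS.hom_comp_includeLeft]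
  have hmi : 𝒳.i ≫ m = 𝒳'.i := by
    refine hom_ext_of_cover (fun α ↦ fs (U α)) (fun α ↦ inferInstance) (fun x ↦ ?_) fun α ↦ ?_
    · obtain ⟨α, hα⟩ := TopologicalSpace.Opens.mem_iSup.1 (hU.ge (Set.mem_univ x))
      exact ⟨α, (range_fs (U α)).ge hα⟩
    · rw [← Category.assoc, ← (h.isTriv α).red_comp, Category.assoc, hm, ← Category.assoc,
        sp_red_hom, (h'.isTriv α).red_comp]
  have h1 : IsOpenImmersion m := by
    refine isOpenImmersion_of_cover τ ho (h.cover hU) m (fun α ↦ ?_) fun x y hxy ↦ ?_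
    · have := (h'.isTriv α).isOpenImmersion
      rw [hm]
      infer_instance
    · obtain ⟨x, rfl⟩ := 𝒳.i.surjective x
      obtain ⟨y, rfl⟩ := 𝒳.i.surjective y
      rw [← Scheme.Hom.comp_apply, ← Scheme.Hom.comp_apply, hmi] at hxy
      rw [𝒳'.i_injective hxy]
  have h2 : Surjective m := ⟨fun y ↦ by
    obtain ⟨y, rfl⟩ := 𝒳'.i.surjective y
    exact ⟨𝒳.i y, by rw [← Scheme.Hom.comp_apply, hmi]⟩⟩
  have h3 : CategoryTheory.IsIso m := (isIso_iff_isOpenImmersion_and_surjective m).2 ⟨h1, h2⟩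
  exact ⟨asIso m, hmf, hmi⟩

lemma IsTriv.of_isIso {R : Type u} [CommRing R] [Algebra k R] {v : Spec (.of R) ⟶ X₀}
    {τ : Spec (.of (A ⊗[k] R)) ⟶ 𝒳.X} (h : IsTriv 𝒳 v τ) {e : 𝒳.X ≅ 𝒳'.X}
    (he : e.hom ≫ 𝒳'.f = 𝒳.f) (he' : 𝒳.i ≫ e.hom = 𝒳'.i) : IsTriv 𝒳' v (τ ≫ e.hom) where
  isOpenImmersion := have := h.isOpenImmersion; inferInstance
  comp_f := by rw [Category.assoc, he, h.comp_f]
  red_comp := by rw [← Category.assoc, h.red_comp, Category.assoc, he']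

lemma IsAtlas.of_isIso (h : IsAtlas D 𝒳 τ) {e : 𝒳.X ≅ 𝒳'.X}
    (he : e.hom ≫ 𝒳'.f = 𝒳.f) (he' : 𝒳.i ≫ e.hom = 𝒳'.i) :
    IsAtlas D 𝒳' (fun α ↦ τ α ≫ e.hom) where
  isTriv α := (h.isTriv α).of_isIso he he'
  glue α β := by
    have := congrArg (· ≫ e.hom) (h.glue α β)
    simpa only [Category.assoc] using this

lemma IsAtlas.exists_isHom {τ' : ∀ α, Spec (.of (A ⊗[k] Γ(X₀, U α))) ⟶ 𝒳.X}
    (h : IsAtlas D 𝒳 τ) (h' : IsAtlas D' 𝒳 τ') : ∃ E, D.IsHom D' E := by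
  choose F hF using fun α ↦ (h'.isTriv α).exists_eq (h.isTriv α)
  refine ⟨fun α ↦ (F α)⁻¹, fun α β ↦ ?_⟩
  rw [HS.res_inv, HS.res_inv, inv_mul_eq_iff_eq_mul, ← mul_assoc, eq_mul_inv_iff_mul_eq]
  refine ((h'.isTriv α).res (inter₂_le_left α β)).eq_of_act ?_
  rw [HS.hom_mul, HS.hom_mul, ← sp_comp, ← sp_comp, Category.assoc, Category.assoc, h'.glue,
    ← Category.assoc (sp (HS.hom (HS.res _ (F α)))), ← sp_tres_hom, Category.assoc, hF, h.glue,
    ← Category.assoc, ← sp_tres_hom, Category.assoc, hF]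

/-- Couples satisfying the cocycle conditions are isomorphic if and only if they induce the same
class. -/
theorem Gluing.InducesClass.eq_iff (hU : ⨆ α, (U α : X₀.Opens) = ⊤) {X X' : LTDef k X₀ A}
    (h : D.InducesClass X) (h' : D'.InducesClass X') : X = X' ↔ ∃ E, D.IsHom D' E := by
  obtain ⟨𝒳, rfl, h⟩ := h
  obtain ⟨𝒳', rfl, h'⟩ := h'
  obtain ⟨τ, hτ⟩ := induces_iff.1 h
  obtain ⟨τ', hτ'⟩ := induces_iff.1 h'
  refine ⟨fun hX ↦ ?_, fun ⟨E, hE⟩ ↦ Quotient.sound (hτ.exists_hom hU hτ' hE)⟩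
  obtain ⟨e, he, he'⟩ : 𝒳.1.IsIso 𝒳'.1 := Quotient.exact hX
  exact (hτ.of_isIso he he').exists_isHom hτ'

theorem Gluing.exists_inducesClass (hU : ⨆ α, (U α : X₀.Opens) = ⊤) (h : D.IsCouple)
    (hD : D.IsCocycle) : ∃ X, D.InducesClass X := by
  obtain ⟨𝒳, h𝒳, hτ⟩ := D.exists_isAtlas h hD hU
  exact ⟨_, ⟨𝒳, h𝒳⟩, rfl, induces_iff.2 hτ⟩

theorem Gluing.InducesClass.baseChange {D : Gluing k U B} {X : LTDef k X₀ B}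
    (h : D.InducesClass X) (φ : B →ₐ[k] A) :
    (D.baseChange φ).InducesClass (LTDef.map φ X) := by
  obtain ⟨𝒳, rfl, h⟩ := h
  obtain ⟨τ, hτ⟩ := induces_iff.1 h
  exact ⟨⟨_, 𝒳.2.baseChange φ⟩, rfl, induces_iff.2 (hτ.exists_baseChange φ)⟩

/-- Every locally trivial deformation is given by a couple satisfying the cocycle conditions. -/
theorem exists_inducesClass [IsAlgClosed k] (p : ℕ) [Fact p.Prime]
    [CharP k p] [LocallyOfFiniteType (X₀ ↘ Spec (.of k))] (U : ι → X₀.affineOpens)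
    (X : LTDef k X₀ A) :
    ∃ x : Gluing k U A, x.IsCouple ∧ x.IsCocycle ∧ x.InducesClass X := by
  obtain ⟨𝒳, rfl⟩ := Quotient.exists_rep X
  choose τ hτ using fun α ↦ 𝒳.2.exists_isTriv p (U α)
  choose D hD using fun α β ↦
    ((hτ α).res (inter₂_le_left (k := k) α β)).exists_eq ((hτ β).res (inter₂_le_right (k := k) α β))
  have hon : ∀ {α β : ι} {W : X₀.affineOpens} (hα : W ≤ U α) (hβ : W ≤ U β),
      sp (HS.hom (Gluing.on D α β hα hβ)) ≫ sp (tres k A hα) ≫ τ α = sp (tres k A hβ) ≫ τ β := by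
    intro α β W hα hβ
    have h1 := congrArg (sp (tres k A (le_inter₂ hα hβ)) ≫ ·) (hD α β)
    simp only [← Category.assoc] at h1
    rw [sp_tres_hom] at h1
    simp only [Category.assoc] at h1
    rw [← Category.assoc (sp (tres k A _)), sp_tres_tres, ← Category.assoc (sp (tres k A _)),
      sp_tres_tres] at h1
    exact h1
  refine ⟨D, ⟨fun α ↦ ?_, fun α β ↦ ?_⟩, fun α β γ ↦ ?_, 𝒳, rfl, induces_iff.2 ⟨τ, hτ, hD⟩⟩
  · refine ((hτ α).res (inter₂_le_left α α)).eq_of_act ?_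
    rw [hD, HS.hom_one, sp_id, Category.id_comp]
  · rw [eq_inv_iff_mul_eq_one]
    refine ((hτ β).res (inter₂_le_right α β)).eq_of_act ?_
    rw [HS.hom_mul, ← sp_comp, Category.assoc, hon, hD, HS.hom_one, sp_id, Category.id_comp]
  · refine ((hτ α).res (inter₃_le_fst (k := k) α β γ)).eq_of_act ?_
    rw [HS.hom_mul, ← sp_comp, Category.assoc, hon, hon, hon]

end Classes

/-! ### Restriction of derivations and of reductions. -/

section Restriction

variable {k : Type u} [Field k] {X₀ : Scheme.{u}} [X₀.Over (Spec (.of k))]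
  {A : Type u} [CommRing A] [Algebra k A] [ArtinLocal k A]
  {B : Type u} [CommRing B] [Algebra k B] [ArtinLocal k B] {Φ : SmallExtension k B A}

lemma res_bracket {V W : X₀.affineOpens} (h : W ≤ V) (d : DerSec k V) :
    HS.res h (bracket Φ d) = bracket Φ (derRes h d) :=
  (HS.eq_res h (bracket_compat Φ _ fun r ↦ derRestrict_apply _ _ d r)).symm

/-- Transitivity is inherited from `HS.res` through the injection d ↦ d⟨t⟩, whence the argument Φ.
-/
lemma derRes_derRes (Φ : SmallExtension k B A) {V W I : X₀.affineOpens} (h : W ≤ V) (h' : I ≤ W)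
    (d : DerSec k V) : derRes h' (derRes h d) = derRes (h'.trans h) d :=
  bracket_injective Φ (by rw [← res_bracket, ← res_bracket, ← res_bracket, HS.res_res])

lemma res_baseChange (φ : B →ₐ[k] A) {V W : X₀.affineOpens} (h : W ≤ V) (D : HS k B Γ(X₀, V)) :
    HS.res h (HS.baseChange φ D) = HS.baseChange φ (HS.res h D) := by
  have h1 := (HS.compat_res h D).comp (HS.compat_baseChange φ (HS.res h D))
  rw [AlgHom.comp_id, AlgHom.id_comp] at h1
  refine (HS.eq_res h (.of_one_tmul fun r ↦ ?_)).symm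
  have h2 := h1 (1 ⊗ₜ r)
  rw [Algebra.TensorProduct.map_tmul, map_one] at h2
  rw [HS.baseChange_one_tmul, map_map_tmul, AlgHom.id_comp, AlgHom.comp_id, h2]

end Restriction

/-! ### Couples, the action of derivations, and loops. -/

section Gluings

variable {k : Type u} [Field k] {X₀ : Scheme.{u}} [X₀.Over (Spec (.of k))]
  [IsSeparated (X₀ ↘ Spec (.of k))] {ι : Type u} {U : ι → X₀.affineOpens}
  {A : Type u} [CommRing A] [Algebra k A] [ArtinLocal k A]
  {B : Type u} [CommRing B] [Algebra k B] [ArtinLocal k B] {Φ : SmallExtension k B A}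

lemma Gluing.on_self (D : Gluing k U A) (α β : ι) :
    D.on α β (inter₂_le_left α β) (inter₂_le_right α β) = D α β :=
  HS.res_self _

lemma Gluing.IsCouple.on_symm {D : Gluing k U A} (h : D.IsCouple) {α β : ι} {W : X₀.affineOpens}
    (hα : W ≤ U α) (hβ : W ≤ U β) : D.on β α hβ hα = (D.on α β hα hβ)⁻¹ := by
  rw [Gluing.on, h.2, HS.res_inv, Gluing.res_on]

lemma Gluing.IsHom.on {D D' : Gluing k U A} {E : ∀ α, HS k A Γ(X₀, U α)} (h : D.IsHom D' E)
    {α β : ι} {W : X₀.affineOpens} (hα : W ≤ U α) (hβ : W ≤ U β) :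
    HS.res hβ (E β) * D.on α β hα hβ = D'.on α β hα hβ * HS.res hα (E α) := by
  have := congrArg (HS.res (le_inter₂ hα hβ)) (h α β)
  rwa [HS.res_mul, HS.res_mul, HS.res_res, HS.res_res] at this

lemma Gluing.IsHom.one (D : Gluing k U A) : D.IsHom D 1 := fun α β ↦ by
  simp [HS.res_one]

lemma Gluing.IsHom.inv {D D' : Gluing k U A} {E : ∀ α, HS k A Γ(X₀, U α)} (h : D.IsHom D' E) :
    D'.IsHom D E⁻¹ := fun α β ↦ by
  rw [Pi.inv_apply, Pi.inv_apply, HS.res_inv, HS.res_inv, inv_mul_eq_iff_eq_mul, ← mul_assoc,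
    h, mul_inv_cancel_right]

lemma Gluing.IsHom.comp {D D' D'' : Gluing k U A} {E E' : ∀ α, HS k A Γ(X₀, U α)}
    (h' : D'.IsHom D'' E') (h : D.IsHom D' E) : D.IsHom D'' (E' * E) := fun α β ↦ by
  rw [Pi.mul_apply, Pi.mul_apply, HS.res_mul, HS.res_mul, mul_assoc, h, ← mul_assoc, h', mul_assoc]

lemma Gluing.baseChange_on (φ : B →ₐ[k] A) (D : Gluing k U B) {α β : ι} {W : X₀.affineOpens}
    (hα : W ≤ U α) (hβ : W ≤ U β) :
    (D.baseChange φ).on α β hα hβ = HS.baseChange φ (D.on α β hα hβ) :=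
  res_baseChange φ _ _

lemma Gluing.IsHom.baseChange (φ : B →ₐ[k] A) {D D' : Gluing k U B} {E : ∀ α, HS k B Γ(X₀, U α)}
    (h : D.IsHom D' E) :
    (D.baseChange φ).IsHom (D'.baseChange φ) fun α ↦ HS.baseChange φ (E α) := fun α β ↦ by
  rw [res_baseChange, res_baseChange, Gluing.baseChange, Gluing.baseChange, ← HS.baseChange_mul,
    ← HS.baseChange_mul, h]

lemma Gluing.IsCouple.baseChange (φ : B →ₐ[k] A) {D : Gluing k U B} (h : D.IsCouple) :
    (D.baseChange φ).IsCouple :=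
  ⟨fun α ↦ by rw [Gluing.baseChange, h.1, HS.baseChange_one], fun α β ↦ by
    rw [Gluing.baseChange_on, ← HS.baseChange_inv, ← h.2]; rfl⟩

lemma Gluing.act_on (d : DerC1 k U) (D : Gluing k U B) {α β : ι} {W : X₀.affineOpens}
    (hα : W ≤ U α) (hβ : W ≤ U β) : (D.act Φ d).on α β hα hβ =
      bracket Φ (derRes (le_inter₂ hα hβ) (d α β)) * D.on α β hα hβ := by
  rw [Gluing.on, Gluing.act, HS.res_mul, res_bracket]
  rfl

lemma Gluing.act_add (d d' : DerC1 k U) (D : Gluing k U B) :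
    D.act Φ (d + d') = (D.act Φ d').act Φ d := by
  funext α β
  simp only [Gluing.act, Pi.add_apply, bracket_add, mul_assoc]

lemma Gluing.act_zero (D : Gluing k U B) : D.act Φ 0 = D := by
  funext α β
  simp only [Gluing.act, Pi.zero_apply, bracket_zero, one_mul]

lemma Gluing.baseChange_act (d : DerC1 k U) (D : Gluing k U B) :
    (D.act Φ d).baseChange Φ.φ = D.baseChange Φ.φ := by
  funext α β
  simp only [Gluing.baseChange, Gluing.act, HS.baseChange_mul, baseChange_bracket, one_mul]

lemma derAlt.res_symm (Φ : SmallExtension k B A) {d : DerC1 k U} (hd : d ∈ derAlt k U) {α β : ι}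
    {W : X₀.affineOpens} (hα : W ≤ U α) (hβ : W ≤ U β) :
    derRes (le_inter₂ hβ hα) (d β α) = - derRes (le_inter₂ hα hβ) (d α β) := by
  have := congrArg (derRes (le_inter₂ hα hβ)) (hd.2 α β)
  rwa [derRes_derRes Φ, map_neg] at this

lemma Gluing.IsCouple.act {D : Gluing k U B} (h : D.IsCouple) {d : DerC1 k U}
    (hd : d ∈ derAlt k U) : (D.act Φ d).IsCouple := by
  refine ⟨fun α ↦ ?_, fun α β ↦ ?_⟩
  · rw [Gluing.act, hd.1, h.1, bracket_zero, one_mul]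
  · rw [Gluing.act_on, hd.2, h.on_symm, mul_inv_rev, inv_inv, Gluing.on_self, bracket_neg, inv_inv]
    exact bracket_commute Φ _ _

/-- The composite `D^{γα} ∘ D^{βγ} ∘ D^{αβ}`. -/
def Gluing.loop (D : Gluing k U A) (α β γ : ι) : HS k A Γ(X₀, inter₃ k U α β γ) :=
  D.on γ α (inter₃_le_thd α β γ) (inter₃_le_fst α β γ) *
    D.on β γ (inter₃_le_snd α β γ) (inter₃_le_thd α β γ) *
    D.on α β (inter₃_le_fst α β γ) (inter₃_le_snd α β γ)

lemma Gluing.IsCouple.isCocycle_iff {D : Gluing k U A} (h : D.IsCouple) :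
    D.IsCocycle ↔ ∀ α β γ, D.loop α β γ = 1 := by
  refine forall_congr' fun α ↦ forall_congr' fun β ↦ forall_congr' fun γ ↦ ?_
  rw [Gluing.loop, h.on_symm (inter₃_le_fst α β γ) (inter₃_le_thd α β γ), mul_assoc,
    inv_mul_eq_one, eq_comm]

/-- The three factors d⟨t⟩ are central and can be collected; since d_{γα} = −d_{αγ}, their sum is
the Čech differential. -/
lemma Gluing.loop_act (D : Gluing k U B) {d : DerC1 k U} (hd : d ∈ derAlt k U) (α β γ : ι) :
    (D.act Φ d).loop α β γ = bracket Φ (derδ1 k U d α β γ) * D.loop α β γ := by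
  rw [Gluing.loop, Gluing.act_on, Gluing.act_on, Gluing.act_on]
  have e : derδ1 k U d α β γ = derRes (le_inter₂ (inter₃_le_thd α β γ) (inter₃_le_fst α β γ)) (d γ α)
      + (derRes (le_inter₂ (inter₃_le_snd α β γ) (inter₃_le_thd α β γ)) (d β γ) +
      derRes (le_inter₂ (inter₃_le_fst α β γ) (inter₃_le_snd α β γ)) (d α β)) := by
    rw [derAlt.res_symm Φ hd (inter₃_le_fst α β γ) (inter₃_le_thd α β γ)]
    change derRes _ (d β γ) - derRes _ (d α γ) + derRes _ (d α β) = _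
    abel
  rw [e, bracket_add, bracket_add, Gluing.loop]
  simp only [mul_assoc]
  congr 1
  rw [← mul_assoc, ← (bracket_commute Φ _ _).eq, mul_assoc]
  congr 1
  rw [← mul_assoc (Gluing.on D β γ _ _), ← (bracket_commute Φ _ _).eq, mul_assoc,
    ← mul_assoc, ← (bracket_commute Φ _ _).eq, mul_assoc]

lemma Gluing.IsHom.loop {D D' : Gluing k U A} {E : ∀ α, HS k A Γ(X₀, U α)} (h : D.IsHom D' E)
    (α β γ : ι) : HS.res (inter₃_le_fst α β γ) (E α) * D.loop α β γ =
      D'.loop α β γ * HS.res (inter₃_le_fst α β γ) (E α) := by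
  rw [Gluing.loop, Gluing.loop, ← mul_assoc, ← mul_assoc, h.on]
  simp only [mul_assoc]
  rw [← h.on, ← mul_assoc (HS.res _ (E γ)), h.on, mul_assoc]

lemma Gluing.baseChange_loop (φ : B →ₐ[k] A) (D : Gluing k U B) (α β γ : ι) :
    (D.baseChange φ).loop α β γ = HS.baseChange φ (D.loop α β γ) := by
  rw [Gluing.loop, Gluing.baseChange_on, Gluing.baseChange_on, Gluing.baseChange_on,
    ← HS.baseChange_mul, ← HS.baseChange_mul]
  rfl

/-- A loop that is trivial over A is of the form d⟨t⟩, so the inverse function in `Gluing.defect`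
returns a genuine preimage. -/
lemma Gluing.bracket_defect {D : Gluing k U B}
    (h : ∀ α β γ, (D.baseChange Φ.φ).loop α β γ = 1) (α β γ : ι) :
    bracket Φ (D.defect Φ α β γ) = D.loop α β γ := by
  refine Function.invFun_eq ?_
  have h1 := h α β γ
  rw [Gluing.baseChange_loop, ← HS.baseChange_one Φ.φ] at h1
  obtain ⟨d, hd⟩ := exists_bracket_of_baseChange_eq Φ h1
  exact ⟨d, by rw [← mul_one (bracket Φ d), ← hd]; rfl⟩

end Gluings

/-! ### Lifts of a couple and their two invariants. -/

section Lifts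

variable {k : Type u} [Field k] {X₀ : Scheme.{u}} [X₀.Over (Spec (.of k))]
  [IsSeparated (X₀ ↘ Spec (.of k))] {ι : Type u} {U : ι → X₀.affineOpens}
  {A : Type u} [CommRing A] [Algebra k A] [ArtinLocal k A]
  {B : Type u} [CommRing B] [Algebra k B] [ArtinLocal k B] {Φ : SmallExtension k B A}

lemma Gluing.IsHom.act {D D' : Gluing k U B} {E : ∀ α, HS k B Γ(X₀, U α)} (h : D.IsHom D' E)
    (d : DerC1 k U) : (D.act Φ d).IsHom (D'.act Φ d) E := fun α β ↦ by
  rw [Gluing.act, Gluing.act, ← mul_assoc, ← (bracket_commute Φ _ _).eq, mul_assoc, h, mul_assoc]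

/-- The couple obtained from `D` by the change of trivializations `E`. -/
def Gluing.conj (D : Gluing k U A) (E : ∀ α, HS k A Γ(X₀, U α)) : Gluing k U A := fun α β ↦
  HS.res (inter₂_le_right α β) (E β) * D α β * (HS.res (inter₂_le_left α β) (E α))⁻¹

lemma Gluing.isHom_conj (D : Gluing k U A) (E : ∀ α, HS k A Γ(X₀, U α)) :
    D.IsHom (D.conj E) E := fun α β ↦ by
  rw [Gluing.conj, inv_mul_cancel_right]

lemma Gluing.IsHom.eq_conj {D D' : Gluing k U A} {E : ∀ α, HS k A Γ(X₀, U α)} (h : D.IsHom D' E) :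
    D' = D.conj E := by
  funext α β
  rw [Gluing.conj, h, mul_inv_cancel_right]

lemma Gluing.IsCouple.of_isHom {D D' : Gluing k U A} (hD : D.IsCouple)
    {E : ∀ α, HS k A Γ(X₀, U α)} (h : D.IsHom D' E) : D'.IsCouple := by
  refine ⟨fun α ↦ ?_, fun α β ↦ ?_⟩
  · have h1 := h α α
    rw [hD.1, mul_one] at h1
    exact mul_eq_right.1 h1.symm
  · have h1 := h.on (inter₂_le_right (k := k) α β) (inter₂_le_left (k := k) α β)
    rw [hD.on_symm, Gluing.on_self] at h1
    rw [eq_inv_iff_mul_eq_one, ← mul_left_inj (HS.res (inter₂_le_right α β) (E β)), mul_assoc, ← h1,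
      ← mul_assoc, ← h, mul_inv_cancel_right, one_mul]

lemma Gluing.IsCouple.mem_derAlt {D : Gluing k U B} (hD : D.IsCouple) {d : DerC1 k U}
    (h : (D.act Φ d).IsCouple) : d ∈ derAlt k U := by
  refine ⟨fun α ↦ bracket_injective Φ ?_, fun α β ↦ bracket_injective Φ ?_⟩
  · have := h.1 α
    rwa [Gluing.act, hD.1, mul_one, ← bracket_zero Φ] at this
  · have := h.2 α β
    rw [Gluing.act_on, hD.on_symm, Gluing.on_self, Gluing.act, mul_inv_rev, inv_inv,
      ← (bracket_commute Φ _ _).inv_left.eq, mul_left_inj] at this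
    rw [bracket_neg, this, inv_inv]

lemma Gluing.exists_act_eq {D D' : Gluing k U B}
    (h : D.baseChange Φ.φ = D'.baseChange Φ.φ) : ∃ d, D' = D.act Φ d := by
  have h1 : ∀ α β, ∃ d, D' α β = bracket Φ d * D α β := fun α β ↦
    exists_bracket_of_baseChange_eq Φ (congrFun (congrFun h α) β).symm
  choose d hd using h1
  exact ⟨d, funext fun α ↦ funext fun β ↦ hd α β⟩

/-- Couples with isomorphic reductions, where the isomorphism lifts, differ by an alternating family
of derivations up to isomorphism. -/
lemma Gluing.exists_isHom_act {D D' : Gluing k U B} (hD : D.IsCouple) (hD' : D'.IsCouple)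
    {F : ∀ α, HS k B Γ(X₀, U α)}
    (h : (D.baseChange Φ.φ).IsHom (D'.baseChange Φ.φ) fun α ↦ HS.baseChange Φ.φ (F α)) :
    ∃ d ∈ derAlt k U, (D.act Φ d).IsHom D' F := by
  obtain ⟨d, rfl⟩ := Gluing.exists_act_eq (Φ := Φ) (D := D.conj F) (D' := D')
    (((D.isHom_conj F).baseChange Φ.φ).eq_conj.trans h.eq_conj.symm)
  exact ⟨d, (hD.of_isHom (D.isHom_conj F)).mem_derAlt hD', (D.isHom_conj F).act d⟩

namespace CoupleLift

variable {x : Gluing k U A} (hx : x.IsCouple) (hx' : x.IsCocycle) (Y Z Z' : CoupleLift Φ x)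

include hx hx' in
lemma bracket_defect (α β γ : ι) : bracket Φ (Z.Y.defect Φ α β γ) = Z.Y.loop α β γ := by
  refine Gluing.bracket_defect (fun α β γ ↦ ?_) α β γ
  have := Z.isHom.loop α β γ
  rw [hx.isCocycle_iff.1 hx', one_mul] at this
  exact mul_eq_left.1 this

include hx hx' in
lemma isCocycle_iff : Z.Y.IsCocycle ↔ Z.Y.defect Φ = 0 := by
  rw [Z.isCouple.isCocycle_iff]
  refine ⟨fun h ↦ ?_, fun h α β γ ↦ ?_⟩
  · funext α β γ
    refine bracket_injective Φ ?_
    rw [Z.bracket_defect hx hx', h]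
    exact (bracket_zero Φ).symm
  · rw [← Z.bracket_defect hx hx', h]
    exact bracket_zero Φ

variable {Z Z'} in
include hx hx' in
-- Loops of isomorphic families are conjugate, and these loops are central, so the defect changes
-- only by the differential of d.
lemma defect_eq {d : DerC1 k U} (hd : d ∈ derAlt k U) {F : ∀ α, HS k B Γ(X₀, U α)}
    (h : (Z.Y.act Φ d).IsHom Z'.Y F) : Z'.Y.defect Φ = derδ1 k U d + Z.Y.defect Φ := by
  funext α β γ
  refine bracket_injective Φ ?_
  have h1 := h.loop α β γ
  rw [Z.Y.loop_act hd, ← Z.bracket_defect hx hx', ← Z'.bracket_defect hx hx', ← bracket_add,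
    ← (bracket_commute Φ _ _).eq, mul_left_inj] at h1
  exact h1.symm

/-- The lift `d · Z`. -/
def act {d : DerC1 k U} (hd : d ∈ derAlt k U) : CoupleLift Φ x where
  Y := Z.Y.act Φ d
  isCouple := Z.isCouple.act hd
  E := Z.E
  isHom := by rw [Gluing.baseChange_act]; exact Z.isHom

/-- The lift `Z` with its identification changed by an automorphism of `x`. -/
def twist {G : ∀ α, HS k A Γ(X₀, U α)} (hG : x.IsHom x G) : CoupleLift Φ x where
  Y := Z.Y
  isCouple := Z.isCouple
  E := G * Z.E
  isHom := hG.comp Z.isHom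

lemma h_apply (α : ι) : Y.h Z α = ob Φ (Z.E α) - ob Φ (Y.E α) := by
  rw [CoupleLift.h, obFamily, ob_mul, ob_inv, neg_add_eq_sub]

lemma h_twist {G : ∀ α, HS k A Γ(X₀, U α)} (hG : x.IsHom x G) :
    Y.h (Z.twist hG) = obFamily Φ G + Y.h Z := by
  funext α
  have h1 : ob Φ ((Z.twist hG).E α) = ob Φ (G α) + ob Φ (Z.E α) := ob_mul Φ _ _
  rw [Pi.add_apply, h_apply, h_apply, h1, obFamily]
  abel

variable {Y Z Z'} in
/-- Lifts with the same first invariant differ by an alternating family of derivations. -/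
lemma exists_isHom_of_h_eq (h : Y.h Z = Y.h Z') :
    ∃ d ∈ derAlt k U, ∃ F, (Z.Y.act Φ d).IsHom Z'.Y F := by
  -- Equality of the first invariants says that (E_{Z'})⁻¹ E_Z is unobstructed on each member of the
  -- cover.
  have h1 : ∀ α, ∃ F : HS k B Γ(X₀, U α), HS.baseChange Φ.φ F = (Z'.E α)⁻¹ * Z.E α := fun α ↦ by
    refine exists_baseChange_eq_of_ob_eq_zero ?_
    have := congrFun h α
    rw [h_apply, h_apply, sub_left_inj] at this
    rw [ob_mul, ob_inv, this, neg_add_cancel]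
  choose F hF using h1
  have h2 : (Z.Y.baseChange Φ.φ).IsHom (Z'.Y.baseChange Φ.φ) fun α ↦ HS.baseChange Φ.φ (F α) := by
    rw [show (fun α ↦ HS.baseChange Φ.φ (F α)) = Z'.E⁻¹ * Z.E from funext hF]
    exact Z'.isHom.inv.comp Z.isHom
  obtain ⟨d, hd, hdF⟩ := Gluing.exists_isHom_act Z.isCouple Z'.isCouple h2
  exact ⟨d, hd, F, hdF⟩

variable {Z Z'} in
/-- The first invariants of isomorphic lifts differ by the obstruction of an automorphism. -/
lemma h_sub_h_mem {d : DerC1 k U} {F : ∀ α, HS k B Γ(X₀, U α)} (h : (Z.Y.act Φ d).IsHom Z'.Y F) :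
    Y.h Z' - Y.h Z ∈ autObs Φ x := by
  have h1 := h.baseChange Φ.φ
  rw [Gluing.baseChange_act] at h1
  refine ⟨Z'.E * ((fun α ↦ HS.baseChange Φ.φ (F α)) * Z.E⁻¹),
    Z'.isHom.comp (h1.comp Z.isHom.inv), ?_⟩
  funext α
  rw [obFamily, Pi.sub_apply, h_apply, h_apply, Pi.mul_apply, Pi.mul_apply, Pi.inv_apply, ob_mul,
    ob_mul, ob_baseChange, ob_inv]
  abel

lemma zero_mem_autObs : (0 : ∀ α, T1 k Γ(X₀, U α)) ∈ autObs Φ x :=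
  ⟨1, .one x, funext fun _ ↦ ob_one Φ⟩

lemma neg_mem_autObs {m : ∀ α, T1 k Γ(X₀, U α)} (h : m ∈ autObs Φ x) : -m ∈ autObs Φ x := by
  obtain ⟨G, hG, rfl⟩ := h
  exact ⟨G⁻¹, Gluing.IsHom.inv hG, funext fun _ ↦ ob_inv Φ _⟩

lemma add_mem_autObs {m m' : ∀ α, T1 k Γ(X₀, U α)} (h : m ∈ autObs Φ x) (h' : m' ∈ autObs Φ x) :
    m + m' ∈ autObs Φ x := by
  obtain ⟨G, hG, rfl⟩ := h
  obtain ⟨G', hG', rfl⟩ := h'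
  exact ⟨G * G', Gluing.IsHom.comp hG hG', funext fun _ ↦ ob_mul Φ _ _⟩

lemma ob_res (Φ : SmallExtension k B A) {V W : X₀.affineOpens} (h : W ≤ V) (D : HS k A Γ(X₀, V)) :
    T1.IsRestriction (resHom k (show (W : X₀.Opens) ≤ V from h)) (ob Φ D) (ob Φ (HS.res h D)) :=
  ob_isRestriction Φ _ (HS.compat_res h D)

lemma h_mem_ObH0 : Y.h Z ∈ ObH0 U Φ := by
  refine ⟨fun α ↦ ⟨_, rfl⟩, fun α β ↦
    ⟨ob Φ (HS.res (inter₂_le_left α β) ((Y.E α)⁻¹ * Z.E α)), ob_res Φ (inter₂_le_left (k := k) α β) _, ?_⟩⟩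
  have h1 := ob_res Φ (inter₂_le_right (k := k) α β) ((Y.E β)⁻¹ * Z.E β)
  -- Since ob vanishes on reductions from B, the isomorphism with x gives ob(E^β) − ob(E^α) =
  -- ob(x^{αβ}) on overlaps. This is the same for every lift and cancels in the difference of Y and
  -- Z.
  have aux : ∀ T : CoupleLift Φ x, ob Φ (HS.res (inter₂_le_right α β) (T.E β)) =
      ob Φ (x α β) + ob Φ (HS.res (inter₂_le_left α β) (T.E α)) := fun T ↦ by
    have h2 := congrArg (ob Φ) (T.isHom α β)
    rwa [Gluing.baseChange, ob_mul, ob_baseChange, add_zero, ob_mul] at h2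
  have h3 : ob Φ (HS.res (inter₂_le_right α β) ((Y.E β)⁻¹ * Z.E β)) =
      ob Φ (HS.res (inter₂_le_left (k := k) α β) ((Y.E α)⁻¹ * Z.E α)) := by
    rw [HS.res_mul, HS.res_mul, HS.res_inv, HS.res_inv, ob_mul, ob_mul, ob_inv, ob_inv, aux, aux]
    abel
  rw [h3] at h1
  exact h1

/-- A couple over `A` all of whose members lift to `B` lifts to a couple. -/
lemma exists_couple {P : Gluing k U A} (hP : P.IsCouple)
    (h : ∀ α β, ∃ D : HS k B Γ(X₀, inter₂ k U α β), HS.baseChange Φ.φ D = P α β) :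
    ∃ D : Gluing k U B, D.IsCouple ∧ D.baseChange Φ.φ = P := by
  classical
  choose D₀ hD₀ using h
  -- An order on the indices decides which of the two members over an overlap is lifted freely; the
  -- other is its inverse, and the diagonal is 1.
  letI : LinearOrder ι := linearOrderOfSTO WellOrderingRel
  let D : Gluing k U B := fun α β ↦ if α < β then D₀ α β else if β < α then
    (Gluing.on D₀ β α (inter₂_le_right α β) (inter₂_le_left α β))⁻¹ else 1
  have h₁ : ∀ {α β}, α < β → D α β = D₀ α β := fun hαβ ↦ if_pos hαβ
  have h₂ : ∀ {α β}, β < α → D α β =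
      (Gluing.on D₀ β α (inter₂_le_right α β) (inter₂_le_left α β))⁻¹ := fun hαβ ↦ by
    simp only [D, if_neg hαβ.not_gt, if_pos hαβ]
  have h₃ : ∀ α, D α α = 1 := fun α ↦ by simp only [D, lt_irrefl, if_false]
  refine ⟨D, ⟨h₃, fun α β ↦ ?_⟩, funext fun α ↦ funext fun β ↦ ?_⟩
  · rcases lt_trichotomy α β with hαβ | rfl | hαβ
    · rw [h₁ hαβ, Gluing.on, h₂ hαβ, HS.res_inv, inv_inv, Gluing.res_on, Gluing.on_self]
    · rw [Gluing.on, h₃, HS.res_one, inv_one]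
    · rw [h₂ hαβ, Gluing.on, Gluing.on, h₁ hαβ]
  · rcases lt_trichotomy α β with hαβ | rfl | hαβ
    · rw [Gluing.baseChange, h₁ hαβ, hD₀]
    · rw [Gluing.baseChange, h₃, HS.baseChange_one, hP.1]
    · rw [Gluing.baseChange, h₂ hαβ, HS.baseChange_inv, hP.2 α β, ← Gluing.baseChange_on]
      congr 2
      exact funext fun α ↦ funext fun β ↦ hD₀ α β

/-- Every section of the obstruction sheaf is the first invariant of a lift. -/
lemma exists_h_eq {m : ∀ α, T1 k Γ(X₀, U α)} (hm : m ∈ ObH0 U Φ) :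
    ∃ Z : CoupleLift Φ x, Y.h Z = m := by
  choose G hG using hm.1
  have hres : ∀ α β, ob Φ (HS.res (inter₂_le_left (k := k) α β) (G α)) =
      ob Φ (HS.res (inter₂_le_right (k := k) α β) (G β)) := fun α β ↦ by
    obtain ⟨c, hα, hβ⟩ := hm.2 α β
    rw [← hG] at hα hβ
    rw [(ob_res Φ (inter₂_le_left (k := k) α β) (G α)).unique
        (formallyEtale_resHom (inter₂_le_left (k := k) α β)) hα,
      (ob_res Φ (inter₂_le_right (k := k) α β) (G β)).unique
        (formallyEtale_resHom (inter₂_le_right (k := k) α β)) hβ]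
  -- Changing the reduction of Y by G⁻¹ alters the obstruction over an overlap by ob(G^α) − ob(G^β),
  -- which vanishes because m is a section. So all members of the new couple lift to B.
  have hP := (Y.isCouple.baseChange Φ.φ).of_isHom (Gluing.isHom_conj _ G⁻¹)
  obtain ⟨D, hD, hDP⟩ := exists_couple (Φ := Φ) hP fun α β ↦ by
    refine exists_baseChange_eq_of_ob_eq_zero ?_
    rw [Gluing.conj, ob_mul, ob_mul, Pi.inv_apply, Pi.inv_apply, HS.res_inv, HS.res_inv, inv_inv,
      ob_inv, Gluing.baseChange, ob_baseChange, hres]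
    abel
  have hE : (D.baseChange Φ.φ).IsHom x (Y.E * G) := by
    rw [hDP]
    have := (Gluing.isHom_conj (Y.Y.baseChange Φ.φ) G⁻¹).inv
    rw [inv_inv] at this
    exact Y.isHom.comp this
  refine ⟨⟨D, hD, _, hE⟩, funext fun α ↦ ?_⟩
  have h1 : ob Φ ((Y.E * G) α) = ob Φ (Y.E α) + m α := by
    rw [Pi.mul_apply, ob_mul, hG]
  rw [h_apply, h1, add_sub_cancel_left]

include hx hx' in
-- The lift picked in the definition of `CoupleLift.g` has the same first invariant as Z, so their
-- defects differ by the differential of an alternating family.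
lemma g_h : Y.g (Y.h Z) = Z.v2 := by
  haveI : Nonempty (CoupleLift Φ x) := ⟨Y⟩
  have h1 : Y.h Z = Y.h (Function.invFun Y.h (Y.h Z)) := (Function.invFun_eq ⟨Z, rfl⟩).symm
  obtain ⟨d, hd, F, hF⟩ := exists_isHom_of_h_eq h1
  have h2 := defect_eq hx hx' hd hF
  refine (QuotientAddGroup.eq_iff_sub_mem.2 ?_)
  rw [h2, add_sub_cancel_right]
  exact ⟨d, hd, rfl⟩

include hx hx' in
lemma h_mem_V (hZ : Z.Y.IsCocycle) : Y.h Z ∈ Y.V := by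
  refine ⟨Y.h_mem_ObH0 Z, ?_⟩
  rw [Y.g_h hx hx' Z, v2, (Z.isCocycle_iff hx hx').1 hZ]
  rfl

include hx hx' in
lemma exists_isCocycle {m : ∀ α, T1 k Γ(X₀, U α)} (hm : m ∈ Y.V) :
    ∃ Z : CoupleLift Φ x, Z.Y.IsCocycle ∧ Y.h Z = m := by
  obtain ⟨Z, rfl⟩ := Y.exists_h_eq hm.1
  have h1 := hm.2
  rw [Y.g_h hx hx' Z, v2, QuotientAddGroup.eq_zero_iff] at h1
  obtain ⟨d, hd, hd'⟩ := h1
  -- The defect of Z is the differential of d; acting by −d cancels it and leaves the first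
  -- invariant unchanged.
  refine ⟨Z.act (neg_mem hd), ?_, rfl⟩
  rw [isCocycle_iff hx hx', defect_eq (Z := Z) (Z' := Z.act (neg_mem hd)) hx hx' (neg_mem hd)
    (.one _), ← hd', map_neg, neg_add_cancel]

end CoupleLift

end Lifts

/-! ### The fibre over X: the action of H¹ and the orbits. -/

section Fibre

variable {k : Type u} [Field k] {X₀ : Scheme.{u}} [X₀.Over (Spec (.of k))]
  [IsSeparated (X₀ ↘ Spec (.of k))] {ι : Type u} {U : ι → X₀.affineOpens}
  {A : Type u} [CommRing A] [Algebra k A] [ArtinLocal k A]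
  {B : Type u} [CommRing B] [Algebra k B] [ArtinLocal k B] {Φ : SmallExtension k B A}
  {X : LTDef k X₀ A}

/-- `z' = d · z`: there are couples `Z` inducing `z` such that `d · Z` induces `z'`. -/
def IsTranslate (Φ : SmallExtension k B A) (U : ι → X₀.affineOpens) (c : DerH1 k U)
    (z z' : LTDef k X₀ B) : Prop :=
  ∃ (d : derZ1 k U) (Z : Gluing k U B), QuotientAddGroup.mk d = c ∧ Z.IsCouple ∧ Z.IsCocycle ∧
    Z.InducesClass z ∧ (Z.act Φ d.1).InducesClass z'

lemma Gluing.IsCocycle.act {Z : Gluing k U B} (h : Z.IsCouple) (h' : Z.IsCocycle) (d : derZ1 k U) :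
    (Z.act Φ d.1).IsCocycle := by
  rw [(h.act d.2.1).isCocycle_iff]
  intro α β γ
  rw [Z.loop_act d.2.1, h.isCocycle_iff.1 h']
  have : derδ1 k U d.1 = 0 := d.2.2
  rw [this]
  simp [bracket_zero]

lemma Gluing.InducesClass.unique (hU : ⨆ α, (U α : X₀.Opens) = ⊤) {Z : Gluing k U B}
    {z z' : LTDef k X₀ B} (h : Z.InducesClass z) (h' : Z.InducesClass z') : z = z' :=
  (h.eq_iff hU h').2 ⟨1, .one Z⟩

/-- If d' − d is the coboundary of e, the elements e_α⟨t⟩ form the isomorphism, by centrality. -/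
lemma exists_isHom_act_of_eq (Z : Gluing k U B) {d d' : derZ1 k U}
    (h : (d : DerH1 k U) = d') : ∃ E, (Z.act Φ d.1).IsHom (Z.act Φ d'.1) E := by
  rw [QuotientAddGroup.eq] at h
  obtain ⟨e, he⟩ := h
  have he' : derδ0 k U e = -d.1 + d'.1 := he
  have hd' : d'.1 = d.1 + derδ0 k U e := by rw [he']; abel
  refine ⟨fun α ↦ bracket Φ (e α), fun α β ↦ ?_⟩
  have h1 : derδ0 k U e α β = derRes (inter₂_le_right α β) (e β) -
    derRes (inter₂_le_left α β) (e α) := rfl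
  rw [res_bracket, res_bracket, Gluing.act, Gluing.act, hd', Pi.add_apply, Pi.add_apply,
    ← (bracket_commute Φ (derRes _ (e α)) _).eq, ← mul_assoc, ← mul_assoc, ← bracket_add,
    ← bracket_add, h1]
  congr 2
  abel

/-- The class `d · z` can be computed by any couple. -/
lemma IsTranslate.inducesClass (hU : ⨆ α, (U α : X₀.Opens) = ⊤) {d : derZ1 k U}
    {z z' : LTDef k X₀ B} (h : IsTranslate Φ U (d : DerH1 k U) z z') {Z : Gluing k U B}
    (h₁ : Z.IsCouple) (h₂ : Z.IsCocycle) (hZ : Z.InducesClass z) :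
    (Z.act Φ d.1).InducesClass z' := by
  obtain ⟨d₀, Z₀, hd, h₁', h₂', hZ', hz'⟩ := h
  obtain ⟨E, hE⟩ := exists_isHom_act_of_eq (Φ := Φ) Z₀ hd
  obtain ⟨F, hF⟩ := (hZ'.eq_iff hU hZ).1 rfl
  obtain ⟨w, hw⟩ := Gluing.exists_inducesClass hU (h₁.act d.2.1) (h₂.act (Φ := Φ) h₁ d)
  obtain rfl : z' = w := (hz'.eq_iff hU hw).2 ⟨_, (hF.act d.1).comp hE⟩
  exact hw

variable [IsAlgClosed k] (p : ℕ) [Fact p.Prime] [CharP k p]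
  [LocallyOfFiniteType (X₀ ↘ Spec (.of k))]

include p in
lemma exists_isTranslate (hU : ⨆ α, (U α : X₀.Opens) = ⊤) (c : DerH1 k U) (z : Φ.fiber X) :
    ∃ z' : Φ.fiber X, IsTranslate Φ U c z.1 z'.1 := by
  obtain ⟨Z, h₁, h₂, hZ⟩ := exists_inducesClass p U z.1
  obtain ⟨d, rfl⟩ := QuotientAddGroup.mk_surjective c
  obtain ⟨w, hw⟩ := Gluing.exists_inducesClass hU (h₁.act d.2.1) (h₂.act (Φ := Φ) h₁ d)
  refine ⟨⟨w, ?_⟩, d, Z, rfl, h₁, h₂, hZ, hw⟩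
  have e₁ := hw.baseChange Φ.φ
  rw [Gluing.baseChange_act] at e₁
  have e₂ : LTDef.map Φ.φ z.1 = X := z.2
  exact (e₁.unique hU (hZ.baseChange Φ.φ)).trans e₂

/-- The action of `H¹(X₀, Der_k(𝒪_{X₀}))` on the fibre of `X`. -/
def fibreAction (Φ : SmallExtension k B A) (X : LTDef k X₀ A)
    (hU : ⨆ α, (U α : X₀.Opens) = ⊤) : AddAction (DerH1 k U) (Φ.fiber X) where
  vadd c z := (exists_isTranslate p hU c z).choose
  zero_vadd z := by
    have h := (exists_isTranslate (Φ := Φ) p hU (0 : DerH1 k U) z).choose_spec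
    obtain ⟨Z, h₁, h₂, hZ⟩ := exists_inducesClass p U z.1
    have h' := IsTranslate.inducesClass (d := 0) hU h h₁ h₂ hZ
    rw [show ((0 : derZ1 k U) : DerC1 k U) = 0 from rfl, Gluing.act_zero] at h'
    exact Subtype.ext (h'.unique hU hZ)
  add_vadd c c' z := by
    obtain ⟨d, rfl⟩ := QuotientAddGroup.mk_surjective c
    obtain ⟨d', rfl⟩ := QuotientAddGroup.mk_surjective c'
    have h := (exists_isTranslate (Φ := Φ) p hU ((d + d' : derZ1 k U) : DerH1 k U) z).choose_spec
    have h' := (exists_isTranslate (Φ := Φ) p hU (d' : DerH1 k U) z).choose_spec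
    have h'' := (exists_isTranslate (Φ := Φ) p hU (d : DerH1 k U)
      (exists_isTranslate (Φ := Φ) p hU (d' : DerH1 k U) z).choose).choose_spec
    obtain ⟨Z, h₁, h₂, hZ⟩ := exists_inducesClass p U z.1
    have e₁ := h.inducesClass hU h₁ h₂ hZ
    have e₂ := h'.inducesClass hU h₁ h₂ hZ
    have e₃ := h''.inducesClass hU (h₁.act d'.2.1) (h₂.act h₁ d') e₂
    rw [← Gluing.act_add] at e₃
    exact Subtype.ext (e₁.unique hU e₃)

lemma fibreAction_spec (hU : ⨆ α, (U α : X₀.Opens) = ⊤) (d : derZ1 k U) (z : Φ.fiber X)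
    {Z : Gluing k U B} (h₁ : Z.IsCouple) (h₂ : Z.IsCocycle) (hZ : Z.InducesClass z.1) :
    (Z.act Φ d.1).InducesClass ((fibreAction p Φ X hU).vadd (QuotientAddGroup.mk d) z).1 :=
  (exists_isTranslate (Φ := Φ) p hU (d : DerH1 k U) z).choose_spec.inducesClass hU h₁ h₂ hZ

section

variable {x : Gluing k U A} (hxX : x.InducesClass X)

include p hxX in
-- A couple Z for z reduces to a couple inducing X, hence isomorphic to x; any such isomorphism
-- makes Z a lift.
lemma exists_coupleLift (hU : ⨆ α, (U α : X₀.Opens) = ⊤) (z : Φ.fiber X) :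
    ∃ Z : CoupleLift Φ x, Z.Y.IsCocycle ∧ Z.Y.InducesClass z.1 := by
  obtain ⟨Z, h₁, h₂, hZ⟩ := exists_inducesClass p U z.1
  obtain ⟨E, hE⟩ := ((hZ.baseChange Φ.φ).eq_iff hU hxX).1 z.2
  exact ⟨⟨Z, h₁, E, hE⟩, h₂, hZ⟩

include hxX in
lemma CoupleLift.exists_fibre (hU : ⨆ α, (U α : X₀.Opens) = ⊤) (Z : CoupleLift Φ x)
    (hZ : Z.Y.IsCocycle) : ∃ z : Φ.fiber X, Z.Y.InducesClass z.1 := by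
  obtain ⟨z, hz⟩ := Gluing.exists_inducesClass hU Z.isCouple hZ
  exact ⟨⟨z, ((hz.baseChange Φ.φ).eq_iff hU hxX).2 ⟨_, Z.isHom⟩⟩, hz⟩

/-- `CoupleLift.VmodL` is the quotient by the relation generated by differences in L(x). As L(x) is
a group, that relation is already an equivalence. -/
lemma CoupleLift.VmodL_mk_eq_iff (Y : CoupleLift Φ x) (m m' : Y.V) :
    (Quot.mk _ m : Y.VmodL) = Quot.mk _ m' ↔ m.1 - m'.1 ∈ autObs Φ x := by
  refine ⟨fun h ↦ ?_, fun h ↦ Quot.sound h⟩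
  have h1 := Quot.eqvGen_exact h
  clear h
  induction h1 with
  | rel _ _ h => exact h
  | refl m =>
    have e : m.1 - m.1 = 0 := sub_self m.1
    exact e ▸ CoupleLift.zero_mem_autObs
  | symm m m' _ ih =>
    have e : -(m.1 - m'.1) = m'.1 - m.1 := neg_sub m.1 m'.1
    exact e ▸ CoupleLift.neg_mem_autObs ih
  | trans m m' m'' _ _ ih ih' =>
    have e : m.1 - m'.1 + (m'.1 - m''.1) = m.1 - m''.1 := sub_add_sub_cancel m.1 m'.1 m''.1
    exact e ▸ CoupleLift.add_mem_autObs ih ih'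

/-- Lifts of `x` satisfying the cocycle conditions induce classes in the same orbit if and only if
their first invariants agree modulo `L(x)`. -/
lemma CoupleLift.sub_mem_autObs_iff (hU : ⨆ α, (U α : X₀.Opens) = ⊤) (hx : x.IsCouple)
    (hx' : x.IsCocycle) (Y : CoupleLift Φ x) {Z Z' : CoupleLift Φ x} (hZ : Z.Y.IsCocycle)
    (hZ' : Z'.Y.IsCocycle) {z z' : Φ.fiber X} (hz : Z.Y.InducesClass z.1)
    (hz' : Z'.Y.InducesClass z'.1) : Y.h Z' - Y.h Z ∈ autObs Φ x ↔
      ∃ c : DerH1 k U, (fibreAction p Φ X hU).vadd c z = z' := by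
  constructor
  · rintro ⟨G, hG, hGh⟩
    -- Composing the identification of Z with the automorphism G shifts its first invariant by
    -- ob(G), which makes it equal to that of Z' without changing the couple.
    have h1 : Y.h (Z.twist hG) = Y.h Z' := by 
      rw [h_twist, hGh]
      exact sub_add_cancel (Y.h Z') (Y.h Z)
    obtain ⟨d, hd, F, hF⟩ := exists_isHom_of_h_eq h1
    have h2 := defect_eq hx hx' hd hF
    rw [(isCocycle_iff hx hx' Z').1 hZ', show (Z.twist hG).Y.defect Φ = 0 from
      (isCocycle_iff hx hx' Z).1 hZ, add_zero] at h2
    -- Both lifts have zero defect, so the differential of d vanishes.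
    let d' : derZ1 k U := ⟨d, hd, h2.symm⟩
    refine ⟨QuotientAddGroup.mk d', Subtype.ext ?_⟩
    exact ((fibreAction_spec p hU d' z Z.isCouple hZ hz).eq_iff hU hz').2 ⟨F, hF⟩
  · rintro ⟨c, rfl⟩
    obtain ⟨d, rfl⟩ := QuotientAddGroup.mk_surjective c
    have h1 := fibreAction_spec p hU d z Z.isCouple hZ hz
    obtain ⟨F, hF⟩ := (h1.eq_iff hU hz').1 rfl
    exact h_sub_h_mem Y hF

/-- The bijection from the orbits in the fibre of `X` to `V_Y(X) / L(X)`. -/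
theorem CoupleLift.exists_equiv (hU : ⨆ α, (U α : X₀.Opens) = ⊤) (hx : x.IsCouple)
    (hx' : x.IsCocycle) (hxX : x.InducesClass X) (Y : CoupleLift Φ x) :
    letI := fibreAction (U := U) p Φ X hU
    ∃ e : AddAction.orbitRel.Quotient (DerH1 k U) (Φ.fiber X) ≃ Y.VmodL,
      ∀ (z : Φ.fiber X) (Z : CoupleLift Φ x), Z.Y.IsCocycle → Z.Y.InducesClass z.1 →
        ∃ hZ : Y.h Z ∈ Y.V, e (Quotient.mk _ z) = Quot.mk _ ⟨Y.h Z, hZ⟩ := by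
  letI := fibreAction (U := U) p Φ X hU
  -- The map is defined by an arbitrary lift inducing each z; `hf` shows that any other such lift
  -- gives the same class.
  choose Z hZ hz using fun z : Φ.fiber X ↦ exists_coupleLift p hxX hU z
  let f : Φ.fiber X → Y.VmodL := fun z ↦ Quot.mk _ ⟨Y.h (Z z), Y.h_mem_V hx hx' _ (hZ z)⟩
  have hf : ∀ (z : Φ.fiber X) (Z' : CoupleLift Φ x) (h : Z'.Y.IsCocycle),
      Z'.Y.InducesClass z.1 → f z = Quot.mk _ ⟨Y.h Z', Y.h_mem_V hx hx' _ h⟩ := by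
    intro z Z' h hz'
    refine (VmodL_mk_eq_iff _ _ _).2 ?_
    exact (sub_mem_autObs_iff p hU hx hx' Y h (hZ z) hz' (hz z)).2 ⟨0, zero_vadd _ z⟩
  have hf' : ∀ z z' : Φ.fiber X, f z = f z' ↔ (AddAction.orbitRel (DerH1 k U) _) z z' := by
    intro z z'
    rw [AddAction.orbitRel_apply]
    refine (VmodL_mk_eq_iff _ _ _).trans ?_
    exact (sub_mem_autObs_iff p hU hx hx' Y (hZ z') (hZ z) (hz z') (hz z))
  let e : AddAction.orbitRel.Quotient (DerH1 k U) (Φ.fiber X) → Y.VmodL :=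
    Quotient.lift f fun z z' h ↦ (hf' z z').2 h
  have he : Function.Bijective e := by
    constructor
    · rintro ⟨z⟩ ⟨z'⟩ h
      exact Quotient.sound ((hf' z z').1 h)
    · rintro ⟨m, hm⟩
      obtain ⟨Z', h, rfl⟩ := Y.exists_isCocycle hx hx' hm
      obtain ⟨z, hz'⟩ := Z'.exists_fibre hxX hU h
      exact ⟨Quotient.mk _ z, hf z Z' h hz'⟩
  exact ⟨Equiv.ofBijective e he, fun z Z' h hz' ↦ ⟨Y.h_mem_V hx hx' _ h, hf z Z' h hz'⟩⟩

end

end Fibre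

end LocTriv

end

theorem theorem5p5 {k : Type u} [Field k] [IsAlgClosed k] (p : ℕ) [Fact p.Prime] [CharP k p]
    -- a closed subscheme `X₀` of a smooth algebraic scheme `P`
    (X₀ P : Scheme.{u}) [X₀.Over (Spec (.of k))] [P.Over (Spec (.of k))]
    [Smooth (P ↘ Spec (.of k))] [QuasiCompact (P ↘ Spec (.of k))]
    [IsSeparated (P ↘ Spec (.of k))] [LocallyOfFiniteType (X₀ ↘ Spec (.of k))]
    [QuasiCompact (X₀ ↘ Spec (.of k))] [IsSeparated (X₀ ↘ Spec (.of k))]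
    (j : X₀ ⟶ P) [j.IsOver (Spec (.of k))] [IsClosedImmersion j]
    {B A : Type u} [CommRing B] [Algebra k B] [ArtinLocal k B]
    [CommRing A] [Algebra k A] [ArtinLocal k A] (Φ : SmallExtension k B A)
    (X : LTDef k X₀ A)
    -- an affine open cover of `X₀`, over which all cohomology groups are computed
    {ι : Type u} (U : ι → X₀.affineOpens) (hU : ⨆ α, (U α : X₀.Opens) = ⊤) :
    -- `X` is given by a couple `x` over the cover
    (∃ x : Gluing k U A, x.IsCouple ∧ x.IsCocycle ∧ x.InducesClass X) ∧
    -- the action of `H¹(X₀, Der_k(𝒪_{X₀}))` on the fibre of `X`, given by `Z ↦ d · Z` on couples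
    ∃ action : AddAction (DerH1 k U) (Φ.fiber X),
      (∀ (d : derZ1 k U) (z : Φ.fiber X) (Z : Gluing k U B), Z.IsCouple → Z.IsCocycle →
        Z.InducesClass z.1 →
          (Z.act Φ d.1).InducesClass (action.vadd (QuotientAddGroup.mk d) z).1) ∧
      ∀ x : Gluing k U A, x.IsCouple → x.IsCocycle → x.InducesClass X →
        ((Φ.fiber X).Nonempty → Nonempty (CoupleLift Φ x)) ∧
        ∀ Y : CoupleLift Φ x,
          ∃ e : AddAction.orbitRel.Quotient (DerH1 k U) (Φ.fiber X) ≃ Y.VmodL,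
            ∀ (z : Φ.fiber X) (Z : CoupleLift Φ x), Z.Y.IsCocycle → Z.Y.InducesClass z.1 →
              ∃ hZ : Y.h Z ∈ Y.V, e (Quotient.mk _ z) = Quot.mk _ ⟨Y.h Z, hZ⟩ := by
  refine ⟨exists_inducesClass p U X, fibreAction p Φ X hU,
    fun d z Z h₁ h₂ hZ ↦ fibreAction_spec p hU d z h₁ h₂ hZ,
    fun x hx hx' hxX ↦ ⟨fun ⟨z, hz⟩ ↦ ?_, fun Y ↦ Y.exists_equiv p hU hx hx' hxX⟩⟩
  obtain ⟨Z, -, -⟩ := exists_coupleLift p hxX hU ⟨z, hz⟩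
  exact ⟨Z⟩
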